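/- Let $\mathbb K$ be a field of characteristic $0$. We use homological grading (differentials have degree $-1$), and $V[1]$ denotes $V$ with the degree $k$ part placed in degree $k-1$. **Operads.** Let $\mathsf{hoLie}_2$ be the dg operad generated by operations $\nu_r$, $r\ge 2$, of degree $-1$ that are invariant under $S_r$, with differential $$d\nu_A=-\sum_{S\subset A,\ 2\le |S|<|A|}\nu_{A/S}\circ_{*}\nu_S ,$$ where $\nu_A$ is $\nu_{|A|}$ with inputs labelled by the finite set $A$, and $A/S$ is obtained from $A$ by collapsing $S$ to a point $*$. (A $\mathsf{hoLie}_2$-structure on a complex $V$ is the same as an $L_\infty$-structure on $V[1]$.) Let $\mathsf{TRT}$ be the following dg operad. $\mathsf{TRT}(r)$ is spanned by rooted trees with vertices numbered $1,\dots,r$ (each number used once) and any number of further black vertices, each with at least two children. Black vertices have degree $-1$ and are ordered, a permutation of the order acting by its sign. The composition $T\circ_i T'$ inserts $T'$ into vertex $i$ of $T$, summing over all ways of reconnecting the children of $i$ to vertices of $T'$, with the black vertices of $T$ preceding those of $T'$. The differential of a tree is the sum over all vertices $v$ and all sets $S$ of children of $v$ of the tree in which $v$ gets a new black child that takes over the children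 in $S$, minus the sum over all numbered vertices $v$ and all such $S$ of the tree in which a new black vertex takes the place of $v$ and has as children $v$ and the elements of $S$. The new black vertex is placed first in the order, and trees containing a black vertex with fewer than two children are omitted. Two morphisms of dg operads $f,g:\mathcal P\to\mathcal Q$ are homotopic if there is a morphism of dg operads $\mathcal P\to \mathcal Q[t,dt]=\mathbb K[t,dt]\otimes\mathcal Q$ (with $|t|=0$, $|dt|=-1$, $d(t)=dt$) whose evaluations at $t=0$ and $t=1$ are $f$ and $g$. **Pre-Lie algebras.** Let $\mathfrak g$ be a dg pre-Lie algebra over $\mathbb K$, that is, a dg vector space with a bilinear product $\bullet$ of degree $0$ for which $d$ is a graded derivation and $$x\bullet(y\bullet z)-(x\bullet y)\bullet z=(-1)^{|y||z|}\bigl(x\bullet(z\bullet y)-(x\bullet z)\bullet y\bigr)$$ for homogeneous $y,z$. Let $\alpha\in\mathfrak g$ be a Maurer–Cartan element: $|\alpha|=-1$ and $d\alpha+\alpha\bullet\alpha=0$. Define $x\bullet(x_1,\dots,x_r)$ by $x\bullet()=x$ and $$x\bullet(x_1,\dots,x_r,y)=\bigl(x\bullet(x_1,\dots,x_r)\bigr)\bullet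 y-\sum_{i=1}^r(-1)^{|y|(|x_{i+1}|+\dots+|x_r|)}\,x\bullet(x_1,\dots,x_i\bullet y,\dots,x_r)$$ for homogeneous arguments. Put $\nu_1(x)=dx+[\alpha,x]$, where $[\alpha,x]=\alpha\bullet x-(-1)^{|x|}x\bullet\alpha$, and $\nu_r(x_1,\dots,x_r)=\alpha\bullet(x_1,\dots,x_r)$ for $r\ge 2$. Let $\mathfrak g^\alpha$ denote $\mathfrak g$ with the differential $\nu_1=d+[\alpha,-]$. **Proposition.** 1. $\mathsf{hoLie}_2$ and $\mathsf{TRT}$ as just described are dg operads. There is a unique morphism of dg operads $\varphi:\mathsf{hoLie}_2\to\mathsf{TRT}$ that sends every generator $\nu_r$, $r\ge2$, to the tree with a black root whose children are the numbered vertices $1,\dots,r$, and a unique morphism of dg operads $\psi:\mathsf{hoLie}_2\to\mathsf{TRT}$ that sends every $\nu_r$, $r\ge 2$, to zero. The morphisms $\varphi$ and $\psi$ are homotopic. 2. For every $\mathfrak g$ and $\alpha$ as above, the operations $\nu_r$, $r\ge1$, are an $L_\infty$-structure on $\mathfrak g^\alpha[1]$, and there is an $L_\infty$-isomorphism (an $L_\infty$-morphism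 whose linear part is bijective) $$(\mathfrak g^\alpha[1],0)\longrightarrow(\mathfrak g^\alpha[1],\nu_r),$$ where the left-hand side is the abelian dg Lie algebra with differential $d+[\alpha,-]$. -/

import Mathlib

open scoped DirectSum

universe u v w

/-- The sign `(-1)^k` as an element of the ground field. -/
def ksgn (K : Type u) [Field K] (k : ℤ) : K := (((k.negOnePow : ℤˣ) : ℤ) : K)

/-! ## Relabellings used in the coordinate-free operad axioms

Operads are described by partial compositions, with inputs labelled by arbitrary finite sets:
for `a ∈ A` the composition `x ∘ₐ y` of `x ∈ P(A)` and `y ∈ P(B)` lies in `P((A ∖ {a}) ⊔ B)`. -/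

namespace OperadLabels

variable {A A' B B' C : Type}

/-- The label set `(A ∖ {a}) ⊔ B` of a partial composition. -/
abbrev Ins (a : A) (B : Type) : Type := {x : A // x ≠ a} ⊕ B

/-- Functoriality of `(A ∖ {a}) ⊔ B` in bijections. -/
def congr (e : A ≃ A') (a : A) (e' : B ≃ B') : Ins a B ≃ Ins (e a) B' :=
  Equiv.sumCongr (e.subtypeEquiv fun x => by simp) e'

/-- `B ≃ ({*} ∖ {*}) ⊔ B`. -/
def unitLeft (B : Type) : B ≃ Ins () B where
  toFun b := Sum.inr b
  invFun
    | Sum.inl x => (x.2 rfl).elim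
    | Sum.inr b => b
  left_inv _ := rfl
  right_inv := by rintro (⟨x, hx⟩ | b); exacts [(hx rfl).elim, rfl]

open Classical in
/-- `A ≃ (A ∖ {a}) ⊔ {*}`. -/
noncomputable def unitRight (a : A) : A ≃ Ins a Unit where
  toFun x := if h : x = a then Sum.inr () else Sum.inl ⟨x, h⟩
  invFun
    | Sum.inl x => x.1
    | Sum.inr _ => a
  left_inv x := by
    by_cases h : x = a <;> simp [h]
  right_inv := by
    rintro (⟨x, hx⟩ | b) <;> simp_all

/-- Labels of `(x ∘ₐ y) ∘_b z` and of `x ∘ₐ (y ∘_b z)`, for `b` an input of `y`. -/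
def seqEquiv (a : A) (b : B) (C : Type) :
    Ins (Sum.inr b : Ins a B) C ≃ Ins a (Ins b C) where
  toFun
    | Sum.inl ⟨Sum.inl x, _⟩ => Sum.inl x
    | Sum.inl ⟨Sum.inr y, h⟩ => Sum.inr (Sum.inl ⟨y, fun e => h (by rw [e])⟩)
    | Sum.inr c => Sum.inr (Sum.inr c)
  invFun
    | Sum.inl x => Sum.inl ⟨Sum.inl x, Sum.inl_ne_inr⟩
    | Sum.inr (Sum.inl y) => Sum.inl ⟨Sum.inr y.1, fun e => y.2 (Sum.inr_injective e)⟩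
    | Sum.inr (Sum.inr c) => Sum.inr c
  left_inv := by rintro (⟨x | y, h⟩ | c) <;> rfl
  right_inv := by rintro (x | y | c) <;> rfl

/-- Labels of `(x ∘ₐ y) ∘_{a'} z` and of `(x ∘_{a'} z) ∘ₐ y`, for inputs `a ≠ a'` of `x`. -/
def parEquiv (a a' : A) (h : a' ≠ a) (B C : Type) :
    Ins (Sum.inl ⟨a', h⟩ : Ins a B) C ≃ Ins (Sum.inl ⟨a, h.symm⟩ : Ins a' C) B where
  toFun
    | Sum.inl ⟨Sum.inl x, hx⟩ =>
        Sum.inl ⟨Sum.inl ⟨x.1, fun e => hx (by congr 1; exact Subtype.ext e)⟩,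
          fun e => x.2 (congrArg Subtype.val (Sum.inl_injective e))⟩
    | Sum.inl ⟨Sum.inr y, _⟩ => Sum.inr y
    | Sum.inr c => Sum.inl ⟨Sum.inr c, Sum.inr_ne_inl⟩
  invFun
    | Sum.inl ⟨Sum.inl x, hx⟩ =>
        Sum.inl ⟨Sum.inl ⟨x.1, fun e => hx (by congr 1; exact Subtype.ext e)⟩,
          fun e => x.2 (congrArg Subtype.val (Sum.inl_injective e))⟩
    | Sum.inl ⟨Sum.inr c, _⟩ => Sum.inr c
    | Sum.inr y => Sum.inl ⟨Sum.inr y, Sum.inr_ne_inl⟩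
  left_inv := by rintro (⟨x | y, h⟩ | c) <;> rfl
  right_inv := by rintro (⟨x | y, h⟩ | c) <;> rfl

/-- The set `A/S` obtained from `A` by collapsing the subset `S` to one point `inr ()`. -/
abbrev Collapse (S : Set A) : Type := {x : A // x ∉ S} ⊕ Unit

open Classical in
/-- Reinserting `S` at the collapsed point of `A/S` gives back `A`. -/
noncomputable def collapseEquiv (S : Set A) :
    Ins (Sum.inr () : Collapse S) {x : A // x ∈ S} ≃ A where
  toFun
    | Sum.inl ⟨Sum.inl x, _⟩ => x.1
    | Sum.inl ⟨Sum.inr _, h⟩ => (h rfl).elim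
    | Sum.inr x => x.1
  invFun x := if h : x ∈ S then Sum.inr ⟨x, h⟩ else Sum.inl ⟨Sum.inl ⟨x, h⟩, Sum.inl_ne_inr⟩
  left_inv := by
    rintro (⟨x | y, h⟩ | c)
    · simp [x.2]
    · exact (h rfl).elim
    · simp [c.2]
  right_inv x := by by_cases h : x ∈ S <;> simp [h]

/-- Subsets `S` of `A` such that both `S` and `A/S` have at least two elements. -/
abbrev SplitSubset (A : Type) : Type :=
  {S : Set A // 2 ≤ Nat.card {x : A // x ∈ S} ∧ 2 ≤ Nat.card (Collapse S)}

end OperadLabels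

open OperadLabels

/-! ## Differential graded operads -/

/-- The data of a dg operad over `K` in homological grading (the differential has degree `-1`):
`obj A k` is the degree `k` part of the space of operations with inputs labelled by the finite
set `A`. The axioms are `DGOperadData.IsDGOperad` below. -/
structure DGOperadData (K : Type u) [Field K] where
  obj : ∀ (A : Type) [Finite A], ℤ → Type v
  [addCommGroup : ∀ (A : Type) [Finite A] (k : ℤ), AddCommGroup (obj A k)]
  [module : ∀ (A : Type) [Finite A] (k : ℤ), Module K (obj A k)]
  /-- relabelling of the inputs -/
  map : ∀ {A B : Type} [Finite A] [Finite B] {k : ℤ}, A ≃ B → obj A k →ₗ[K] obj B k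
  /-- the differential -/
  d : ∀ {A : Type} [Finite A] {k : ℤ}, obj A (k + 1) →ₗ[K] obj A k
  /-- the operadic unit -/
  one : obj Unit 0
  /-- the partial composition `x ∘ₐ y` -/
  comp : ∀ {A B : Type} [Finite A] [Finite B] {k l n : ℤ} (a : A), k + l = n →
    (obj A k →ₗ[K] obj B l →ₗ[K] obj (Ins a B) n)

namespace DGOperadData

attribute [instance] DGOperadData.addCommGroup DGOperadData.module

variable {K : Type u} [Field K]

/-- The axioms of a dg operad. -/
structure IsDGOperad (P : DGOperadData.{u, v} K) : Prop where
  map_refl : ∀ {A : Type} [Finite A] {k : ℤ} (x : P.obj A k), P.map (Equiv.refl A) x = x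
  map_trans : ∀ {A B C : Type} [Finite A] [Finite B] [Finite C] {k : ℤ} (e : A ≃ B) (e' : B ≃ C)
    (x : P.obj A k), P.map (e.trans e') x = P.map e' (P.map e x)
  comp_map : ∀ {A A' B B' : Type} [Finite A] [Finite A'] [Finite B] [Finite B'] {k l n : ℤ}
    (e : A ≃ A') (e' : B ≃ B') (a : A) (h : k + l = n) (x : P.obj A k) (y : P.obj B l),
    P.comp (e a) h (P.map e x) (P.map e' y) = P.map (congr e a e') (P.comp a h x y)
  one_comp : ∀ {B : Type} [Finite B] {k : ℤ} (y : P.obj B k),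
    P.comp () (zero_add k) P.one y = P.map (unitLeft B) y
  comp_one : ∀ {A : Type} [Finite A] {k : ℤ} (a : A) (x : P.obj A k),
    P.comp a (add_zero k) x P.one = P.map (unitRight a) x
  assoc_seq : ∀ {A B C : Type} [Finite A] [Finite B] [Finite C] {k l m p q n : ℤ} (a : A) (b : B)
    (h₁ : k + l = p) (h₂ : p + m = n) (h₃ : l + m = q) (h₄ : k + q = n)
    (x : P.obj A k) (y : P.obj B l) (z : P.obj C m),
    P.map (seqEquiv a b C) (P.comp (Sum.inr b) h₂ (P.comp a h₁ x y) z)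
      = P.comp a h₄ x (P.comp b h₃ y z)
  assoc_par : ∀ {A B C : Type} [Finite A] [Finite B] [Finite C] {k l m p q n : ℤ} (a a' : A)
    (h : a' ≠ a) (h₁ : k + l = p) (h₂ : p + m = n) (h₃ : k + m = q) (h₄ : q + l = n)
    (x : P.obj A k) (y : P.obj B l) (z : P.obj C m),
    P.map (parEquiv a a' h B C) (P.comp (Sum.inl ⟨a', h⟩) h₂ (P.comp a h₁ x y) z)
      = ksgn K (l * m) • P.comp (Sum.inl ⟨a, h.symm⟩) h₄ (P.comp a' h₃ x z) y
  d_d : ∀ {A : Type} [Finite A] {k : ℤ} (x : P.obj A (k + 1 + 1)), P.d (P.d x) = 0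
  d_map : ∀ {A B : Type} [Finite A] [Finite B] {k : ℤ} (e : A ≃ B) (x : P.obj A (k + 1)),
    P.d (P.map e x) = P.map e (P.d x)
  d_comp : ∀ {A B : Type} [Finite A] [Finite B] {k l n : ℤ} (a : A) (h : (k + 1) + (l + 1) = n + 1)
    (h₁ : k + (l + 1) = n) (h₂ : (k + 1) + l = n) (x : P.obj A (k + 1)) (y : P.obj B (l + 1)),
    P.d (P.comp a h x y) = P.comp a h₁ (P.d x) y + ksgn K (k + 1) • P.comp a h₂ x (P.d y)

/-- Morphisms of dg operads. -/
@[ext]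
structure Hom (P : DGOperadData.{u, v} K) (Q : DGOperadData.{u, w} K) where
  app : ∀ (A : Type) [Finite A] (k : ℤ), P.obj A k →ₗ[K] Q.obj A k
  app_map : ∀ {A B : Type} [Finite A] [Finite B] {k : ℤ} (e : A ≃ B) (x : P.obj A k),
    app B k (P.map e x) = Q.map e (app A k x)
  app_one : app Unit 0 P.one = Q.one
  app_comp : ∀ {A B : Type} [Finite A] [Finite B] {k l n : ℤ} (a : A) (h : k + l = n)
    (x : P.obj A k) (y : P.obj B l),
    app (Ins a B) n (P.comp a h x y) = Q.comp a h (app A k x) (app B l y)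
  app_d : ∀ {A : Type} [Finite A] {k : ℤ} (x : P.obj A (k + 1)),
    app A k (P.d x) = Q.d (app A (k + 1) x)

/-! ### The path object `Q[t, dt]` and homotopies -/

/-- The extension of a bilinear map `M × N → L` to polynomials `M[t] × N[t] → L[t]`
(`M[t]` being finitely supported sequences in `M`). -/
noncomputable def polyMul {M N L : Type v} [AddCommGroup M] [Module K M] [AddCommGroup N]
    [Module K N] [AddCommGroup L] [Module K L] (b : M →ₗ[K] N →ₗ[K] L) :
    (ℕ →₀ M) →ₗ[K] (ℕ →₀ N) →ₗ[K] (ℕ →₀ L) :=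
  Finsupp.lsum ℕ fun i => LinearMap.flip <| Finsupp.lsum ℕ fun j =>
    LinearMap.flip (b.compr₂ (Finsupp.lsingle (i + j)))

/-- The formal derivative `∂ₜ` on `M[t]`. -/
noncomputable def polyDeriv {M : Type v} [AddCommGroup M] [Module K M] :
    (ℕ →₀ M) →ₗ[K] (ℕ →₀ M) :=
  Finsupp.lsum ℕ fun i => (i : K) • Finsupp.lsingle (i - 1)

/-- Evaluation of a polynomial in `M[t]` at `t = c`. -/
noncomputable def polyEval {M : Type v} [AddCommGroup M] [Module K M] (c : K) :
    (ℕ →₀ M) →ₗ[K] M :=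
  Finsupp.lsum ℕ fun i => (c ^ i) • LinearMap.id

/-- The dg operad `Q[t, dt] = K[t, dt] ⊗ Q`, where `t` has degree `0` and `dt = d(t)` has
degree `-1`. The pair `(p, q)` stands for `p(t) + dt · q(t)`. -/
noncomputable def path (Q : DGOperadData.{u, v} K) : DGOperadData.{u, v} K where
  obj A _ k := (ℕ →₀ Q.obj A k) × (ℕ →₀ Q.obj A (k + 1))
  map e := LinearMap.prodMap (Finsupp.mapRange.linearMap (Q.map e))
    (Finsupp.mapRange.linearMap (Q.map e))
  -- `d (p + dt q) = d p + dt (∂ₜ p - d q)`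
  d := LinearMap.prod
    (Finsupp.mapRange.linearMap Q.d ∘ₗ LinearMap.fst K _ _)
    (polyDeriv ∘ₗ LinearMap.fst K _ _ - Finsupp.mapRange.linearMap Q.d ∘ₗ LinearMap.snd K _ _)
  one := (Finsupp.single 0 Q.one, 0)
  -- `(p + dt q) ∘ (p' + dt q') = p ∘ p' + dt (q ∘ p' + (-1)^{|p|} p ∘ q')`
  comp {A B _ _ k l n} a h := LinearMap.mk₂ K
    (fun x y => (polyMul (Q.comp a h) x.1 y.1,
      polyMul (Q.comp a (show (k + 1) + l = n + 1 by omega)) x.2 y.1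
        + ksgn K k • polyMul (Q.comp a (show k + (l + 1) = n + 1 by omega)) x.1 y.2))
    (fun x x' y => by ext1 <;> simp; abel)
    (fun c x y => by ext1 <;> simp [smul_comm c])
    (fun x y y' => by ext1 <;> simp; abel)
    (fun c x y => by ext1 <;> simp [smul_comm c])

/-- Evaluation `Q[t, dt] → Q` at `t = c`, `dt = 0`. -/
noncomputable def pathEval (Q : DGOperadData.{u, v} K) (c : K) {A : Type} [Finite A] {k : ℤ}
    (x : Q.path.obj A k) : Q.obj A k := polyEval c x.1

/-- Two morphisms of dg operads `f, g : P → Q` are homotopic if there is a morphism of dg operads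
`P → Q[t, dt]` that restricts to `f` at `t = 0` and to `g` at `t = 1`. -/
def Homotopic {P : DGOperadData.{u, v} K} {Q : DGOperadData.{u, w} K} (f g : Hom P Q) : Prop :=
  ∃ F : Hom P Q.path, ∀ (A : Type) [Finite A] (k : ℤ) (x : P.obj A k),
    Q.pathEval 0 (F.app A k x) = f.app A k x ∧ Q.pathEval 1 (F.app A k x) = g.app A k x

end DGOperadData

/-! ## The dg operad `hoLie₂`

It is generated by symmetric operations `ν_A` of degree `-1`, one for each finite set `A` of at
least two inputs (equivalently, `ν_r` with trivial action of `S_r` for `r ≥ 2`), with differential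
`d ν_A = - ∑_S ν_{A/S} ∘_* ν_S` over the subsets `S ⊂ A` with `2 ≤ |S| < |A|`. It is built as the
space of formal expressions modulo the relations that hold in every dg operad and the relations for
the generators. -/

namespace HoLieTwo

/-- Formal expressions of arity `A` and degree `k`. -/
inductive Pre (K : Type u) : Type → ℤ → Type (max 1 u)
  | zero {A : Type} {k : ℤ} : Pre K A k
  | add {A : Type} {k : ℤ} : Pre K A k → Pre K A k → Pre K A k
  | smul {A : Type} {k : ℤ} : K → Pre K A k → Pre K A k
  | one : Pre K Unit 0
  | nu (A : Type) [Finite A] (hA : 2 ≤ Nat.card A) {k : ℤ} (hk : k = -1) : Pre K A k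
  | map {A B : Type} [Finite A] [Finite B] {k : ℤ} (e : A ≃ B) : Pre K A k → Pre K B k
  | d {A : Type} [Finite A] {k : ℤ} : Pre K A (k + 1) → Pre K A k
  | comp {A B : Type} [Finite A] [Finite B] {k l n : ℤ} (a : A) (h : k + l = n) :
      Pre K A k → Pre K B l → Pre K (Ins a B) n

/-- The formal sum of a list of expressions. -/
def Pre.listSum {K : Type u} {A : Type} {k : ℤ} (l : List (Pre K A k)) : Pre K A k :=
  l.foldr Pre.add Pre.zero

open Classical in
/-- The expression `∑_S ν_{A/S} ∘_* ν_S`. -/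
noncomputable def Pre.nuNu (K : Type u) (A : Type) [Finite A] {k : ℤ} (hk : -1 + -1 = k) :
    Pre K A k :=
  letI : Fintype (SplitSubset A) := Fintype.ofFinite _
  Pre.listSum ((Finset.univ : Finset (SplitSubset A)).toList.map fun S =>
    Pre.map (collapseEquiv S.1) (Pre.comp (Sum.inr ()) hk
      (Pre.nu (Collapse S.1) S.2.2 rfl) (Pre.nu {x : A // x ∈ S.1} S.2.1 rfl)))

open Pre in
/-- The relations between formal expressions. -/
inductive Rel (K : Type u) [Field K] : ∀ {A : Type} {k : ℤ}, Pre K A k → Pre K A k → Prop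
  -- equivalence relation and congruence
  | refl {A : Type} {k : ℤ} (x : Pre K A k) : Rel K x x
  | symm {A : Type} {k : ℤ} {x y : Pre K A k} : Rel K x y → Rel K y x
  | trans {A : Type} {k : ℤ} {x y z : Pre K A k} : Rel K x y → Rel K y z → Rel K x z
  | add_congr {A : Type} {k : ℤ} {x x' y y' : Pre K A k} :
      Rel K x x' → Rel K y y' → Rel K (add x y) (add x' y')
  | smul_congr {A : Type} {k : ℤ} (c : K) {x x' : Pre K A k} :
      Rel K x x' → Rel K (smul c x) (smul c x')
  | map_congr {A B : Type} [Finite A] [Finite B] {k : ℤ} (e : A ≃ B) {x x' : Pre K A k} :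
      Rel K x x' → Rel K (map e x) (map e x')
  | d_congr {A : Type} [Finite A] {k : ℤ} {x x' : Pre K A (k + 1)} :
      Rel K x x' → Rel K (d x) (d x')
  | comp_congr {A B : Type} [Finite A] [Finite B] {k l n : ℤ} (a : A) (h : k + l = n)
      {x x' : Pre K A k} {y y' : Pre K B l} :
      Rel K x x' → Rel K y y' → Rel K (comp a h x y) (comp a h x' y')
  -- vector space axioms
  | add_comm {A : Type} {k : ℤ} (x y : Pre K A k) : Rel K (add x y) (add y x)
  | add_assoc {A : Type} {k : ℤ} (x y z : Pre K A k) :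
      Rel K (add (add x y) z) (add x (add y z))
  | zero_add {A : Type} {k : ℤ} (x : Pre K A k) : Rel K (add zero x) x
  | zero_smul {A : Type} {k : ℤ} (x : Pre K A k) : Rel K (smul 0 x) zero
  | one_smul {A : Type} {k : ℤ} (x : Pre K A k) : Rel K (smul 1 x) x
  | mul_smul {A : Type} {k : ℤ} (c c' : K) (x : Pre K A k) :
      Rel K (smul (c * c') x) (smul c (smul c' x))
  | smul_add {A : Type} {k : ℤ} (c : K) (x y : Pre K A k) :
      Rel K (smul c (add x y)) (add (smul c x) (smul c y))
  | add_smul {A : Type} {k : ℤ} (c c' : K) (x : Pre K A k) :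
      Rel K (smul (c + c') x) (add (smul c x) (smul c' x))
  -- linearity of the operations
  | map_add {A B : Type} [Finite A] [Finite B] {k : ℤ} (e : A ≃ B) (x y : Pre K A k) :
      Rel K (map e (add x y)) (add (map e x) (map e y))
  | map_smul {A B : Type} [Finite A] [Finite B] {k : ℤ} (e : A ≃ B) (c : K) (x : Pre K A k) :
      Rel K (map e (smul c x)) (smul c (map e x))
  | d_add {A : Type} [Finite A] {k : ℤ} (x y : Pre K A (k + 1)) :
      Rel K (d (add x y)) (add (d x) (d y))
  | d_smul {A : Type} [Finite A] {k : ℤ} (c : K) (x : Pre K A (k + 1)) :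
      Rel K (d (smul c x)) (smul c (d x))
  | comp_add_left {A B : Type} [Finite A] [Finite B] {k l n : ℤ} (a : A) (h : k + l = n)
      (x x' : Pre K A k) (y : Pre K B l) :
      Rel K (comp a h (add x x') y) (add (comp a h x y) (comp a h x' y))
  | comp_smul_left {A B : Type} [Finite A] [Finite B] {k l n : ℤ} (a : A) (h : k + l = n)
      (c : K) (x : Pre K A k) (y : Pre K B l) :
      Rel K (comp a h (smul c x) y) (smul c (comp a h x y))
  | comp_add_right {A B : Type} [Finite A] [Finite B] {k l n : ℤ} (a : A) (h : k + l = n)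
      (x : Pre K A k) (y y' : Pre K B l) :
      Rel K (comp a h x (add y y')) (add (comp a h x y) (comp a h x y'))
  | comp_smul_right {A B : Type} [Finite A] [Finite B] {k l n : ℤ} (a : A) (h : k + l = n)
      (c : K) (x : Pre K A k) (y : Pre K B l) :
      Rel K (comp a h x (smul c y)) (smul c (comp a h x y))
  -- dg operad axioms
  | map_refl {A : Type} [Finite A] {k : ℤ} (x : Pre K A k) : Rel K (map (Equiv.refl A) x) x
  | map_trans {A B C : Type} [Finite A] [Finite B] [Finite C] {k : ℤ} (e : A ≃ B) (e' : B ≃ C)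
      (x : Pre K A k) : Rel K (map (e.trans e') x) (map e' (map e x))
  | comp_map {A A' B B' : Type} [Finite A] [Finite A'] [Finite B] [Finite B'] {k l n : ℤ}
      (e : A ≃ A') (e' : B ≃ B') (a : A) (h : k + l = n) (x : Pre K A k) (y : Pre K B l) :
      Rel K (comp (e a) h (map e x) (map e' y)) (map (congr e a e') (comp a h x y))
  | one_comp {B : Type} [Finite B] {k : ℤ} (h : 0 + k = k) (y : Pre K B k) :
      Rel K (comp () h one y) (map (unitLeft B) y)
  | comp_one {A : Type} [Finite A] {k : ℤ} (h : k + 0 = k) (a : A) (x : Pre K A k) :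
      Rel K (comp a h x one) (map (unitRight a) x)
  | assoc_seq {A B C : Type} [Finite A] [Finite B] [Finite C] {k l m p q n : ℤ} (a : A) (b : B)
      (h₁ : k + l = p) (h₂ : p + m = n) (h₃ : l + m = q) (h₄ : k + q = n)
      (x : Pre K A k) (y : Pre K B l) (z : Pre K C m) :
      Rel K (map (seqEquiv a b C) (comp (Sum.inr b) h₂ (comp a h₁ x y) z))
        (comp a h₄ x (comp b h₃ y z))
  | assoc_par {A B C : Type} [Finite A] [Finite B] [Finite C] {k l m p q n : ℤ} (a a' : A)
      (h : a' ≠ a) (h₁ : k + l = p) (h₂ : p + m = n) (h₃ : k + m = q) (h₄ : q + l = n)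
      (x : Pre K A k) (y : Pre K B l) (z : Pre K C m) :
      Rel K (map (parEquiv a a' h B C) (comp (Sum.inl ⟨a', h⟩) h₂ (comp a h₁ x y) z))
        (smul (ksgn K (l * m)) (comp (Sum.inl ⟨a, h.symm⟩) h₄ (comp a' h₃ x z) y))
  | d_d {A : Type} [Finite A] {k : ℤ} (x : Pre K A (k + 1 + 1)) : Rel K (d (d x)) zero
  | d_map {A B : Type} [Finite A] [Finite B] {k : ℤ} (e : A ≃ B) (x : Pre K A (k + 1)) :
      Rel K (d (map e x)) (map e (d x))
  | d_comp {A B : Type} [Finite A] [Finite B] {k l n : ℤ} (a : A)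
      (h : (k + 1) + (l + 1) = n + 1) (h₁ : k + (l + 1) = n) (h₂ : (k + 1) + l = n)
      (x : Pre K A (k + 1)) (y : Pre K B (l + 1)) :
      Rel K (d (comp a h x y))
        (add (comp a h₁ (d x) y) (smul (ksgn K (k + 1)) (comp a h₂ x (d y))))
  -- the generators: symmetry and differential
  | map_nu {A B : Type} [Finite A] [Finite B] (hA : 2 ≤ Nat.card A) (hB : 2 ≤ Nat.card B)
      {k : ℤ} (hk : k = -1) (e : A ≃ B) : Rel K (map e (nu A hA hk)) (nu B hB hk)
  | d_nu {A : Type} [Finite A] (hA : 2 ≤ Nat.card A) {k : ℤ} (hk : k + 1 = -1)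
      (hk' : -1 + -1 = k) :
      Rel K (d (nu A hA hk)) (smul (-1) (nuNu K A hk'))

variable (K : Type u) [Field K]

/-- Formal expressions up to the relations. -/
def relSetoid (A : Type) (k : ℤ) : Setoid (Pre K A k) :=
  ⟨Rel K, Rel.refl, Rel.symm, Rel.trans⟩

/-- The degree `k` part of `hoLie₂(A)`. -/
def Obj (A : Type) (k : ℤ) : Type (max 1 u) := Quotient (relSetoid K A k)

namespace Obj

variable {K} {A B : Type} {k l n : ℤ}

/-- The class of a formal expression. -/
def mk (x : Pre K A k) : Obj K A k := Quotient.mk (relSetoid K A k) x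

theorem mk_eq {x y : Pre K A k} (h : Rel K x y) : mk x = mk y := Quotient.sound h

instance : Zero (Obj K A k) := ⟨mk Pre.zero⟩

instance : Add (Obj K A k) :=
  ⟨Quotient.map₂ Pre.add fun _ _ h _ _ h' => Rel.add_congr h h'⟩

instance : SMul K (Obj K A k) := ⟨fun c => Quotient.map (Pre.smul c) fun _ _ h => Rel.smul_congr c h⟩

instance : Neg (Obj K A k) := ⟨fun x => (-1 : K) • x⟩

instance : AddCommGroup (Obj K A k) where
  add_assoc := by
    rintro ⟨x⟩ ⟨y⟩ ⟨z⟩; exact mk_eq (Rel.add_assoc x y z)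
  zero_add := by rintro ⟨x⟩; exact mk_eq (Rel.zero_add x)
  add_zero := by
    rintro ⟨x⟩; exact mk_eq ((Rel.add_comm x Pre.zero).trans (Rel.zero_add x))
  add_comm := by rintro ⟨x⟩ ⟨y⟩; exact mk_eq (Rel.add_comm x y)
  neg_add_cancel := by
    rintro ⟨x⟩
    refine mk_eq (Rel.trans (Rel.add_congr (Rel.refl _) (Rel.one_smul x).symm) ?_)
    refine (Rel.add_smul (-1) 1 x).symm.trans ?_
    rw [neg_add_cancel]
    exact Rel.zero_smul x
  nsmul := nsmulRec
  zsmul := zsmulRec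

instance : Module K (Obj K A k) where
  one_smul := by rintro ⟨x⟩; exact mk_eq (Rel.one_smul x)
  mul_smul := by rintro c c' ⟨x⟩; exact mk_eq (Rel.mul_smul c c' x)
  smul_zero := by
    intro c
    refine mk_eq ((Rel.smul_congr c (Rel.zero_smul Pre.zero).symm).trans ?_)
    refine (Rel.mul_smul c 0 Pre.zero).symm.trans ?_
    rw [mul_zero]
    exact Rel.zero_smul _
  smul_add := by rintro c ⟨x⟩ ⟨y⟩; exact mk_eq (Rel.smul_add c x y)
  add_smul := by rintro c c' ⟨x⟩; exact mk_eq (Rel.add_smul c c' x)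
  zero_smul := by rintro ⟨x⟩; exact mk_eq (Rel.zero_smul x)

end Obj

end HoLieTwo

open HoLieTwo in
/-- The dg operad `hoLie₂`. -/
def hoLieTwo (K : Type u) [Field K] : DGOperadData.{u, max 1 u} K where
  obj A _ k := Obj K A k
  map e :=
    { toFun := Quotient.map (Pre.map e) fun _ _ h => Rel.map_congr e h
      map_add' := by rintro ⟨x⟩ ⟨y⟩; exact Obj.mk_eq (Rel.map_add e x y)
      map_smul' := by rintro c ⟨x⟩; exact Obj.mk_eq (Rel.map_smul e c x) }
  d :=
    { toFun := Quotient.map Pre.d fun _ _ h => Rel.d_congr h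
      map_add' := by rintro ⟨x⟩ ⟨y⟩; exact Obj.mk_eq (Rel.d_add x y)
      map_smul' := by rintro c ⟨x⟩; exact Obj.mk_eq (Rel.d_smul c x) }
  one := Obj.mk Pre.one
  comp a h := LinearMap.mk₂ K
    (Quotient.map₂ (Pre.comp a h) fun _ _ hx _ _ hy => Rel.comp_congr a h hx hy)
    (by rintro ⟨x⟩ ⟨x'⟩ ⟨y⟩; exact Obj.mk_eq (Rel.comp_add_left a h x x' y))
    (by rintro c ⟨x⟩ ⟨y⟩; exact Obj.mk_eq (Rel.comp_smul_left a h c x y))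
    (by rintro ⟨x⟩ ⟨y⟩ ⟨y'⟩; exact Obj.mk_eq (Rel.comp_add_right a h x y y'))
    (by rintro c ⟨x⟩ ⟨y⟩; exact Obj.mk_eq (Rel.comp_smul_right a h c x y))

/-- The generator `ν_A` of `hoLie₂`. -/
def hoLieTwo.nu (K : Type u) [Field K] (A : Type) [Finite A] (hA : 2 ≤ Nat.card A) :
    (hoLieTwo K).obj A (-1) :=
  HoLieTwo.Obj.mk (HoLieTwo.Pre.nu A hA rfl)

/-! ## The dg operad `TRT` of rooted trees with numbered and black vertices

A tree on a vertex set `V` is encoded by its parent function `V → Option V`; the root is the vertex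
with parent `none`. A tree in `TRT(A)` with `m` black vertices has the vertex set `A ⊕ Fin m`: the
vertices `inl a` are the numbered ones and the vertices `inr i` are the black ones. -/

namespace ParentFn

variable {V W : Type}

/-- Transport of a parent function along a bijection of vertex sets. -/
def conj (e : V ≃ W) (p : V → Option V) : W → Option W := fun w => (p (e.symm w)).map e

/-- `p` is the parent function of a rooted tree: there is a unique root, and a vertex is always
strictly deeper than its parent, for some depth function. -/
def IsTree (p : V → Option V) : Prop :=
  (∃! r, p r = none) ∧ ∃ depth : V → ℕ, ∀ v u, p v = some u → depth u < depth v

open Classical in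
/-- A vertex `u ≠ v₀` as a vertex of the tree obtained by inserting into `v₀`. -/
noncomputable def lift (W : Type) (v₀ u : V) : Option ({v : V // v ≠ v₀} ⊕ W) :=
  if h : u ≠ v₀ then some (Sum.inl ⟨u, h⟩) else none

open Classical in
/-- Insertion of the tree `q` into the vertex `v₀` of the tree `p`: the root of `q` takes the
place of `v₀`, and each child `v` of `v₀` is reconnected to the vertex `f v` of `q`. -/
noncomputable def insertAt (p : V → Option V) (v₀ : V) (q : W → Option W)
    (f : {v : V // p v = some v₀} → W) :
    {v : V // v ≠ v₀} ⊕ W → Option ({v : V // v ≠ v₀} ⊕ W)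
  | Sum.inl v => if h : p v = some v₀ then some (Sum.inr (f ⟨v, h⟩)) else (p v).bind (lift W v₀)
  | Sum.inr w =>
    match q w with
    | some w' => some (Sum.inr w')
    | none => (p v₀).bind (lift W v₀)

open Classical in
/-- Splitting of the vertex `v`, the new vertex `none` being a child of `v` that takes over the
children of `v` in the set `S`. -/
noncomputable def splitLower (p : V → Option V) (v : V) (S : Set V) : Option V → Option (Option V)
  | none => some (some v)
  | some u => if u ∈ S then some none else (p u).map some

open Classical in
/-- Splitting of the vertex `v`, the new vertex `none` taking the place of `v` and having as its
children `v` and those children of `v` that lie in the set `S`. -/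
noncomputable def splitUpper (p : V → Option V) (v : V) (S : Set V) : Option V → Option (Option V)
  | none => (p v).map some
  | some u => if u = v ∨ u ∈ S then some none else (p u).map some

/-- The sets of children of `v`. -/
def childSets (p : V → Option V) (v : V) : Set (Set V) := {S | S ⊆ {u | p u = some v}}

end ParentFn

open ParentFn

namespace TRT

variable {A B : Type} {m n : ℕ}

/-- A rooted tree on `A ⊕ Fin m` all of whose black vertices have at least two children. -/
def IsAdm (p : A ⊕ Fin m → Option (A ⊕ Fin m)) : Prop :=
  IsTree p ∧ ∀ i : Fin m, 2 ≤ Nat.card {v // p v = some (Sum.inr i)}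

/-- The trees of `TRT(A)` of degree `k`: each black vertex, labelled by `Fin m`, has degree
`-1`. -/
structure Tree (A : Type) (k : ℤ) where
  m : ℕ
  deg : (m : ℤ) = -k
  par : A ⊕ Fin m → Option (A ⊕ Fin m)
  adm : IsAdm par

theorem isTree_conj {V W : Type} (e : V ≃ W) {p : V → Option V} (h : IsTree p) :
    IsTree (conj e p) := by
  obtain ⟨⟨r, hr, hr'⟩, depth, hd⟩ := h
  refine ⟨⟨e r, by simp [conj, hr], fun w hw => ?_⟩, depth ∘ e.symm, fun v u h => ?_⟩
  · rw [← hr' (e.symm w) (by simpa [conj] using hw), e.apply_symm_apply]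
  · simp only [conj, Option.map_eq_some_iff] at h
    obtain ⟨u', hu, rfl⟩ := h
    simpa using hd _ _ hu

theorem conj_symm_conj {V W : Type} (e : V ≃ W) (p : V → Option V) :
    conj e.symm (conj e p) = p := by
  funext v; simp [conj, Function.comp_def]

theorem conj_conj {V W U : Type} (e : V ≃ W) (e' : W ≃ U) (p : V → Option V) :
    conj e' (conj e p) = conj (e.trans e') p := by
  funext v; simp [conj, Function.comp_def]

theorem conj_eq_some {V W : Type} (e : V ≃ W) (p : V → Option V) (v u : V) :
    conj e p (e v) = some (e u) ↔ p v = some u := by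
  simp [conj]

/-- Relabelling of the numbered and of the black vertices. -/
abbrev relabel (e : A ≃ B) (s : Fin m ≃ Fin n) (p : A ⊕ Fin m → Option (A ⊕ Fin m)) :
    B ⊕ Fin n → Option (B ⊕ Fin n) := conj (Equiv.sumCongr e s) p

theorem IsAdm.relabel (e : A ≃ B) (s : Fin m ≃ Fin n) {p : A ⊕ Fin m → Option (A ⊕ Fin m)}
    (h : IsAdm p) : IsAdm (relabel e s p) := by
  refine ⟨isTree_conj _ h.1, fun i => ?_⟩
  rw [← Nat.card_congr ((Equiv.sumCongr e s).subtypeEquiv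
    (p := fun v => p v = some (Sum.inr (s.symm i))) fun v => ?_)]
  · exact h.2 _
  · rw [← conj_eq_some (Equiv.sumCongr e s)]; simp

theorem relabel_one (p : A ⊕ Fin m → Option (A ⊕ Fin m)) :
    relabel (Equiv.refl A) (1 : Equiv.Perm (Fin m)) p = p := by
  have : Equiv.sumCongr (Equiv.refl A) (1 : Equiv.Perm (Fin m)) = Equiv.refl _ := by
    ext x; rcases x with x | x <;> rfl
  rw [relabel, this]
  funext v
  simp [conj]

/-- Relabelling of a tree. -/
def Tree.relabel {k : ℤ} (T : Tree A k) (e : A ≃ B) (s : Fin T.m ≃ Fin T.m) : Tree B k :=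
  ⟨T.m, T.deg, TRT.relabel e s T.par, T.adm.relabel e s⟩

variable (K : Type u) [Field K]

/-- The black vertices are odd: permuting them multiplies a tree by the sign. -/
noncomputable def signRel (A : Type) (k : ℤ) : Submodule K (Tree A k →₀ K) :=
  Submodule.span K {x | ∃ (T : Tree A k) (s : Equiv.Perm (Fin T.m)),
    x = Finsupp.single (T.relabel (Equiv.refl A) s) 1
      - Finsupp.single T (((Equiv.Perm.sign s : ℤˣ) : ℤ) : K)}

/-- The degree `k` part of `TRT(A)`. -/
abbrev Obj (A : Type) (k : ℤ) : Type u := (Tree A k →₀ K) ⧸ signRel K A k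

open Classical in
/-- The element of `TRT(A)` given by the parent function `p`; it is zero if `p` is not a tree all
of whose black vertices have at least two children. -/
noncomputable def mk {k : ℤ} (hm : (m : ℤ) = -k) (p : A ⊕ Fin m → Option (A ⊕ Fin m)) :
    Obj K A k :=
  if h : IsAdm p then (signRel K A k).mkQ (Finsupp.single ⟨m, hm, p, h⟩ 1) else 0

variable {K}

theorem isAdm_relabel_iff (e : A ≃ B) (s : Fin m ≃ Fin n)
    {p : A ⊕ Fin m → Option (A ⊕ Fin m)} : IsAdm (relabel e s p) ↔ IsAdm p := by
  refine ⟨fun h => ?_, fun h => h.relabel e s⟩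
  have := h.relabel e.symm s.symm
  rwa [relabel, relabel, ← Equiv.sumCongr_symm, conj_symm_conj] at this

theorem mk_relabel {k : ℤ} (hm : (m : ℤ) = -k) (s : Equiv.Perm (Fin m))
    (p : A ⊕ Fin m → Option (A ⊕ Fin m)) :
    mk K hm (relabel (Equiv.refl A) s p) = (((Equiv.Perm.sign s : ℤˣ) : ℤ) : K) • mk K hm p := by
  unfold mk
  by_cases h : IsAdm p
  · rw [dif_pos h, dif_pos (h.relabel _ s), ← map_smul, ← sub_eq_zero, ← map_sub]
    simp only [Submodule.mkQ_apply, Submodule.Quotient.mk_eq_zero, Finsupp.smul_single,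
      smul_eq_mul, mul_one]
    exact Submodule.subset_span ⟨⟨m, hm, p, h⟩, s, rfl⟩
  · rw [dif_neg h, dif_neg (by rwa [isAdm_relabel_iff]), smul_zero]

/-- A function on trees that is compatible with the signs extends linearly to `TRT(A)`. -/
noncomputable def extend {M : Type v} [AddCommGroup M] [Module K M] {k : ℤ} (F : Tree A k → M)
    (hF : ∀ (T : Tree A k) (s : Equiv.Perm (Fin T.m)), F (T.relabel (Equiv.refl A) s)
      = (((Equiv.Perm.sign s : ℤˣ) : ℤ) : K) • F T) : Obj K A k →ₗ[K] M :=
  (signRel K A k).liftQ (Finsupp.linearCombination K F) <| by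
    rw [signRel, Submodule.span_le]
    rintro _ ⟨T, s, rfl⟩
    simp [hF]

/-! ### Composition -/

/-- The vertices of a tree obtained by insertion; the black vertices of the outer tree come before
those of the inserted tree. -/
def insEquiv (a : A) (B : Type) (m n : ℕ) :
    {v : A ⊕ Fin m // v ≠ Sum.inl a} ⊕ (B ⊕ Fin n) ≃ Ins a B ⊕ Fin (m + n) where
  toFun
    | Sum.inl ⟨Sum.inl x, h⟩ => Sum.inl (Sum.inl ⟨x, fun e => h (by rw [e])⟩)
    | Sum.inl ⟨Sum.inr i, _⟩ => Sum.inr (finSumFinEquiv (Sum.inl i))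
    | Sum.inr (Sum.inl b) => Sum.inl (Sum.inr b)
    | Sum.inr (Sum.inr j) => Sum.inr (finSumFinEquiv (Sum.inr j))
  invFun
    | Sum.inl (Sum.inl x) => Sum.inl ⟨Sum.inl x.1, fun e => x.2 (Sum.inl_injective e)⟩
    | Sum.inl (Sum.inr b) => Sum.inr (Sum.inl b)
    | Sum.inr i =>
      match finSumFinEquiv.symm i with
      | Sum.inl i => Sum.inl ⟨Sum.inr i, Sum.inr_ne_inl⟩
      | Sum.inr j => Sum.inr (Sum.inr j)
  left_inv := by rintro (⟨x | i, h⟩ | b | j) <;> simp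
  right_inv := by
    rintro ((x | b) | i)
    · rfl
    · rfl
    · obtain ⟨i | j, rfl⟩ := finSumFinEquiv.surjective i <;> simp

theorem insertAt_conj {V V' W W' : Type} (e : V ≃ V') (e' : W ≃ W') (p : V → Option V) (v₀ : V)
    (q : W → Option W) (f : {v : V // p v = some v₀} → W)
    (f' : {v : V' // conj e p v = some (e v₀)} → W')
    (hf : ∀ v h h', f' ⟨e v, h'⟩ = e' (f ⟨v, h⟩)) :
    insertAt (conj e p) (e v₀) (conj e' q) f'
      = conj (Equiv.sumCongr (e.subtypeEquiv fun x => by simp) e') (insertAt p v₀ q f) := by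
  have hl : ∀ u : V, lift W' (e v₀) (e u) =
      (lift W v₀ u).map (Equiv.sumCongr (e.subtypeEquiv fun x => by simp) e') := by
    intro u
    by_cases h : u = v₀ <;> simp [lift, h]
  have hb : ∀ v : V, (conj e p (e v)).bind (lift W' (e v₀)) = ((p v).bind (lift W v₀)).map
      (Equiv.sumCongr (e.subtypeEquiv fun x => by simp) e') := by
    intro v
    cases h : p v <;> simp [conj, h, hl]
  funext x
  obtain ⟨x, rfl⟩ := (Equiv.sumCongr (e.subtypeEquiv
    (p := fun v => v ≠ v₀) (q := fun v => v ≠ e v₀) fun x => by simp) e').surjective x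
  conv_rhs => rw [conj, Equiv.symm_apply_apply]
  rcases x with ⟨v, hv⟩ | w
  · by_cases h : p v = some v₀
    · have h' := (conj_eq_some e p v v₀).2 h
      simp only [Equiv.sumCongr_apply, Sum.map_inl, Equiv.subtypeEquiv_apply, insertAt, dif_pos h,
        dif_pos h', Option.map_some, Sum.map_inr, hf v h h']
    · have h' := fun h' => h ((conj_eq_some e p v v₀).1 h')
      simp only [Equiv.sumCongr_apply, Sum.map_inl, Equiv.subtypeEquiv_apply, insertAt, dif_neg h,
        dif_neg h']
      exact hb v
  · cases h : q w with
    | none => simpa [insertAt, conj, h] using hb v₀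
    | some w' => simp [insertAt, conj, h]

variable (K) in
/-- The sum over all insertions of the tree `q` into the numbered vertex `a` of the tree `p`. -/
noncomputable def insSum {k : ℤ} (hk : ((m + n : ℕ) : ℤ) = -k) (a : A)
    (p : A ⊕ Fin m → Option (A ⊕ Fin m)) (q : B ⊕ Fin n → Option (B ⊕ Fin n)) :
    Obj K (Ins a B) k :=
  ∑ᶠ f : {v // p v = some (Sum.inl a)} → B ⊕ Fin n,
    mk K hk (conj (insEquiv a B m n) (insertAt p (Sum.inl a) q f))

theorem insSum_relabel {k : ℤ} (hk : ((m + n : ℕ) : ℤ) = -k) (a : A)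
    (p : A ⊕ Fin m → Option (A ⊕ Fin m)) (q : B ⊕ Fin n → Option (B ⊕ Fin n))
    (s : Equiv.Perm (Fin m)) (t : Equiv.Perm (Fin n)) :
    insSum K hk a (relabel (Equiv.refl A) s p) (relabel (Equiv.refl B) t q) =
      ((((Equiv.Perm.sign s : ℤˣ) : ℤ) : K) * (((Equiv.Perm.sign t : ℤˣ) : ℤ) : K)) •
        insSum K hk a p q := by
  set e := Equiv.sumCongr (Equiv.refl A) s with he
  set e' := Equiv.sumCongr (Equiv.refl B) t with he'
  let c : {v // p v = some (Sum.inl a)} ≃ {v // conj e p v = some (Sum.inl a)} :=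
    e.subtypeEquiv fun v => (conj_eq_some e p v (Sum.inl a)).symm
  unfold insSum
  rw [← finsum_comp_equiv (Equiv.arrowCongr c e'), smul_finsum]
  refine finsum_congr fun f => ?_
  have h := insertAt_conj e e' p (Sum.inl a) q f (Equiv.arrowCongr c e' f) fun v h h' => by
    have hc : c.symm ⟨e v, h'⟩ = ⟨v, h⟩ := c.symm_apply_eq.2 rfl
    change e' (f (c.symm ⟨e v, h'⟩)) = _
    rw [hc]
  have h2 : (Equiv.sumCongr (e.subtypeEquiv (p := fun v => v ≠ Sum.inl a)
      (q := fun v => v ≠ e (Sum.inl a)) fun x => by simp) e').trans (insEquiv a B m n)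
      = (insEquiv a B m n).trans (Equiv.sumCongr (Equiv.refl _)
        (finSumFinEquiv.permCongr (Equiv.sumCongr s t))) := by
    ext x : 1
    rcases x with ⟨x | i, hx⟩ | b | j
    · rfl
    · simp [insEquiv, e, e']; rfl
    · simp [insEquiv, e, e']
    · simp [insEquiv, e, e']
  have h3 := mk_relabel (K := K) hk (finSumFinEquiv.permCongr (Equiv.sumCongr s t))
    (conj (insEquiv a B m n) (insertAt p (Sum.inl a) q f))
  rw [relabel, conj_conj, ← h2, Equiv.Perm.sign_permCongr] at h3
  have h4 := (conj_conj _ (insEquiv a B m n) (insertAt p (Sum.inl a) q f)).symm.trans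
    (congrArg (conj (insEquiv a B m n)) h.symm)
  refine (congrArg (mk K hk) h4).symm.trans ?_
  refine h3.trans ?_
  congr 1
  have := Equiv.Perm.sign_sumCongr s t
  rw [Equiv.Perm.sumCongr] at this
  rw [this]
  push_cast
  rfl

/-- The partial composition of `TRT`. -/
noncomputable def comp {k l n : ℤ} (a : A) (h : k + l = n) :
    Obj K A k →ₗ[K] Obj K B l →ₗ[K] Obj K (Ins a B) n :=
  extend (fun T => extend (fun T' => insSum K
      (by have := T.deg; have := T'.deg; omega) a T.par T'.par)
    (fun T' t => by
      have := insSum_relabel (K := K) (k := n)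
        (by have := T.deg; have := T'.deg; omega) a T.par T'.par 1 t
      rw [relabel_one] at this
      simp only [Equiv.Perm.sign_one, Units.val_one, Int.cast_one, one_mul] at this
      exact this))
    (fun T s => by
      refine Submodule.linearMap_qext _ (Finsupp.lhom_ext' fun T' => LinearMap.ext_ring ?_)
      have := insSum_relabel (K := K) (k := n)
        (by have := T.deg; have := T'.deg; omega) a T.par T'.par s 1
      rw [relabel_one T'.par] at this
      simp only [Equiv.Perm.sign_one, Units.val_one, Int.cast_one, mul_one] at this
      simp only [extend, LinearMap.comp_apply, Finsupp.lsingle_apply, Submodule.mkQ_apply,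
        Submodule.liftQ_apply, Finsupp.linearCombination_single, one_smul, LinearMap.smul_apply]
      exact this)

/-! ### Differential -/

/-- The vertices of a split tree: the new black vertex comes first. -/
def splitEquiv (A : Type) (m : ℕ) : Option (A ⊕ Fin m) ≃ A ⊕ Fin (m + 1) where
  toFun
    | none => Sum.inr 0
    | some (Sum.inl a) => Sum.inl a
    | some (Sum.inr i) => Sum.inr i.succ
  invFun
    | Sum.inl a => some (Sum.inl a)
    | Sum.inr i => Fin.cases none (fun i => some (Sum.inr i)) i
  left_inv := by rintro (_ | a | i) <;> rfl
  right_inv := by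
    rintro (a | i)
    · rfl
    · induction i using Fin.cases <;> rfl

variable (K) in
/-- The differential of a tree: the sum over all ways to split a vertex by a new black child, minus
the sum over all ways to split a numbered vertex by a new black parent. Trees with a black vertex
having fewer than two children are omitted. -/
noncomputable def splitSum {k : ℤ} (hk : ((m + 1 : ℕ) : ℤ) = -k)
    (p : A ⊕ Fin m → Option (A ⊕ Fin m)) : Obj K A k :=
  (∑ᶠ (v : A ⊕ Fin m) (S : childSets p v), mk K hk (conj (splitEquiv A m) (splitLower p v S)))
    - ∑ᶠ (a : A) (S : childSets p (Sum.inl a)),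
        mk K hk (conj (splitEquiv A m) (splitUpper p (Sum.inl a) S))

theorem splitLower_conj {V W : Type} (e : V ≃ W) (p : V → Option V) (v : V) (S : Set V) :
    splitLower (conj e p) (e v) (e '' S) = conj (Equiv.optionCongr e) (splitLower p v S) := by
  funext x
  obtain ⟨x, rfl⟩ := (Equiv.optionCongr e).surjective x
  conv_rhs => rw [conj, Equiv.symm_apply_apply]
  rcases x with _ | u
  · simp [splitLower]
  · by_cases h : u ∈ S <;> simp [splitLower, conj, h, Function.comp_def]

theorem splitUpper_conj {V W : Type} (e : V ≃ W) (p : V → Option V) (v : V) (S : Set V) :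
    splitUpper (conj e p) (e v) (e '' S) = conj (Equiv.optionCongr e) (splitUpper p v S) := by
  funext x
  obtain ⟨x, rfl⟩ := (Equiv.optionCongr e).surjective x
  conv_rhs => rw [conj, Equiv.symm_apply_apply]
  rcases x with _ | u
  · simp [splitUpper, conj, Function.comp_def]
  · by_cases h : u = v ∨ u ∈ S <;> simp [splitUpper, conj, h, Function.comp_def]

/-- Transport of sets of children along a bijection. -/
def childSetsEquiv {V W : Type} (e : V ≃ W) (p : V → Option V) (v : V) :
    childSets p v ≃ childSets (conj e p) (e v) :=
  (Equiv.Set.congr e).subtypeEquiv fun S => by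
    simp only [childSets, Set.mem_ofPred_eq, Equiv.Set.congr_apply, Set.image_subset_iff]
    refine forall₂_congr fun u _ => ?_
    exact (conj_eq_some e p u v).symm

theorem mk_splitEquiv {k : ℤ} (hk : ((m + 1 : ℕ) : ℤ) = -k) (s : Equiv.Perm (Fin m))
    (p : Option (A ⊕ Fin m) → Option (Option (A ⊕ Fin m))) :
    mk K hk (conj (splitEquiv A m)
      (conj (Equiv.optionCongr (Equiv.sumCongr (Equiv.refl A) s)) p))
      = (((Equiv.Perm.sign s : ℤˣ) : ℤ) : K) • mk K hk (conj (splitEquiv A m) p) := by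
  have h : (Equiv.optionCongr (Equiv.sumCongr (Equiv.refl A) s)).trans (splitEquiv A m)
      = (splitEquiv A m).trans (Equiv.sumCongr (Equiv.refl A)
        ((finSuccEquiv m).symm.permCongr (Equiv.optionCongr s))) := by
    ext x : 1
    rcases x with _ | a | i <;> simp [splitEquiv]
  rw [conj_conj, h, ← conj_conj]
  refine (mk_relabel hk _ _).trans ?_
  rw [Equiv.Perm.sign_permCongr, Equiv.optionCongr_sign]

theorem splitSum_relabel {k : ℤ} (hk : ((m + 1 : ℕ) : ℤ) = -k) (s : Equiv.Perm (Fin m))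
    (p : A ⊕ Fin m → Option (A ⊕ Fin m)) :
    splitSum K hk (relabel (Equiv.refl A) s p)
      = (((Equiv.Perm.sign s : ℤˣ) : ℤ) : K) • splitSum K hk p := by
  set e := Equiv.sumCongr (Equiv.refl A) s with he
  unfold splitSum
  rw [smul_sub, smul_finsum, smul_finsum, ← finsum_comp_equiv e]
  congr 1
  · refine finsum_congr fun v => ?_
    rw [smul_finsum, ← finsum_comp_equiv (childSetsEquiv e p v)]
    refine finsum_congr fun S => ?_
    rw [← mk_splitEquiv, ← splitLower_conj]
    rfl
  · refine finsum_congr fun a => ?_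
    rw [smul_finsum]
    refine (finsum_comp_equiv (childSetsEquiv e p (Sum.inl a))).symm.trans ?_
    refine finsum_congr fun S => ?_
    rw [← mk_splitEquiv, ← splitUpper_conj]
    rfl

/-- The differential of `TRT`. -/
noncomputable def d {k : ℤ} : Obj K A (k + 1) →ₗ[K] Obj K A k :=
  extend (fun T => splitSum K (by have := T.deg; omega) T.par)
    fun T s => splitSum_relabel _ s T.par

/-- Relabelling of the numbered vertices in `TRT`. -/
noncomputable def map {k : ℤ} (e : A ≃ B) : Obj K A k →ₗ[K] Obj K B k :=
  extend (fun T => mk K T.deg (relabel e (Equiv.refl _) T.par)) fun T s => by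
    rw [← mk_relabel]
    simp only [Tree.relabel, relabel, conj_conj]
    congr 2
    ext x : 1
    rcases x with x | x <;> rfl

end TRT

/-- The dg operad `TRT` of rooted trees with numbered and black vertices, all black vertices having
at least two children. -/
noncomputable def TRT (K : Type u) [Field K] : DGOperadData.{u, u} K where
  obj A _ k := TRT.Obj K A k
  map := TRT.map
  d := TRT.d
  one := TRT.mk K (m := 0) rfl fun _ => none
  comp := TRT.comp

/-- The tree in `TRT(A)` with a black root and one numbered child for each element of `A`. -/
noncomputable def TRT.corolla (K : Type u) [Field K] (A : Type) [Finite A] : (TRT K).obj A (-1) :=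
  TRT.mk K (m := 1) rfl (Sum.elim (fun _ => some (Sum.inr 0)) fun _ => none)

/-! ## `L∞`-algebras

An `L∞`-structure on the shift `V[1]` (where `V[1]` has the degree `k` element of `V` in degree
`k - 1`) is the same as a `hoLie₂`-structure on `V`: graded symmetric operations `ν_r` on `V` of
degree `-1`, with `ν₁` the differential. -/

section LInfinity

variable {K : Type u} [Field K] {V : Type v} [AddCommGroup V] [Module K V]
  {W : Type w} [AddCommGroup W] [Module K W]

/-- Families of `r`-ary multilinear operations from `V` to `W`. -/
abbrev MultiOps (K : Type u) [Field K] (V : Type v) [AddCommGroup V] [Module K V]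
    (W : Type w) [AddCommGroup W] [Module K W] :=
  ∀ r : ℕ, MultilinearMap K (fun _ : Fin r => V) W

/-- The operation of the appropriate arity applied to a list of arguments. -/
def MultiOps.app (ν : MultiOps K V W) (l : List V) : W := ν l.length l.get

/-- The Koszul sign of the rearrangement of elements of degrees `k 0, …, k (r-1)` that sorts them by
the value of `c`, keeping the order among elements with the same value. -/
def koszulSign (K : Type u) [Field K] {r m : ℕ} (k : Fin r → ℤ) (c : Fin r → Fin m) : K :=
  ∏ i : Fin r, ∏ j : Fin r, if i < j ∧ c j < c i then ksgn K (k i * k j) else 1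

/-- The list of those `x i`, in increasing order of `i`, with `c i = b`. -/
def block {r m : ℕ} (x : Fin r → V) (c : Fin r → Fin m) (b : Fin m) : List V :=
  ((List.finRange r).filter fun i => c i = b).map x

/-- Operations that are graded symmetric of degree `δ` and have no `0`-ary part. -/
structure IsGradedSymm (𝒱 : ℤ → Submodule K V) (𝒲 : ℤ → Submodule K W) (δ : ℤ)
    (ν : MultiOps K V W) : Prop where
  zero : ν 0 = 0
  mem : ∀ (r : ℕ) (k : Fin r → ℤ) (x : Fin r → V), (∀ i, x i ∈ 𝒱 (k i)) →
    ν r x ∈ 𝒲 ((∑ i, k i) + δ)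
  symm : ∀ (r : ℕ) (k : Fin r → ℤ) (x : Fin r → V), (∀ i, x i ∈ 𝒱 (k i)) →
    ∀ s : Equiv.Perm (Fin r), ν r (x ∘ s) = koszulSign K (k ∘ s) s • ν r x

/-- `ν` is an `L∞`-structure on `V[1]`, i.e. a `hoLie₂`-structure on `V`: the operations are graded
symmetric of degree `-1` and
`∑ ± ν (ν (x_{i₁}, …, x_{iₚ}), x_{j₁}, …, x_{j_q}) = 0`, summed over all decompositions of the
arguments into two ordered subsequences. -/
structure IsLInfinity (𝒱 : ℤ → Submodule K V) (ν : MultiOps K V V) : Prop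
    extends IsGradedSymm 𝒱 𝒱 (-1) ν where
  rel : ∀ (r : ℕ) (k : Fin r → ℤ) (x : Fin r → V), (∀ i, x i ∈ 𝒱 (k i)) →
    ∑ c : Fin r → Fin 2, koszulSign K k c • ν.app (ν.app (block x c 0) :: block x c 1) = 0

/-- `F` is an `L∞`-morphism `(V[1], μ) → (W[1], ν)`: the operations are graded symmetric of degree
`0` (as operations from `V` to `W`) and
`∑ ± F (μ (x_I), x_J) = ∑ₘ 1/m! ∑ ± ν_m (F (x_{B₁}), …, F (x_{Bₘ}))`, summed over all
decompositions `I ⊔ J` and `B₁ ⊔ … ⊔ Bₘ` of the arguments. -/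
structure IsLInfinityMorphism (𝒱 : ℤ → Submodule K V) (𝒲 : ℤ → Submodule K W)
    (μ : MultiOps K V V) (ν : MultiOps K W W) (F : MultiOps K V W) : Prop
    extends IsGradedSymm 𝒱 𝒲 0 F where
  rel : ∀ (r : ℕ) (k : Fin r → ℤ) (x : Fin r → V), (∀ i, x i ∈ 𝒱 (k i)) →
    ∑ c : Fin r → Fin 2, koszulSign K k c • F.app (μ.app (block x c 0) :: block x c 1)
      = ∑ m ∈ Finset.range (r + 1), ((m.factorial : K)⁻¹) •
          ∑ c : Fin r → Fin m, koszulSign K k c • ν m fun b => F.app (block x c b)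

/-- An `L∞`-isomorphism is an `L∞`-morphism whose linear part is bijective. -/
structure IsLInfinityIso (𝒱 : ℤ → Submodule K V) (𝒲 : ℤ → Submodule K W)
    (μ : MultiOps K V V) (ν : MultiOps K W W) (F : MultiOps K V W) : Prop
    extends IsLInfinityMorphism 𝒱 𝒲 μ ν F where
  bijective : Function.Bijective fun x : V => F 1 fun _ => x

/-- The operations of the abelian dg Lie algebra with differential `D`. -/
noncomputable def abelianOps (D : V →ₗ[K] V) : MultiOps K V V
  | 1 => MultilinearMap.ofSubsingleton K V V 0 D
  | _ => 0

end LInfinity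

/-! ## Differential graded pre-Lie algebras and the operations `ν_r` -/

/-- A dg pre-Lie algebra structure on the `ℤ`-graded vector space `g = ⨁ₖ 𝒢 k` (homological
grading, Koszul sign rule). -/
structure DGPreLie (K : Type u) [Field K] {g : Type v} [AddCommGroup g] [Module K g]
    (𝒢 : ℤ → Submodule K g) where
  /-- the differential -/
  d : g →ₗ[K] g
  /-- the product `x • y` -/
  mul : g →ₗ[K] g →ₗ[K] g
  d_mem : ∀ {k : ℤ} {x : g}, x ∈ 𝒢 k → d x ∈ 𝒢 (k - 1)
  mul_mem : ∀ {k l : ℤ} {x y : g}, x ∈ 𝒢 k → y ∈ 𝒢 l → mul x y ∈ 𝒢 (k + l)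
  d_d : ∀ x : g, d (d x) = 0
  d_mul : ∀ {k : ℤ} {x : g} (y : g), x ∈ 𝒢 k →
    d (mul x y) = mul (d x) y + ksgn K k • mul x (d y)
  pre_lie : ∀ {k l : ℤ} (x : g) {y z : g}, y ∈ 𝒢 k → z ∈ 𝒢 l →
    mul x (mul y z) - mul (mul x y) z = ksgn K (k * l) • (mul x (mul z y) - mul (mul x z) y)

namespace DGPreLie

variable {K : Type u} [Field K] {g : Type v} [AddCommGroup g] [Module K g]
  {𝒢 : ℤ → Submodule K g} (L : DGPreLie K 𝒢)

/-- Maurer-Cartan elements. -/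
def IsMaurerCartan (α : g) : Prop := α ∈ 𝒢 (-1) ∧ L.d α + L.mul α α = 0

section

variable (𝒢) [DirectSum.Decomposition 𝒢]

/-- The linear map that multiplies elements of degree `k` by the scalar `c k`. -/
noncomputable def scaleBy (c : ℤ → K) : g →ₗ[K] g :=
  (DirectSum.decomposeLinearEquiv 𝒢).symm.toLinearMap ∘ₗ
    DirectSum.lmap (fun k => c k • LinearMap.id) ∘ₗ
      (DirectSum.decomposeLinearEquiv 𝒢).toLinearMap

/-- The linear map `x ↦ (-1)^{|x|} x`. -/
noncomputable def gradeSign : g →ₗ[K] g := scaleBy 𝒢 (ksgn K)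

/-- The projection to the sum of the parts of even degree. -/
noncomputable def evenPart : g →ₗ[K] g := scaleBy 𝒢 fun k => if Even k then 1 else 0

/-- The projection to the sum of the parts of odd degree. -/
noncomputable def oddPart : g →ₗ[K] g := scaleBy 𝒢 fun k => if Even k then 0 else 1

end

theorem actAt_aux {r : ℕ} (s : g →ₗ[K] g) (i : Fin r) (v : Fin r → g) (y : g) :
    (fun j => (if j < i then LinearMap.id else if j = i then L.mul.flip y else s : g →ₗ[K] g)
      (v j)) = Function.update (fun j => if j < i then v j else s (v j)) i (L.mul (v i) y) := by
  funext j
  rcases lt_trichotomy j i with h | rfl | h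
  · simp [h, h.ne]
  · simp
  · simp [h.not_gt, h.ne']

/-- The linear map `y ↦ f (x₁, …, xᵢ₋₁, xᵢ • y, s xᵢ₊₁, …, s xᵣ)`. -/
noncomputable def actAt {r : ℕ} (f : MultilinearMap K (fun _ : Fin r => g) g) (s : g →ₗ[K] g)
    (i : Fin r) : g →ₗ[K] MultilinearMap K (fun _ : Fin r => g) g where
  toFun y := f.compLinearMap fun j =>
    if j < i then LinearMap.id else if j = i then L.mul.flip y else s
  map_add' y z := by
    ext v
    have h (y : g) := congrArg f (actAt_aux L s i v y)
    refine (h (y + z)).trans ?_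
    rw [map_add, f.map_update_add]
    exact (congrArg₂ (· + ·) (h y) (h z)).symm
  map_smul' c y := by
    ext v
    have h (y : g) := congrArg f (actAt_aux L s i v y)
    refine (h (c • y)).trans ?_
    rw [map_smul, f.map_update_smul]
    exact (congrArg (c • ·) (h y)).symm

/-- The operation `(x₁, …, xᵣ, y) ↦ f (x₁, …, xᵣ) • y`, with `y` as the first argument. -/
noncomputable def actOutside {r : ℕ} (f : MultilinearMap K (fun _ : Fin r => g) g) :
    g →ₗ[K] MultilinearMap K (fun _ : Fin r => g) g where
  toFun y := (L.mul.flip y).compMultilinearMap f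
  map_add' y z := by ext; simp
  map_smul' c y := by ext; simp

variable [DirectSum.Decomposition 𝒢]

/-- The operation `y ↦ ∑ᵢ (-1)^{|y| (|xᵢ₊₁| + … + |xᵣ|)} f (x₁, …, xᵢ • y, …, xᵣ)`; in the summands
the sign is produced by the odd part of `y` changing the signs of `xᵢ₊₁, …, xᵣ`. -/
noncomputable def actInside {r : ℕ} (f : MultilinearMap K (fun _ : Fin r => g) g) :
    g →ₗ[K] MultilinearMap K (fun _ : Fin r => g) g :=
  ∑ i : Fin r, (L.actAt f LinearMap.id i ∘ₗ evenPart 𝒢 + L.actAt f (gradeSign 𝒢) i ∘ₗ oddPart 𝒢)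

/-- The operation `x • (x₁, …, xᵣ)` given by the rooted tree whose root `x` has the children
`x₁, …, xᵣ`. It satisfies `x • () = x` and
`x • (x₁, …, xᵣ, y) = (x • (x₁, …, xᵣ)) • y - ∑ᵢ ± x • (x₁, …, xᵢ • y, …, xᵣ)`. -/
noncomputable def corolla (x : g) : ∀ r : ℕ, MultilinearMap K (fun _ : Fin r => g) g
  | 0 => MultilinearMap.constOfIsEmpty K _ x
  | r + 1 =>
    (LinearMap.uncurryLeft (L.actOutside (corolla x r) - L.actInside (corolla x r))).domDomCongr
      (finRotate (r + 1)).symm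

/-- The twisted differential `d + [α, -]`, where `[α, x] = α • x - (-1)^{|α||x|} x • α` for `α` of
degree `-1`. -/
noncomputable def twistedD (α : g) : g →ₗ[K] g :=
  L.d + L.mul α - L.mul.flip α ∘ₗ gradeSign 𝒢

/-- The operations `ν₁ = d + [α, -]` and `ν_r(x₁, …, x_r) = α • (x₁, …, x_r)` for `r ≥ 2`. -/
noncomputable def nu (α : g) : MultiOps K g g
  | 0 => 0
  | 1 => MultilinearMap.ofSubsingleton K g g 0 (L.twistedD α)
  | r + 2 => L.corolla α (r + 2)

end DGPreLie

/-! ## The two morphisms `hoLie₂ → TRT` -/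

/-- The morphism sends every generator `ν_A` to the corolla with a black root. -/
def SendsToCorolla {K : Type u} [Field K] (φ : DGOperadData.Hom (hoLieTwo K) (TRT K)) : Prop :=
  ∀ (A : Type) [Finite A] (hA : 2 ≤ Nat.card A),
    φ.app A (-1) (hoLieTwo.nu K A hA) = TRT.corolla K A

/-- The morphism sends every generator `ν_A` to zero. -/
def KillsGenerators {K : Type u} [Field K] (φ : DGOperadData.Hom (hoLieTwo K) (TRT K)) : Prop :=
  ∀ (A : Type) [Finite A] (hA : 2 ≤ Nat.card A), φ.app A (-1) (hoLieTwo.nu K A hA) = 0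

/-!
# The canonical map from `hoLie₂` to trees is homotopic to zero

*Operads.* The operad `hoLie₂` is quasi-free: a morphism out of it is determined by symmetric
elements `ν_A` with the prescribed differential, and all such elements occur (`HoLieTwo.lift`,
`HoLieTwo.hom_ext`). A homotopy from the corollas to zero is therefore a family
of elements of `TRT[t, dt]`. The one used here is
`ν_r ↦ (1 - t)^(r-1) c_r + dt (1 - t)^(r-2) h_r`, where `c_r` is the corolla with black root and
`h_r = ∑_T Ω_T'(1) T` runs over the trees without black vertices; `Ω_T(n)` is the number of
labellings of the vertices of `T` by `0, …, n - 1` that strictly increase away from the root. The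
differentials of `c_r` (`dSum_star`) and of `h_r` (`dSum_weightSum`) make this work. For the second,
a formal sum of trees is replaced by a multilinear polynomial in the entries of a matrix
(`TreeSum.ev`), on which insertions and splittings of vertices act by substitutions. The polynomial
of the sum of all `Ω_T(n) T` is a sum over labellings, and the identity for `h_r` becomes a
summation by parts over the label of a collapsed point (`sum_ev_clp_weightSum`). The same
polynomials verify the axioms of a dg operad for formal sums of trees; `TRT` is a quotient of these,
and the valence condition is respected because the splittings that violate it cancel
(`ParentFn.sum_split_eq_zero`).

*Pre-Lie algebras.* The algebra `g` is extended by finitely many square-zero generators `e_i` of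
arbitrary degrees. The elements of total degree zero are a pre-Lie algebra without grading and
without signs (`DGPreLie.coeffPreLie`), and graded symmetric operations on `g` are symmetric
multilinear operations there (`IsLift`), hence determined by their values `ν(X, …, X)` on
`X = ∑ e_i x_i + …`. The relations to be proved are coefficients of identities for such `X`. Both
identities hold because their two sides solve the same equation `N Z = Z • y + …`, where `N`
multiplies a monomial by the number of its generators `e_i`, and such an equation determines `Z`
from its part of weight zero.

For generators `e_p`, `e_q` of degree `-1`, the vector fields
`V_p = ∑_m e_p α • (X, …, X) / m! + …` given by `ν` commute; this rests on the brace identity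
`(a • b) • exp X = a • (exp X, b • exp X)` (`expC_mul`, `sum_liftNu_cons_comm`). As `e_p` and `e_q`
anticommute, this is the quadratic relation between the `ν_r` (`nu_isLInfinity`).

The isomorphism `W` has as components the graded symmetrizations of `((x₁ • x₂) • …) • xᵣ`
(`symMul`). In the extended algebra it is the map `y ↦ X = ∑_n (…(y • y)…) • y / n!`, which solves
`N X = y + X • y` if `N y = y`, and it takes the linear vector field of the differential
`d + [α, -]` to the vector field of the `ν_r` (`sum_symMul_cons_liftD`, `symMul_isLInfinityIso`).
-/


open Finset (add_sum_erase card_univ empty_union mem_biUnion mem_filter mem_image mem_univ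
  mul_prod_erase mul_sum ne_of_mem_erase prod_comm prod_congr prod_const_one prod_disjSum
  prod_empty prod_eq_one prod_eq_zero prod_mul_distrib prod_univ_sum range smul_sum
  sum_add_distrib sum_comm sum_congr sum_disjSum sum_eq_single sum_eq_zero sum_filter sum_mul
  sum_neg_distrib sum_range_succ sum_range_succ' sum_singleton sum_sub_distrib sum_union
  union_empty univ univ_sum_single univ_unique)
open Function (comp_apply update update_comp_equiv update_of_ne update_self)
open Equiv (coe_fn_mk optionCongr sumCongr sumEmpty swap swap_apply_of_ne_of_ne)
open Option (bind_none bind_some elim_none elim_some map_eq_none_iff map_eq_some_iff map_none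
  map_some)
open LinearMap (compr₂_apply eqLocus mk₂)
open Fintype (card_fin card_perm card_subtype ofFinite prod_equiv prod_option prod_sum_type
  sum_option sum_sum_type)
open Finsupp (induction_linear linearCombination linearCombination_single mapRange)
open Fin (lastCases snoc snoc_castSucc snoc_init_self snoc_last)

/-! ### The universal property of `hoLie₂` -/

namespace HoLieTwo

variable {K : Type u} [Field K]

theorem isDGOperad (K : Type u) [Field K] : (hoLieTwo K).IsDGOperad where
  map_refl := by rintro A _ k ⟨x⟩; exact Obj.mk_eq (Rel.map_refl x)
  map_trans := by rintro A B C _ _ _ k e e' ⟨x⟩; exact Obj.mk_eq (Rel.map_trans e e' x)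
  comp_map := by
    rintro A A' B B' _ _ _ _ k l n e e' a h ⟨x⟩ ⟨y⟩; exact Obj.mk_eq (Rel.comp_map e e' a h x y)
  one_comp := by rintro B _ k ⟨y⟩; exact Obj.mk_eq (Rel.one_comp _ y)
  comp_one := by rintro A _ k a ⟨x⟩; exact Obj.mk_eq (Rel.comp_one _ a x)
  assoc_seq := by
    rintro A B C _ _ _ k l m p q n a b h₁ h₂ h₃ h₄ ⟨x⟩ ⟨y⟩ ⟨z⟩
    exact Obj.mk_eq (Rel.assoc_seq a b h₁ h₂ h₃ h₄ x y z)
  assoc_par := by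
    rintro A B C _ _ _ k l m p q n a a' h h₁ h₂ h₃ h₄ ⟨x⟩ ⟨y⟩ ⟨z⟩
    exact Obj.mk_eq (Rel.assoc_par a a' h h₁ h₂ h₃ h₄ x y z)
  d_d := by rintro A _ k ⟨x⟩; exact Obj.mk_eq (Rel.d_d x)
  d_map := by rintro A B _ _ k e ⟨x⟩; exact Obj.mk_eq (Rel.d_map e x)
  d_comp := by
    rintro A B _ _ k l n a h h₁ h₂ ⟨x⟩ ⟨y⟩
    exact Obj.mk_eq (Rel.d_comp a h h₁ h₂ x y)

/-- Symmetric elements `ν_A` of a dg operad with the differential prescribed by `hoLie₂`. -/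
structure Generators (Q : DGOperadData.{u, w} K) where
  /-- the image of the generator `ν_A` -/
  nu : ∀ (A : Type) [Finite A], 2 ≤ Nat.card A → Q.obj A (-1)
  map_nu : ∀ {A B : Type} [Finite A] [Finite B] (hA : 2 ≤ Nat.card A) (hB : 2 ≤ Nat.card B)
    (e : A ≃ B), Q.map e (nu A hA) = nu B hB
  d_nu : ∀ {A : Type} [Finite A] (hA : 2 ≤ Nat.card A),
    Q.d (k := -2) (nu A hA) = -∑ᶠ S : SplitSubset A, Q.map (collapseEquiv S.1)
      (Q.comp (k := -1) (l := -1) (n := -2) (Sum.inr ()) (by norm_num)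
        (nu (Collapse S.1) S.2.2) (nu {x : A // x ∈ S.1} S.2.1))

variable {Q : DGOperadData.{u, w} K}

/-- The value of a formal expression at given values of the generators. -/
noncomputable def Pre.eval (G : Generators Q) :
    ∀ {A : Type} {k : ℤ}, Pre K A k → ∀ [Finite A], Q.obj A k
  | _, _, .zero, _ => 0
  | _, _, .add x y, _ => Pre.eval G x + Pre.eval G y
  | _, _, .smul c x, _ => c • Pre.eval G x
  | _, _, .one, _ => Q.one
  | _, _, @Pre.nu _ A _iA hA _ hk, _ => hk ▸ G.nu A hA
  | _, _, @Pre.map _ _ _ _iA _iB _ e x, _ => Q.map e (Pre.eval G x)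
  | _, _, @Pre.d _ _ _iA _ x, _ => Q.d (Pre.eval G x)
  | _, _, @Pre.comp _ _ _ _iA _iB _ _ _ a h x y, _ => Q.comp a h (Pre.eval G x) (Pre.eval G y)

theorem Pre.eval_listSum (G : Generators Q) {A : Type} {k : ℤ} [Finite A]
    (l : List (Pre K A k)) : Pre.eval G (Pre.listSum l) = (l.map fun x => Pre.eval G x).sum := by
  induction l with
  | nil => rfl
  | cons x l ih => simp only [List.map_cons, List.sum_cons, ← ih]; rfl

theorem Pre.eval_eq_of_rel (hQ : Q.IsDGOperad) (G : Generators Q) {A : Type} {k : ℤ}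
    {x y : Pre K A k} (h : Rel K x y) : ∀ [Finite A], Pre.eval G x = Pre.eval G y := by
  induction h with
  | refl x => intro; rfl
  | symm _ ih => intro _; exact ih.symm
  | trans _ _ ih ih' => intro _; exact ih.trans ih'
  | add_congr _ _ ih ih' => intro _; simp only [eval, ih, ih']
  | smul_congr c _ ih => intro _; simp only [eval, ih]
  | map_congr e _ ih => intro _; simp only [eval, ih]
  | d_congr _ ih => intro _; simp only [eval, ih]
  | comp_congr a h _ _ ih ih' => intro _; simp only [eval, ih, ih']
  | add_comm x y => intro _; exact add_comm _ _
  | add_assoc x y z => intro _; exact add_assoc _ _ _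
  | zero_add x => intro _; exact zero_add _
  | zero_smul x => intro _; exact zero_smul _ _
  | one_smul x => intro _; exact one_smul _ _
  | mul_smul c c' x => intro _; exact mul_smul _ _ _
  | smul_add c x y => intro _; exact smul_add _ _ _
  | add_smul c c' x => intro _; exact add_smul _ _ _
  | map_add e x y => intro _; exact map_add _ _ _
  | map_smul e c x => intro _; exact map_smul _ _ _
  | d_add x y => intro _; exact map_add _ _ _
  | d_smul c x => intro _; exact map_smul _ _ _
  | comp_add_left a h x x' y => intro _; simp only [eval, _root_.map_add, LinearMap.add_apply]
  | comp_smul_left a h c x y => intro _; simp only [eval, _root_.map_smul, LinearMap.smul_apply]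
  | comp_add_right a h x y y' => intro _; exact map_add _ _ _
  | comp_smul_right a h c x y => intro _; exact map_smul _ _ _
  | map_refl x => intro _; exact hQ.map_refl _
  | map_trans e e' x => intro _; exact hQ.map_trans _ _ _
  | comp_map e e' a h x y => intro _; exact hQ.comp_map _ _ _ _ _ _
  | one_comp h y => intro _; exact hQ.one_comp _
  | comp_one h a x => intro _; exact hQ.comp_one _ _
  | assoc_seq a b h₁ h₂ h₃ h₄ x y z => intro _; exact hQ.assoc_seq _ _ _ _ _ _ _ _ _
  | assoc_par a a' h h₁ h₂ h₃ h₄ x y z => intro _; exact hQ.assoc_par _ _ _ _ _ _ _ _ _ _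
  | d_d x => intro _; exact hQ.d_d _
  | d_map e x => intro _; exact hQ.d_map _ _
  | d_comp a h h₁ h₂ x y => intro _; exact hQ.d_comp _ _ _ _ _ _
  | map_nu hA hB hk e => intro _; subst hk; exact G.map_nu _ _ _
  | @d_nu A _ hA k hk hk' =>
    intro _
    obtain rfl : k = -2 := by omega
    refine (G.d_nu hA).trans ?_
    simp only [eval, neg_one_smul, nuNu, eval_listSum, List.map_map]
    congr 1
    let _ : Fintype (SplitSubset A) := ofFinite _
    rw [finsum_eq_sum_of_fintype, ← Finset.sum_map_toList]
    rfl

/-- The morphism out of `hoLie₂` with given values on the generators. -/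
noncomputable def lift (hQ : Q.IsDGOperad) (G : Generators Q) :
    DGOperadData.Hom (hoLieTwo K) Q where
  app A _ k :=
    { toFun := Quotient.lift (fun x => Pre.eval G x) fun _ _ h => Pre.eval_eq_of_rel hQ G h
      map_add' := by rintro ⟨x⟩ ⟨y⟩; rfl
      map_smul' := by rintro c ⟨x⟩; rfl }
  app_map := by rintro A B _ _ k e ⟨x⟩; rfl
  app_one := rfl
  app_comp := by rintro A B _ _ k l n a h ⟨x⟩ ⟨y⟩; rfl
  app_d := by rintro A _ k ⟨x⟩; rfl

theorem lift_nu (hQ : Q.IsDGOperad) (G : Generators Q) (A : Type) [Finite A]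
    (hA : 2 ≤ Nat.card A) : (lift hQ G).app A (-1) (hoLieTwo.nu K A hA) = G.nu A hA := rfl

/-- A morphism out of `hoLie₂` is determined by its values on the generators. -/
theorem hom_ext {F F' : DGOperadData.Hom (hoLieTwo K) Q}
    (h : ∀ (A : Type) [Finite A] (hA : 2 ≤ Nat.card A),
      F.app A (-1) (hoLieTwo.nu K A hA) = F'.app A (-1) (hoLieTwo.nu K A hA)) : F = F' := by
  have key : ∀ {A : Type} {k : ℤ} (x : Pre K A k), ∀ [Finite A],
      F.app A k (Obj.mk x) = F'.app A k (Obj.mk x) := by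
    intro A k x
    induction x with
    | zero => intro _; exact (map_zero (F.app _ _)).trans (map_zero (F'.app _ _)).symm
    | add x y ihx ihy =>
      intro _
      exact (map_add (F.app _ _) (Obj.mk x) (Obj.mk y)).trans
        ((congrArg₂ (· + ·) ihx ihy).trans (map_add (F'.app _ _) (Obj.mk x) (Obj.mk y)).symm)
    | smul c x ih =>
      intro _
      exact (map_smul (F.app _ _) c (Obj.mk x)).trans
        ((congrArg (c • ·) ih).trans (map_smul (F'.app _ _) c (Obj.mk x)).symm)
    | one => intro _; exact F.app_one.trans F'.app_one.symm
    | nu A hA hk => intro _; subst hk; exact h A hA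
    | map e x ih =>
      intro _
      exact (F.app_map e (Obj.mk x)).trans
        ((congrArg (Q.map e) ih).trans (F'.app_map e (Obj.mk x)).symm)
    | d x ih =>
      intro _
      exact (F.app_d (Obj.mk x)).trans ((congrArg Q.d ih).trans (F'.app_d (Obj.mk x)).symm)
    | comp a h x y ihx ihy =>
      intro _
      exact (F.app_comp a h (Obj.mk x) (Obj.mk y)).trans
        ((congrArg₂ (fun x y => Q.comp a h x y) ihx ihy).trans
          (F'.app_comp a h (Obj.mk x) (Obj.mk y)).symm)
  ext A _ k ⟨x⟩
  exact key x

end HoLieTwo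

/-! ### Signs -/

section Signs

variable (K : Type u) [Field K]

theorem ksgn_zero : ksgn K 0 = 1 := by simp [ksgn]

theorem ksgn_add (k l : ℤ) : ksgn K (k + l) = ksgn K k * ksgn K l := by
  simp [ksgn, Int.negOnePow_add]

theorem ksgn_one : ksgn K 1 = -1 := by simp [ksgn]

theorem ksgn_neg (k : ℤ) : ksgn K (-k) = ksgn K k := by simp [ksgn, Int.negOnePow_neg]

theorem ksgn_add_one (k : ℤ) : ksgn K (k + 1) = -ksgn K k := by
  rw [ksgn_add, ksgn_one, mul_neg_one]

theorem ksgn_mul_self (k : ℤ) : ksgn K k * ksgn K k = 1 := by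
  rw [← ksgn_add]
  simp [ksgn, Int.negOnePow_even _ (Even.add_self k)]

theorem ksgn_natCast (n : ℕ) : ksgn K n = (-1) ^ n := by
  simp [ksgn, Int.negOnePow_def]

end Signs

/-! ### The path object of a dg operad -/

namespace DGOperadData

variable {K : Type u} [Field K]

section Poly

variable {M N L M' N' L' R R' : Type v} [AddCommGroup M] [Module K M] [AddCommGroup N] [Module K N]
  [AddCommGroup L] [Module K L] [AddCommGroup M'] [Module K M'] [AddCommGroup N'] [Module K N']
  [AddCommGroup L'] [Module K L'] [AddCommGroup R] [Module K R] [AddCommGroup R'] [Module K R']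

@[simp] theorem polyMul_single (b : M →ₗ[K] N →ₗ[K] L) (i j : ℕ) (x : M) (y : N) :
    polyMul b (Finsupp.single i x) (Finsupp.single j y) = Finsupp.single (i + j) (b x y) := by
  simp [polyMul]

@[simp] theorem polyDeriv_single (i : ℕ) (x : M) :
    polyDeriv (K := K) (Finsupp.single i x) = (i : K) • Finsupp.single (i - 1) x := by
  simp [polyDeriv]

@[simp] theorem polyEval_single (c : K) (i : ℕ) (x : M) :
    polyEval c (Finsupp.single i x) = c ^ i • x := by
  simp [polyEval]

theorem mapRange_polyMul {b : M →ₗ[K] N →ₗ[K] L} {b' : M' →ₗ[K] N' →ₗ[K] L'} {f : L →ₗ[K] L'}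
    {g : M →ₗ[K] M'} {h : N →ₗ[K] N'} (H : ∀ x y, b' (g x) (h y) = f (b x y)) (x : ℕ →₀ M)
    (y : ℕ →₀ N) :
    polyMul b' (mapRange.linearMap g x) (mapRange.linearMap h y)
      = mapRange.linearMap f (polyMul b x y) := by
  induction x using induction_linear with
  | zero => simp
  | add x x' hx hx' => simp only [map_add, LinearMap.add_apply, hx, hx']
  | single i x =>
    induction y using induction_linear with
    | zero => simp
    | add y y' hy hy' => simp only [map_add, hy, hy']
    | single j y => simp [H]

theorem polyMul_assoc {b₁ : M →ₗ[K] N →ₗ[K] L} {b₂ : L →ₗ[K] M' →ₗ[K] N'}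
    {b₃ : N →ₗ[K] M' →ₗ[K] R} {b₄ : M →ₗ[K] R →ₗ[K] R'} {f : N' →ₗ[K] R'}
    (H : ∀ x y z, f (b₂ (b₁ x y) z) = b₄ x (b₃ y z)) (x : ℕ →₀ M) (y : ℕ →₀ N) (z : ℕ →₀ M') :
    mapRange.linearMap f (polyMul b₂ (polyMul b₁ x y) z)
      = polyMul b₄ x (polyMul b₃ y z) := by
  induction x using induction_linear with
  | zero => simp
  | add x x' hx hx' => simp only [map_add, LinearMap.add_apply, hx, hx']
  | single i x =>
    induction y using induction_linear with
    | zero => simp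
    | add y y' hy hy' => simp only [map_add, LinearMap.add_apply, hy, hy']
    | single j y =>
      induction z using induction_linear with
      | zero => simp
      | add z z' hz hz' => simp only [map_add, hz, hz']
      | single l z => simp [H, add_assoc]

theorem polyMul_comm {b₁ : M →ₗ[K] N →ₗ[K] L} {b₂ : L →ₗ[K] M' →ₗ[K] N'}
    {b₃ : M →ₗ[K] M' →ₗ[K] R} {b₄ : R →ₗ[K] N →ₗ[K] R'} {f : N' →ₗ[K] R'} {c : K}
    (H : ∀ x y z, f (b₂ (b₁ x y) z) = c • b₄ (b₃ x z) y) (x : ℕ →₀ M) (y : ℕ →₀ N)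
    (z : ℕ →₀ M') :
    mapRange.linearMap f (polyMul b₂ (polyMul b₁ x y) z)
      = c • polyMul b₄ (polyMul b₃ x z) y := by
  induction x using induction_linear with
  | zero => simp
  | add x x' hx hx' => simp only [map_add, LinearMap.add_apply, smul_add, hx, hx']
  | single i x =>
    induction y using induction_linear with
    | zero => simp
    | add y y' hy hy' => simp only [map_add, LinearMap.add_apply, smul_add, hy, hy']
    | single j y =>
      induction z using induction_linear with
      | zero => simp
      | add z z' hz hz' => simp only [map_add, LinearMap.add_apply, smul_add, hz, hz']
      | single l z => simp [H, add_right_comm]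

theorem polyMul_leibniz {b : M →ₗ[K] N →ₗ[K] L} {b₁ : M' →ₗ[K] N →ₗ[K] L'}
    {b₂ : M →ₗ[K] N' →ₗ[K] L'} {f : L →ₗ[K] L'} {g : M →ₗ[K] M'} {h : N →ₗ[K] N'} {c : K}
    (H : ∀ x y, f (b x y) = b₁ (g x) y + c • b₂ x (h y)) (x : ℕ →₀ M) (y : ℕ →₀ N) :
    mapRange.linearMap f (polyMul b x y)
      = polyMul b₁ (mapRange.linearMap g x) y
        + c • polyMul b₂ x (mapRange.linearMap h y) := by
  induction x using induction_linear with
  | zero => simp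
  | add x x' hx hx' => simp only [map_add, LinearMap.add_apply, smul_add, hx, hx']; abel
  | single i x =>
    induction y using induction_linear with
    | zero => simp
    | add y y' hy hy' => simp only [map_add, smul_add, hy, hy']; abel
    | single j y => simp [H]

theorem polyDeriv_polyMul (b : M →ₗ[K] N →ₗ[K] L) (x : ℕ →₀ M) (y : ℕ →₀ N) :
    polyDeriv (K := K) (polyMul b x y) = polyMul b (polyDeriv (K := K) x) y
      + polyMul b x (polyDeriv (K := K) y) := by
  induction x using induction_linear with
  | zero => simp
  | add x x' hx hx' => simp only [map_add, LinearMap.add_apply, hx, hx']; abel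
  | single i x =>
    induction y using induction_linear with
    | zero => simp
    | add y y' hy hy' => simp only [map_add, hy, hy']; abel
    | single j y =>
      rcases i with _ | i
      · simp
      rcases j with _ | j
      · simp
      have h₁ : i + 1 + (j + 1) - 1 = i + j + 1 := by omega
      have h₂ : i + (j + 1) = i + j + 1 := by omega
      have h₃ : i + 1 + j = i + j + 1 := by omega
      simp only [polyMul_single, polyDeriv_single, h₁, map_smul, LinearMap.smul_apply,
        Nat.add_sub_cancel, h₂, h₃, ← add_smul]
      push_cast
      ring_nf

theorem mapRange_polyDeriv (f : M →ₗ[K] N) (x : ℕ →₀ M) :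
    mapRange.linearMap f (polyDeriv (K := K) x)
      = polyDeriv (K := K) (mapRange.linearMap f x) := by
  induction x using induction_linear with
  | zero => simp
  | add x x' hx hx' => simp only [map_add, hx, hx']
  | single i x => simp [-Finsupp.smul_single]

theorem polyEval_polyMul (b : M →ₗ[K] N →ₗ[K] L) (c : K) (x : ℕ →₀ M) (y : ℕ →₀ N) :
    polyEval c (polyMul b x y) = b (polyEval c x) (polyEval c y) := by
  induction x using induction_linear with
  | zero => simp
  | add x x' hx hx' => simp only [map_add, LinearMap.add_apply, hx, hx']
  | single i x =>
    induction y using induction_linear with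
    | zero => simp
    | add y y' hy hy' => simp only [map_add, hy, hy']
    | single j y => simp [pow_add, smul_smul, mul_comm]

theorem polyEval_mapRange (f : M →ₗ[K] N) (c : K) (x : ℕ →₀ M) :
    polyEval c (mapRange.linearMap f x) = f (polyEval c x) := by
  induction x using induction_linear with
  | zero => simp
  | add x x' hx hx' => simp only [map_add, hx, hx']
  | single i x => simp

/-- The element `p(t) x` of `M[t]` for a polynomial `p` and `x` in `M`. -/
noncomputable def polySmul (x : M) : Polynomial K →ₗ[K] (ℕ →₀ M) :=
  Polynomial.lsum fun n => Finsupp.lsingle n ∘ₗ LinearMap.toSpanSingleton K M x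

theorem polySmul_monomial (x : M) (n : ℕ) (c : K) :
    polySmul x (Polynomial.monomial n c) = Finsupp.single n (c • x) := by
  simp [polySmul, Polynomial.lsum_apply]

theorem polyMul_polySmul (b : M →ₗ[K] N →ₗ[K] L) (p q : Polynomial K) (x : M) (y : N) :
    polyMul b (polySmul x p) (polySmul y q) = polySmul (b x y) (p * q) := by
  induction p using Polynomial.induction_on' with
  | add p p' hp hp' => simp only [map_add, LinearMap.add_apply, add_mul, hp, hp']
  | monomial i c =>
    induction q using Polynomial.induction_on' with
    | add q q' hq hq' => simp only [map_add, mul_add, hq, hq']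
    | monomial j c' =>
      simp [polySmul_monomial, Polynomial.monomial_mul_monomial, smul_smul, mul_comm]

theorem polyDeriv_polySmul (p : Polynomial K) (x : M) :
    polyDeriv (K := K) (polySmul x p) = polySmul x (Polynomial.derivative p) := by
  induction p using Polynomial.induction_on' with
  | add p p' hp hp' => simp only [map_add, hp, hp']
  | monomial i c =>
    simp [polySmul_monomial, Polynomial.derivative_monomial, smul_smul, mul_comm]

theorem polyEval_polySmul (c : K) (p : Polynomial K) (x : M) :
    polyEval c (polySmul x p) = p.eval c • x := by
  induction p using Polynomial.induction_on' with
  | add p p' hp hp' => simp only [map_add, Polynomial.eval_add, add_smul, hp, hp']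
  | monomial i a => simp [polySmul_monomial, smul_smul, mul_comm]

theorem mapRange_polySmul (f : M →ₗ[K] N) (p : Polynomial K) (x : M) :
    mapRange.linearMap f (polySmul x p) = polySmul (f x) p := by
  induction p using Polynomial.induction_on' with
  | add p p' hp hp' => simp only [map_add, hp, hp']
  | monomial i a => simp [polySmul_monomial]

end Poly

variable {Q : DGOperadData.{u, v} K}

theorem mapRange_polyMul_single_left {M N L : Type v} [AddCommGroup M] [Module K M]
    [AddCommGroup N] [Module K N] [AddCommGroup L] [Module K L]
    {b : M →ₗ[K] N →ₗ[K] L} {f : N →ₗ[K] L} {x : M} (H : ∀ y, b x y = f y) (y : ℕ →₀ N) :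
    polyMul b (Finsupp.single 0 x) y = mapRange.linearMap f y := by
  induction y using induction_linear with
  | zero => simp
  | add y y' hy hy' => simp only [map_add, hy, hy']
  | single j y => simp [H]

theorem mapRange_polyMul_single_right {M N L : Type v} [AddCommGroup M] [Module K M]
    [AddCommGroup N] [Module K N] [AddCommGroup L] [Module K L]
    {b : M →ₗ[K] N →ₗ[K] L} {f : M →ₗ[K] L} {y : N} (H : ∀ x, b x y = f x) (x : ℕ →₀ M) :
    polyMul b x (Finsupp.single 0 y) = mapRange.linearMap f x := by
  induction x using induction_linear with
  | zero => simp
  | add x x' hx hx' => simp only [map_add, LinearMap.add_apply, hx, hx']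
  | single j x => simp [H]

theorem mapRange_eq_self {M : Type v} [AddCommGroup M] [Module K M] {f : M →ₗ[K] M}
    (H : ∀ x, f x = x) (x : ℕ →₀ M) : mapRange.linearMap f x = x := by
  ext n
  simp [H]

theorem mapRange_mapRange {M N L N' : Type v} [AddCommGroup M] [Module K M] [AddCommGroup N]
    [Module K N] [AddCommGroup L] [Module K L] [AddCommGroup N'] [Module K N']
    {f : M →ₗ[K] N} {g : N →ₗ[K] L} {f' : M →ₗ[K] N'} {g' : N' →ₗ[K] L}
    (H : ∀ x, g (f x) = g' (f' x)) (x : ℕ →₀ M) :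
    mapRange.linearMap g (mapRange.linearMap f x)
      = mapRange.linearMap g' (mapRange.linearMap f' x) := by
  ext n
  simp [H]

theorem path_comp {A B : Type} [Finite A] [Finite B] {k l n : ℤ} (a : A) (h : k + l = n)
    (p : ℕ →₀ Q.obj A k) (q : ℕ →₀ Q.obj A (k + 1)) (p' : ℕ →₀ Q.obj B l)
    (q' : ℕ →₀ Q.obj B (l + 1)) :
    Q.path.comp a h (show Q.path.obj A k from (p, q)) (show Q.path.obj B l from (p', q'))
      = (polyMul (Q.comp a h) p p', polyMul (Q.comp a (show k + 1 + l = n + 1 by omega)) q p'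
        + ksgn K k • polyMul (Q.comp a (show k + (l + 1) = n + 1 by omega)) p q') := rfl

theorem path_assoc_seq (hQ : Q.IsDGOperad) {A B C : Type} [Finite A] [Finite B] [Finite C]
    {k l m r s n : ℤ} (a : A) (b : B)
    (h₁ : k + l = r) (h₂ : r + m = n) (h₃ : l + m = s) (h₄ : k + s = n)
    (x : Q.path.obj A k) (y : Q.path.obj B l) (z : Q.path.obj C m) :
    Q.path.map (seqEquiv a b C) (Q.path.comp (Sum.inr b) h₂ (Q.path.comp a h₁ x y) z)
      = Q.path.comp a h₄ x (Q.path.comp b h₃ y z) := by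
  obtain ⟨p, q⟩ := x
  obtain ⟨p', q'⟩ := y
  obtain ⟨p'', q''⟩ := z
  have e₁ := polyMul_assoc (hQ.assoc_seq a b (k := k + 1) (p := r + 1) (n := n + 1)
    (by omega) (by omega) h₃ (by omega)) q p' p''
  have e₂ := polyMul_assoc (hQ.assoc_seq a b (l := l + 1) (p := r + 1) (q := s + 1) (n := n + 1)
    (by omega) (by omega) (by omega) (by omega)) p q' p''
  have e₃ := polyMul_assoc (hQ.assoc_seq a b (m := m + 1) (q := s + 1) (n := n + 1)
    h₁ (by omega) (by omega) (by omega)) p p' q''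
  have e₄ := path_comp a h₁ p q p' q'
  have e₅ := path_comp b h₃ p' q' p'' q''
  refine (congrArg (fun x => Q.path.map (seqEquiv a b C) (Q.path.comp (Sum.inr b) h₂ x
    (show Q.path.obj C m from (p'', q'')))) e₄).trans ?_
  refine Eq.trans ?_ (congrArg (Q.path.comp a h₄ (show Q.path.obj A k from (p, q))) e₅).symm
  refine (congrArg (Q.path.map (seqEquiv a b C)) (path_comp _ h₂ _ _ p'' q'')).trans ?_
  refine Eq.trans ?_ (path_comp a h₄ p q _ _).symm
  refine Prod.ext (polyMul_assoc (hQ.assoc_seq a b h₁ h₂ h₃ h₄) p p' p'') ?_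
  refine (map_add (mapRange.linearMap _) _ _).trans ?_
  simp only [map_add, map_smul, LinearMap.add_apply, LinearMap.smul_apply, smul_add, smul_smul,
    e₁, e₂, e₃, ← h₁, ksgn_add, add_assoc]

theorem path_assoc_par (hQ : Q.IsDGOperad) {A B C : Type} [Finite A] [Finite B] [Finite C]
    {k l m r s n : ℤ} (a a' : A) (h : a' ≠ a)
    (h₁ : k + l = r) (h₂ : r + m = n) (h₃ : k + m = s) (h₄ : s + l = n)
    (x : Q.path.obj A k) (y : Q.path.obj B l) (z : Q.path.obj C m) :
    Q.path.map (parEquiv a a' h B C)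
        (Q.path.comp (Sum.inl ⟨a', h⟩) h₂ (Q.path.comp a h₁ x y) z)
      = ksgn K (l * m) • Q.path.comp (Sum.inl ⟨a, h.symm⟩) h₄ (Q.path.comp a' h₃ x z) y := by
  obtain ⟨p, q⟩ := x
  obtain ⟨p', q'⟩ := y
  obtain ⟨p'', q''⟩ := z
  have e₁ := polyMul_comm (hQ.assoc_par a a' h (k := k + 1) (p := r + 1) (n := n + 1) (q := s + 1)
    (by omega) (by omega) (by omega) (by omega)) q p' p''
  have e₂ := polyMul_comm (hQ.assoc_par a a' h (l := l + 1) (p := r + 1) (q := s) (n := n + 1)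
    (by omega) (by omega) (by omega) (by omega)) p q' p''
  have e₃ := polyMul_comm (hQ.assoc_par a a' h (m := m + 1) (q := s + 1) (n := n + 1)
    h₁ (by omega) (by omega) (by omega)) p p' q''
  have e₄ := path_comp a h₁ p q p' q'
  have e₅ := path_comp a' h₃ p q p'' q''
  refine (congrArg (fun x => Q.path.map (parEquiv a a' h B C) (Q.path.comp (Sum.inl ⟨a', h⟩) h₂ x
    (show Q.path.obj C m from (p'', q'')))) e₄).trans ?_
  refine Eq.trans ?_ (congrArg (fun x => ksgn K (l * m) • Q.path.comp (Sum.inl ⟨a, h.symm⟩) h₄ x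
    (show Q.path.obj B l from (p', q'))) e₅).symm
  refine (congrArg (Q.path.map (parEquiv a a' h B C)) (path_comp _ h₂ _ _ p'' q'')).trans ?_
  refine Eq.trans ?_ (congrArg (ksgn K (l * m) • ·) (path_comp _ h₄ _ _ p' q')).symm
  refine Prod.ext (polyMul_comm (hQ.assoc_par a a' h h₁ h₂ h₃ h₄) p p' p'') ?_
  have hl := ksgn_mul_self K l
  refine (map_add (mapRange.linearMap _) _ _).trans ?_
  refine Eq.trans ?_ (smul_add (ksgn K (l * m)) _ _).symm
  simp only [map_add, map_smul, LinearMap.add_apply, LinearMap.smul_apply, smul_add, smul_smul,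
    e₁, e₂, e₃, ← h₁, ← h₃, ksgn_add, add_mul, mul_add, one_mul, mul_one]
  have s₁ : ksgn K k * (ksgn K (l * m) * ksgn K m) = ksgn K (l * m) * (ksgn K k * ksgn K m) := by
    ring
  have s₂ : ksgn K k * ksgn K l * (ksgn K (l * m) * ksgn K l) = ksgn K (l * m) * ksgn K k := by
    linear_combination (ksgn K k * ksgn K (l * m)) * hl
  rw [s₁, s₂]
  abel

theorem IsDGOperad.path (hQ : Q.IsDGOperad) : Q.path.IsDGOperad where
  map_refl x := Prod.ext (mapRange_eq_self hQ.map_refl _) (mapRange_eq_self hQ.map_refl _)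
  map_trans e e' x := by
    have h {k : ℤ} : Q.map (k := k) (e.trans e') = Q.map e' ∘ₗ Q.map e :=
      LinearMap.ext fun x => hQ.map_trans e e' x
    refine Prod.ext ?_ ?_
    · change mapRange.linearMap (Q.map (e.trans e')) _ = _
      rw [h, mapRange.linearMap_comp]
      rfl
    · change mapRange.linearMap (Q.map (e.trans e')) _ = _
      rw [h, mapRange.linearMap_comp]
      rfl
  comp_map {A A' B B'} _ _ _ _ k l n e e' a h := by
    rintro ⟨p, q⟩ ⟨p', q'⟩
    refine Prod.ext (mapRange_polyMul (hQ.comp_map e e' a h) p p') ?_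
    have h₁ := mapRange_polyMul (hQ.comp_map e e' a (show k + 1 + l = n + 1 by omega)) q p'
    have h₂ := mapRange_polyMul (hQ.comp_map e e' a (show k + (l + 1) = n + 1 by omega)) p q'
    refine (congrArg₂ (fun x y => x + ksgn K k • y) h₁ h₂).trans ?_
    rw [← map_smul, ← map_add]
    rfl
  one_comp {B} _ k := by
    rintro ⟨p, q⟩
    have h₁ := mapRange_polyMul_single_left (hQ.one_comp (B := B) (k := k)) p
    refine Prod.ext h₁ ?_
    have h (n : ℤ) (hn : 0 + (k + 1) = n) (hn' : k + 1 = n) (y : Q.obj B (k + 1)) :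
        Q.comp () hn Q.one y = hn' ▸ Q.map (unitLeft B) y := by
      subst hn'
      exact hQ.one_comp y
    have h₂ := mapRange_polyMul_single_left (h (k + 1) (by omega) rfl) q
    refine (congrArg (fun x : ℕ →₀ Q.obj (Ins () B) (k + 1) => _ + ksgn K 0 • x) h₂).trans ?_
    rw [ksgn_zero, one_smul]
    exact (congrArg (· + _) (LinearMap.map_zero₂ (polyMul (Q.comp () (B := B)
      (show (0 : ℤ) + 1 + k = k + 1 by omega))) p)).trans (zero_add _)
  comp_one {A} _ k a := by
    rintro ⟨p, q⟩
    refine Prod.ext (mapRange_polyMul_single_right (hQ.comp_one a) p) ?_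
    have h (n : ℤ) (hn : (k + 1) + 0 = n) (hn' : k + 1 = n) (y : Q.obj A (k + 1)) :
        Q.comp a hn y Q.one = hn' ▸ Q.map (unitRight a) y := by
      subst hn'
      exact hQ.comp_one a y
    have h₂ := mapRange_polyMul_single_right (h (k + 1) (by omega) rfl) q
    refine (congrArg (fun x => x + _) h₂).trans ?_
    refine (congrArg (fun x => _ + ksgn K k • x) (map_zero _)).trans ?_
    rw [smul_zero, add_zero]
    rfl
  assoc_seq := path_assoc_seq hQ
  assoc_par := path_assoc_par hQ
  d_d {A} _ k := by
    rintro ⟨p, q⟩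
    refine Prod.ext ?_ ?_
    · change mapRange.linearMap Q.d (mapRange.linearMap Q.d p) = 0
      ext n
      simp [hQ.d_d]
    · change polyDeriv (K := K) (mapRange.linearMap Q.d p)
        - mapRange.linearMap Q.d (polyDeriv (K := K) p
          - mapRange.linearMap Q.d q) = 0
      rw [map_sub, mapRange_polyDeriv, sub_sub_cancel]
      ext n
      simp [hQ.d_d]
  d_map {A B} _ _ k e := by
    rintro ⟨p, q⟩
    refine Prod.ext (mapRange_mapRange (hQ.d_map e) p) ?_
    change polyDeriv (K := K) (mapRange.linearMap (Q.map e) p)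
        - mapRange.linearMap Q.d (mapRange.linearMap (Q.map e) q) =
        mapRange.linearMap (Q.map e) (polyDeriv (K := K) p
          - mapRange.linearMap Q.d q)
    rw [map_sub, mapRange_polyDeriv, mapRange_mapRange (hQ.d_map e) q]
  d_comp {A B} _ _ k l n a h h₁ h₂ := by
    rintro ⟨p, q⟩ ⟨p', q'⟩
    refine Prod.ext (polyMul_leibniz (hQ.d_comp a h h₁ h₂) p p') ?_
    have e₁ := polyMul_leibniz (hQ.d_comp a (k := k + 1) (n := n + 1)
      (by omega) (by omega) (by omega)) q p'
    have e₂ := polyMul_leibniz (hQ.d_comp a (l := l + 1) (n := n + 1)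
      (by omega) (by omega) (by omega)) p q'
    change polyDeriv (K := K) (polyMul _ p p') - mapRange.linearMap Q.d
        (polyMul _ q p' + ksgn K (k + 1) • polyMul _ p q') =
      (polyMul _ (polyDeriv (K := K) p - mapRange.linearMap Q.d q) p'
        + ksgn K k • polyMul _ (mapRange.linearMap Q.d p) q') +
      ksgn K (k + 1) • (polyMul _ q (mapRange.linearMap Q.d p')
        + ksgn K (k + 1) • polyMul _ p (polyDeriv (K := K) p' - mapRange.linearMap Q.d q'))
    have hk : ksgn K k = -ksgn K (k + 1) := by rw [ksgn_add_one, neg_neg]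
    simp only [polyDeriv_polyMul, map_add, map_smul, map_sub, LinearMap.sub_apply, e₁, e₂,
      smul_add, smul_sub, smul_smul, ksgn_mul_self, ksgn_add_one K (k + 1), hk, one_smul, neg_smul]
    abel

/-- Evaluation at `t = c`, `dt = 0`, as a morphism of dg operads. -/
noncomputable def pathEvalHom (Q : DGOperadData.{u, v} K) (c : K) : Hom Q.path Q where
  app A _ k := polyEval c ∘ₗ LinearMap.fst K _ _
  app_map e x := polyEval_mapRange _ c x.1
  app_one := by
    change polyEval c (Finsupp.single 0 Q.one) = Q.one
    simp
  app_comp a h x y := polyEval_polyMul _ c x.1 y.1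
  app_d x := polyEval_mapRange _ c x.1

/-- Composition of morphisms of dg operads. -/
def Hom.comp {P : DGOperadData.{u, v} K} {Q R : DGOperadData.{u, w} K} (F : Hom Q R)
    (F' : Hom P Q) : Hom P R where
  app A _ k := F.app A k ∘ₗ F'.app A k
  app_map e x := by simp [F'.app_map, F.app_map]
  app_one := by simp [F'.app_one, F.app_one]
  app_comp a h x y := by simp [F'.app_comp, F.app_comp]
  app_d x := by simp [F'.app_d, F.app_d]

end DGOperadData

/-! ### Formal sums of rooted trees as multilinear polynomials -/

namespace ParentFn

variable {V W : Type}

theorem IsTree.ne_self {p : V → Option V} (h : IsTree p) (v : V) : p v ≠ some v := by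
  obtain ⟨-, depth, hd⟩ := h
  exact fun e => lt_irrefl _ (hd v v e)

theorem isTree_splitLower {p : V → Option V} (h : IsTree p) {v : V} {S : Set V}
    (hS : ∀ u ∈ S, p u = some v) : IsTree (splitLower p v S) := by
  obtain ⟨⟨r, hr, hr'⟩, depth, hd⟩ := h
  refine ⟨⟨some r, ?_, ?_⟩, fun u => u.elim (2 * depth v + 1) fun u => 2 * depth u, ?_⟩
  · have : r ∉ S := fun hS' => by simpa [hr] using hS r hS'
    simp [splitLower, this, hr]
  · rintro (_ | u) hu
    · simp [splitLower] at hu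
    · by_cases hS' : u ∈ S
      · simp [splitLower, hS'] at hu
      · simp only [splitLower, hS', if_false, map_eq_none_iff] at hu
        rw [hr' u hu]
  · rintro (_ | u) w hw
    · simp only [splitLower, Option.some.injEq] at hw
      subst hw
      simp
    · by_cases hS' : u ∈ S
      · simp only [splitLower, hS', if_true, Option.some.injEq] at hw
        subst hw
        have := hd u v (hS u hS')
        simp only [elim_none, elim_some]
        omega
      · simp only [splitLower, hS', if_false, map_eq_some_iff] at hw
        obtain ⟨w, hw, rfl⟩ := hw
        have := hd u w hw
        simp only [elim_some]
        omega

theorem isTree_splitUpper {p : V → Option V} (h : IsTree p) {v : V} {S : Set V}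
    (hS : ∀ u ∈ S, p u = some v) : IsTree (splitUpper p v S) := by
  obtain ⟨⟨r, hr, hr'⟩, depth, hd⟩ := h
  have hrS : r ∉ S := fun h => by simpa [hr] using hS r h
  -- depths are doubled to make room for the new vertex just below `v`
  refine ⟨?_, fun u => u.elim (2 * depth v) fun u => 2 * depth u + 1, ?_⟩
  · by_cases hrv : r = v
    · subst hrv
      refine ⟨none, by simp [splitUpper, hr], ?_⟩
      rintro (_ | u) hu
      · rfl
      · by_cases hS' : u = r ∨ u ∈ S
        · simp [splitUpper, hS'] at hu
        · simp only [splitUpper, hS', if_false, map_eq_none_iff] at hu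
          exact absurd (Or.inl (hr' u hu)) hS'
    · refine ⟨some r, by simp [splitUpper, hr, hrv, hrS], ?_⟩
      rintro (_ | u) hu
      · simp only [splitUpper, map_eq_none_iff] at hu
        exact absurd (hr' v hu).symm hrv
      · by_cases hS' : u = v ∨ u ∈ S
        · simp [splitUpper, hS'] at hu
        · simp only [splitUpper, hS', if_false, map_eq_none_iff] at hu
          rw [hr' u hu]
  · rintro (_ | u) w hw
    · simp only [splitUpper, map_eq_some_iff] at hw
      obtain ⟨w, hw, rfl⟩ := hw
      have := hd v w hw
      simp only [elim_none, elim_some]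
      omega
    · by_cases hS' : u = v ∨ u ∈ S
      · simp only [splitUpper, hS', if_true, Option.some.injEq] at hw
        subst hw
        simp only [elim_none, elim_some]
        rcases hS' with rfl | hS'
        · omega
        · have := hd u v (hS u hS')
          omega
      · simp only [splitUpper, hS', if_false, map_eq_some_iff] at hw
        obtain ⟨w, hw, rfl⟩ := hw
        have := hd u w hw
        simp only [elim_some]
        omega

/-- The tree obtained from `p` by adding a new root `none` below the root of `p`. -/
def newRoot (p : V → Option V) : Option V → Option (Option V)
  | none => none
  | some u => some (p u)

theorem isTree_newRoot {p : V → Option V} (h : IsTree p) : IsTree (newRoot p) := by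
  obtain ⟨-, depth, hd⟩ := h
  refine ⟨⟨none, rfl, ?_⟩, fun u => u.elim 0 fun u => depth u + 1, ?_⟩
  · rintro (_ | u) hu
    · rfl
    · simp [newRoot] at hu
  · rintro (_ | u) w hw
    · simp [newRoot] at hw
    · simp only [newRoot, Option.some.injEq] at hw
      subst hw
      cases h : p u with
      | none => simp
      | some w => simpa using hd u w h

theorem lift_of_ne {v₀ u : V} (h : u ≠ v₀) : lift W v₀ u = some (Sum.inl ⟨u, h⟩) := dif_pos h

theorem insertAt_inl_of_ne {p : V → Option V} {v₀ : V} {q : W → Option W}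
    {f : {v : V // p v = some v₀} → W} {v : {v : V // v ≠ v₀}} (h : p v.1 ≠ some v₀) :
    insertAt p v₀ q f (Sum.inl v) = (p v.1).bind (lift W v₀) := dif_neg h

theorem isTree_insertAt [Finite W] {p : V → Option V} (hp : IsTree p) (v₀ : V)
    {q : W → Option W} (hq : IsTree q) (f : {v : V // p v = some v₀} → W) :
    IsTree (insertAt p v₀ q f) := by
  have hv₀ := hp.ne_self v₀
  obtain ⟨⟨r, hr, hr'⟩, depth, hd⟩ := hp
  obtain ⟨⟨s, hs, hs'⟩, depth', hd'⟩ := hq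
  have := ofFinite W
  obtain ⟨N, hN⟩ : ∃ N, ∀ w, depth' w < N :=
    ⟨(univ.sup depth') + 1, fun w => Nat.lt_succ_of_le (Finset.le_sup (mem_univ w))⟩
  have hlt {i j : ℕ} (h : i < j) : i * N + N ≤ j * N := by
    have := Nat.mul_le_mul_right N h
    rwa [Nat.succ_mul] at this
  -- depths in `p` are stretched by a factor `N` that exceeds all depths in `q`
  refine ⟨?_, Sum.elim (fun v => depth v.1 * N) fun w => depth v₀ * N + depth' w, ?_⟩
  · by_cases hrv : r = v₀
    · subst hrv
      refine ⟨Sum.inr s, by simp [insertAt, hs, hr], ?_⟩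
      rintro (⟨v, hv⟩ | w) h
      · by_cases hvr : p v = some r
        · simp [insertAt, hvr] at h
        · cases hu : p v with
          | none => exact absurd (hr' v hu) hv
          | some u =>
            rw [insertAt_inl_of_ne hvr] at h
            simp [hu, lift_of_ne (fun e => hvr (by rw [hu, e]) : u ≠ r)] at h
      · cases hw : q w with
        | none => rw [hs' w hw]
        | some w' => simp [insertAt, hw] at h
    · refine ⟨Sum.inl ⟨r, hrv⟩, by simp [insertAt, hr], ?_⟩
      rintro (⟨v, hv⟩ | w) h
      · by_cases hvr : p v = some v₀
        · simp [insertAt, hvr] at h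
        · cases hu : p v with
          | none => simp [hr' v hu]
          | some u =>
            rw [insertAt_inl_of_ne hvr] at h
            simp [hu, lift_of_ne (fun e => hvr (by rw [hu, e]) : u ≠ v₀)] at h
      · cases hw : q w with
        | none =>
          cases hu : p v₀ with
          | none => exact absurd (hr' v₀ hu).symm hrv
          | some u =>
            have hne : u ≠ v₀ := fun e => hv₀ (by rw [hu, e])
            simp [insertAt, hu, hw, lift_of_ne hne] at h
        | some w' => simp [insertAt, hw] at h
  · rintro (⟨v, hv⟩ | w) u h
    · by_cases hvr : p v = some v₀
      · simp only [insertAt, hvr, dif_pos, Option.some.injEq] at h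
        subst h
        have := hlt (hd v v₀ hvr)
        have := hN (f ⟨v, hvr⟩)
        simp only [Sum.elim_inl, Sum.elim_inr]
        omega
      · cases hu : p v with
        | none => simp [insertAt, hu] at h
        | some u' =>
          have hne : u' ≠ v₀ := fun e => hvr (by rw [hu, e])
          rw [insertAt_inl_of_ne hvr] at h
          simp only [hu, bind_some, lift_of_ne hne, Option.some.injEq] at h
          subst h
          have := hlt (hd v u' hu)
          have := hN s
          simp only [Sum.elim_inl]
          omega
    · cases hw : q w with
      | none =>
        cases hu : p v₀ with
        | none => simp [insertAt, hu, hw] at h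
        | some u' =>
          have hne : u' ≠ v₀ := fun e => hv₀ (by rw [hu, e])
          simp only [insertAt, hw, hu, bind_some, lift_of_ne hne, Option.some.injEq] at h
          subst h
          have := hlt (hd v₀ u' hu)
          have := hN s
          simp only [Sum.elim_inl, Sum.elim_inr]
          omega
      | some w' =>
        simp only [insertAt, hw, Option.some.injEq] at h
        subst h
        have := hd' w w' hw
        simp only [Sum.elim_inr]
        omega

end ParentFn

namespace TreeSum

open Classical

variable {K : Type u} [Field K] {V W : Type}

/-- Formal linear combinations of rooted trees on the vertex set `V`. -/
abbrev Sums (K : Type u) [Field K] (V : Type) : Type u := {p : V → Option V // IsTree p} →₀ K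

variable (K) in
/-- The tree `p` as a formal sum; it is zero if `p` is not a tree. -/
noncomputable def single (p : V → Option V) : Sums K V :=
  if h : IsTree p then Finsupp.single ⟨p, h⟩ 1 else 0

theorem single_of_isTree {p : V → Option V} (h : IsTree p) :
    single K p = Finsupp.single ⟨p, h⟩ 1 := dif_pos h

/-- The value at the matrix `a` of the multilinear polynomial given by a formal sum of trees: a tree
`p` stands for the product of the entries `a v (p v)`. -/
noncomputable def ev [Fintype V] (a : V → Option V → K) : Sums K V →ₗ[K] K :=
  linearCombination K fun p => ∏ v, a v (p.1 v)

section

variable [Fintype V] [Fintype W]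

theorem ev_finsuppSingle (a : V → Option V → K) (p : {p : V → Option V // IsTree p}) (c : K) :
    ev a (Finsupp.single p c) = c * ∏ v, a v (p.1 v) := by
  simp [ev]

theorem ev_single (a : V → Option V → K) {p : V → Option V} (h : IsTree p) :
    ev a (single K p) = ∏ v, a v (p v) := by
  simp [single_of_isTree h, ev_finsuppSingle]

theorem ev_indicator (p : {p : V → Option V // IsTree p}) (x : Sums K V) :
    ev (fun v u => if p.1 v = u then 1 else 0) x = x p := by
  induction x using induction_linear with
  | zero => simp
  | add x y hx hy => simp [hx, hy]
  | single q c =>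
    rw [ev_finsuppSingle, Finset.prod_ite_zero, Finsupp.single_apply]
    by_cases h : q = p
    · simp [h]
    · have : ¬ ∀ v, p.1 v = q.1 v := fun e => h (Subtype.ext (funext e)).symm
      simp [h, this]

/-- Formal sums of trees are determined by their polynomials. -/
theorem ext_ev {x y : Sums K V} (h : ∀ a, ev a x = ev a y) : x = y := by
  ext p
  rw [← ev_indicator, ← ev_indicator, h]

theorem ev_congr {a a' : V → Option V → K} (x : Sums K V)
    (h : ∀ v u, u ≠ some v → a v u = a' v u) : ev a x = ev a' x := by
  induction x using induction_linear with
  | zero => simp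
  | add x y hx hy => simp [hx, hy]
  | single q c =>
    rw [ev_finsuppSingle, ev_finsuppSingle]
    congr 1
    exact prod_congr rfl fun v _ => h v _ (q.2.ne_self v)

theorem ev_single_update (a : V → Option V → K) (v : V) (ρ : Option V → K)
    (q : {p : V → Option V // IsTree p}) :
    ∏ u, update a v ρ u (q.1 u)
      = ρ (q.1 v) * ∏ u ∈ univ.erase v, a u (q.1 u) := by
  rw [← mul_prod_erase _ _ (mem_univ v)]
  congr 1
  · simp
  · refine prod_congr rfl fun u hu => ?_
    rw [update_of_ne (ne_of_mem_erase hu)]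

/-- The polynomials are linear in each row of the matrix. -/
noncomputable def evRow (a : V → Option V → K) (v : V) (x : Sums K V) : (Option V → K) →ₗ[K] K where
  toFun ρ := ev (update a v ρ) x
  map_add' ρ ρ' := by
    induction x using induction_linear with
    | zero => simp
    | add x y hx hy => simp only [map_add, hx, hy]; ring
    | single q c =>
      simp only [ev_finsuppSingle, ev_single_update, Pi.add_apply]
      ring
  map_smul' c ρ := by
    induction x using induction_linear with
    | zero => simp
    | add x y hx hy => simp only [map_add, hx, hy, smul_add]
    | single q c' =>
      simp only [ev_finsuppSingle, ev_single_update, Pi.smul_apply, smul_eq_mul, RingHom.id_apply]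
      ring

theorem ev_eq_evRow {a : V → Option V → K} (v : V) (x : Sums K V) : ev a x = evRow a v x (a v) := by
  simp [evRow]

theorem evRow_congr {a a' : V → Option V → K} (v : V) (x : Sums K V)
    (h : ∀ w u, w ≠ v → u ≠ some w → a w u = a' w u) : evRow a v x = evRow a' v x := by
  refine LinearMap.ext fun ρ => ev_congr x fun w u hu => ?_
  by_cases hw : w = v
  · subst hw; simp
  · rw [update_of_ne hw, update_of_ne hw, h w u hw hu]

/-! ### Relabelling and insertion -/

/-- Relabelling of the vertices. -/
noncomputable def conj (e : V ≃ W) : Sums K V →ₗ[K] Sums K W :=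
  Finsupp.lmapDomain K K fun p => ⟨ParentFn.conj e p.1, TRT.isTree_conj e p.2⟩

theorem ev_conj (e : V ≃ W) (a : W → Option W → K) (x : Sums K V) :
    ev a (conj e x) = ev (fun v u => a (e v) (u.map e)) x := by
  induction x using induction_linear with
  | zero => simp
  | add x y hx hy => simp only [map_add, hx, hy]
  | single q c =>
    simp only [conj, Finsupp.lmapDomain_apply, Finsupp.mapDomain_single, ev_finsuppSingle]
    congr 1
    rw [← e.prod_comp]
    simp [ParentFn.conj]

/-- Insertion of trees into the vertex `v₀`. -/
noncomputable def ins (v₀ : V) :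
    Sums K V →ₗ[K] Sums K W →ₗ[K] Sums K ({v : V // v ≠ v₀} ⊕ W) :=
  linearCombination K fun p => linearCombination K fun q =>
    ∑ᶠ f : {v : V // p.1 v = some v₀} → W, single K (insertAt p.1 v₀ q.1 f)

/-- The row of the vertex `w` of the inserted tree, where `u` is the parent of the root. -/
def innerMat {v₀ : V} (a : {v : V // v ≠ v₀} ⊕ W → Option ({v : V // v ≠ v₀} ⊕ W) → K)
    (u : Option ({v : V // v ≠ v₀} ⊕ W)) : W → Option W → K :=
  fun w w' => a (Sum.inr w) (w'.elim u fun w' => some (Sum.inr w'))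

/-- The substitution of matrices that corresponds to the insertion of `y` into the vertex `v₀`. -/
noncomputable def sub (v₀ : V) (a : {v : V // v ≠ v₀} ⊕ W → Option ({v : V // v ≠ v₀} ⊕ W) → K)
    (y : Sums K W) : V → Option V → K := fun v u =>
  if h : v = v₀ then ev (innerMat a (u.bind (lift W v₀))) y
  else if u = some v₀ then ∑ w, a (Sum.inl ⟨v, h⟩) (some (Sum.inr w))
  else a (Sum.inl ⟨v, h⟩) (u.bind (lift W v₀))

theorem sum_prod_dite {ι κ R : Type*} [Fintype ι] [Fintype κ] [CommRing R] (P : ι → Prop)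
    [DecidablePred P] (g : ι → κ → R) (c : ι → R) :
    ∑ f : {i // P i} → κ, ∏ i, (if h : P i then g i (f ⟨i, h⟩) else c i)
      = ∏ i, if P i then ∑ k, g i k else c i := by
  have h₁ : ∏ i, (if P i then ∑ k, g i k else c i)
      = (∏ i : {i // P i}, ∑ k, g i k) * ∏ i : {i // ¬ P i}, c i :=
    Fintype.prod_dite (p := P) (fun i _ => ∑ k, g i k) fun i _ => c i
  rw [h₁, prod_univ_sum, sum_mul, Fintype.piFinset_univ]
  refine sum_congr rfl fun f _ => ?_
  exact Fintype.prod_dite (p := P) (fun i h => g i (f ⟨i, h⟩)) fun i _ => c i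

theorem ev_ins (v₀ : V) [Fintype {v : V // v ≠ v₀}]
    (a : {v : V // v ≠ v₀} ⊕ W → Option ({v : V // v ≠ v₀} ⊕ W) → K)
    (x : Sums K V) (y : Sums K W) : ev a (ins v₀ x y) = ev (sub v₀ a y) x := by
  have hy (y y' : Sums K W) (v : V) (h : v ≠ v₀) : sub v₀ a y v = sub v₀ a y' v := by
    funext u
    simp [sub, h]
  rw [ev_eq_evRow (a := sub v₀ a y) v₀]
  have : evRow (sub v₀ a y) v₀ x = evRow (sub v₀ a 0) v₀ x :=
    evRow_congr v₀ x fun w u hw _ => by rw [hy]; exact hw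
  rw [this]
  -- both sides are linear in `y`: on the right only the row `v₀` depends on `y`
  induction y using induction_linear with
  | zero =>
    have : sub v₀ a (0 : Sums K W) v₀ = 0 := by funext u; simp [sub]
    simp [this]
  | add y y' h h' =>
    have e : sub v₀ a (y + y') v₀ = sub v₀ a y v₀ + sub v₀ a y' v₀ := by funext u; simp [sub]
    have hr (z : Sums K W) : evRow (sub v₀ a z) v₀ x = evRow (sub v₀ a 0) v₀ x :=
      evRow_congr v₀ x fun w u hw _ => by rw [hy]; exact hw
    rw [map_add, map_add, e, map_add, h (hr _), h' (hr _)]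
  | single q c =>
    rw [← this, ← ev_eq_evRow]
    clear this
    induction x using induction_linear with
    | zero => simp
    | add x x' h h' => simp only [map_add, LinearMap.add_apply, h, h']
    | single p c' =>
      simp only [ins, linearCombination_single, LinearMap.smul_apply, map_smul,
        finsum_eq_sum_of_fintype, map_sum, ev_finsuppSingle, smul_eq_mul]
      congr 1
      rw [sum_congr rfl fun f _ => ev_single a (isTree_insertAt p.2 v₀ q.2 f)]
      simp only [prod_sum_type]
      have e₁ (f : {v : V // p.1 v = some v₀} → W) (w : W) :
          insertAt p.1 v₀ q.1 f (Sum.inr w) = (q.1 w).elim ((p.1 v₀).bind (lift W v₀))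
            fun w' => some (Sum.inr w') := by
        cases h : q.1 w <;> simp [insertAt, h]
      simp only [e₁]
      rw [← sum_mul, ← mul_prod_erase _ (fun v => sub v₀ a _ v (p.1 v))
        (mem_univ v₀)]
      have e₂ : sub v₀ a (Finsupp.single q c) v₀ (p.1 v₀) = c * ∏ w, a (Sum.inr w)
          ((q.1 w).elim ((p.1 v₀).bind (lift W v₀)) fun w' => some (Sum.inr w')) := by
        simp [sub, ev_finsuppSingle, innerMat]
      rw [e₂]
      have e₃ : ∏ v ∈ univ.erase v₀, sub v₀ a (Finsupp.single q c) v (p.1 v)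
          = ∏ v : {v // v ≠ v₀}, if p.1 v.1 = some v₀ then ∑ w, a (Sum.inl v) (some (Sum.inr w))
            else a (Sum.inl v) ((p.1 v.1).bind (lift W v₀)) := by
        rw [Finset.prod_subtype (p := fun v => v ≠ v₀) _ (by simp)]
        refine prod_congr rfl fun v _ => ?_
        simp [sub, v.2]
      -- expanding the product of sums gives the sum over all ways to reconnect the children of `v₀`
      rw [e₃, ← sum_prod_dite (fun v : {v // v ≠ v₀} => p.1 v.1 = some v₀)
        (fun v w => a (Sum.inl v) (some (Sum.inr w)))
        fun v => a (Sum.inl v) ((p.1 v.1).bind (lift W v₀))]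
      have e₄ : ∑ f : {v : V // p.1 v = some v₀} → W, ∏ v : {v // v ≠ v₀},
            a (Sum.inl v) (insertAt p.1 v₀ q.1 f (Sum.inl v))
          = ∑ f : {v : {v // v ≠ v₀} // p.1 v.1 = some v₀} → W, ∏ v : {v // v ≠ v₀},
            if h : p.1 v.1 = some v₀ then a (Sum.inl v) (some (Sum.inr (f ⟨v, h⟩)))
            else a (Sum.inl v) ((p.1 v.1).bind (lift W v₀)) := by
        let e : {v : {v // v ≠ v₀} // p.1 v.1 = some v₀} ≃ {v : V // p.1 v = some v₀} :=
          Equiv.subtypeSubtypeEquivSubtype (p := fun v => v ≠ v₀) fun {v} (h : p.1 v = some v₀)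
            (e : v = v₀) => p.2.ne_self v (by rw [h, e])
        rw [← (Equiv.arrowCongr e (Equiv.refl W)).sum_comp]
        refine sum_congr rfl fun f _ => prod_congr rfl fun v _ => ?_
        by_cases h : p.1 v.1 = some v₀
        · simp only [insertAt, h, dif_pos]
          rfl
        · simp [insertAt, h]
      rw [e₄]
      rw [mul_comm (∑ _, _), ← mul_assoc]
      congr!

end

end TreeSum

/-! ### Splitting vertices of formal sums of trees -/

namespace TreeSum

open Classical

variable {K : Type u} [Field K] {V W : Type}

/-- Adding a new root. -/
noncomputable def Rt : Sums K V →ₗ[K] Sums K (Option V) :=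
  linearCombination K fun p => single K (newRoot p.1)

/-- Adding a leaf at the vertex `v`. -/
noncomputable def Lf (v : V) : Sums K V →ₗ[K] Sums K (Option V) :=
  linearCombination K fun p => single K (splitLower p.1 v ∅)

/-- The sum over all ways to split off a child of the vertex `v`. -/
noncomputable def Lw (v : V) : Sums K V →ₗ[K] Sums K (Option V) :=
  linearCombination K fun p => ∑ᶠ S : childSets p.1 v, single K (splitLower p.1 v S)

/-- The sum over all ways to split off a parent of the vertex `v`. -/
noncomputable def Up (v : V) : Sums K V →ₗ[K] Sums K (Option V) :=
  linearCombination K fun p => ∑ᶠ S : childSets p.1 v, single K (splitUpper p.1 v S)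

/-- The matrix substitution for splitting off a child of `v`. -/
noncomputable def low (a : Option V → Option (Option V) → K) (v : V) : V → Option V → K :=
  fun u w => a (some u) (w.map some) + if w = some v then a (some u) (some none) else 0

/-- The matrix substitution for splitting off a parent of `v`. -/
noncomputable def upp (a : Option V → Option (Option V) → K) (v : V) : V → Option V → K :=
  fun u w => if u = v then a (some v) (some none) * a none (w.map some) else low a v u w

/-- Sets of children as functions on the children. -/
noncomputable def childSetsEquivFun (p : V → Option V) (v : V) :
    ({u // p u = some v} → Prop) ≃ childSets p v where
  toFun f := ⟨{u | ∃ h, f ⟨u, h⟩}, fun _ hu => hu.1⟩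
  invFun S u := u.1 ∈ S.1
  left_inv f := by funext u; simp [u.2]
  right_inv S := by
    ext u
    exact ⟨fun h => h.2, fun h => ⟨S.2 h, h⟩⟩

section

variable [Fintype V] [Fintype W]

theorem ev_Rt (a : Option V → Option (Option V) → K) (x : Sums K V) :
    ev a (Rt x) = a none none * ev (fun u w => a (some u) (some w)) x := by
  induction x using induction_linear with
  | zero => simp
  | add x y hx hy => simp only [map_add, hx, hy, mul_add]
  | single p c =>
    simp only [Rt, linearCombination_single, map_smul, ev_single a (isTree_newRoot p.2),
      ev_finsuppSingle, prod_option, newRoot, smul_eq_mul]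
    ring

theorem ev_Lf (a : Option V → Option (Option V) → K) (v : V) (x : Sums K V) :
    ev a (Lf v x) = a none (some (some v)) * ev (fun u w => a (some u) (w.map some)) x := by
  induction x using induction_linear with
  | zero => simp
  | add x y hx hy => simp only [map_add, hx, hy, mul_add]
  | single p c =>
    simp only [Lf, linearCombination_single, map_smul,
      ev_single a (isTree_splitLower p.2 (v := v) (S := ∅) (by simp)),
      ev_finsuppSingle, prod_option, splitLower, smul_eq_mul, Set.mem_empty_iff_false,
      if_false]
    ring

theorem sum_childSets {R : Type*} [CommRing R] (p : V → Option V) (v : V) (g c : V → R) :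
    ∑ᶠ S : childSets p v, ∏ u, (if u ∈ S.1 then g u else c u)
      = ∏ u, (c u + if p u = some v then g u else 0) := by
  have e := sum_prod_dite (κ := Prop) (fun u => p u = some v)
    (fun u (b : Prop) => if b then g u else c u) c
  have : ∀ u, (c u + if p u = some v then g u else 0)
      = if p u = some v then ∑ k : Prop, (if k then g u else c u) else c u := by
    intro u
    split_ifs <;> simp [add_comm]
  rw [prod_congr rfl fun u _ => this u, ← e, ← finsum_comp_equiv (childSetsEquivFun p v),
    finsum_eq_sum_of_fintype]
  refine sum_congr rfl fun f _ => prod_congr rfl fun u _ => ?_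
  by_cases h : p u = some v <;> simp [childSetsEquivFun, h]

theorem ev_finsum {ι : Type*} [Finite ι] (a : V → Option V → K) (f : ι → Sums K V) :
    ev a (∑ᶠ i, f i) = ∑ᶠ i, ev a (f i) :=
  map_finsum (ev a) (Set.toFinite _)

theorem ev_Lw (a : Option V → Option (Option V) → K) (v : V) (x : Sums K V) :
    ev a (Lw v x) = a none (some (some v)) * ev (low a v) x := by
  induction x using induction_linear with
  | zero => simp
  | add x y hx hy => simp only [map_add, hx, hy, mul_add]
  | single p c =>
    simp only [Lw, linearCombination_single, map_smul, ev_finsum, smul_eq_mul,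
      fun S : childSets p.1 v => ev_single a (isTree_splitLower p.2 S.2),
      ev_finsuppSingle, prod_option, splitLower, apply_ite (a (some _))]
    rw [← mul_finsum, sum_childSets, mul_left_comm]
    rfl

theorem ev_Up (a : Option V → Option (Option V) → K) (v : V) (x : Sums K V) :
    ev a (Up v x) = ev (upp a v) x := by
  induction x using induction_linear with
  | zero => simp
  | add x y hx hy => simp only [map_add, hx, hy]
  | single p c =>
    simp only [Up, linearCombination_single, map_smul, ev_finsum, smul_eq_mul,
      fun S : childSets p.1 v => ev_single a (isTree_splitUpper p.2 S.2),
      ev_finsuppSingle, prod_option]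
    have h (S : childSets p.1 v) (u : V) : a (some u) (splitUpper p.1 v S (some u))
        = if u ∈ S.1 then a (some u) (some none) else
          if u = v then a (some u) (some none) else a (some u) ((p.1 u).map some) := by
      simp only [splitUpper]
      split_ifs <;> simp_all
    simp only [h]
    simp only [splitUpper]
    rw [← mul_finsum, sum_childSets, ← mul_prod_erase _ _ (mem_univ v),
      ← mul_prod_erase _ (fun u => upp a v u _) (mem_univ v)]
    simp only [upp, if_true, p.2.ne_self v, if_false, add_zero]
    rw [mul_left_comm (a none _), mul_assoc]
    congr 3
    refine prod_congr rfl fun u hu => ?_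
    simp [ne_of_mem_erase hu, low]

/-! ### Insertion at the vertex `none` -/

/-- The elements of `Option V` other than `none` are those of `V`. -/
def neNoneEquiv (V : Type) : {v : Option V // v ≠ none} ≃ V where
  toFun v := v.1.get (Option.isSome_iff_ne_none.2 v.2)
  invFun v := ⟨some v, by simp⟩
  left_inv v := by simp
  right_inv v := by simp

/-- Insertion into the vertex `none`. -/
noncomputable def insNone :
    Sums K (Option V) →ₗ[K] Sums K W →ₗ[K] Sums K (V ⊕ W) :=
  (ins none).compr₂ (conj (sumCongr (neNoneEquiv V) (Equiv.refl W)))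

/-- The row of the vertex `w` of the inserted tree, where `u` is the parent of the root. -/
def inner (a : V ⊕ W → Option (V ⊕ W) → K) (u : Option (V ⊕ W)) : W → Option W → K :=
  fun w w' => a (Sum.inr w) (w'.elim u fun w' => some (Sum.inr w'))

/-- The substitution of matrices for insertion at the vertex `none`. -/
noncomputable def subNone (a : V ⊕ W → Option (V ⊕ W) → K) (y : Sums K W) :
    Option V → Option (Option V) → K
  | none, u => ev (inner a (u.bind fun u => u.map Sum.inl)) y
  | some v, some none => ∑ w, a (Sum.inl v) (some (Sum.inr w))
  | some v, none => a (Sum.inl v) none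
  | some v, some (some u) => a (Sum.inl v) (some (Sum.inl u))

theorem ev_insNone (a : V ⊕ W → Option (V ⊕ W) → K) (x : Sums K (Option V)) (y : Sums K W) :
    ev a (insNone x y) = ev (subNone a y) x := by
  rw [insNone, compr₂_apply, ev_conj, ev_ins]
  refine ev_congr x ?_
  rintro (_ | v) (_ | _ | u) h
  · simp only [sub, subNone, dif_pos, bind_none]
    exact ev_congr y fun w w' _ => by cases w' <;> rfl
  · simp at h
  · simp only [sub, subNone, dif_pos, bind_some, map_some]
    refine ev_congr y fun w w' _ => ?_
    rw [lift_of_ne (by simp)]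
    cases w' <;> rfl
  · simp [sub, subNone]; rfl
  · simp [sub, subNone]; rfl
  · simp [sub, subNone, lift]; rfl

/-- Insertion at an arbitrary vertex reduces to insertion at the vertex `none`. -/
theorem ins_eq_insNone [DecidableEq V] (v₀ : V) (x : Sums K V) (y : Sums K W) :
    ins v₀ x y = insNone (conj (Equiv.optionSubtypeNe v₀).symm x) y := by
  refine ext_ev fun a => ?_
  rw [ev_insNone, ev_conj, ev_ins]
  refine ev_congr x fun v u hu => ?_
  by_cases hv : v = v₀
  · subst hv
    rcases u with _ | u
    · simp [sub, subNone]; rfl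
    · have : u ≠ v := fun e => hu (by rw [e])
      simp [sub, subNone, this, lift_of_ne]; rfl
  · rcases u with _ | u
    · simp [sub, subNone, hv]
    · by_cases h : u = v₀
      · subst h
        simp [sub, subNone, hv]
      · simp [sub, subNone, hv, h, lift_of_ne]

/-- Exchange of the two new vertices. -/
def swapNew (V : Type) : Option (Option V) ≃ Option (Option V) where
  toFun
    | none => some none
    | some none => none
    | some (some v) => some (some v)
  invFun
    | none => some none
    | some none => none
    | some (some v) => some (some v)
  left_inv := by rintro (_ | _ | v) <;> rfl
  right_inv := by rintro (_ | _ | v) <;> rfl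

/-- Moving a new vertex of the first summand to the front. -/
def outerNew (V W : Type) : Option V ⊕ W ≃ Option (V ⊕ W) where
  toFun
    | Sum.inl none => none
    | Sum.inl (some v) => some (Sum.inl v)
    | Sum.inr w => some (Sum.inr w)
  invFun
    | none => Sum.inl none
    | some (Sum.inl v) => Sum.inl (some v)
    | some (Sum.inr w) => Sum.inr w
  left_inv := by rintro ((_ | v) | w) <;> rfl
  right_inv := by rintro (_ | v | w) <;> rfl

/-- Moving a new vertex of the second summand to the front. -/
def innerNew (V W : Type) : V ⊕ Option W ≃ Option (V ⊕ W) where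
  toFun
    | Sum.inr none => none
    | Sum.inl v => some (Sum.inl v)
    | Sum.inr (some w) => some (Sum.inr w)
  invFun
    | none => Sum.inr none
    | some (Sum.inl v) => Sum.inl v
    | some (Sum.inr w) => Sum.inr (some w)
  left_inv := by rintro (v | _ | w) <;> rfl
  right_inv := by rintro (_ | v | w) <;> rfl

/-- A sum of trees in which a row of the matrix is a linear combination. -/
theorem ev_row_sum {ι : Type*} [Fintype ι] {a : V → Option V → K} (v : V) (x : Sums K V)
    (c : ι → K) (b : ι → V → Option V → K) (h : ∀ u, u ≠ some v → a v u = ∑ i, c i * b i v u)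
    (h' : ∀ i w u, w ≠ v → u ≠ some w → a w u = b i w u) :
    ev a x = ∑ i, c i * ev (b i) x := by
  have : ∀ i, ev (b i) x = evRow a v x (b i v) := fun i => by
    rw [ev_eq_evRow v, evRow_congr v x fun w u hw hu => (h' i w u hw hu).symm]
  simp only [this]
  rw [ev_congr (a' := update a v (∑ i, c i • b i v)) x]
  · change evRow a v x _ = _
    simp
  · intro w u hu
    by_cases hw : w = v
    · subst hw; simp [h u hu]
    · rw [update_of_ne hw]

theorem ev_row_smul {a : V → Option V → K} (v : V) (x : Sums K V)
    (c : K) (b : V → Option V → K) (h : ∀ u, u ≠ some v → a v u = c * b v u)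
    (h' : ∀ w u, w ≠ v → u ≠ some w → a w u = b w u) :
    ev a x = c * ev b x := by
  simpa using ev_row_sum (ι := Unit) v x (fun _ => c) (fun _ => b) (by simpa using h)
    (by simpa using h')

/-- Every tree has exactly one root, so the polynomials are linear in the column of the roots. -/
theorem ev_col_sum {ι : Type*} [Fintype ι] {a : V → Option V → K} (b : ι → V → Option V → K)
    (x : Sums K V) (h : ∀ i u w, b i u (some w) = a u (some w))
    (h' : ∀ u, a u none = ∑ i, b i u none) : ev a x = ∑ i, ev (b i) x := by
  induction x using induction_linear with
  | zero => simp
  | add x y hx hy => simp only [map_add, hx, hy, sum_add_distrib]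
  | single p k =>
    obtain ⟨r, hr, hr'⟩ := p.2.1
    simp only [ev_finsuppSingle, ← mul_prod_erase _ _ (mem_univ r), hr, h',
      ← mul_sum, sum_mul]
    congr 1
    refine sum_congr rfl fun i _ => ?_
    congr 1
    refine prod_congr rfl fun u hu => ?_
    obtain ⟨w, hw⟩ := Option.ne_none_iff_exists'.1
      fun e => ne_of_mem_erase hu (hr' u e)
    rw [hw, h]

theorem ev_col_add {a b c : V → Option V → K} (x : Sums K V)
    (h : ∀ u w, b u (some w) = a u (some w)) (h' : ∀ u w, c u (some w) = a u (some w))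
    (h'' : ∀ u, a u none = b u none + c u none) : ev a x = ev b x + ev c x := by
  simpa using ev_col_sum (ι := Bool) (a := a) (fun i => cond i b c) x
    (by rintro (_ | _) <;> assumption) (by simpa using h'')

section

variable (x : Sums K (Option V)) (y : Sums K W)

attribute [local simp] subNone low upp inner outerNew innerNew swapNew ev_Lw ev_Up ev_Rt ev_Lf

theorem Rt_insNone : Rt (insNone x y)
    = conj (outerNew V W) (insNone (conj (swapNew V) (Rt x)) y) := by
  refine ext_ev fun a => ?_
  simp only [ev_conj, ev_insNone, ev_Rt]
  congr 1
  refine ev_congr x ?_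
  rintro (_ | v) (_ | _ | u) hu
  all_goals first | rfl | exact absurd rfl hu | skip
  all_goals exact ev_congr y fun w w' _ => by cases w' <;> rfl

theorem Lf_insNone (v : V) : Lf (Sum.inl v) (insNone x y)
    = conj (outerNew V W) (insNone (conj (swapNew V) (Lf (some v) x)) y) := by
  refine ext_ev fun a => ?_
  simp only [ev_conj, ev_insNone, ev_Lf]
  congr 1
  refine ev_congr x ?_
  rintro (_ | v) (_ | _ | u) hu
  all_goals first | rfl | exact absurd rfl hu | skip
  all_goals exact ev_congr y fun w w' _ => by cases w' <;> rfl

theorem Lw_insNone (v : V) : Lw (Sum.inl v) (insNone x y)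
    = conj (outerNew V W) (insNone (conj (swapNew V) (Lw (some v) x)) y) := by
  refine ext_ev fun a => ?_
  simp only [ev_conj, ev_insNone, ev_Lw]
  congr 1
  refine ev_congr x ?_
  rintro (_ | v') (_ | _ | u) hu
  all_goals try simp
  · exact ev_congr y fun w w' _ => by cases w' <;> simp
  · exact absurd rfl hu
  · by_cases h : u = v
    · subst h
      rw [if_pos rfl]
      refine ev_col_add y (fun w w' => ?_) (fun w w' => ?_) fun w => ?_ <;> simp
    · rw [if_neg h, add_zero]
      exact ev_congr y fun w w' _ => by cases w' <;> simp [h]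

theorem Up_insNone (v : V) : Up (Sum.inl v) (insNone x y)
    = conj (outerNew V W) (insNone (conj (swapNew V) (Up (some v) x)) y) := by
  refine ext_ev fun a => ?_
  simp only [ev_conj, ev_insNone, ev_Up]
  refine ev_congr x ?_
  rintro (_ | v') (_ | _ | u) hu
  all_goals try simp
  · exact ev_congr y fun w w' _ => by cases w' <;> simp
  · exact absurd rfl hu
  · by_cases h : u = v
    · subst h
      rw [if_pos rfl]
      refine ev_col_add y (fun w w' => ?_) (fun w w' => ?_) fun w => ?_ <;> simp
    · rw [if_neg h, add_zero]
      exact ev_congr y fun w w' _ => by cases w' <;> simp [h]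
  · split_ifs <;> simp [mul_sum]

theorem insNone_Lw (w : W) : Lw (Sum.inr w) (insNone x y)
    = conj (innerNew V W) (insNone x (Lw w y)) := by
  refine ext_ev fun a => ?_
  simp only [ev_conj, ev_insNone, ev_Lw]
  refine (ev_row_smul none x _ _ ?_ ?_).symm
  · intro u hu
    simp only [subNone, ev_Lw]
    congr 1
    rcases u with _ | _ | u
    · exact ev_congr y fun w w' _ => by cases w' <;> simp
    · exact absurd rfl hu
    · exact ev_congr y fun w w' _ => by cases w' <;> simp
  · rintro (_ | v) (_ | _ | u) hw hu
    · exact absurd rfl hw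
    · exact absurd rfl hw
    · exact absurd rfl hw
    all_goals simp
    simp [sum_add_distrib, add_comm]

theorem insNone_Up (w : W) : Up (Sum.inr w) (insNone x y)
    = conj (innerNew V W) (insNone x (Up w y)) := by
  refine ext_ev fun a => ?_
  simp only [ev_conj, ev_insNone, ev_Up]
  refine ev_congr x ?_
  rintro (_ | v) (_ | _ | u) hu
  all_goals try simp
  · exact ev_congr y fun w w' _ => by cases w' <;> simp
  · exact absurd rfl hu
  · exact ev_congr y fun w w' _ => by cases w' <;> simp
  · simp [sum_add_distrib, add_comm]

theorem insNone_Rt : conj (outerNew V W) (insNone (conj (swapNew V) (Up none x)) y)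
    = conj (innerNew V W) (insNone x (Rt y)) := by
  refine ext_ev fun a => ?_
  simp only [ev_conj, ev_insNone, ev_Up]
  refine ev_congr x ?_
  rintro (_ | v) (_ | _ | u) hu
  all_goals try simp
  · rw [mul_comm]
    congr 1
    exact ev_congr y fun w w' _ => by cases w' <;> simp
  · exact absurd rfl hu
  · rw [mul_comm]
    congr 1
    exact ev_congr y fun w w' _ => by cases w' <;> simp
  · exact add_comm _ _

theorem sum_Lf_insNone : ∑ w, Lf (Sum.inr w) (insNone x y)
    = conj (outerNew V W) (insNone (conj (swapNew V) (Lf none x)) y) := by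
  refine ext_ev fun a => ?_
  simp only [map_sum, ev_conj, ev_insNone, ev_Lf, ← sum_mul]
  congr 1
  refine ev_congr x ?_
  rintro (_ | v) (_ | _ | u) hu
  all_goals first | rfl | exact absurd rfl hu | skip
  all_goals exact ev_congr y fun w w' _ => by cases w' <;> rfl

theorem sum_insNone_Lf : ∑ w, conj (innerNew V W) (insNone x (Lf w y))
    = conj (outerNew V W) (insNone (conj (swapNew V) (Lw none x)) y) := by
  refine ext_ev fun a => ?_
  simp only [map_sum, ev_conj, ev_insNone, ev_Lw]
  refine (sum_congr rfl fun w _ => ev_row_smul none x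
    (a none (some (some (Sum.inr w)))) (low (fun v u => subNone (fun v u =>
      a (outerNew V W v) (u.map (outerNew V W))) y (swapNew V v) (u.map (swapNew V))) none)
      ?_ ?_).trans (sum_mul _ _ _).symm
  · intro u hu
    simp only [subNone, ev_Lf]
    rcases u with _ | _ | u
    · simp only [low, swapNew, coe_fn_mk, map_none, reduceCtorEq, if_false, add_zero, bind_none]
      congr 1
      exact ev_congr y fun w w' _ => by cases w' <;> simp
    · exact absurd rfl hu
    · simp only [low, swapNew, coe_fn_mk, map_some, reduceCtorEq, Option.some.injEq, if_false,
      add_zero,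
        bind_some]
      congr 1
      exact ev_congr y fun w w' _ => by cases w' <;> simp
  · rintro (_ | v) (_ | _ | u) hw hu
    any_goals exact absurd rfl hw
    all_goals simp
    exact add_comm _ _

end

end

end TreeSum

namespace TreeSum

open Classical

variable {K : Type u} [Field K] {V W U : Type} [Fintype V] [Fintype W] [Fintype U]

/-! ### Equivariance, associativity and units of insertions -/

theorem conj_conj (e : V ≃ W) (e' : W ≃ U) (x : Sums K V) :
    conj e' (conj e x) = conj (e.trans e') x := by
  refine ext_ev fun a => ?_
  simp only [ev_conj, Option.map_map]
  rfl

theorem conj_refl (x : Sums K V) : conj (Equiv.refl V) x = x := by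
  refine ext_ev fun a => ?_
  simp [ev_conj]

theorem Rt_conj (e : V ≃ W) (x : Sums K V) :
    Rt (conj e x) = conj (optionCongr e) (Rt x) := by
  refine ext_ev fun a => ?_
  simp only [ev_conj, ev_Rt]
  rfl

theorem Lf_conj (e : V ≃ W) (v : V) (x : Sums K V) :
    Lf (e v) (conj e x) = conj (optionCongr e) (Lf v x) := by
  refine ext_ev fun a => ?_
  simp only [ev_conj, ev_Lf, Option.map_map]
  rfl

theorem Lw_conj (e : V ≃ W) (v : V) (x : Sums K V) :
    Lw (e v) (conj e x) = conj (optionCongr e) (Lw v x) := by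
  refine ext_ev fun a => ?_
  simp only [ev_conj, ev_Lw]
  congr 1
  refine ev_congr x fun u w _ => ?_
  cases w <;> simp [low]

theorem Up_conj (e : V ≃ W) (v : V) (x : Sums K V) :
    Up (e v) (conj e x) = conj (optionCongr e) (Up v x) := by
  refine ext_ev fun a => ?_
  simp only [ev_conj, ev_Up]
  refine ev_congr x fun u w _ => ?_
  cases w <;> simp [low, upp]

theorem insNone_conj {V' W' : Type} [Fintype V'] [Fintype W'] (e : V ≃ V') (e' : W ≃ W')
    (x : Sums K (Option V)) (y : Sums K W) :
    insNone (conj (optionCongr e) x) (conj e' y)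
      = conj (sumCongr e e') (insNone x y) := by
  refine ext_ev fun a => ?_
  simp only [ev_conj, ev_insNone]
  refine ev_congr x ?_
  rintro (_ | v) (_ | _ | u) hu
  · simp only [subNone, ev_conj, Equiv.optionCongr_apply, map_none, bind_none]
    exact ev_congr y fun w w' _ => by cases w' <;> rfl
  · exact absurd rfl hu
  · simp only [subNone, ev_conj, Equiv.optionCongr_apply, map_none, bind_some,
      map_some]
    exact ev_congr y fun w w' _ => by cases w' <;> rfl
  · rfl
  · simp [subNone, ← e'.sum_comp]
  · rfl

theorem insNone_assoc_seq (x : Sums K (Option V)) (y : Sums K (Option W)) (z : Sums K U) :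
    conj (Equiv.sumAssoc V W U) (insNone (conj (innerNew V W) (insNone x y)) z)
      = insNone x (insNone y z) := by
  refine ext_ev fun a => ?_
  simp only [ev_conj, ev_insNone]
  refine ev_congr x ?_
  rintro (_ | v) (_ | _ | u) hu
  · simp only [subNone, ev_insNone]
    refine ev_congr y ?_
    rintro (_ | w) (_ | _ | w') h
    all_goals first | rfl | exact absurd rfl h | skip
    all_goals exact ev_congr z fun w w' _ => by cases w' <;> rfl
  · exact absurd rfl hu
  · simp only [subNone, ev_insNone]
    refine ev_congr y ?_
    rintro (_ | w) (_ | _ | w') h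
    all_goals first | rfl | exact absurd rfl h | skip
    all_goals exact ev_congr z fun w w' _ => by cases w' <;> rfl
  · rfl
  · simp [subNone, innerNew, add_comm]
  · rfl

/-- The exchange of the last two summands. -/
def sumSwapRight (V W U : Type) : (V ⊕ W) ⊕ U ≃ (V ⊕ U) ⊕ W where
  toFun
    | Sum.inl (Sum.inl v) => Sum.inl (Sum.inl v)
    | Sum.inl (Sum.inr w) => Sum.inr w
    | Sum.inr u => Sum.inl (Sum.inr u)
  invFun
    | Sum.inl (Sum.inl v) => Sum.inl (Sum.inl v)
    | Sum.inr w => Sum.inl (Sum.inr w)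
    | Sum.inl (Sum.inr u) => Sum.inr u
  left_inv := by rintro ((v | w) | u) <;> rfl
  right_inv := by rintro ((v | w) | u) <;> rfl

theorem insNone_assoc_par (x : Sums K (Option (Option V))) (y : Sums K W) (z : Sums K U) :
    conj (sumSwapRight V W U) (insNone (conj (outerNew V W) (insNone x y)) z)
      = insNone (conj (outerNew V U) (insNone (conj (swapNew V) x) z)) y := by
  refine ext_ev fun a => ?_
  simp only [ev_conj, ev_insNone]
  refine ev_congr x ?_
  rintro (_ | _ | v) (_ | _ | _ | u) hu
  all_goals first | rfl | exact absurd rfl hu | skip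
  · exact ev_congr y fun w w' _ => by cases w' <;> rfl
  · exact ev_col_sum (fun w => inner a (some (Sum.inl (Sum.inr w)))) y (fun _ _ _ => rfl)
      fun _ => rfl
  · exact ev_congr y fun w w' _ => by cases w' <;> rfl
  · exact ev_congr z fun w w' _ => by cases w' <;> rfl
  · exact (ev_col_sum (fun w => inner (fun v u => a (sumSwapRight V W U v)
      (u.map (sumSwapRight V W U))) (some (Sum.inl (Sum.inr w)))) z (fun _ _ _ => rfl)
      fun _ => rfl).symm
  · exact ev_congr z fun w w' _ => by cases w' <;> rfl

theorem insNone_unit [Unique W] (x : Sums K (Option V)) :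
    insNone x (single K fun _ : W => none)
      = conj ((Equiv.optionEquivSumPUnit.{0, 0} V).trans
          (sumCongr (Equiv.refl V) (Equiv.ofUnique Unit W))) x := by
  refine ext_ev fun a => ?_
  have h : IsTree fun _ : W => (none : Option W) :=
    ⟨⟨default, rfl, fun _ _ => Subsingleton.elim _ _⟩, fun _ => 0, by simp⟩
  simp only [ev_conj, ev_insNone]
  refine ev_congr x ?_
  rintro (_ | v) (_ | _ | u) hu
  all_goals simp [subNone, ev_single _ h, inner] at hu ⊢

theorem unit_insNone [IsEmpty V] (y : Sums K W) :
    insNone (single K fun _ : Option V => none) y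
      = conj (Equiv.emptySum V W).symm y := by
  refine ext_ev fun a => ?_
  have h : IsTree fun _ : Option V => (none : Option (Option V)) :=
    ⟨⟨none, rfl, fun _ _ => Subsingleton.elim _ _⟩, fun _ => 0, by simp⟩
  simp only [ev_conj, ev_insNone, ev_single _ h]
  simp [subNone]
  exact ev_congr y fun w w' _ => by cases w' <;> rfl

/-! ### The differential on formal sums of trees -/

/-- The terms of the differential in which the vertex `v` is split. -/
noncomputable def Dv (N : V → K) (v : V) : Sums K V →ₗ[K] Sums K (Option V) :=
  Lw v - Lf v - N v • Up v

theorem Dv_apply (N : V → K) (v : V) (x : Sums K V) :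
    Dv N v x = Lw v x - Lf v x - N v • Up v x := rfl

/-- The differential on formal sums of trees without a condition on the new vertex: the sum over all
ways to split a vertex, including the numbered ones with a new parent (these have weight `N v = 1`).
The new leaves are omitted, and a new root is added as a further term. -/
noncomputable def DM (N : V → K) : Sums K V →ₗ[K] Sums K (Option V) :=
  Rt + ∑ v, Dv N v

theorem DM_apply (N : V → K) (x : Sums K V) :
    DM N x = Rt x + ∑ v, (Lw v x - Lf v x - N v • Up v x) := by
  simp [DM, Dv_apply]

theorem DM_conj (N : W → K) (e : V ≃ W) (x : Sums K V) :
    DM N (conj e x) = conj (optionCongr e) (DM (fun v => N (e v)) x) := by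
  simp only [DM_apply, map_add, map_sum, map_sub, map_smul, Rt_conj, ← Lw_conj, ← Lf_conj,
    ← Up_conj]
  congr 1
  exact (e.sum_comp _).symm

theorem DM_insNone (N : Option V → K) (N' : W → K) (h : N none = 1) (x : Sums K (Option V))
    (y : Sums K W) : DM (Sum.elim (fun v => N (some v)) N') (insNone x y)
      = conj (outerNew V W) (insNone (conj (swapNew V) (DM N x)) y)
        + conj (innerNew V W) (insNone x (DM N' y)) := by
  simp only [DM_apply, map_add, map_sum, map_sub, map_smul, sum_sum_type, Sum.elim_inl,
    Sum.elim_inr, sum_option, Rt_insNone, Lw_insNone, Lf_insNone, Up_insNone, insNone_Lw,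
    insNone_Up, LinearMap.add_apply, LinearMap.sub_apply, LinearMap.sum_apply,
    LinearMap.smul_apply, ← insNone_Rt, ← sum_insNone_Lf, ← sum_Lf_insNone, h, one_smul,
    sum_sub_distrib]
  abel

section

variable (x : Sums K V)

theorem swapNew_Rt_Lf (v : V) :
    conj (swapNew V) (Rt (Lf v x)) = Lf (some v) (Rt x) := by
  refine ext_ev fun a => ?_
  simp only [ev_conj, ev_Lf, ev_Rt]
  rw [mul_left_comm]
  congr 2
  exact ev_congr x fun u w _ => by cases w <;> rfl

theorem swapNew_Rt_Lw (v : V) :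
    conj (swapNew V) (Rt (Lw v x)) = Lw (some v) (Rt x) := by
  refine ext_ev fun a => ?_
  simp only [ev_conj, ev_Lw, ev_Rt]
  rw [mul_left_comm]
  congr 1
  congr 1
  · simp [low, swapNew]
  · exact ev_congr x fun u w _ => by cases w <;> simp [low, swapNew]

theorem swapNew_Rt_Up (v : V) :
    conj (swapNew V) (Rt (Up v x)) = Up (some v) (Rt x) := by
  refine ext_ev fun a => ?_
  simp only [ev_conj, ev_Up, ev_Rt]
  congr 1
  · simp [low, upp, swapNew]
  · exact ev_congr x fun u w _ => by cases w <;> simp [low, upp, swapNew]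

theorem swapNew_Rt_Rt :
    conj (swapNew V) (Rt (Rt x)) = Lw none (Rt x) - Lf none (Rt x) := by
  refine ext_ev fun a => ?_
  simp only [ev_conj, ev_Rt, map_sub, ev_Lw, ev_Lf]
  rw [ev_col_add (a := fun u w => low a none (some u) (some w))
    (b := fun u w => a (some (some u)) ((some w).map some))
    (c := fun u w => a (some (some u)) (some (w.map some))) x]
  · simp only [low, reduceCtorEq, if_false, add_zero]
    rw [mul_add, mul_add, add_sub_cancel_left, mul_left_comm]
    congr 2
    exact ev_congr x fun u w _ => by cases w <;> rfl
  · simp [low]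
  · simp [low]
  · simp [low]

theorem swapNew_comm {v w : V} (h : v ≠ w) (Y Z : V → Sums K V →ₗ[K] Sums K (Option V))
    (Y' Z' : Option V → Sums K (Option V) →ₗ[K] Sums K (Option (Option V)))
    (hY : Y = Lw ∧ Y' = Lw ∨ Y = Lf ∧ Y' = Lf ∨ Y = Up ∧ Y' = Up)
    (hZ : Z = Lw ∧ Z' = Lw ∨ Z = Lf ∧ Z' = Lf ∨ Z = Up ∧ Z' = Up) :
    conj (swapNew V) (Y' (some v) (Z w x)) = Z' (some w) (Y v x) := by
  have h' := h.symm
  refine ext_ev fun a => ?_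
  have hc (c c' d d' : K) {b b' : V → Option V → K} (hc : c * c' = d * d')
      (hb : ∀ u w, w ≠ some u → b u w = b' u w) : c * (c' * ev b x) = d * (d' * ev b' x) := by
    rw [← mul_assoc, ← mul_assoc, hc, ev_congr x hb]
  have hc₁ (c d : K) {b b' : V → Option V → K} (hc : c = d)
      (hb : ∀ u w, w ≠ some u → b u w = b' u w) : c * ev b x = d * ev b' x := by
    rw [hc, ev_congr x hb]
  rcases hY with ⟨rfl, rfl⟩ | ⟨rfl, rfl⟩ | ⟨rfl, rfl⟩ <;>
  rcases hZ with ⟨rfl, rfl⟩ | ⟨rfl, rfl⟩ | ⟨rfl, rfl⟩ <;>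
  simp only [ev_conj, ev_Lw, ev_Lf, ev_Up]
  all_goals first
    | refine hc _ _ _ _ ?_ fun u u' hu => ?_
    | refine hc₁ _ _ ?_ fun u u' hu => ?_
    | refine ev_congr x fun u u' hu => ?_
  all_goals try
    rcases u' with _ | u'
  all_goals simp only [low, upp, swapNew, coe_fn_mk, map_some, map_none,
    reduceCtorEq, if_false, add_zero, Option.some.injEq, if_true, h, h']
  all_goals try ring1
  all_goals split_ifs
  all_goals first | ring1 | subst_vars; simp_all

/-- The matrix obtained from `a` by splitting the vertex `v` twice, where the children of `v` may
also be attached to the new vertices with the weights `p` and `q`, evaluated with the row `ρ` at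
`v`. -/
noncomputable def evTwice (a : Option (Option V) → Option (Option (Option V)) → K) (v : V) (p q :
    K) :
    (Option V → K) →ₗ[K] K :=
  evRow (fun u w => a (some (some u)) (w.map fun w => some (some w))
    + if w = some v then p * a (some (some u)) (some none)
      + q * a (some (some u)) (some (some none)) else 0) v x

variable {x} in
theorem ev_eq_evTwice (a : Option (Option V) → Option (Option (Option V)) → K) (v : V) (p q : K)
    (c : K) (ρ : Option V → K) {b : V → Option V → K} (hρ : ∀ w, w ≠ some v → b v w = c * ρ w)
    (hb : ∀ u w, u ≠ v → b u w = a (some (some u)) (w.map fun w => some (some w))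
      + if w = some v then p * a (some (some u)) (some none)
      + q * a (some (some u)) (some (some none)) else 0) :
    ev b x = c * evTwice x a v p q ρ := by
  rw [← smul_eq_mul, ← map_smul]
  refine ev_congr x fun u w hw => ?_
  by_cases h : u = v
  · subst h
    simp [hρ w hw]
  · rw [update_of_ne h, hb u w h]

set_option maxHeartbeats 1000000 in
theorem ev_splitTwice (N : K) (v : V) (a : Option (Option V) → Option (Option (Option V)) → K)
    (y : Sums K (Option V)) (hy : y = Lw v x - Lf v x - N • Up v x) :
    ev a (Lw (some v) y - Lf (some v) y - N • Up (some v) y + (Lw none y - Lf none y))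
      = let a₁ := a none (some (some (some v)))
        let a₂ := a (some none) (some (some (some v)))
        let a₁₂ := a none (some (some none))
        let a₂₁ := a (some none) (some none)
        let b₁ := a (some (some v)) (some none)
        let b₂ := a (some (some v)) (some (some none))
        let ρ := fun w : Option V => a (some (some v)) (w.map fun w => some (some w))
        let r₁ := fun w : Option V => a none (w.map fun w => some (some w))
        let r₂ := fun w : Option V => a (some none) (w.map fun w => some (some w))
        let E := evTwice x a v
        (a₁ * (a₂ + a₂₁) * E 1 1 ρ - a₁ * (a₂ + a₂₁) * E 1 0 ρ - N * (a₁ * b₂ * E 1 1 r₂))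
        - (a₁ * a₂ * E 0 1 ρ - a₁ * a₂ * E 0 0 ρ - N * (a₁ * b₂ * E 0 1 r₂))
        - N * ((a₂ + a₂₁) * b₁ * E 1 1 r₁ - (a₂ + a₂₁) * b₁ * E 1 0 r₁
          - N * (b₁ * a₁₂ * E 1 1 r₂))
        + ((a₁₂ * a₂ * E 1 1 ρ - a₁₂ * a₂ * E 0 0 ρ - N * (a₁₂ * (b₁ + b₂) * E 1 1 r₂))
        - (a₁₂ * a₂ * E 0 1 ρ - a₁₂ * a₂ * E 0 0 ρ - N * (a₁₂ * b₂ * E 0 1 r₂))) := by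
  extract_lets a₁ a₂ a₁₂ a₂₁ b₁ b₂ ρ r₁ r₂ E
  subst hy
  simp only [map_add, map_sub, map_smul, smul_eq_mul, ev_Lw, ev_Lf, ev_Up]
  -- each of the matrices that arises agrees, up to a factor, with a matrix of `evTwice`
  have e (p q : K) (b : V → Option V → K) (c : K) (ρ : Option V → K)
    (hρ : ∀ w, w ≠ some v → b v w = c * ρ w)
    (hb : ∀ u w, u ≠ v → b u w = a (some (some u)) (w.map fun w => some (some w))
      + if w = some v then p * a (some (some u)) (some none)
      + q * a (some (some u)) (some (some none)) else 0) :
    ev b x = c * evTwice x a v p q ρ := ev_eq_evTwice a v p q c ρ hρ hb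
  have s₁ : low a (some v) none (some (some v))
      = a (some none) (some (some (some v))) + a (some none) (some none) := by simp [low]
  have s₂ : upp a (some v) none (some (some v))
      = a (some none) (some (some (some v))) + a (some none) (some none) := by simp [low, upp]
  have s₃ : low a none none (some (some v)) = a (some none) (some (some (some v))) := by simp [low]
  rw [e 1 1 (low (low a (some v)) v) 1 ρ, e 1 0 (fun u w => low a (some v) (some u)
    (w.map some)) 1 ρ,
    e 1 1 (upp (low a (some v)) v) b₂ r₂, e 0 1 (low (fun u w => a (some u) (w.map some)) v) 1 ρ,
    e 0 0 (fun u w => a (some (some u)) ((w.map some).map some)) 1 ρ,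
    e 0 1 (upp (fun u w => a (some u) (w.map some)) v) b₂ r₂,
    e 1 1 (low (upp a (some v)) v) b₁ r₁,
    e 1 0 (fun u w => upp a (some v) (some u) (w.map some)) b₁ r₁,
    e 1 1 (upp (upp a (some v)) v) (b₁ * a₁₂) r₂, e 1 1 (low (low a none) v) 1 ρ,
    e 0 0 (fun u w => low a none (some u) (w.map some)) 1 ρ,
    e 1 1 (upp (low a none) v) (b₂ + b₁) r₂, s₁, s₂, s₃]
  · simp only [map_some, a₁, a₂, a₁₂, a₂₁, b₁, b₂, E]
    ring
  all_goals first
    | rintro u (_ | w) hu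
      · simp [low, upp, hu]
      · by_cases h : w = v <;> simp [low, upp, hu, h]
        try ring
    | rintro (_ | w) hw
      · simp [ρ, r₁, r₂, b₁, b₂, a₁₂, low, upp]
      · have h : w ≠ v := fun h => hw (by rw [h])
        simp [ρ, r₁, r₂, b₁, b₂, a₁₂, low, upp, h]
        try ring

/-- The sum of the trees in which the vertex `v` is split twice is symmetric in the two new
vertices. -/
theorem swapNew_twice (N : K) (hN : N * N = N) (v : V) (y : Sums K (Option V))
    (hy : y = Lw v x - Lf v x - N • Up v x) :
    conj (swapNew V)
      (Lw (some v) y - Lf (some v) y - N • Up (some v) y + (Lw none y - Lf none y))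
      = Lw (some v) y - Lf (some v) y - N • Up (some v) y + (Lw none y - Lf none y) := by
  refine ext_ev fun a => ?_
  have h (p q : K) (ρ : Option V → K) : evTwice x (fun v u => a (swapNew V v) (u.map (swapNew V)))
      v p q ρ = evTwice x a v q p ρ := by
    refine ev_congr x fun u w _ => ?_
    by_cases hu : u = v
    · subst hu; simp
    · rw [update_of_ne hu, update_of_ne hu]
      cases w <;> simp [swapNew, add_comm]
  have hm (w : Option V) : (w.map fun w => some (some w)).map (swapNew V)
      = w.map fun w => some (some w) := by cases w <;> rfl
  rw [ev_conj, ev_splitTwice x N v a y hy, ev_splitTwice x N v _ y hy]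
  simp only [h, hm]
  simp only [swapNew, coe_fn_mk, map_some]
  linear_combination
    (a (some none) (some none) * a (some (some v)) (some (some none))
      * evTwice x a v 1 1 (fun w => a none (w.map fun w => some (some w)))
    - a none (some (some none)) * a (some (some v)) (some none)
      * evTwice x a v 1 1 (fun w => a (some none) (w.map fun w => some (some w)))) * hN

/-- The square of the differential is symmetric in the two new vertices. -/
theorem swapNew_DM_DM (N : V → K) (hN : ∀ v, N v * N v = N v) :
    conj (swapNew V) (DM (fun v => v.elim 0 N) (DM N x)) = DM (fun v => v.elim 0 N) (DM N x) := by
  set N' : Option V → K := fun v => v.elim 0 N with hN'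
  have e₀ : swapNew V = (swapNew V).symm := by ext v; rcases v with _ | _ | v <;> rfl
  have e₁ (z : Sums K (Option (Option V))) : conj (swapNew V) (conj (swapNew V) z) = z := by
    rw [conj_conj]
    nth_rewrite 2 [e₀]
    rw [Equiv.self_trans_symm, conj_refl]
  have h₀ (y : Sums K (Option V)) : Dv N' none y = Lw none y - Lf none y := by
    simp [Dv_apply, hN']
  have hs (v : V) (y : Sums K (Option V)) :
      Dv N' (some v) y = Lw (some v) y - Lf (some v) y - N v • Up (some v) y := rfl
  -- the terms of the square pair up: a new root with a splitting, splittings of `v ≠ w` in either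
  -- order, and the splittings of `v` or of the new vertex it has created
  have h₁ (v : V) : conj (swapNew V) (Rt (Dv N v x)) = Dv N' (some v) (Rt x) := by
    rw [hs, Dv_apply]
    simp only [map_sub, map_smul, swapNew_Rt_Lw, swapNew_Rt_Lf, swapNew_Rt_Up]
  have h₂ (v w : V) (h : v ≠ w) :
      conj (swapNew V) (Dv N' (some v) (Dv N w x)) = Dv N' (some w) (Dv N v x) := by
    have hc := swapNew_comm x h
    simp only [hs, Dv_apply, map_sub, map_smul,
      hc Lw Lw Lw Lw (by simp) (by simp), hc Lw Lf Lw Lf (by simp) (by simp),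
      hc Lw Up Lw Up (by simp) (by simp), hc Lf Lw Lf Lw (by simp) (by simp),
      hc Lf Lf Lf Lf (by simp) (by simp), hc Lf Up Lf Up (by simp) (by simp),
      hc Up Lw Up Lw (by simp) (by simp), hc Up Lf Up Lf (by simp) (by simp),
      hc Up Up Up Up (by simp) (by simp), smul_sub, smul_comm (N v) (N w)]
    abel
  have h₃ (v : V) : conj (swapNew V) (Dv N' (some v) (Dv N v x) + Dv N' none (Dv N v x))
      = Dv N' (some v) (Dv N v x) + Dv N' none (Dv N v x) := by
    rw [h₀, hs]
    exact swapNew_twice x (N v) (hN v) v (Dv N v x) rfl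
  have h₄ : DM N' (DM N x) = (Rt (Rt x) + Dv N' none (Rt x))
        + ∑ v, (Rt (Dv N v x) + Dv N' (some v) (Rt x))
        + ∑ v, (Dv N' (some v) (Dv N v x) + Dv N' none (Dv N v x))
        + ∑ v, ∑ w, if v = w then 0 else Dv N' (some v) (Dv N w x) := by
    have (v : V) : ∑ w, Dv N' (some v) (Dv N w x) = Dv N' (some v) (Dv N v x)
        + ∑ w, if v = w then 0 else Dv N' (some v) (Dv N w x) := by
      rw [Finset.sum_ite, Finset.sum_const_zero, zero_add,
        ← add_sum_erase _ _ (mem_univ v)]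
      congr 1
      refine sum_congr ?_ fun _ _ => rfl
      ext w
      simp [eq_comm]
    simp only [DM, LinearMap.add_apply, LinearMap.sum_apply, sum_option, map_add, map_sum,
      sum_add_distrib]
    have hc : ∑ w, ∑ v, Dv N' (some v) (Dv N w x) = ∑ v, ∑ w, Dv N' (some v) (Dv N w x) :=
      sum_comm
    rw [hc]
    simp only [this, sum_add_distrib]
    generalize ∑ v, ∑ w, (if v = w then 0 else Dv N' (some v) (Dv N w x)) = s₁
    generalize ∑ v, Dv N' (some v) (Dv N v x) = s₂
    generalize ∑ v, Dv N' none (Dv N v x) = s₃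
    generalize ∑ v, Dv N' (some v) (Rt x) = s₄
    generalize ∑ v, Rt (Dv N v x) = s₅
    generalize Dv N' none (Rt x) = s₆
    generalize Rt (Rt x) = s₇
    abel
  have h₅ : conj (swapNew V) (Rt (Rt x) + Dv N' none (Rt x)) = Rt (Rt x) + Dv N' none (Rt x) := by
    rw [h₀, ← swapNew_Rt_Rt, map_add, e₁, add_comm]
  have h₆ : conj (swapNew V) (∑ v, (Rt (Dv N v x) + Dv N' (some v) (Rt x)))
      = ∑ v, (Rt (Dv N v x) + Dv N' (some v) (Rt x)) := by
    rw [map_sum]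
    refine sum_congr rfl fun v _ => ?_
    rw [map_add, ← h₁, e₁, add_comm]
  have h₇ : conj (swapNew V) (∑ v, (Dv N' (some v) (Dv N v x) + Dv N' none (Dv N v x)))
      = ∑ v, (Dv N' (some v) (Dv N v x) + Dv N' none (Dv N v x)) := by
    rw [map_sum]
    exact sum_congr rfl fun v _ => h₃ v
  have h₈ : conj (swapNew V) (∑ v, ∑ w, if v = w then 0 else Dv N' (some v) (Dv N w x))
      = ∑ v, ∑ w, if v = w then 0 else Dv N' (some v) (Dv N w x) := by
    simp only [map_sum]
    refine sum_comm.trans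
      (sum_congr rfl fun v _ => sum_congr rfl fun w _ => ?_)
    by_cases h : v = w
    · simp [h]
    · rw [if_neg h, if_neg (Ne.symm h), h₂ _ _ (Ne.symm h)]
  rw [h₄, map_add, map_add, map_add, h₅, h₆, h₇, h₈]

end

end TreeSum

/-! ### The operad of trees as a quotient of formal sums -/

namespace TRT

open Classical TreeSum

variable {K : Type u} [Field K] {A B C : Type} {m n l : ℕ}

/-- The class in `TRT(A)` of a formal sum of trees with `m` black vertices. -/
noncomputable def ofSum {k : ℤ} (hm : (m : ℤ) = -k) : Sums K (A ⊕ Fin m) →ₗ[K] Obj K A k :=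
  linearCombination K fun p => mk K hm p.1

theorem ofSum_single {k : ℤ} (hm : (m : ℤ) = -k) {p : A ⊕ Fin m → Option (A ⊕ Fin m)}
    (hp : IsTree p) : ofSum hm (single K p) = mk K hm p := by
  simp [ofSum, single_of_isTree hp]

theorem single_of_not_isTree {V : Type} {p : V → Option V} (hp : ¬ IsTree p) : single K p = 0 :=
  dif_neg hp

theorem ofSum_single' {k : ℤ} (hm : (m : ℤ) = -k) (p : A ⊕ Fin m → Option (A ⊕ Fin m)) :
    ofSum hm (single K p) = mk K hm p := by
  by_cases hp : IsTree p
  · exact ofSum_single hm hp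
  · rw [single_of_not_isTree hp, map_zero, mk, dif_neg fun h => hp h.1]

theorem conj_single {V W : Type} (e : V ≃ W) (p : V → Option V) :
    TreeSum.conj e (single K p) = single K (ParentFn.conj e p) := by
  by_cases hp : IsTree p
  · rw [single_of_isTree hp, single_of_isTree (isTree_conj e hp)]
    simp [TreeSum.conj, Finsupp.mapDomain_single]
  · rw [single_of_not_isTree hp, map_zero, single_of_not_isTree fun h => hp ?_]
    rw [← conj_symm_conj e p]
    exact isTree_conj e.symm h

/-- Relabelling of the black vertices. -/
noncomputable abbrev black (A : Type) (s : Fin m ≃ Fin n) :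
    Sums K (A ⊕ Fin m) →ₗ[K] Sums K (A ⊕ Fin n) :=
  TreeSum.conj (sumCongr (Equiv.refl A) s)

/-- The sign of a bijection of finite ordinals, as the parity of the number of inversions. -/
def invSign (s : Fin m ≃ Fin n) : ℤˣ := ∏ i, ∏ j, if i < j ∧ s j < s i then -1 else 1

theorem invSign_eq_sign (s : Equiv.Perm (Fin m)) : invSign s = Equiv.Perm.sign s := by
  rw [Equiv.Perm.sign_eq_prod_prod_Iio, invSign, prod_comm]
  refine prod_congr rfl fun j _ => ?_
  rw [← Finset.prod_filter_mul_prod_filter_not univ (fun i => i < j)]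
  have h₁ : ∏ i with ¬ i < j, (if i < j ∧ s j < s i then (-1 : ℤˣ) else 1) = 1 :=
    prod_eq_one fun i hi => by simp [(mem_filter.1 hi).2]
  rw [h₁, mul_one]
  refine prod_congr (by ext; simp) fun i hi => ?_
  have hi : i < j := by simpa using hi
  have : s i ≠ s j := fun h => hi.ne (s.injective h)
  by_cases h : s i < s j
  · simp [h, h.not_gt]
  · have h' : s j < s i := lt_of_le_of_ne (not_lt.1 h) this.symm
    simp [hi, h, h']

theorem ofSum_black {k : ℤ} (hm : (m : ℤ) = -k) (hn : (n : ℤ) = -k) (s : Fin m ≃ Fin n)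
    (x : Sums K (A ⊕ Fin m)) :
    ofSum hn (black A s x) = ((invSign s : ℤ) : K) • ofSum hm x := by
  obtain rfl : m = n := by omega
  rw [invSign_eq_sign]
  induction x using induction_linear with
  | zero => simp
  | add x y hx hy => simp only [map_add, hx, hy, smul_add]
  | single p c =>
    have : Finsupp.single p c = c • single K p.1 := by simp [single_of_isTree p.2]
    rw [this, map_smul, map_smul, map_smul, conj_single, ofSum_single', ofSum_single', mk_relabel,
      smul_comm]

/-! ### Sums that are compatible with all operations -/

variable (K A m) in
/-- The sums of trees that vanish because the black vertices are odd. -/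
noncomputable def nullSums : Submodule K (Sums K (A ⊕ Fin m)) :=
  Submodule.span K {z | ∃ (s : Equiv.Perm (Fin m)) (x : Sums K (A ⊕ Fin m)),
    z = black A s x - ((Equiv.Perm.sign s : ℤ) : K) • x}

variable (K A m) in
/-- The sums of trees that, up to the sign rule for the black vertices, only involve trees all of
whose black vertices have at least two children. -/
noncomputable def goodSums : Submodule K (Sums K (A ⊕ Fin m)) :=
  Submodule.span K {x | ∃ p, IsAdm p ∧ x = single K p} ⊔ nullSums K A m

theorem mem_goodSums_of_isAdm {p : A ⊕ Fin m → Option (A ⊕ Fin m)} (hp : IsAdm p) :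
    single K p ∈ goodSums K A m :=
  Submodule.mem_sup_left (Submodule.subset_span ⟨p, hp, rfl⟩)

theorem nullSums_le_goodSums : nullSums K A m ≤ goodSums K A m := le_sup_right

theorem nullSums_le {S : Submodule K (Sums K (A ⊕ Fin m))}
    (h : ∀ (s : Equiv.Perm (Fin m)) (x : Sums K (A ⊕ Fin m)),
      black A s x - ((Equiv.Perm.sign s : ℤ) : K) • x ∈ S) : nullSums K A m ≤ S := by
  rw [nullSums, Submodule.span_le]
  rintro _ ⟨s, x, rfl⟩
  exact h s x

theorem goodSums_le {S : Submodule K (Sums K (A ⊕ Fin m))}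
    (h : ∀ p, IsAdm p → single K p ∈ S) (h' : nullSums K A m ≤ S) : goodSums K A m ≤ S := by
  refine sup_le (Submodule.span_le.2 ?_) h'
  rintro _ ⟨p, hp, rfl⟩
  exact h p hp

theorem ofSum_of_mem_nullSums {k : ℤ} (hm : (m : ℤ) = -k) {x : Sums K (A ⊕ Fin m)}
    (hx : x ∈ nullSums K A m) : ofSum hm x = 0 := by
  refine (nullSums_le (S := LinearMap.ker (ofSum hm)) fun s x => ?_) hx
  rw [LinearMap.mem_ker, map_sub, ofSum_black hm hm, map_smul, invSign_eq_sign, sub_self]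

/-- A map that is compatible with relabellings of the black vertices preserves null sums. -/
theorem mem_nullSums_of_black (F : Sums K (A ⊕ Fin m) →ₗ[K] Sums K (B ⊕ Fin n))
    (hF : ∀ s : Equiv.Perm (Fin m), ∃ t : Equiv.Perm (Fin n),
      Equiv.Perm.sign t = Equiv.Perm.sign s ∧ ∀ x, F (black A s x) = black B t (F x))
    {x : Sums K (A ⊕ Fin m)} (hx : x ∈ nullSums K A m) : F x ∈ nullSums K B n := by
  refine (nullSums_le (S := (nullSums K B n).comap F) fun s x => ?_) hx
  obtain ⟨t, ht, h⟩ := hF s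
  rw [Submodule.mem_comap, map_sub, h, map_smul, ← ht]
  exact Submodule.subset_span ⟨t, F x, rfl⟩

/-- Every element of `TRT(A)` is the class of a good sum. -/
theorem exists_ofSum_eq {k : ℤ} (x : Obj K A k) :
    x = 0 ∨ ∃ (m : ℕ) (hm : (m : ℤ) = -k), ∃ X ∈ goodSums K A m, x = ofSum hm X := by
  by_cases hk : ∃ m : ℕ, (m : ℤ) = -k
  · obtain ⟨m, hm⟩ := hk
    refine Or.inr ⟨m, hm, ?_⟩
    obtain ⟨x, rfl⟩ := (signRel K A k).mkQ_surjective x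
    induction x using induction_linear with
    | zero => exact ⟨0, zero_mem _, by simp⟩
    | add x y hx hy =>
      obtain ⟨X, hX, hx⟩ := hx
      obtain ⟨Y, hY, hy⟩ := hy
      exact ⟨X + Y, add_mem hX hY, by rw [map_add, map_add, hx, hy]⟩
    | single T c =>
      obtain ⟨m', hm', p, hp⟩ := T
      obtain rfl : m' = m := by omega
      refine ⟨c • single K p, Submodule.smul_mem _ _ (mem_goodSums_of_isAdm hp), ?_⟩
      rw [map_smul, ofSum_single', mk, dif_pos hp, ← map_smul, Finsupp.smul_single, smul_eq_mul,
        mul_one]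
  · left
    obtain ⟨x, rfl⟩ := (signRel K A k).mkQ_surjective x
    have : x = 0 := Finsupp.ext fun T => (hk ⟨T.m, T.deg⟩).elim
    rw [this, map_zero]

theorem extend_mk {M : Type v} [AddCommGroup M] [Module K M] {k : ℤ} (F : Tree A k → M)
    (hF : ∀ (T : Tree A k) (s : Equiv.Perm (Fin T.m)), F (T.relabel (Equiv.refl A) s)
      = (((Equiv.Perm.sign s : ℤˣ) : ℤ) : K) • F T) (hm : (m : ℤ) = -k)
    {p : A ⊕ Fin m → Option (A ⊕ Fin m)} (hp : IsAdm p) :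
    extend F hF (mk K hm p) = F ⟨m, hm, p, hp⟩ := by
  rw [mk, dif_pos hp, extend, Submodule.mkQ_apply, Submodule.liftQ_apply]
  simp

section

variable [Fintype A] [Fintype B] [Fintype C]

theorem conj_mem_nullSums (e : A ≃ B) {x : Sums K (A ⊕ Fin m)} (hx : x ∈ nullSums K A m) :
    TreeSum.conj (sumCongr e (Equiv.refl _)) x ∈ nullSums K B m := by
  refine mem_nullSums_of_black (TreeSum.conj (sumCongr e (Equiv.refl _)))
    (fun s => ⟨s, rfl, fun x => ?_⟩) hx
  rw [TreeSum.conj_conj, TreeSum.conj_conj]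
  congr 2
  ext v
  rcases v with v | v <;> rfl

theorem map_ofSum {k : ℤ} (hm : (m : ℤ) = -k) (e : A ≃ B) {x : Sums K (A ⊕ Fin m)}
    (hx : x ∈ goodSums K A m) :
    map e (ofSum hm x) = ofSum hm (TreeSum.conj (sumCongr e (Equiv.refl _)) x) := by
  refine (goodSums_le (S := eqLocus (map e ∘ₗ ofSum hm)
    (ofSum hm ∘ₗ TreeSum.conj (sumCongr e (Equiv.refl _)))) (fun p hp => ?_)
    fun x hx => ?_) hx
  · change map e (ofSum hm _) = ofSum hm _
    rw [ofSum_single', conj_single, ofSum_single', map, extend_mk _ _ hm hp]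
  · change map e (ofSum hm _) = ofSum hm _
    rw [ofSum_of_mem_nullSums hm hx, map_zero,
      ofSum_of_mem_nullSums hm (conj_mem_nullSums e hx)]

theorem conj_mem_goodSums (e : A ≃ B) {x : Sums K (A ⊕ Fin m)} (hx : x ∈ goodSums K A m) :
    TreeSum.conj (sumCongr e (Equiv.refl _)) x ∈ goodSums K B m := by
  refine (goodSums_le (S := (goodSums K B m).comap
    (TreeSum.conj (sumCongr e (Equiv.refl _)))) (fun p hp => ?_) fun x hx => ?_) hx
  · rw [Submodule.mem_comap, conj_single]
    exact mem_goodSums_of_isAdm (hp.relabel e (Equiv.refl _))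
  · exact nullSums_le_goodSums (conj_mem_nullSums e hx)

/-! ### Composition on formal sums -/

/-- The vertices of a tree with a marked numbered vertex `a`, moved to `none`. -/
noncomputable def markEquiv (a : A) (m : ℕ) : Option ({x : A // x ≠ a} ⊕ Fin m) ≃ A ⊕ Fin m where
  toFun
    | none => Sum.inl a
    | some (Sum.inl x) => Sum.inl x.1
    | some (Sum.inr i) => Sum.inr i
  invFun
    | Sum.inl x => if h : x = a then none else some (Sum.inl ⟨x, h⟩)
    | Sum.inr i => some (Sum.inr i)
  left_inv := by
    rintro (_ | x | i)
    · simp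
    · simp [x.2]
    · rfl
  right_inv := by
    rintro (x | i)
    · by_cases h : x = a <;> simp [h]
    · rfl

/-- The vertices of a composition. -/
def joinEquiv (A B : Type) (m n : ℕ) : (A ⊕ Fin m) ⊕ (B ⊕ Fin n) ≃ (A ⊕ B) ⊕ Fin (m + n) :=
  (Equiv.sumSumSumComm A (Fin m) B (Fin n)).trans (sumCongr (Equiv.refl _) finSumFinEquiv)

/-- Composition on formal sums. -/
noncomputable def compSum (a : A) :
    Sums K (A ⊕ Fin m) →ₗ[K] Sums K (B ⊕ Fin n) →ₗ[K] Sums K (Ins a B ⊕ Fin (m + n)) :=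
  (ins (Sum.inl a)).compr₂ (TreeSum.conj (insEquiv a B m n))

theorem compSum_eq (a : A) (x : Sums K (Option ({x : A // x ≠ a} ⊕ Fin m)))
    (y : Sums K (B ⊕ Fin n)) :
    compSum a (TreeSum.conj (markEquiv a m) x) y
      = TreeSum.conj (joinEquiv {x : A // x ≠ a} B m n) (insNone x y) := by
  let e : {x : A // x ≠ a} ⊕ Fin m ≃ {v : A ⊕ Fin m // v ≠ Sum.inl a} :=
    { toFun := Sum.elim (fun x => ⟨Sum.inl x.1, fun h => x.2 (Sum.inl_injective h)⟩)
        fun i => ⟨Sum.inr i, Sum.inr_ne_inl⟩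
      invFun := fun
        | ⟨Sum.inl x, h⟩ => Sum.inl ⟨x, fun e => h (by rw [e])⟩
        | ⟨Sum.inr i, _⟩ => Sum.inr i
      left_inv := by rintro (x | i) <;> rfl
      right_inv := by rintro ⟨x | i, h⟩ <;> rfl }
  have h : TreeSum.conj (Equiv.optionSubtypeNe (Sum.inl a)).symm
      (TreeSum.conj (markEquiv a m) x) = TreeSum.conj (optionCongr e) x := by
    rw [TreeSum.conj_conj]
    congr 2
    ext1 v
    rw [Equiv.trans_apply, Equiv.symm_apply_eq]
    rcases v with _ | x | i <;> rfl
  have h' := insNone_conj e (Equiv.refl (B ⊕ Fin n)) x y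
  rw [conj_refl] at h'
  rw [compSum, compr₂_apply, ins_eq_insNone, h, h', TreeSum.conj_conj]
  congr 2
  ext1 v
  rcases v with (x | i) | (x | i) <;> rfl

theorem exists_conj_eq {V W : Type} [Fintype V] [Fintype W] (e : V ≃ W) (x : Sums K W) :
    ∃ y, x = TreeSum.conj e y :=
  ⟨TreeSum.conj e.symm x, by rw [TreeSum.conj_conj, Equiv.symm_trans_self, conj_refl]⟩

theorem compSum_conj {A' B' : Type} [Fintype A'] [Fintype B'] {m' n' : ℕ} (e : A ≃ A')
    (s : Fin m ≃ Fin m') (e' : B ≃ B') (t : Fin n ≃ Fin n') (a : A) (x : Sums K (A ⊕ Fin m))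
    (y : Sums K (B ⊕ Fin n)) :
    compSum (e a) (TreeSum.conj (sumCongr e s) x) (TreeSum.conj (sumCongr e' t) y)
      = TreeSum.conj (sumCongr (OperadLabels.congr e a e')
          ((finSumFinEquiv.symm.trans (sumCongr s t)).trans finSumFinEquiv))
        (compSum a x y) := by
  obtain ⟨x, rfl⟩ := exists_conj_eq (markEquiv a m) x
  have h : TreeSum.conj (sumCongr e s) (TreeSum.conj (markEquiv a m) x)
      = TreeSum.conj (markEquiv (e a) m') (TreeSum.conj (optionCongr
        (sumCongr (e.subtypeEquiv fun x => by simp) s)) x) := by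
    rw [TreeSum.conj_conj, TreeSum.conj_conj]
    congr 2
    ext1 v
    rcases v with _ | v | i <;> rfl
  rw [h, compSum_eq, compSum_eq, insNone_conj, TreeSum.conj_conj, TreeSum.conj_conj]
  congr 2
  ext1 v
  rcases v with (x | i) | (x | i) <;> simp [joinEquiv, OperadLabels.congr]

theorem one_compSum (y : Sums K (B ⊕ Fin n)) :
    compSum () (single K fun _ : Unit ⊕ Fin 0 => none) y
      = TreeSum.conj (sumCongr (unitLeft B) (finCongr (zero_add n).symm)) y := by
  have h : (single K fun _ : Unit ⊕ Fin 0 => none)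
      = TreeSum.conj (markEquiv () 0) (single K fun _ => none) := by
    rw [conj_single]; rfl
  have : IsEmpty ({x : Unit // x ≠ ()} ⊕ Fin 0) := by
    rw [isEmpty_sum]
    exact ⟨⟨fun x => x.2 rfl⟩, inferInstance⟩
  rw [h, compSum_eq, unit_insNone, TreeSum.conj_conj]
  congr 2
  ext1 v
  rcases v with x | i
  · rfl
  · simp [joinEquiv]

theorem compSum_one (a : A) (x : Sums K (A ⊕ Fin m)) :
    compSum a x (single K fun _ : Unit ⊕ Fin 0 => none)
      = TreeSum.conj (sumCongr (unitRight a) (finCongr (add_zero m).symm)) x := by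
  obtain ⟨x, rfl⟩ := exists_conj_eq (markEquiv a m) x
  have : Unique (Unit ⊕ Fin 0) := ⟨⟨Sum.inl ()⟩, by rintro (_ | i); exacts [rfl, i.elim0]⟩
  rw [compSum_eq, insNone_unit, TreeSum.conj_conj, TreeSum.conj_conj]
  congr 2
  ext1 v
  rcases v with _ | x | i
  · have : (default : Unit ⊕ Fin 0) = Sum.inl () := Subsingleton.elim _ _
    simp [joinEquiv, markEquiv, unitRight, this]
  · simpa [joinEquiv, markEquiv, unitRight] using x.2
  · rfl

theorem compSum_assoc_seq (a : A) (b : B) (x : Sums K (A ⊕ Fin m)) (y : Sums K (B ⊕ Fin n))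
    (z : Sums K (C ⊕ Fin l)) :
    TreeSum.conj (sumCongr (seqEquiv a b C) (finCongr (add_assoc m n l)))
      (compSum (Sum.inr b) (compSum a x y) z) = compSum a x (compSum b y z) := by
  -- all compositions are moved to the vertex `none`, where associativity is `insNone_assoc_seq`
  obtain ⟨x, rfl⟩ := exists_conj_eq (markEquiv a m) x
  obtain ⟨y, rfl⟩ := exists_conj_eq (markEquiv b n) y
  have h := insNone_conj (Equiv.refl _) (markEquiv b n) x y
  rw [Equiv.optionCongr_refl, conj_refl] at h
  have h' := insNone_conj (Equiv.refl _) (joinEquiv _ C n l) x (insNone y z)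
  rw [Equiv.optionCongr_refl, conj_refl] at h'
  let e : ({x : A // x ≠ a} ⊕ Fin m) ⊕ ({x : B // x ≠ b} ⊕ Fin n)
      ≃ {x : Ins a B // x ≠ Sum.inr b} ⊕ Fin (m + n) :=
    (joinEquiv {x : A // x ≠ a} {x : B // x ≠ b} m n).trans (sumCongr
      { toFun := Sum.elim (fun x => ⟨Sum.inl x, Sum.inl_ne_inr⟩)
          fun y => ⟨Sum.inr y.1, fun h => y.2 (Sum.inr_injective h)⟩
        invFun := fun
          | ⟨Sum.inl x, _⟩ => Sum.inl x
          | ⟨Sum.inr y, h⟩ => Sum.inr ⟨y, fun e => h (by rw [e])⟩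
        left_inv := by rintro (x | y) <;> rfl
        right_inv := by rintro ⟨x | y, h⟩ <;> rfl } (Equiv.refl _))
  have h₁ : TreeSum.conj (joinEquiv {x : A // x ≠ a} B m n) (insNone x (TreeSum.conj
      (markEquiv b n) y)) = TreeSum.conj (markEquiv (Sum.inr b) (m + n)) (TreeSum.conj
        (optionCongr e) (TreeSum.conj (innerNew _ _) (insNone x y))) := by
    rw [h, TreeSum.conj_conj, TreeSum.conj_conj, TreeSum.conj_conj]
    congr 2
    ext1 v
    rcases v with (x | i) | _ | x | i <;> rfl
  have h₂ := insNone_conj e (Equiv.refl _) (TreeSum.conj (innerNew _ _) (insNone x y)) z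
  rw [conj_refl] at h₂
  rw [compSum_eq, compSum_eq, compSum_eq, h', h₁, compSum_eq, h₂, ← insNone_assoc_seq,
    TreeSum.conj_conj, TreeSum.conj_conj, TreeSum.conj_conj, TreeSum.conj_conj]
  congr 2
  ext1 v
  rcases v with ((x | i) | (x | i)) | (x | i)
  · rfl
  · exact congrArg Sum.inr (Fin.ext (by simp [joinEquiv]))
  · rfl
  · exact congrArg Sum.inr (Fin.ext (by simp [joinEquiv]))
  · rfl
  · exact congrArg Sum.inr (Fin.ext (by simp [joinEquiv, add_assoc]))

/-- The exchange of the last two of three blocks. -/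
def blockSwap (m n l : ℕ) : Fin (m + n + l) ≃ Fin (m + l + n) :=
  ((finSumFinEquiv.symm.trans (sumCongr finSumFinEquiv.symm (Equiv.refl _))).trans
    (sumSwapRight _ _ _)).trans
    ((sumCongr finSumFinEquiv (Equiv.refl _)).trans finSumFinEquiv)

theorem blockSwap_fst (i : Fin m) : blockSwap m n l (Fin.castAdd l (Fin.castAdd n i))
    = Fin.castAdd n (Fin.castAdd l i) := by simp [blockSwap, sumSwapRight]

theorem blockSwap_snd (i : Fin n) : blockSwap m n l (Fin.castAdd l (Fin.natAdd m i))
    = Fin.natAdd (m + l) i := by simp [blockSwap, sumSwapRight]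

theorem blockSwap_thd (i : Fin l) : blockSwap m n l (Fin.natAdd (m + n) i)
    = Fin.castAdd n (Fin.natAdd m i) := by simp [blockSwap, sumSwapRight]

theorem invSign_blockSwap (m n l : ℕ) : invSign (blockSwap m n l) = (-1) ^ (n * l) := by
  simp only [invSign, Fin.prod_univ_add, blockSwap_fst, blockSwap_snd, blockSwap_thd,
    Fin.lt_def, Fin.val_castAdd, Fin.val_natAdd]
  have e {k : ℕ} (P : Fin k → Prop) [DecidablePred P] (h : ∀ i, ¬ P i) :
      ∏ i, (if P i then (-1 : ℤˣ) else 1) = 1 := prod_eq_one fun i _ => if_neg (h i)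
  have e' {k : ℕ} (P : Fin k → Prop) [DecidablePred P] (h : ∀ i, P i) :
      ∏ i, (if P i then (-1 : ℤˣ) else 1) = (-1) ^ k := by
    rw [prod_congr rfl fun i _ => if_pos (h i)]
    simp
  refine (congrArg₂ (· * ·) (congrArg₂ (· * ·) (prod_eq_one fun x _ => ?_)
    (prod_congr rfl fun x _ => (?_ : _ = (-1 : ℤˣ) ^ l)))
    (prod_eq_one fun x _ => ?_)).trans ?_
  · rw [e, e, e, one_mul, one_mul]
    all_goals intro i; have := i.2; have := x.2; omega
  · rw [e, e, e', one_mul, one_mul]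
    all_goals intro i; have := i.2; have := x.2; omega
  · rw [e, e, e, one_mul, one_mul]
    all_goals intro i; have := i.2; have := x.2; omega
  · simp [← pow_mul, mul_comm]

/-- The vertices of a tree with two marked numbered vertices. -/
def markTwice {R : Type} (r : Option (Option R) ≃ A) (m : ℕ) :
    Option (Option (R ⊕ Fin m)) ≃ A ⊕ Fin m where
  toFun
    | none => Sum.inl (r none)
    | some none => Sum.inl (r (some none))
    | some (some (Sum.inl x)) => Sum.inl (r (some (some x)))
    | some (some (Sum.inr i)) => Sum.inr i
  invFun
    | Sum.inl x => (r.symm x).map (Option.map Sum.inl)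
    | Sum.inr i => some (some (Sum.inr i))
  left_inv := by rintro (_ | _ | x | i) <;> simp
  right_inv := by
    rintro (x | i)
    · obtain ⟨x, rfl⟩ := r.surjective x
      rcases x with _ | _ | x <;> simp
    · rfl

/-- The vertices other than the second marked one, after insertion into the first marked one. -/
noncomputable def insMarked {R : Type} (r : Option (Option R) ≃ A) (h : r (some none) ≠ r none)
    (B : Type)
    (m n : ℕ) : (R ⊕ Fin m) ⊕ (B ⊕ Fin n)
      ≃ {x : Ins (r none) B // x ≠ Sum.inl ⟨r (some none), h⟩} ⊕ Fin (m + n) :=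
  (joinEquiv R B m n).trans <| sumCongr
    (Equiv.ofBijective (Sum.elim (fun x => ⟨Sum.inl ⟨r (some (some x)), by simp⟩, by simp⟩)
      fun b => ⟨Sum.inr b, by simp⟩) <| by
        constructor
        · rintro (x | x) (y | y) h <;> simp_all
        · rintro ⟨⟨x, hx⟩ | b, h'⟩
          · obtain ⟨x, rfl⟩ := r.surjective x
            rcases x with _ | _ | x
            · exact absurd rfl hx
            · exact absurd rfl h'
            · exact ⟨Sum.inl x, rfl⟩
          · exact ⟨Sum.inr b, rfl⟩) (Equiv.refl _)

theorem compSum_compSum_par {R : Type} [Fintype R] (r : Option (Option R) ≃ A)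
    (h : r (some none) ≠ r none) (x : Sums K (Option (Option (R ⊕ Fin m))))
    (y : Sums K (B ⊕ Fin n)) (z : Sums K (C ⊕ Fin l)) :
    compSum (Sum.inl ⟨r (some none), h⟩) (compSum (r none) (TreeSum.conj (markTwice r m) x) y) z
      = TreeSum.conj ((sumCongr (insMarked r h B m n) (Equiv.refl _)).trans
          (joinEquiv _ C (m + n) l))
        (insNone (TreeSum.conj (outerNew _ _) (insNone x y)) z) := by
  let e : Option (R ⊕ Fin m) ≃ {x : A // x ≠ r none} ⊕ Fin m :=
    { toFun := fun
        | none => Sum.inl ⟨r (some none), h⟩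
        | some (Sum.inl x) => Sum.inl ⟨r (some (some x)), by simp⟩
        | some (Sum.inr i) => Sum.inr i
      invFun := fun
        | Sum.inl x => (r.symm x).elim none (Option.map Sum.inl)
        | Sum.inr i => some (Sum.inr i)
      left_inv := by rintro (_ | x | i) <;> simp
      right_inv := by
        rintro (⟨x, hx⟩ | i)
        · obtain ⟨x, rfl⟩ := r.surjective x
          rcases x with _ | _ | x
          · exact absurd rfl hx
          · simp
          · simp
        · rfl }
  have h₁ : TreeSum.conj (markTwice r m) x
      = TreeSum.conj (markEquiv (r none) m) (TreeSum.conj (optionCongr e) x) := by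
    rw [TreeSum.conj_conj]
    congr 2
    ext1 v
    rcases v with _ | _ | x | i <;> rfl
  have h₂ := insNone_conj e (Equiv.refl _) x y
  rw [conj_refl] at h₂
  have h₃ : TreeSum.conj (joinEquiv _ B m n) (TreeSum.conj (sumCongr e (Equiv.refl _))
      (insNone x y)) = TreeSum.conj (markEquiv (Sum.inl ⟨r (some none), h⟩) (m + n))
        (TreeSum.conj (optionCongr (insMarked r h B m n))
          (TreeSum.conj (outerNew _ _) (insNone x y))) := by
    rw [TreeSum.conj_conj, TreeSum.conj_conj, TreeSum.conj_conj]
    congr 2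
    ext1 v
    rcases v with (_ | x | i) | (x | i) <;> rfl
  have h₄ := insNone_conj (insMarked r h B m n) (Equiv.refl _)
    (TreeSum.conj (outerNew _ _) (insNone x y)) z
  rw [conj_refl] at h₄
  rw [h₁, compSum_eq, h₂, h₃, compSum_eq, h₄, TreeSum.conj_conj]

theorem compSum_assoc_par (a a' : A) (h : a' ≠ a) (x : Sums K (A ⊕ Fin m))
    (y : Sums K (B ⊕ Fin n)) (z : Sums K (C ⊕ Fin l)) :
    TreeSum.conj (sumCongr (parEquiv a a' h B C) (blockSwap m n l))
      (compSum (Sum.inl ⟨a', h⟩) (compSum a x y) z)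
      = compSum (Sum.inl ⟨a, h.symm⟩) (compSum a' x z) y := by
  obtain ⟨R, _, r, hr, hr'⟩ : ∃ (R : Type) (_ : Fintype R) (r : Option (Option R) ≃ A),
      r none = a ∧ r (some none) = a' :=
    ⟨{y : {x // x ≠ a} // y ≠ ⟨a', h⟩}, inferInstance,
      (optionCongr (Equiv.optionSubtypeNe ⟨a', h⟩)).trans (Equiv.optionSubtypeNe a),
      by simp, by simp⟩
  subst hr hr'
  obtain ⟨x, rfl⟩ := exists_conj_eq (markTwice r m) x
  have h₁ : TreeSum.conj (markTwice r m) x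
      = TreeSum.conj (markTwice ((swapNew R).trans r) m) (TreeSum.conj (swapNew _) x) := by
    rw [TreeSum.conj_conj]
    congr 2
    ext1 v
    rcases v with _ | _ | x | i <;> rfl
  have h₂ := compSum_compSum_par ((swapNew R).trans r) h.symm (TreeSum.conj (swapNew _) x) z y
  rw [← insNone_assoc_par, ← h₁] at h₂
  rw [compSum_compSum_par r h]
  refine Eq.trans ?_ h₂.symm
  rw [TreeSum.conj_conj, TreeSum.conj_conj]
  congr 2
  ext1 v
  rcases v with ((x | i) | (x | i)) | (x | i)
  · rfl
  · exact congrArg Sum.inr (blockSwap_fst i)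
  · rfl
  · exact congrArg Sum.inr (blockSwap_snd i)
  · rfl
  · exact congrArg Sum.inr (blockSwap_thd i)

end

end TRT

namespace TRT

open Classical TreeSum

variable {K : Type u} [Field K] {A B C : Type} {m n l : ℕ} [Fintype A] [Fintype B] [Fintype C]

/-! ### The differential on formal sums -/

/-- The differential on formal sums. -/
noncomputable def dSum : Sums K (A ⊕ Fin m) →ₗ[K] Sums K (A ⊕ Fin (m + 1)) :=
  TreeSum.conj (splitEquiv A m) ∘ₗ DM (Sum.elim (fun _ => 1) fun _ => 0)

theorem dSum_apply (x : Sums K (A ⊕ Fin m)) : dSum x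
    = TreeSum.conj (splitEquiv A m) (DM (Sum.elim (fun _ => 1) fun _ => 0) x) := rfl

/-- The bijection that fixes `0` and otherwise is a shift of `s`. -/
def succEquiv (s : Fin m ≃ Fin n) : Fin (m + 1) ≃ Fin (n + 1) :=
  ((finSuccEquiv m).trans (optionCongr s)).trans (finSuccEquiv n).symm

theorem dSum_conj {n : ℕ} (e : A ≃ B) (s : Fin m ≃ Fin n) (x : Sums K (A ⊕ Fin m)) :
    dSum (TreeSum.conj (sumCongr e s) x)
      = TreeSum.conj (sumCongr e (succEquiv s)) (dSum x) := by
  have : (fun v => Sum.elim (fun _ => (1 : K)) (fun _ => 0) (sumCongr e s v))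
      = Sum.elim (fun _ => 1) fun _ => 0 := by
    funext v
    rcases v with v | v <;> rfl
  rw [dSum_apply, dSum_apply, DM_conj, this, TreeSum.conj_conj, TreeSum.conj_conj]
  congr 2
  ext1 v
  rcases v with _ | v | i
  · simp [splitEquiv, succEquiv]
  · rfl
  · simp [splitEquiv, succEquiv]

theorem black_swap_dSum_dSum (x : Sums K (A ⊕ Fin m)) :
    black A (swap 0 1) (dSum (dSum x)) = dSum (dSum x) := by
  have h : DM (Sum.elim (fun _ => (1 : K)) fun _ => 0) (dSum x)
      = TreeSum.conj (optionCongr (splitEquiv A m))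
        (DM (fun v => v.elim 0 (Sum.elim (fun _ => 1) fun _ => 0))
          (DM (Sum.elim (fun _ => 1) fun _ => 0) x)) := by
    rw [dSum_apply, DM_conj]
    congr 3
    funext v
    rcases v with _ | v | i <;> rfl
  rw [dSum_apply, h]
  nth_rewrite 1 [← swapNew_DM_DM]
  · rw [TreeSum.conj_conj, TreeSum.conj_conj, TreeSum.conj_conj, TreeSum.conj_conj]
    congr 2
    ext1 v
    rcases v with _ | _ | v | i
    · exact congrArg Sum.inr (Equiv.swap_apply_right _ _)
    · exact congrArg Sum.inr (Equiv.swap_apply_left _ _)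
    · rfl
    · refine congrArg Sum.inr (swap_apply_of_ne_of_ne ?_ ?_)
      · exact Fin.succ_ne_zero _
      · exact fun h => Fin.succ_ne_zero i (Fin.succ_injective _ h)
  · rintro (v | v) <;> simp

/-- Moving the first element of the second block to the front. -/
def frontEquiv (m n : ℕ) : Fin (m + (n + 1)) ≃ Fin (m + n + 1) :=
  (((finSumFinEquiv.symm.trans (sumCongr (Equiv.refl _) (finSuccEquiv n))).trans
    (innerNew _ _)).trans (optionCongr finSumFinEquiv)).trans (finSuccEquiv _).symm

theorem frontEquiv_fst (i : Fin m) : frontEquiv m n (Fin.castAdd (n + 1) i)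
    = (Fin.castAdd n i).succ := by simp [frontEquiv, innerNew]

theorem frontEquiv_zero : frontEquiv m n (Fin.natAdd m 0) = 0 := by
  simp [frontEquiv, innerNew]

theorem frontEquiv_succ (i : Fin n) : frontEquiv m n (Fin.natAdd m i.succ)
    = (Fin.natAdd m i).succ := by simp [frontEquiv, innerNew]

theorem invSign_frontEquiv (m n : ℕ) : invSign (frontEquiv m n) = (-1) ^ m := by
  have e {k : ℕ} (P : Fin k → Prop) [DecidablePred P] (h : ∀ i, ¬ P i) :
      ∏ i, (if P i then (-1 : ℤˣ) else 1) = 1 := prod_eq_one fun i _ => if_neg (h i)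
  simp only [invSign, Fin.prod_univ_add, Fin.prod_univ_succ, frontEquiv_fst, frontEquiv_zero,
    frontEquiv_succ, Fin.lt_def, Fin.val_castAdd, Fin.val_natAdd, Fin.val_succ, Fin.val_zero]
  refine (congrArg₂ (· * ·) (prod_congr rfl fun x _ => (?_ : _ = (-1 : ℤˣ)))
    (congrArg₂ (· * ·) (?_ : _ = (1 : ℤˣ)) (prod_eq_one fun x _ => ?_))).trans ?_
  · have := x.2
    rw [e, e, if_pos, one_mul, mul_one]
    all_goals first | (intro i; have := i.2; omega) | omega
  · rw [e, e, if_neg, one_mul, mul_one]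
    all_goals first | (intro i; have := i.2; omega) | omega
  · rw [e, e, if_neg, one_mul, mul_one]
    all_goals first | (intro i; have := i.2; omega) | omega
  · simp

theorem dSum_compSum (a : A) (x : Sums K (A ⊕ Fin m)) (y : Sums K (B ⊕ Fin n)) :
    dSum (compSum a x y)
      = black _ (finCongr (by omega)) (compSum a (dSum x) y)
        + black _ (frontEquiv m n) (compSum a x (dSum y)) := by
  obtain ⟨x, rfl⟩ := exists_conj_eq (markEquiv a m) x
  have hN : (fun v => Sum.elim (fun _ => (1 : K)) (fun _ => 0) (markEquiv a m v))
      = fun v => v.elim 1 (Sum.elim (fun _ => 1) fun _ => 0) := by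
    funext v
    rcases v with _ | v | v <;> rfl
  have hN' : (fun v => Sum.elim (fun _ => (1 : K)) (fun _ => 0) (joinEquiv {x // x ≠ a} B m n v))
      = Sum.elim (fun v => Sum.elim (fun _ => 1) (fun _ => 0) v)
        (Sum.elim (fun _ => 1) fun _ => 0) := by
    funext v
    rcases v with (v | v) | (v | v) <;> rfl
  have h := DM_insNone (fun v => v.elim (1 : K) (Sum.elim (fun _ => 1) fun _ => 0))
    (Sum.elim (fun _ => 1) fun _ => 0) rfl x y
  have h₁ : dSum (TreeSum.conj (markEquiv a m) x)
      = TreeSum.conj (markEquiv a (m + 1)) (TreeSum.conj (optionCongr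
        ((splitEquiv {x // x ≠ a} m))) (TreeSum.conj (swapNew _)
          (DM (fun v => v.elim 1 (Sum.elim (fun _ => 1) fun _ => 0)) x))) := by
    rw [dSum_apply, DM_conj, hN, TreeSum.conj_conj, TreeSum.conj_conj, TreeSum.conj_conj]
    congr 2
    ext1 v
    rcases v with _ | _ | v | i <;> rfl
  have h₂ := insNone_conj (splitEquiv {x // x ≠ a} m) (Equiv.refl _) (TreeSum.conj (swapNew _)
          (DM (fun v => v.elim 1 (Sum.elim (fun _ => 1) fun _ => 0)) x)) y
  rw [conj_refl] at h₂
  have h₃ := insNone_conj (Equiv.refl _) (splitEquiv B n) x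
    (DM (Sum.elim (fun _ => 1) fun _ => 0) y)
  rw [Equiv.optionCongr_refl, conj_refl, ← dSum_apply] at h₃
  rw [h₁, compSum_eq, compSum_eq, compSum_eq, h₂, h₃, dSum_apply, DM_conj, hN']
  refine (congrArg _ (congrArg _ h)).trans ?_
  rw [map_add, map_add]
  congr 1
  · simp only [TreeSum.conj_conj]
    congr 2
    ext1 v
    rcases v with (_ | v | i) | (v | i)
    · exact congrArg Sum.inr (Fin.ext (by simp))
    · rfl
    · exact congrArg Sum.inr (Fin.ext (by simp))
    · rfl
    · exact congrArg Sum.inr (Fin.ext (by simp; omega))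
  · simp only [TreeSum.conj_conj]
    congr 2
    ext1 v
    rcases v with (v | i) | (_ | v | i)
    · rfl
    · exact congrArg Sum.inr (frontEquiv_fst i).symm
    · exact congrArg Sum.inr frontEquiv_zero.symm
    · rfl
    · exact congrArg Sum.inr (frontEquiv_succ i).symm

theorem sign_succEquiv (s : Equiv.Perm (Fin m)) :
    Equiv.Perm.sign (succEquiv s) = Equiv.Perm.sign s := by
  have : succEquiv s = (finSuccEquiv m).symm.permCongr (optionCongr s) := by
    ext i; simp [succEquiv]
  rw [this, Equiv.Perm.sign_permCongr, Equiv.optionCongr_sign]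

theorem dSum_mem_nullSums {x : Sums K (A ⊕ Fin m)} (hx : x ∈ nullSums K A m) :
    dSum x ∈ nullSums K A (m + 1) :=
  mem_nullSums_of_black dSum (fun s => ⟨succEquiv s, sign_succEquiv s, fun _ => dSum_conj _ _ _⟩) hx

theorem compSum_mem_nullSums_left (a : A) {x : Sums K (A ⊕ Fin m)} (hx : x ∈ nullSums K A m)
    (y : Sums K (B ⊕ Fin n)) : compSum a x y ∈ nullSums K (Ins a B) (m + n) := by
  refine mem_nullSums_of_black ((compSum a).flip y)
    (fun s => ⟨finSumFinEquiv.permCongr (sumCongr s 1), ?_, fun x => ?_⟩) hx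
  · have := Equiv.Perm.sign_sumCongr s (1 : Equiv.Perm (Fin n))
    rw [Equiv.Perm.sumCongr] at this
    rw [Equiv.Perm.sign_permCongr, this, Equiv.Perm.sign_one, mul_one]
  · have := compSum_conj (Equiv.refl A) s (Equiv.refl B) (Equiv.refl _) a x y
    rw [Equiv.sumCongr_refl, conj_refl] at this
    refine this.trans ?_
    congr 2
    ext1 v
    rcases v with (v | v) | i <;> rfl

theorem compSum_mem_nullSums_right (a : A) (x : Sums K (A ⊕ Fin m)) {y : Sums K (B ⊕ Fin n)}
    (hy : y ∈ nullSums K B n) : compSum a x y ∈ nullSums K (Ins a B) (m + n) := by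
  refine mem_nullSums_of_black (compSum a x)
    (fun s => ⟨finSumFinEquiv.permCongr (sumCongr 1 s), ?_, fun y => ?_⟩) hy
  · have := Equiv.Perm.sign_sumCongr (1 : Equiv.Perm (Fin m)) s
    rw [Equiv.Perm.sumCongr] at this
    rw [Equiv.Perm.sign_permCongr, this, Equiv.Perm.sign_one, one_mul]
  · have := compSum_conj (Equiv.refl A) (Equiv.refl _) (Equiv.refl B) s a x y
    rw [Equiv.sumCongr_refl, conj_refl] at this
    refine this.trans ?_
    congr 2
    ext1 v
    rcases v with (v | v) | i <;> rfl

/-! ### Compatibility with the operations of `TRT` -/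

theorem isAdm_insertAt {p : A ⊕ Fin m → Option (A ⊕ Fin m)} (hp : IsAdm p) (a : A)
    {q : B ⊕ Fin n → Option (B ⊕ Fin n)} (hq : IsAdm q)
    (f : {v // p v = some (Sum.inl a)} → B ⊕ Fin n) :
    IsAdm (ParentFn.conj (insEquiv a B m n) (insertAt p (Sum.inl a) q f)) := by
  refine ⟨isTree_conj _ (isTree_insertAt hp.1 _ hq.1 f), fun i => ?_⟩
  have h : ∃ v, insEquiv a B m n v = Sum.inr i ∧
      2 ≤ Nat.card {u // insertAt p (Sum.inl a) q f u = some v} := by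
    -- black vertices keep their number of children: a child `a` is replaced by the root of `q`
    obtain ⟨i | j, rfl⟩ := finSumFinEquiv.surjective i
    · refine ⟨Sum.inl ⟨Sum.inr i, Sum.inr_ne_inl⟩, rfl, (hp.2 i).trans ?_⟩
      obtain ⟨r, hr, -⟩ := hq.1.1
      refine Nat.card_le_card_of_injective (fun u : {u // p u = some (Sum.inr i)} =>
        (⟨if h : u.1 = Sum.inl a then Sum.inr r else Sum.inl ⟨u.1, h⟩, ?_⟩ :
          {u // insertAt p (Sum.inl a) q f u = some _})) ?_
      · have hl : lift (B ⊕ Fin n) (Sum.inl a : A ⊕ Fin m) (Sum.inr i)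
            = some (Sum.inl ⟨Sum.inr i, Sum.inr_ne_inl⟩) := lift_of_ne Sum.inr_ne_inl
        by_cases hu : u.1 = Sum.inl a
        · rw [dif_pos hu]
          have h := u.2
          rw [hu] at h
          simp only [insertAt, hr]
          rw [h, bind_some, hl]
        · rw [dif_neg hu, insertAt_inl_of_ne, u.2, bind_some, hl]
          rw [u.2]
          simp
      · rintro ⟨u, hu⟩ ⟨v, hv⟩ h
        have h := congrArg Subtype.val h
        simp only at h
        ext1
        by_cases h₁ : u = Sum.inl a <;> by_cases h₂ : v = Sum.inl a
        · exact h₁.trans h₂.symm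
        · rw [dif_pos h₁, dif_neg h₂] at h; cases h
        · rw [dif_neg h₁, dif_pos h₂] at h; cases h
        · rw [dif_neg h₁, dif_neg h₂] at h
          injection h with h
          have h := congrArg Subtype.val h
          exact h
    · refine ⟨Sum.inr (Sum.inr j), rfl, (hq.2 j).trans ?_⟩
      refine Nat.card_le_card_of_injective (fun u : {u // q u = some (Sum.inr j)} =>
        (⟨Sum.inr u.1, by simp [insertAt, u.2]⟩ :
          {u // insertAt p (Sum.inl a) q f u = some _})) ?_
      rintro ⟨u, hu⟩ ⟨v, hv⟩ h
      have h := congrArg Subtype.val h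
      exact Subtype.ext (Sum.inr_injective h)
  obtain ⟨v, hv, h⟩ := h
  refine h.trans (Nat.card_congr ((insEquiv a B m n).subtypeEquiv fun u => ?_)).le
  rw [← hv]
  exact (conj_eq_some (insEquiv a B m n) _ u v).symm

theorem compSum_single (a : A) {p : A ⊕ Fin m → Option (A ⊕ Fin m)} (hp : IsTree p)
    {q : B ⊕ Fin n → Option (B ⊕ Fin n)} (hq : IsTree q) :
    compSum a (single K p) (single K q) = ∑ᶠ f : {v // p v = some (Sum.inl a)} → B ⊕ Fin n,
      single K (ParentFn.conj (insEquiv a B m n) (insertAt p (Sum.inl a) q f)) := by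
  rw [compSum, compr₂_apply, single_of_isTree hp, single_of_isTree hq, ins,
    linearCombination_single, LinearMap.smul_apply, linearCombination_single,
    one_smul, one_smul, map_finsum _ (Set.toFinite _)]
  simp only [conj_single]

theorem compSum_mem_goodSums (a : A) {x : Sums K (A ⊕ Fin m)} (hx : x ∈ goodSums K A m)
    {y : Sums K (B ⊕ Fin n)} (hy : y ∈ goodSums K B n) :
    compSum a x y ∈ goodSums K (Ins a B) (m + n) := by
  refine (goodSums_le (S := (goodSums K (Ins a B) (m + n)).comap ((compSum a).flip y))
    (fun p hp => ?_) fun x hx => ?_) hx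
  · refine (goodSums_le (S := (goodSums K (Ins a B) (m + n)).comap (compSum a (single K p)))
      (fun q hq => ?_) fun y hy => ?_) hy
    · rw [Submodule.mem_comap, compSum_single a hp.1 hq.1]
      exact finsum_induction (· ∈ goodSums K (Ins a B) (m + n)) (zero_mem _)
        (fun _ _ => add_mem) fun f => mem_goodSums_of_isAdm (isAdm_insertAt hp a hq f)
    · exact nullSums_le_goodSums (compSum_mem_nullSums_right a _ hy)
  · exact nullSums_le_goodSums (compSum_mem_nullSums_left a hx _)

theorem comp_ofSum {k l i : ℤ} (a : A) (h : k + l = i) (hm : (m : ℤ) = -k) (hn : (n : ℤ) = -l)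
    (hi : ((m + n : ℕ) : ℤ) = -i) {x : Sums K (A ⊕ Fin m)} (hx : x ∈ goodSums K A m)
    {y : Sums K (B ⊕ Fin n)} (hy : y ∈ goodSums K B n) :
    comp a h (ofSum hm x) (ofSum hn y) = ofSum hi (compSum a x y) := by
  refine (goodSums_le (S := eqLocus ((comp a h).flip (ofSum hn y) ∘ₗ ofSum hm)
    (ofSum hi ∘ₗ (compSum a).flip y)) (fun p hp => ?_) fun x hx => ?_) hx
  · refine (goodSums_le (S := eqLocus (comp a h (ofSum hm (single K p)) ∘ₗ ofSum hn)
      (ofSum hi ∘ₗ compSum a (single K p))) (fun q hq => ?_) fun y hy => ?_) hy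
    · change comp a h (ofSum hm _) (ofSum hn _) = ofSum hi (compSum a _ _)
      rw [ofSum_single', ofSum_single', compSum_single a hp.1 hq.1, map_finsum _ (Set.toFinite _)]
      simp only [ofSum_single']
      exact (DFunLike.congr_fun (extend_mk _ _ hm hp) _).trans (extend_mk _ _ hn hq)
    · change comp a h (ofSum hm _) (ofSum hn _) = ofSum hi (compSum a _ _)
      rw [ofSum_of_mem_nullSums hn hy, map_zero,
        ofSum_of_mem_nullSums hi (compSum_mem_nullSums_right a _ hy)]
  · change comp a h (ofSum hm _) (ofSum hn _) = ofSum hi (compSum a _ _)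
    rw [ofSum_of_mem_nullSums hm hx, map_zero, LinearMap.zero_apply,
      ofSum_of_mem_nullSums hi (compSum_mem_nullSums_left a hx _)]

theorem mk_splitEquiv_of_subsingleton {k : ℤ} (hm : ((m + 1 : ℕ) : ℤ) = -k)
    {p : Option (A ⊕ Fin m) → Option (Option (A ⊕ Fin m))}
    (hp : ∀ u v, p u = some none → p v = some none → u = v) :
    mk K hm (ParentFn.conj (splitEquiv A m) p) = 0 := by
  refine dif_neg fun h => ?_
  have h := h.2 0
  have : Subsingleton {v // ParentFn.conj (splitEquiv A m) p v = some (Sum.inr 0)} := by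
    refine ⟨fun u v => Subtype.ext ?_⟩
    obtain ⟨u, hu⟩ := u
    obtain ⟨v, hv⟩ := v
    obtain ⟨u, rfl⟩ := (splitEquiv A m).surjective u
    obtain ⟨v, rfl⟩ := (splitEquiv A m).surjective v
    exact congrArg (splitEquiv A m) (hp u v ((conj_eq_some (splitEquiv A m) p u none).1 hu)
      ((conj_eq_some (splitEquiv A m) p v none).1 hv))
  have := Finite.card_le_one_iff_subsingleton.2 this
  omega

theorem mk_newRoot {k : ℤ} (hm : ((m + 1 : ℕ) : ℤ) = -k) {p : A ⊕ Fin m → Option (A ⊕ Fin m)}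
    (hp : IsTree p) : mk K hm (ParentFn.conj (splitEquiv A m) (newRoot p)) = 0 := by
  refine mk_splitEquiv_of_subsingleton hm ?_
  rintro (_ | u) (_ | v) hu hv
  · rfl
  · cases hu
  · cases hv
  · rw [newRoot, Option.some.injEq] at hu hv
    exact congrArg some (hp.1.unique (by simpa using hu) (by simpa using hv))

theorem mk_splitLower_empty {k : ℤ} (hm : ((m + 1 : ℕ) : ℤ) = -k)
    (p : A ⊕ Fin m → Option (A ⊕ Fin m)) (v : A ⊕ Fin m) :
    mk K hm (ParentFn.conj (splitEquiv A m) (splitLower p v ∅)) = 0 := by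
  refine mk_splitEquiv_of_subsingleton hm ?_
  have h (u) : splitLower p v ∅ u ≠ some none := by
    rcases u with _ | u
    · simp [splitLower]
    · cases h : p u <;> simp [splitLower, h]
  exact fun u _ hu => (h u hu).elim

theorem DM_single {V : Type} [Fintype V] (N : V → K) {p : V → Option V} (hp : IsTree p) :
    DM N (single K p) = single K (newRoot p)
      + ∑ v, (∑ᶠ S : childSets p v, single K (splitLower p v S) - single K (splitLower p v ∅)
        - N v • ∑ᶠ S : childSets p v, single K (splitUpper p v S)) := by
  simp [DM_apply, Rt, Lw, Lf, Up, single_of_isTree hp]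

theorem d_ofSum_single {k : ℤ} (hm : (m : ℤ) = -(k + 1)) (hm' : ((m + 1 : ℕ) : ℤ) = -k)
    {p : A ⊕ Fin m → Option (A ⊕ Fin m)} (hp : IsAdm p) :
    d (ofSum hm (single K p)) = ofSum hm' (dSum (single K p)) := by
  have h {v : A ⊕ Fin m} (f : childSets p v → Sums K (Option (A ⊕ Fin m))) :
      ofSum hm' (TreeSum.conj (splitEquiv A m) (∑ᶠ S, f S))
        = ∑ᶠ S, ofSum hm' (TreeSum.conj (splitEquiv A m) (f S)) :=
    map_finsum (ofSum hm' ∘ₗ TreeSum.conj (K := K) (splitEquiv A m)) (Set.toFinite _)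
  rw [ofSum_single', dSum_apply, DM_single _ hp.1]
  refine (extend_mk _ _ hm hp).trans ?_
  simp only [map_add, map_sum, map_sub, map_smul, h, conj_single, ofSum_single',
    mk_newRoot hm' hp.1, mk_splitLower_empty, sub_zero, zero_add, sum_sub_distrib]
  rw [splitSum, finsum_eq_sum_of_fintype, finsum_eq_sum_of_fintype]
  refine congrArg₂ (· - ·) ?_ ?_
  · simp
  rw [sum_sum_type]
  simp

end TRT

/-! ### Splittings that violate the valence condition cancel -/

theorem ParentFn.splitLower_singleton {V : Type} {p : V → Option V} (hp : IsTree p) {u v : V}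
    (h : p u = some v) :
    splitLower p v {u} = splitUpper p u ∅ := by
  funext w
  rcases w with _ | w
  · simp [splitLower, splitUpper, h]
  · by_cases hw : w = u <;> simp [splitLower, splitUpper, hw]

theorem ParentFn.newRoot_eq {V : Type} {p : V → Option V} (hp : IsTree p) {u : V}
    (h : p u = none) : newRoot p = splitUpper p u ∅ := by
  funext w
  rcases w with _ | w
  · simp [newRoot, splitUpper, h]
  · by_cases hw : w = u
    · simp [newRoot, splitUpper, hw, h]
    · obtain ⟨v, hv⟩ := Option.ne_none_iff_exists'.1 fun h' => hw (hp.1.unique h' h)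
      simp [newRoot, splitUpper, hw, hv]

/-- Exchanging a vertex with a new child that takes over all its children amounts to putting the
vertex above the new one. -/
theorem ParentFn.conj_swap_splitLower {V : Type} [DecidableEq V] {p : V → Option V}
    (hp : IsTree p) (v : V) :
    ParentFn.conj (swap none (some v)) (splitLower p v {u | p u = some v})
      = splitUpper p v ∅ := by
  have hv := hp.ne_self v
  funext w
  rw [ParentFn.conj, Equiv.symm_swap]
  rcases w with _ | w
  · rw [Equiv.swap_apply_left]
    cases h : p v with
    | none => simp [splitLower, splitUpper, h]
    | some u =>
      have : u ≠ v := fun e => hv (by rw [h, e])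
      simp [splitLower, splitUpper, h, this, swap_apply_of_ne_of_ne]
  · by_cases hw : w = v
    · subst hw
      rw [Equiv.swap_apply_right]
      simp [splitLower, splitUpper]
    · rw [swap_apply_of_ne_of_ne (by simp) (by simpa using hw)]
      by_cases h : p w = some v
      · simp [splitLower, splitUpper, h, hw]
      · cases h' : p w with
        | none => simp [splitLower, splitUpper, h', hw]
        | some u =>
          have : u ≠ v := fun e => h (by rw [h', e])
          simp [splitLower, splitUpper, h', hw, this, swap_apply_of_ne_of_ne]

/-- In the differential, the splittings that create a vertex with less than two children cancel
each other, up to those that exchange the new black vertex with an old one. Here `b` marks the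
black vertices, and `Φ` is a function that respects the valence condition and the sign rule. -/
theorem ParentFn.sum_split_eq_zero {V : Type} {M : Type*} [Fintype V] [AddCommGroup M] {p : V →
    Option V}
    (hp : IsTree p) (b : V → Prop) [DecidablePred b] (Φ : (Option V → Option (Option V)) → M)
    (h₁ : ∀ v, ∀ S ⊆ {u | p u = some v}, S.Nontrivial → (b v → S ≠ {u | p u = some v}) →
      Φ (splitLower p v S) = 0)
    (h₂ : ∀ v, ¬ b v → ∀ S ⊆ {u | p u = some v}, S.Nonempty → Φ (splitUpper p v S) = 0)
    (h₃ : ∀ v, b v → Φ (splitLower p v {u | p u = some v}) = -Φ (splitUpper p v ∅))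
    (h₄ : ∀ v, b v → {u | p u = some v}.Nontrivial) :
    Φ (newRoot p) + ∑ v, (∑ᶠ S : childSets p v, Φ (splitLower p v S) - Φ (splitLower p v ∅)
      - if b v then 0 else ∑ᶠ S : childSets p v, Φ (splitUpper p v S)) = 0 := by
  classical
  have e (v) (T : Set V) (hT : T ⊆ {u | p u = some v}) (c : M) :
      ∑ᶠ S : childSets p v, (if S.1 = T then c else 0) = c :=
    (finsum_eq_single _ ⟨T, hT⟩ fun S hS => if_neg fun h => hS (Subtype.ext h)).trans (if_pos rfl)
  -- of the splittings below `v`, only `S = ∅`, the singletons, and the set of all children of a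
  -- black `v` contribute; a singleton `{u}` amounts to a new vertex above `u`
  have hL (v) : ∑ᶠ S : childSets p v, Φ (splitLower p v S) = Φ (splitLower p v ∅)
      + ∑ u, (if p u = some v then Φ (splitUpper p u ∅) else 0)
      - if b v then Φ (splitUpper p v ∅) else 0 := by
    have hS (S : childSets p v) : Φ (splitLower p v S)
        = (if S.1 = ∅ then Φ (splitLower p v ∅) else 0)
          + ∑ u with p u = some v, (if S.1 = {u} then Φ (splitUpper p u ∅) else 0)
          + if S.1 = {u | p u = some v} then (if b v then -Φ (splitUpper p v ∅) else 0) else 0 := by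
      obtain ⟨S, hS⟩ := S
      dsimp only
      rcases S.eq_empty_or_nonempty with rfl | hne
      · rw [if_pos rfl, sum_eq_zero, add_zero, left_eq_add]
        · by_cases hb : b v
          · exact if_neg (h₄ v hb).nonempty.ne_empty.symm
          · rw [if_neg hb, ite_self]
        · exact fun u _ => if_neg (Set.singleton_ne_empty u).symm
      rw [if_neg hne.ne_empty, zero_add]
      rcases S.subsingleton_or_nontrivial with hs | hs
      · obtain ⟨u, rfl⟩ := (Set.exists_eq_singleton_iff_nonempty_subsingleton).2 ⟨hne, hs⟩
        have hu : p u = some v := hS rfl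
        rw [sum_eq_single u, if_pos rfl, splitLower_singleton hp hu, left_eq_add]
        · by_cases hb : b v
          · refine if_neg fun h => ?_
            have := h₄ v hb
            rw [← h] at this
            exact Set.not_nontrivial_singleton this
          · rw [if_neg hb, ite_self]
        · exact fun w _ hw => if_neg fun h => hw (Set.singleton_injective h).symm
        · exact fun h => (h (mem_filter.2 ⟨mem_univ _, hu⟩)).elim
      · rw [sum_eq_zero, zero_add]
        · by_cases hb : b v
          · by_cases hC : S = {u | p u = some v}
            · rw [if_pos hC, if_pos hb, ← h₃ v hb, hC]
            · rw [if_neg hC, h₁ v S hS hs fun _ => hC]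
          · rw [if_neg hb, ite_self, h₁ v S hS hs fun h => (hb h).elim]
        · refine fun u _ => if_neg fun h => ?_
          rw [h] at hs
          exact Set.not_nontrivial_singleton hs
    have hfin (f : childSets p v → M) : (Function.support f).Finite := Set.toFinite _
    rw [finsum_congr hS, finsum_add_distrib (hfin _) (hfin _), finsum_add_distrib (hfin _) (hfin _),
      e v _ (Set.empty_subset _), e v _ subset_rfl, finsum_sum_comm _ _ fun _ _ => hfin _,
      sum_congr rfl fun u (hu : u ∈ univ.filter fun u => p u = some v) => e v {u}
        (Set.singleton_subset_iff.2 (mem_filter.1 hu).2) _, sum_filter]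
    by_cases hb : b v
    · rw [if_pos hb, if_pos hb, sub_eq_add_neg]
    · rw [if_neg hb, if_neg hb, sub_zero, add_zero]
  have hU (v) : (if b v then 0 else ∑ᶠ S : childSets p v, Φ (splitUpper p v S))
      = Φ (splitUpper p v ∅) - if b v then Φ (splitUpper p v ∅) else 0 := by
    by_cases hb : b v
    · rw [if_pos hb, if_pos hb, sub_self]
    · rw [if_neg hb, if_neg hb, sub_zero]
      refine finsum_eq_single (fun S : childSets p v => Φ (splitUpper p v S))
        ⟨∅, Set.empty_subset _⟩ fun S hS => h₂ v hb S.1 S.2 ?_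
      exact Set.nonempty_iff_ne_empty.2 fun h => hS (Subtype.ext h)
  obtain ⟨r, hr, -⟩ := hp.1
  -- what remains is the sum over the edges minus the sum over the vertices; the difference is the
  -- root
  have hv (v) : ∑ᶠ S : childSets p v, Φ (splitLower p v S) - Φ (splitLower p v ∅)
      - (if b v then 0 else ∑ᶠ S : childSets p v, Φ (splitUpper p v S))
      = ∑ u, (if p u = some v then Φ (splitUpper p u ∅) else 0) - Φ (splitUpper p v ∅) := by
    rw [hL, hU]
    abel
  rw [sum_congr rfl fun v _ => hv v, sum_sub_distrib, sum_comm,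
    newRoot_eq hp hr, ← add_sub_assoc, sub_eq_zero, ← add_sum_erase _ _ (mem_univ r),
    ← add_sum_erase _ (fun v => Φ (splitUpper p v ∅)) (mem_univ r)]
  congr 1
  rw [sum_eq_zero fun v _ => if_neg (by simp [hr]), zero_add]
  refine sum_congr rfl fun u hu => ?_
  obtain ⟨v, hv⟩ := Option.ne_none_iff_exists'.1 fun h' => (Finset.mem_erase.1 hu).1
    (hp.1.unique h' hr)
  rw [sum_eq_single v (fun w _ hw => if_neg fun h => hw ?_) (by simp), if_pos hv]
  exact Option.some_injective _ (h.symm.trans hv)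

namespace TRT

open Classical TreeSum

variable {K : Type u} [Field K] {A B C : Type} {m n l : ℕ} [Fintype A] [Fintype B] [Fintype C]

theorem isAdm_splitEquiv {p : Option (A ⊕ Fin m) → Option (Option (A ⊕ Fin m))} (hp : IsTree p)
    (h₀ : ∃ u v, u ≠ v ∧ p u = some none ∧ p v = some none)
    (h : ∀ i : Fin m, ∃ u v, u ≠ v ∧ p u = some (some (Sum.inr i))
      ∧ p v = some (some (Sum.inr i))) :
    IsAdm (ParentFn.conj (splitEquiv A m) p) := by
  refine ⟨isTree_conj _ hp, fun i => ?_⟩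
  obtain ⟨w, hw, u, v, huv, hu, hv⟩ :
      ∃ w, splitEquiv A m w = Sum.inr i ∧ ∃ u v, u ≠ v ∧ p u = some w ∧ p v = some w := by
    induction i using Fin.cases with
    | zero => exact ⟨none, rfl, h₀⟩
    | succ i => exact ⟨some (Sum.inr i), rfl, h i⟩
  rw [← hw]
  exact Finite.one_lt_card_iff_nontrivial.2
    ⟨⟨⟨splitEquiv A m u, (conj_eq_some (splitEquiv A m) p u w).2 hu⟩,
      ⟨splitEquiv A m v, (conj_eq_some (splitEquiv A m) p v w).2 hv⟩,
      fun h => huv ((splitEquiv A m).injective (congrArg Subtype.val h))⟩⟩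

theorem IsAdm.children_nontrivial {p : A ⊕ Fin m → Option (A ⊕ Fin m)} (hp : IsAdm p) (i : Fin m) :
    {v | p v = some (Sum.inr i)}.Nontrivial :=
  Set.nontrivial_coe_sort.1 (Finite.one_lt_card_iff_nontrivial.1 (hp.2 i))

theorem isAdm_splitLower {p : A ⊕ Fin m → Option (A ⊕ Fin m)} (hp : IsAdm p) {v : A ⊕ Fin m}
    {S : Set (A ⊕ Fin m)} (hS : S ⊆ {u | p u = some v}) (hS' : S.Nontrivial)
    (hv : v.isRight → S ≠ {u | p u = some v}) :
    IsAdm (ParentFn.conj (splitEquiv A m) (splitLower p v S)) := by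
  refine isAdm_splitEquiv (isTree_splitLower hp.1 hS) ?_ fun i => ?_
  · obtain ⟨u, hu, w, hw, h⟩ := hS'
    exact ⟨some u, some w, by simpa using h, by simp [splitLower, hu], by simp [splitLower, hw]⟩
  · by_cases hi : v = Sum.inr i
    · subst hi
      obtain ⟨u, hu, hu'⟩ := Set.exists_of_ssubset (hS.ssubset_of_ne (hv rfl))
      exact ⟨none, some u, by simp, by simp [splitLower], by simpa [splitLower, hu'] using hu⟩
    · obtain ⟨u, hu, w, hw, h⟩ := hp.children_nontrivial i
      have h' {u} (hu : p u = some (Sum.inr i)) : u ∉ S := fun h => hi (by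
        have : p u = some v := hS h
        rw [hu] at this
        exact (Option.some_injective _ this).symm)
      refine ⟨some u, some w, by simpa using h, ?_, ?_⟩
      · simp [splitLower, h' hu]; exact hu
      · simp [splitLower, h' hw]; exact hw

theorem isAdm_splitUpper {p : A ⊕ Fin m → Option (A ⊕ Fin m)} (hp : IsAdm p) {v : A ⊕ Fin m}
    {S : Set (A ⊕ Fin m)} (hS : S ⊆ {u | p u = some v}) (hS' : S.Nonempty)
    (hv : ¬ v.isRight) :
    IsAdm (ParentFn.conj (splitEquiv A m) (splitUpper p v S)) := by
  refine isAdm_splitEquiv (isTree_splitUpper hp.1 hS) ?_ fun i => ?_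
  · obtain ⟨u, hu⟩ := hS'
    have : u ≠ v := fun h => hp.1.ne_self v (h ▸ hS hu)
    exact ⟨some u, some v, by simpa using this, by simp [splitUpper, hu], by simp [splitUpper]⟩
  · obtain ⟨u, hu, w, hw, h⟩ := hp.children_nontrivial i
    have h' {u} (hu : p u = some (Sum.inr i)) : ∃ u', (u = v → u' = none) ∧ (u ≠ v → u' = some u) ∧
        splitUpper p v S u' = some (some (Sum.inr i)) := by
      by_cases huv : u = v
      · subst huv
        exact ⟨none, fun _ => rfl, fun h => (h rfl).elim, by simp [splitUpper, hu]⟩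
      · have h' : u ∉ S := fun h => hv (by
          have : p u = some v := hS h
          rw [hu] at this
          rw [← Option.some_injective _ this]
          rfl)
        exact ⟨some u, fun h => (huv h).elim, fun _ => rfl, by simp [splitUpper, huv, h', hu]⟩
    obtain ⟨u', hu₁, hu₂, hu₃⟩ := h' hu
    obtain ⟨w', hw₁, hw₂, hw₃⟩ := h' hw
    refine ⟨u', w', ?_, hu₃, hw₃⟩
    by_cases huv : u = v
    · rw [hu₁ huv, hw₂ fun hw => h (huv.trans hw.symm)]
      simp
    · rw [hu₂ huv]
      by_cases hwv : w = v
      · rw [hw₁ hwv]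
        simp
      · rw [hw₂ hwv]
        simpa using h

/-- The differential of formal sums preserves the sums that are compatible with all operations. -/
theorem dSum_mem_goodSums {x : Sums K (A ⊕ Fin m)} (hx : x ∈ goodSums K A m) :
    dSum x ∈ goodSums K A (m + 1) := by
  refine (goodSums_le (S := (goodSums K A (m + 1)).comap dSum) (fun p hp => ?_)
    fun x hx => nullSums_le_goodSums (dSum_mem_nullSums hx)) hx
  rw [Submodule.mem_comap, ← Submodule.Quotient.mk_eq_zero, ← Submodule.mkQ_apply]
  let π : Sums K (Option (A ⊕ Fin m)) →ₗ[K] (Sums K (A ⊕ Fin (m + 1)) ⧸ goodSums K A (m + 1)) :=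
    (goodSums K A (m + 1)).mkQ ∘ₗ TreeSum.conj (splitEquiv A m)
  have hπ (q) : π (single K q)
      = (goodSums K A (m + 1)).mkQ (single K (ParentFn.conj (splitEquiv A m) q)) := by
    rw [← conj_single]
    rfl
  have hadm {q} (hq : IsAdm (ParentFn.conj (splitEquiv A m) q)) : π (single K q) = 0 := by
    rw [hπ, Submodule.mkQ_apply, Submodule.Quotient.mk_eq_zero]
    exact mem_goodSums_of_isAdm hq
  have h := sum_split_eq_zero hp.1 (fun v => v.isRight = true) (fun q => π (single K q))
    (fun v S hS hS' hv => hadm (isAdm_splitLower hp hS hS' hv))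
    (fun v hv S hS hS' => hadm (isAdm_splitUpper hp hS hS' hv)) ?_ ?_
  · refine Eq.trans ?_ h
    change π (DM _ (single K p)) = _
    have hf {v : A ⊕ Fin m} (f : childSets p v → Sums K (Option (A ⊕ Fin m))) :
        π (∑ᶠ S, f S) = ∑ᶠ S, π (f S) := map_finsum π (Set.toFinite _)
    rw [DM_single _ hp.1]
    simp only [map_add, map_sum, map_sub, map_smul, hf]
    congr 1
    refine sum_congr rfl fun v _ => ?_
    rcases v with v | v <;> simp
  · rintro (v | i) hv
    · cases hv
    · rw [← conj_swap_splitLower hp.1, eq_neg_iff_add_eq_zero, ← conj_single, ← map_add]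
      have hs (x : Sums K (Option (A ⊕ Fin m))) : TreeSum.conj (splitEquiv A m)
          (TreeSum.conj (swap none (some (Sum.inr i))) x)
          = black A (swap 0 i.succ) (TreeSum.conj (splitEquiv A m) x) := by
        rw [TreeSum.conj_conj, TreeSum.conj_conj]
        congr 2
        ext1 v
        rcases v with _ | a | j
        · simp [splitEquiv]
        · simp [splitEquiv, swap_apply_of_ne_of_ne]
        · by_cases h : j = i
          · subst h
            simp [splitEquiv]
          · simp [splitEquiv, h, swap_apply_of_ne_of_ne]
      change (goodSums K A (m + 1)).mkQ (TreeSum.conj (splitEquiv A m) _) = 0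
      rw [map_add, hs, Submodule.mkQ_apply, Submodule.Quotient.mk_eq_zero]
      refine nullSums_le_goodSums (Submodule.subset_span ⟨swap 0 i.succ,
        TreeSum.conj (splitEquiv A m) (single K (splitLower p (Sum.inr i) {u | p u = some
          (Sum.inr i)})), ?_⟩)
      rw [Equiv.Perm.sign_swap (Fin.succ_ne_zero i).symm]
      simp [add_comm]
  · rintro (v | i) hv
    · cases hv
    · exact hp.children_nontrivial i

theorem d_ofSum {k : ℤ} (hm : (m : ℤ) = -(k + 1)) (hm' : ((m + 1 : ℕ) : ℤ) = -k)
    {x : Sums K (A ⊕ Fin m)} (hx : x ∈ goodSums K A m) :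
    d (ofSum hm x) = ofSum hm' (dSum x) := by
  refine (goodSums_le (S := eqLocus (d ∘ₗ ofSum hm) (ofSum hm' ∘ₗ dSum))
    (fun p hp => d_ofSum_single hm hm' hp) fun x hx => ?_) hx
  change d (ofSum hm _) = ofSum hm' _
  rw [ofSum_of_mem_nullSums hm hx, map_zero, ofSum_of_mem_nullSums hm' (dSum_mem_nullSums hx)]

/-! ### `TRT` is a dg operad -/

theorem invSign_finCongr (h : m = n) : invSign (finCongr h) = 1 := by
  subst h
  exact (invSign_eq_sign (Equiv.refl _)).trans Equiv.Perm.sign_one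

theorem ofSum_conj {k : ℤ} (hm : (m : ℤ) = -k) (hn : (n : ℤ) = -k) (e : A ≃ B) (s : Fin m ≃ Fin n)
    {x : Sums K (A ⊕ Fin m)} (hx : x ∈ goodSums K A m) :
    ofSum hn (TreeSum.conj (sumCongr e s) x)
      = ((invSign s : ℤ) : K) • map e (ofSum hm x) := by
  rw [map_ofSum hm e hx, ← ofSum_black hm hn s, TreeSum.conj_conj]
  refine congrArg (fun e => ofSum hn (TreeSum.conj e x)) (Equiv.ext ?_)
  rintro (v | v) <;> rfl

theorem ofSum_conj_finCongr {k : ℤ} (hm : (m : ℤ) = -k) (hn : (n : ℤ) = -k) (e : A ≃ B)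
    (h : m = n) {x : Sums K (A ⊕ Fin m)} (hx : x ∈ goodSums K A m) :
    ofSum hn (TreeSum.conj (sumCongr e (finCongr h)) x) = map e (ofSum hm x) := by
  rw [ofSum_conj hm hn e _ hx, invSign_finCongr, Units.val_one, Int.cast_one, one_smul]

theorem isAdm_one : IsAdm fun _ : Unit ⊕ Fin 0 => none :=
  ⟨⟨⟨Sum.inl (), rfl, by rintro (_ | i) _; exacts [rfl, i.elim0]⟩, fun _ => 0, by simp⟩,
    fun i => i.elim0⟩

variable (K) in
theorem one_mem_goodSums : (single K fun _ => none) ∈ goodSums K Unit 0 :=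
  mem_goodSums_of_isAdm isAdm_one

variable (K) in
theorem one_eq : (TRT K).one = ofSum (K := K) (m := 0) rfl (single K fun _ :
    Unit ⊕ Fin 0 => none) :=
  (ofSum_single' _ _).symm

theorem exists_good [Finite A] {k : ℤ} (x : (TRT K).obj A k) :
    x = 0 ∨ ∃ (m : ℕ) (hm : (m : ℤ) = -k), ∃ X ∈ goodSums K A m, x = ofSum hm X :=
  exists_ofSum_eq x

theorem TRT_map_ofSum {k : ℤ} (hm : (m : ℤ) = -k) (e : A ≃ B) {x : Sums K (A ⊕ Fin m)}
    (hx : x ∈ goodSums K A m) :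
    (TRT K).map e (ofSum hm x : (TRT K).obj A k)
      = ofSum hm (TreeSum.conj (sumCongr e (Equiv.refl _)) x) := map_ofSum hm e hx

theorem TRT_d_ofSum {k : ℤ} (hm : (m : ℤ) = -(k + 1)) {x : Sums K (A ⊕ Fin m)}
    (hx : x ∈ goodSums K A m) :
    (TRT K).d (ofSum hm x : (TRT K).obj A (k + 1))
      = ofSum (show ((m + 1 : ℕ) : ℤ) = -k by omega) (dSum x) := d_ofSum hm _ hx

theorem TRT_comp_ofSum {k l i : ℤ} (a : A) (h : k + l = i) (hm : (m : ℤ) = -k) (hn : (n : ℤ) = -l)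
    {x : Sums K (A ⊕ Fin m)} (hx : x ∈ goodSums K A m)
    {y : Sums K (B ⊕ Fin n)} (hy : y ∈ goodSums K B n) :
    (TRT K).comp a h (ofSum hm x : (TRT K).obj A k) (ofSum hn y : (TRT K).obj B l)
      = ofSum (show ((m + n : ℕ) : ℤ) = -i by omega) (compSum a x y) :=
  comp_ofSum a h hm hn _ hx hy

theorem TRT_map_ofSum_equiv {k : ℤ} (hm : (m : ℤ) = -k) (e : A ≃ B) (s : Fin m ≃ Fin n)
    {x : Sums K (A ⊕ Fin m)} (hx : x ∈ goodSums K A m) :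
    (TRT K).map e (ofSum hm x : (TRT K).obj A k) = ((invSign s : ℤ) : K) •
      ofSum ((congrArg Nat.cast (Fin.equiv_iff_eq.1 ⟨s⟩).symm).trans hm)
        (TreeSum.conj (sumCongr e s) x) := by
  rw [ofSum_conj hm _ e s hx, smul_smul, ← Int.cast_mul, ← Units.val_mul, ← sq, Int.units_sq,
    Units.val_one, Int.cast_one, one_smul]
  rfl

theorem TRT_map_ofSum_finCongr {k : ℤ} (hm : (m : ℤ) = -k) (e : A ≃ B)
    (h : m = n) {x : Sums K (A ⊕ Fin m)} (hx : x ∈ goodSums K A m) :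
    (TRT K).map e (ofSum hm x : (TRT K).obj A k)
      = ofSum ((congrArg Nat.cast h.symm).trans hm)
        (TreeSum.conj (sumCongr e (finCongr h)) x) :=
  (ofSum_conj_finCongr hm _ e h hx).symm

theorem ksgn_eq_pow {k : ℤ} (hm : (m : ℤ) = -k) : ksgn K k = (-1) ^ m := by
  rw [← ksgn_natCast, hm, ksgn_neg]

theorem isDGOperad [CharZero K] : (TRT K).IsDGOperad where
  map_refl {A _ k} x := by
    have := ofFinite A
    obtain rfl | ⟨m, hm, x, hx, rfl⟩ := exists_good x
    · simp
    rw [TRT_map_ofSum hm _ hx, Equiv.sumCongr_refl, conj_refl]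
  map_trans {A B C _ _ _ k} e e' x := by
    have := ofFinite A; have := ofFinite B; have := ofFinite C
    obtain rfl | ⟨m, hm, x, hx, rfl⟩ := exists_good x
    · simp
    rw [TRT_map_ofSum hm _ hx, TRT_map_ofSum hm _ hx, TRT_map_ofSum hm _ (conj_mem_goodSums e hx),
      TreeSum.conj_conj]
    refine congrArg (fun e => ofSum hm (TreeSum.conj e x)) (Equiv.ext ?_)
    rintro (v | v) <;> rfl
  comp_map {A A' B B' _ _ _ _ k l n} e e' a h x y := by
    have := ofFinite A; have := ofFinite B; have := ofFinite A'; have := ofFinite B'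
    obtain rfl | ⟨m, hm, x, hx, rfl⟩ := exists_good x
    · simp
    obtain rfl | ⟨n, hn, y, hy, rfl⟩ := exists_good y
    · simp
    rw [TRT_map_ofSum hm _ hx, TRT_map_ofSum hn _ hy, TRT_comp_ofSum _ _ hm hn
      (conj_mem_goodSums e hx) (conj_mem_goodSums e' hy), TRT_comp_ofSum _ _ hm hn hx hy,
      TRT_map_ofSum _ _ (compSum_mem_goodSums a hx hy), compSum_conj]
    refine congrArg (fun e => ofSum _ (TreeSum.conj e (compSum a x y))) (Equiv.ext ?_)
    rintro (v | v) <;> simp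
  one_comp {B _ k} y := by
    have := ofFinite B
    obtain rfl | ⟨n, hn, y, hy, rfl⟩ := exists_good y
    · simp
    rw [one_eq, TRT_comp_ofSum _ _ _ hn (one_mem_goodSums K) hy, one_compSum,
      TRT_map_ofSum_finCongr hn _ (zero_add _).symm hy]
  comp_one {A _ k} a x := by
    have := ofFinite A
    obtain rfl | ⟨n, hn, x, hx, rfl⟩ := exists_good x
    · simp
    rw [one_eq, TRT_comp_ofSum _ _ hn _ hx (one_mem_goodSums K), compSum_one,
      TRT_map_ofSum_finCongr hn _ (add_zero _).symm hx]
  assoc_seq {A B C _ _ _ k l m p q n} a b h₁ h₂ h₃ h₄ x y z := by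
    have := ofFinite A; have := ofFinite B; have := ofFinite C
    obtain rfl | ⟨m, hm, x, hx, rfl⟩ := exists_good x
    · simp
    obtain rfl | ⟨n, hn, y, hy, rfl⟩ := exists_good y
    · simp
    obtain rfl | ⟨l, hl, z, hz, rfl⟩ := exists_good z
    · simp
    have hxy := compSum_mem_goodSums a hx hy
    have hyz := compSum_mem_goodSums b hy hz
    rw [TRT_comp_ofSum _ _ hm hn hx hy, TRT_comp_ofSum _ _ _ hl hxy hz,
      TRT_comp_ofSum _ _ hn hl hy hz, TRT_comp_ofSum _ _ hm _ hx hyz,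
      TRT_map_ofSum_finCongr _ _ (add_assoc _ _ _) (compSum_mem_goodSums _ hxy hz),
      compSum_assoc_seq]
  assoc_par {A B C _ _ _ k k₂ k₃ p q i} a a' h h₁ h₂ h₃ h₄ x y z := by
    have := ofFinite A; have := ofFinite B; have := ofFinite C
    obtain rfl | ⟨m, hm, x, hx, rfl⟩ := exists_good x
    · simp
    obtain rfl | ⟨n, hn, y, hy, rfl⟩ := exists_good y
    · simp
    obtain rfl | ⟨l, hl, z, hz, rfl⟩ := exists_good z
    · simp
      exact (smul_zero _).symm
    have hxy := compSum_mem_goodSums a hx hy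
    have hxz := compSum_mem_goodSums a' hx hz
    rw [TRT_comp_ofSum _ _ hm hn hx hy, TRT_comp_ofSum _ _ _ hl hxy hz,
      TRT_comp_ofSum _ _ hm hl hx hz, TRT_comp_ofSum _ _ _ hn hxz hy,
      ← compSum_assoc_par a a' h, TRT_map_ofSum_equiv _ _ (blockSwap _ _ _)
        (compSum_mem_goodSums _ hxy hz),
      invSign_blockSwap, show k₂ * k₃ = ((n * l : ℕ) : ℤ) by push_cast; rw [hn, hl]; ring,
        ksgn_natCast]
    push_cast
    rfl
  d_d {A _ k} x := by
    have := ofFinite A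
    obtain rfl | ⟨m, hm, x, hx, rfl⟩ := exists_good x
    · simp
    rw [TRT_d_ofSum hm hx, TRT_d_ofSum _ (dSum_mem_goodSums hx)]
    have h := ofSum_black (k := k) (by omega) (by omega) (swap 0 1) (dSum (dSum x))
    rw [black_swap_dSum_dSum, invSign_eq_sign, Equiv.Perm.sign_swap (by simp)] at h
    have h2 : (2 : K) • ofSum (K := K) (k := k) (by omega) (dSum (dSum x)) = 0 := by
      rw [two_smul, ← eq_neg_iff_add_eq_zero]
      simpa using h
    exact (smul_eq_zero.1 h2).resolve_left two_ne_zero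
  d_map {A B _ _ k} e x := by
    have := ofFinite A; have := ofFinite B
    obtain rfl | ⟨m, hm, x, hx, rfl⟩ := exists_good x
    · simp
    rw [TRT_map_ofSum hm _ hx, TRT_d_ofSum hm (conj_mem_goodSums e hx),
      TRT_d_ofSum hm hx, TRT_map_ofSum _ _ (dSum_mem_goodSums hx), dSum_conj]
    congr 3
    ext1 i
    simp [succEquiv]
  d_comp {A B _ _ k l n} a h h₁ h₂ x y := by
    have := ofFinite A; have := ofFinite B
    obtain rfl | ⟨m, hm, x, hx, rfl⟩ := exists_good x
    · simp
    obtain rfl | ⟨n, hn, y, hy, rfl⟩ := exists_good y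
    · simp
    rw [TRT_comp_ofSum _ _ hm hn hx hy, TRT_d_ofSum _ (compSum_mem_goodSums a hx hy),
      TRT_d_ofSum hm hx, TRT_d_ofSum hn hy,
      TRT_comp_ofSum _ _ _ hn (dSum_mem_goodSums hx) hy,
      TRT_comp_ofSum _ _ hm _ hx (dSum_mem_goodSums hy), dSum_compSum, map_add,
      ofSum_black (by omega) _ (finCongr _), ofSum_black (by omega) _ (frontEquiv _ _),
      invSign_finCongr, invSign_frontEquiv, ksgn_eq_pow hm]
    simp
    rfl

end TRT

/-! ### Counting strictly increasing labellings of rooted forests -/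

namespace ParentFn

open Classical Polynomial

variable {V : Type}

/-- A labelling of the vertices of a rooted forest that strictly increases away from the roots. -/
def IsStrict (q : V → Option V) {n : ℕ} (g : V → Fin n) : Prop := ∀ u v, q u = some v → g v < g u

/-- The restriction of a parent function to the vertices with the property `P`. -/
noncomputable def restrict (q : V → Option V) (P : V → Prop) : {u // P u} → Option {u // P u} :=
  fun u => (q u).bind fun v => if h : P v then some ⟨v, h⟩ else none

theorem restrict_eq_some {q : V → Option V} {P : V → Prop} {u v : {u // P u}} :
    restrict q P u = some v ↔ q u = some v.1 := by
  cases h : q u with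
  | none => simp [restrict, h]
  | some w =>
    by_cases hw : P w
    · simp [restrict, h, hw, Subtype.ext_iff]
    · simp only [restrict, h, bind_some, dif_neg hw, Option.some.injEq, reduceCtorEq,
        false_iff]
      exact fun e => hw (e ▸ v.2)

variable (K : Type u) [Field K]

/-- The polynomial whose value at `n` is the number of strictly increasing labellings of the forest
`q` by `0, …, n - 1`. -/
noncomputable def strictPoly (q : V → Option V) : K[X] :=
  ∑ k ∈ range (Nat.card V + 1),
    C ((Nat.card {g : V → Fin k // IsStrict q g ∧ Function.Surjective g} : K) / k.factorial)
      * descPochhammer K k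

variable {K} [CharZero K]

theorem _root_.Polynomial.ext_natCast {p q : K[X]} (h : ∀ n : ℕ, p.eval (n : K) = q.eval (n : K)) :
    p = q := by
  refine Polynomial.eq_of_infinite_eval_eq p q
    ((Set.infinite_range_of_injective (Nat.cast_injective (R := K))).mono ?_)
  rintro _ ⟨n, rfl⟩
  exact h n

theorem card_isStrict_image [Finite V] (q : V → Option V) {n : ℕ} (I : Finset (Fin n)) :
    Nat.card {g : V → Fin n // IsStrict q g ∧ Set.range g = I}
      = Nat.card {g : V → Fin I.card // IsStrict q g ∧ Function.Surjective g} := by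
  let o := I.orderIsoOfFin rfl
  refine Nat.card_congr ⟨fun g => ⟨fun v => o.symm ⟨g.1 v, ?_⟩, fun u v h => ?_, fun i => ?_⟩,
    fun g => ⟨fun v => o (g.1 v), fun u v h => ?_, ?_⟩, fun g => ?_, fun g => ?_⟩
  · have : g.1 v ∈ Set.range g.1 := ⟨v, rfl⟩
    rwa [g.2.2] at this
  · exact o.symm.lt_iff_lt.2 (g.2.1 u v h)
  · have : (o i).1 ∈ Set.range g.1 := by
      rw [g.2.2]
      exact (o i).2
    obtain ⟨v, hv⟩ := this
    refine ⟨v, ?_⟩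
    rw [OrderIso.symm_apply_eq]
    exact Subtype.ext hv
  · exact o.lt_iff_lt.2 (g.2.1 u v h)
  · ext i
    refine ⟨?_, fun hi => ?_⟩
    · rintro ⟨v, rfl⟩
      exact (o (g.1 v)).2
    · obtain ⟨v, hv⟩ := g.2.2 (o.symm ⟨i, hi⟩)
      exact ⟨v, by simp [hv]⟩
  · exact Subtype.ext (funext fun v => by simp)
  · exact Subtype.ext (funext fun v => by simp)

theorem eval_strictPoly [Finite V] (q : V → Option V) (n : ℕ) :
    (strictPoly K q).eval (n : K) = Nat.card {g : V → Fin n // IsStrict q g} := by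
  have := ofFinite V
  -- labellings are counted by their image
  let e (k : ℕ) : ℕ := Nat.card {g : V → Fin k // IsStrict q g ∧ Function.Surjective g}
  have he (k) (hk : Nat.card V < k) : e k = 0 := by
    have : IsEmpty {g : V → Fin k // IsStrict q g ∧ Function.Surjective g} := by
      refine ⟨fun g => ?_⟩
      have := Nat.card_le_card_of_surjective g.1 g.2.2
      rw [Nat.card_fin] at this
      omega
    exact Nat.card_of_isEmpty
  have h₁ : Nat.card {g : V → Fin n // IsStrict q g}
      = ∑ k ∈ range (n + 1), n.choose k * e k := by
    have h := Finset.sum_powerset_apply_card e (x := (univ : Finset (Fin n)))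
    simp only [card_univ, card_fin, smul_eq_mul] at h
    rw [← h, Nat.card_eq_fintype_card, card_subtype,
      Finset.card_eq_sum_card_fiberwise (f := fun g => univ.image g)
        (t := univ.powerset) (fun g _ => by simp)]
    refine sum_congr rfl fun I _ => ?_
    rw [Finset.filter_filter, ← card_subtype, ← Nat.card_eq_fintype_card]
    refine Eq.trans ?_ (card_isStrict_image q I)
    refine Nat.card_congr (Equiv.subtypeEquivRight fun g => and_congr_right fun _ => ?_)
    rw [← Finset.coe_inj, Finset.coe_image, Finset.coe_univ, Set.image_univ]
  -- no term with `k > n` or `k > |V|` contributes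
  have h₂ : ∑ k ∈ range (n + 1), n.choose k * e k
      = ∑ k ∈ range (Nat.card V + 1), n.choose k * e k := by
    rw [Finset.sum_subset (s₁ := range (n + 1)) (s₂ := range (n + Nat.card V + 1)),
      Finset.sum_subset (s₁ := range (Nat.card V + 1))
        (s₂ := range (n + Nat.card V + 1))]
    · intro k; simp only [Finset.mem_range]; omega
    · intro k _ hk
      rw [he, mul_zero]
      simpa [Nat.lt_succ_iff] using hk
    · intro k; simp only [Finset.mem_range]; omega
    · intro k _ hk
      rw [Nat.choose_eq_zero_of_lt, zero_mul]
      simpa [Nat.lt_succ_iff] using hk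
  rw [h₁, h₂, strictPoly, eval_finset_sum, Nat.cast_sum]
  refine sum_congr rfl fun k _ => ?_
  rw [eval_mul, eval_C, descPochhammer_eval_eq_descFactorial,
    Nat.descFactorial_eq_factorial_mul_choose]
  have := Nat.cast_ne_zero (R := K).2 k.factorial_ne_zero
  push_cast
  field_simp
  ring

theorem strictPoly_congr {W : Type} [Finite V] [Finite W] (e : V ≃ W) (q : V → Option V)
    (q' : W → Option W) (h : ∀ u v, q u = some v ↔ q' (e u) = some (e v)) :
    strictPoly K q = strictPoly K q' := by
  refine ext_natCast fun n => ?_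
  rw [eval_strictPoly, eval_strictPoly]
  refine congrArg Nat.cast (Nat.card_congr ((e.arrowCongr (Equiv.refl _)).subtypeEquiv
    fun g => ⟨fun hg u v huv => ?_, fun hg u v huv => ?_⟩))
  · obtain ⟨u, rfl⟩ := e.surjective u
    obtain ⟨v, rfl⟩ := e.surjective v
    simpa using hg _ _ ((h u v).2 huv)
  · simpa using hg _ _ ((h u v).1 huv)

/-- Labellings of a forest that is a disjoint union are independent labellings of the parts. -/
theorem strictPoly_eq_prod [Fintype V] (q : V → Option V) {ι : Type} [Fintype ι] (ρ : V → ι)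
    (hρ : ∀ u v, q u = some v → ρ u = ρ v) :
    strictPoly K q = ∏ i, strictPoly K (restrict q fun u => ρ u = i) := by
  refine ext_natCast fun n => ?_
  simp only [eval_prod, eval_strictPoly]
  rw [← Nat.cast_prod, ← Nat.card_pi]
  refine congrArg Nat.cast (Nat.card_congr ⟨fun g i => ⟨fun u => g.1 u, fun u v h => ?_⟩,
    fun g => ⟨fun u => (g (ρ u)).1 ⟨u, rfl⟩, fun u v h => ?_⟩, fun g => ?_, fun g => ?_⟩)
  · exact g.2 _ _ (restrict_eq_some.1 h)
  · have h' := hρ u v h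
    have hg (i) (hi : ρ v = i) : (g (ρ v)).1 ⟨v, rfl⟩ = (g i).1 ⟨v, hi⟩ := by
      subst hi
      rfl
    refine (hg _ h'.symm).trans_lt ?_
    exact (g (ρ u)).2 _ _ (restrict_eq_some.2 h)
  · rfl
  · funext i
    refine Subtype.ext (funext fun u => ?_)
    obtain ⟨u, rfl⟩ := u
    rfl

theorem eval_one_strictPoly [Finite V] (q : V → Option V) :
    (strictPoly K q).eval 1 = if ∀ u, q u = none then 1 else 0 := by
  rw [← Nat.cast_one, eval_strictPoly]
  split_ifs with h
  · have : Unique {g : V → Fin 1 // IsStrict q g} :=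
      ⟨⟨⟨fun _ => 0, fun u v huv => by simp [h u] at huv⟩⟩,
        fun g => Subtype.ext (Subsingleton.elim _ _)⟩
    rw [Nat.card_unique]
  · push Not at h
    obtain ⟨u, hu⟩ := h
    obtain ⟨v, hv⟩ := Option.ne_none_iff_exists'.1 hu
    have : IsEmpty {g : V → Fin 1 // IsStrict q g} :=
      ⟨fun g => (g.2 u v hv).ne (Subsingleton.elim _ _)⟩
    rw [Nat.card_of_isEmpty, Nat.cast_zero]

/-- The parent function that extends `p` by isolated vertices. -/
noncomputable def addRoots {P : V → Prop} (p : {u // P u} → Option {u // P u}) :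
    V → Option V :=
  fun u => if h : P u then (p ⟨u, h⟩).map Subtype.val else none

theorem restrict_addRoots {P : V → Prop} (p : {u // P u} → Option {u // P u}) :
    restrict (addRoots p) P = p := by
  funext u
  cases h : p u with
  | none => simp [restrict, addRoots, h, u.2]
  | some v => simp [restrict, addRoots, h, u.2, v.2]

theorem addRoots_restrict {q : V → Option V} {P : V → Prop}
    (h : ∀ u v, q u = some v → P u ∧ P v) : addRoots (restrict q P) = q := by
  funext u
  by_cases hu : P u
  · cases hq : q u with
    | none => simp [addRoots, restrict, hu, hq]
    | some v => simp [addRoots, restrict, hu, hq, (h u v hq).2]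
  · cases hq : q u with
    | none => simp [addRoots, hu]
    | some v => exact (hu (h u v hq).1).elim

/-- In a finite forest every vertex lies above a unique root. -/
theorem exists_rootMap [Finite V] {q : V → Option V} {depth : V → ℕ}
    (hd : ∀ v u, q v = some u → depth u < depth v) :
    ∃ ρ : V → V, (∀ u, q (ρ u) = none) ∧ (∀ u, q u = none → ρ u = u) ∧
      ∀ u v, q u = some v → ρ u = ρ v := by
  have := ofFinite V
  let f (u : V) : V := (q u).getD u
  have hf {u} (h : q u = none) : f u = u := by simp [f, h]
  have hf' {u v} (h : q u = some v) : f u = v := by simp [f, h]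
  have hk (k : ℕ) : ∀ u, depth u ≤ k → q (f^[k] u) = none := by
    induction k with
    | zero =>
      intro u hu
      cases h : q u with
      | none => exact h
      | some v => have := hd u v h; omega
    | succ k ih =>
      intro u hu
      cases h : q u with
      | none => rwa [Function.iterate_fixed (hf h)]
      | some v =>
        have := hd u v h
        rw [Function.iterate_succ_apply, hf' h]
        exact ih v (by omega)
  have hD (u) : q (f^[∑ u, depth u] u) = none :=
    hk _ u (Finset.single_le_sum (f := depth) (fun _ _ => Nat.zero_le _) (mem_univ u))
  refine ⟨f^[∑ u, depth u], hD, fun u h => Function.iterate_fixed (hf h) _, fun u v h => ?_⟩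
  rw [← hf' h, ← Function.iterate_succ_apply, Function.iterate_succ_apply', hf (hD u)]

/-- The number `Ω'(1)`, where `Ω` counts the strictly increasing labellings of a rooted forest. -/
noncomputable def strictWeight (K : Type u) [Field K] (q : V → Option V) : K :=
  (derivative (strictPoly K q)).eval 1

/-- The weight of a forest is the weight of its only tree with more than one vertex; if there is no
such tree, then every vertex contributes once. -/
theorem strictWeight_eq_sum [Fintype V] (q : V → Option V) :
    strictWeight K q = ∑ S : Set V, ∑ T : {u // u ∈ S} → Option {u // u ∈ S},
      if IsTree T ∧ addRoots T = q then strictWeight K T else 0 := by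
  have hin (S : Set V) (u v : V)
      (h : addRoots (restrict q (· ∈ S)) = q) (huv : q u = some v) : u ∈ S ∧ v ∈ S := by
    rw [← h] at huv
    by_cases hu : u ∈ S
    · simp only [addRoots, dif_pos hu, map_eq_some_iff] at huv
      obtain ⟨v, -, rfl⟩ := huv
      exact ⟨hu, v.2⟩
    · simp [addRoots, hu] at huv
  have hT (S : Set V) : (∑ T : {u // u ∈ S} → Option {u // u ∈ S},
      if IsTree T ∧ addRoots T = q then strictWeight K T else 0)
      = if IsTree (restrict q (· ∈ S)) ∧ addRoots (restrict q (· ∈ S)) = q then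
        strictWeight K (restrict q (· ∈ S)) else 0 := by
    refine sum_eq_single _ (fun T _ h => if_neg fun h' => h ?_) (by simp)
    rw [← h'.2, restrict_addRoots]
  rw [sum_congr rfl fun S _ => hT S]
  by_cases hq : ∃ depth : V → ℕ, ∀ v u, q v = some u → depth u < depth v
  · obtain ⟨depth, hd⟩ := hq
    obtain ⟨ρ, hρ, hρ', hρq⟩ := exists_rootMap hd
    have hr (r u) : restrict q (fun u => ρ u = r) u = none ↔ q u = none := by
      cases h : q u with
      | none => simp [restrict, h]
      | some v =>
        have : restrict q (fun u => ρ u = r) u = some ⟨v, (hρq _ _ h).symm.trans u.2⟩ :=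
          restrict_eq_some.2 h
        simp [this]
    -- `Ω` is the product over the trees of the forest, so `Ω'(1)` is a sum over the trees, with the
    -- values `Ω(1)` of the other trees; these vanish unless the tree is a single vertex
    have hL (r) : (∏ s ∈ univ.erase r,
        (strictPoly K (restrict q fun u => ρ u = s)).eval 1)
        = if ∀ u, ρ u ≠ r → q u = none then 1 else 0 := by
      simp only [eval_one_strictPoly, hr]
      rw [Finset.prod_ite_zero]
      simp only [prod_const_one, Finset.mem_erase, mem_univ, and_true]
      refine if_congr ⟨fun h u hu => h (ρ u) hu ⟨u, rfl⟩, fun h s hs u => h u ?_⟩ rfl rfl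
      rw [u.2]
      exact hs
    have h₀ (r) (h : q r ≠ none) : strictWeight K (restrict q fun u => ρ u = r) = 0 := by
      have : IsEmpty {u // ρ u = r} := ⟨fun u => h (u.2 ▸ hρ u)⟩
      have h₁ : strictPoly K (restrict q fun u => ρ u = r) = 1 := by
        refine ext_natCast fun n => ?_
        rw [eval_strictPoly, eval_one, Nat.cast_eq_one, Nat.card_eq_one_iff_unique]
        exact ⟨⟨fun f g => Subtype.ext (Subsingleton.elim _ _)⟩,
          ⟨⟨isEmptyElim, fun u => isEmptyElim u⟩⟩⟩
      rw [strictWeight, h₁, derivative_one, eval_zero]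
    rw [strictWeight, strictPoly_eq_prod q ρ hρq, derivative_prod_finset, eval_finset_sum]
    simp only [eval_mul, eval_prod, hL]
    rw [← Finset.sum_filter_of_ne (p := fun r => q r = none)
      (fun r _ h => by_contra fun h' => h (by rw [← strictWeight, h₀ r h', mul_zero]))]
    refine Finset.sum_of_injOn (fun r => {u | ρ u = r}) ?_ (by simp) (fun S _ hS => ?_)
      fun r hr' => ?_
    · intro r hr r' _ h
      have : r ∈ {u | ρ u = r'} := (Set.ext_iff.1 h r).1 (hρ' r (by simpa using hr))
      exact (hρ' r (by simpa using hr)).symm.trans this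
    · refine if_neg fun h => hS ?_
      obtain ⟨⟨t, ht, ht'⟩, -⟩ := h.1
      have ht₀ : q t = none := by
        cases h' : q t with
        | none => rfl
        | some v =>
          have := (restrict_eq_some (u := t) (v := ⟨v, (hin S _ _ h.2 h').2⟩)).2 h'
          rw [this] at ht
          cases ht
      refine ⟨t, by simpa using ht₀, ?_⟩
      ext u
      refine ⟨fun hu => by_contra fun hu' => hu' ?_, fun hu => ?_⟩
      · have hu₀ : q u = none := by
          rw [← h.2]
          exact dif_neg hu'
        have : u = t := (hρ' u hu₀).symm.trans hu
        exact this ▸ t.2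
      · have key (N : ℕ) : ∀ u ∈ S, depth u ≤ N → ρ u ∈ S := by
          induction N with
          | zero =>
            intro u hu hN
            cases h' : q u with
            | none => rwa [hρ' u h']
            | some v => have := hd u v h'; omega
          | succ N ih =>
            intro u hu hN
            cases h' : q u with
            | none => rwa [hρ' u h']
            | some v =>
              have := hd u v h'
              rw [hρq u v h']
              exact ih v (hin S u v h.2 h').2 (by omega)
        have hmem := key _ u hu le_rfl
        have := ht' ⟨ρ u, hmem⟩ (by
          have := hρ u
          simp [restrict, this])
        exact congrArg Subtype.val this
    · have hr₀ : q r = none := by simpa using hr'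
      rw [ite_mul, one_mul, zero_mul]
      refine if_congr ⟨fun h => ⟨⟨⟨⟨r, hρ' r hr₀⟩, ?_, fun u hu => ?_⟩, fun u => depth u,
        fun u v huv => hd _ _ (restrict_eq_some.1 huv)⟩, addRoots_restrict fun u v huv => ?_⟩,
        fun h u hu => ?_⟩ rfl rfl
      · exact (hr r ⟨r, hρ' r hr₀⟩).2 hr₀
      · have := (hρ' _ ((hr r u).1 hu)).symm.trans u.2
        exact Subtype.ext this
      · have hu : ρ u = r := by_contra fun hu => by simp [h u hu] at huv
        exact ⟨hu, (hρq u v huv).symm.trans hu⟩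
      · rw [← h.2]
        exact dif_neg hu
  -- if `q` is not a forest, then it has no labellings, and none of the summands is a forest
  · have h₀ : strictPoly K q = 0 := by
      refine ext_natCast fun n => ?_
      have : IsEmpty {g : V → Fin n // IsStrict q g} := ⟨fun g => hq ⟨fun u => g.1 u, g.2⟩⟩
      rw [eval_strictPoly, Nat.card_of_isEmpty, Nat.cast_zero, eval_zero]
    rw [strictWeight, h₀, derivative_zero, eval_zero]
    refine (sum_eq_zero fun S _ => if_neg fun h => hq ?_).symm
    obtain ⟨⟨-, depth, hd⟩, h⟩ := h
    refine ⟨fun u => if hu : u ∈ S then depth ⟨u, hu⟩ else 0, fun u v huv => ?_⟩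
    have hm := hin S u v h huv
    dsimp only
    rw [dif_pos hm.1, dif_pos hm.2]
    exact hd _ _ (restrict_eq_some.2 huv)

end ParentFn

/-! ### Generating polynomials of labelled trees -/

namespace TreeSum

open Classical Polynomial

variable {K : Type u} [Field K] {V W : Type}

section

variable [Fintype V]

/-- The generating polynomial of strictly labelled trees. -/
noncomputable def treePoly (b : V → Option V → K) : K[X] :=
  ∑ T : V → Option V, if IsTree T then C (∏ v, b v (T v)) * strictPoly K T else 0

/-- The generating polynomial of strictly labelled forests. -/
noncomputable def forestPoly (b : V → Option V → K) : K[X] :=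
  ∑ q : V → Option V, C (∏ v, b v (q v)) * strictPoly K q

variable (K V) in
/-- The sum of all trees, weighted by their numbers `Ω'(1)`. -/
noncomputable def weightSum : Sums K V := ∑ T : V → Option V, strictWeight K T • single K T

theorem ev_weightSum (b : V → Option V → K) :
    ev b (weightSum K V) = (derivative (treePoly b)).eval 1 := by
  rw [weightSum, treePoly, map_sum, derivative_sum, eval_finset_sum]
  refine sum_congr rfl fun T _ => ?_
  rw [map_smul]
  split_ifs with hT
  · rw [ev_single b hT, derivative_C_mul, eval_C_mul, smul_eq_mul, mul_comm]
    rfl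
  · rw [TRT.single_of_not_isTree hT, map_zero, smul_zero, derivative_zero, eval_zero]

theorem ev_weightSum_eq_sum (b : V → Option V → K) :
    ev b (weightSum K V)
      = ∑ T : V → Option V, if IsTree T then (∏ v, b v (T v)) * strictWeight K T else 0 := by
  rw [weightSum, map_sum]
  refine sum_congr rfl fun T _ => ?_
  rw [map_smul]
  split_ifs with hT
  · rw [ev_single b hT, smul_eq_mul, mul_comm]
  · rw [TRT.single_of_not_isTree hT, map_zero, smul_zero]

end

variable [CharZero K]

theorem conj_weightSum [Fintype V] [Fintype W] (e : V ≃ W) :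
    conj e (weightSum K V) = weightSum K W := by
  rw [weightSum, weightSum, map_sum]
  refine Fintype.sum_equiv (e.arrowCongr (optionCongr e)) _ _ fun T => ?_
  rw [map_smul, TRT.conj_single]
  have h : ParentFn.conj e T = e.arrowCongr (optionCongr e) T := rfl
  rw [← h, strictWeight, strictWeight,
    strictPoly_congr e T (ParentFn.conj e T) fun u v => (TRT.conj_eq_some e T u v).symm]

/-! Trees are counted over a `K`-algebra with an element `ε` of square zero: giving every root the
weight `ε` and multiplying by `ε` where needed singles out the forests with one root. -/

variable {R : Type u} [CommRing R] [Algebra K R] {ε : R}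

theorem prod_strict_eq [Fintype V] [Nonempty V] (hε : ε * ε = 0) (b : V → Option V → K) {n : ℕ}
    (g : V → Fin n) (T : V → Option V) :
    (∏ v, (T v).elim (ε * algebraMap K R (b v none))
      fun w => if g w < g v then algebraMap K R (b v (some w)) else 0)
      = if IsTree T ∧ IsStrict T g then ε * algebraMap K R (∏ v, b v (T v)) else 0 := by
  by_cases hg : IsStrict T g
  · have h₁ (v) : ((T v).elim (ε * algebraMap K R (b v none))
        fun w => if g w < g v then algebraMap K R (b v (some w)) else 0)
        = (if T v = none then ε else 1) * algebraMap K R (b v (T v)) := by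
      cases h : T v with
      | none => simp
      | some w => simp [hg v w h]
    rw [prod_congr rfl fun v _ => h₁ v, prod_mul_distrib, ← map_prod,
      Finset.prod_ite, prod_const_one, mul_one, Finset.prod_const]
    obtain ⟨ρ, hρ, -⟩ := exists_rootMap (depth := fun v => (g v : ℕ)) hg
    obtain ⟨v⟩ := ‹Nonempty V›
    by_cases hT : IsTree T
    · obtain ⟨r, hr, hr'⟩ := hT.1
      have : (univ.filter fun v => T v = none) = {r} := by
        ext v
        simp only [mem_filter, mem_univ, true_and, Finset.mem_singleton]
        exact ⟨hr' v, fun h => h ▸ hr⟩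
      rw [this, Finset.card_singleton, pow_one, if_pos ⟨hT, hg⟩]
    · rw [if_neg fun h => hT h.1, pow_eq_zero_of_le (m := 2) ?_ (by rw [pow_two, hε]), zero_mul]
      refine Finset.one_lt_card.2 ?_
      by_contra h
      push Not at h
      refine hT ⟨⟨ρ v, hρ v, fun u hu => h u ?_ _ ?_⟩, fun v => g v, hg⟩
      · simpa using hu
      · simpa using hρ v
  · rw [if_neg fun h => hg h.2]
    simp only [IsStrict] at hg
    push Not at hg
    obtain ⟨u, v, h, hv⟩ := hg
    refine prod_eq_zero (mem_univ u) ?_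
    rw [h, elim_some, if_neg hv.not_gt]

theorem eval_treePoly [Fintype V] [Nonempty V] (hε : ε * ε = 0) (b : V → Option V → K) (n : ℕ) :
    ε * algebraMap K R ((treePoly b).eval (n : K)) = ∑ g : V → Fin n,
      ∏ v, (ε * algebraMap K R (b v none)
        + ∑ w, if g w < g v then algebraMap K R (b v (some w)) else 0) := by
  have h (g : V → Fin n) : ∏ v, (ε * algebraMap K R (b v none)
      + ∑ w, if g w < g v then algebraMap K R (b v (some w)) else 0)
      = ∑ T : V → Option V,
        if IsTree T ∧ IsStrict T g then ε * algebraMap K R (∏ v, b v (T v)) else 0 := by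
    rw [← sum_congr rfl fun T _ => prod_strict_eq hε b g T]
    have := prod_univ_sum (fun _ : V => (univ : Finset (Option V)))
      fun v (o : Option V) => o.elim (ε * algebraMap K R (b v none))
      fun w => if g w < g v then algebraMap K R (b v (some w)) else 0
    simpa [sum_option] using this
  simp only [h]
  rw [sum_comm, treePoly, eval_finset_sum, map_sum, mul_sum]
  refine sum_congr rfl fun T _ => ?_
  by_cases hT : IsTree T
  · simp only [hT, true_and, if_true]
    rw [eval_C_mul, eval_strictPoly, map_mul, map_natCast, ← sum_filter, Finset.sum_const,
      Nat.card_eq_fintype_card, card_subtype, nsmul_eq_mul]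
    ring
  · simp [hT]

theorem eval_forestPoly [Fintype V] (b : V → Option V → K) (n : ℕ) :
    (forestPoly b).eval (n : K) = ∑ g : V → Fin n,
      ∏ v, (b v none + ∑ w, if g w < g v then b v (some w) else 0) := by
  have h (g : V → Fin n) : ∏ v, (b v none + ∑ w, if g w < g v then b v (some w) else 0)
      = ∑ T : V → Option V, if IsStrict T g then ∏ v, b v (T v) else 0 := by
    have h₁ (T : V → Option V) : (if IsStrict T g then ∏ v, b v (T v) else 0)
        = ∏ v, (T v).elim (b v none) fun w => if g w < g v then b v (some w) else 0 := by
      split_ifs with hg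
      · refine prod_congr rfl fun v _ => ?_
        cases h : T v with
        | none => rfl
        | some w => simp [hg v w h]
      · simp only [IsStrict] at hg
        push Not at hg
        obtain ⟨u, v, h, hv⟩ := hg
        refine (prod_eq_zero (mem_univ u) ?_).symm
        rw [h, elim_some, if_neg hv.not_gt]
    rw [sum_congr rfl fun T _ => h₁ T]
    have := prod_univ_sum (fun _ : V => (univ : Finset (Option V)))
      fun v (o : Option V) => o.elim (b v none)
      fun w => if g w < g v then b v (some w) else 0
    simpa [sum_option] using this
  simp only [h]
  rw [sum_comm, forestPoly, eval_finset_sum]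
  refine sum_congr rfl fun T _ => ?_
  rw [eval_C_mul, eval_strictPoly, ← sum_filter, Finset.sum_const,
      Nat.card_eq_fintype_card, card_subtype, nsmul_eq_mul, mul_comm]

/-- The weighted sum of all forests, in terms of their trees with more than one vertex. -/
theorem derivative_forestPoly [Fintype V] (c : V → Option V → K) :
    (derivative (forestPoly c)).eval 1 = ∑ S : Set V, (∏ u : {u // u ∉ S}, c u none) *
      ev (fun (u : {u // u ∈ S}) w => c u (w.map Subtype.val)) (weightSum K {u // u ∈ S}) := by
  have h (S : Set V) (T : {u // u ∈ S} → Option {u // u ∈ S}) :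
      ∏ u, c u (addRoots T u) = (∏ u : {u // u ∉ S}, c u none)
        * ∏ u : {u // u ∈ S}, c u ((T u).map Subtype.val) := by
    rw [← Fintype.prod_subtype_mul_prod_subtype (· ∈ S), mul_comm]
    congr 1
    · exact prod_congr rfl fun u _ => by rw [addRoots, dif_neg u.2]
    · exact prod_congr rfl fun u _ => by rw [addRoots, dif_pos u.2]
  simp only [ev_weightSum_eq_sum, mul_sum, mul_ite, mul_zero, ← mul_assoc, ← h]
  rw [forestPoly, derivative_sum, eval_finset_sum]
  have h₁ (q : V → Option V) : (derivative (C (∏ v, c v (q v)) * strictPoly K q)).eval 1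
      = ∑ S : Set V, ∑ T : {u // u ∈ S} → Option {u // u ∈ S},
        if addRoots T = q then
          (if IsTree T then (∏ v, c v (addRoots T v)) * strictWeight K T else 0) else 0 := by
    rw [derivative_C_mul, eval_C_mul, ← strictWeight, strictWeight_eq_sum, mul_sum]
    refine sum_congr (Finset.ext fun _ => by simp) fun S _ => ?_
    rw [mul_sum]
    refine sum_congr (Finset.ext fun _ => by simp) fun T _ => ?_
    by_cases hT : addRoots T = q <;> by_cases hT' : IsTree T <;> simp [hT, hT']
  rw [sum_congr rfl fun q _ => h₁ q, sum_comm]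
  refine sum_congr
    (Finset.ext fun _ => iff_of_true (mem_univ _) (mem_univ _)) fun S _ => ?_
  rw [sum_comm]
  refine sum_congr (Finset.ext fun _ => by simp) fun T _ => ?_
  exact (Finset.sum_ite_eq _ _ _).trans (if_pos (by simp))

/-! ### Summation by parts -/

theorem prod_add_eq_sum_set [Fintype V] (x y : V → R) :
    ∏ u, (x u + y u) = ∑ S : Set V, ∏ u, if u ∈ S then y u else x u := by
  have := prod_univ_sum (fun _ : V => (univ : Finset Prop))
    fun u (P : Prop) => if P then y u else x u
  simp only [Fintype.piFinset_univ, Fintype.sum_Prop, if_true, if_false] at this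
  refine Eq.trans (prod_congr rfl fun u _ => add_comm _ _) (this.trans ?_)
  refine Finset.sum_bij' (fun (P : V → Prop) _ => {v | P v}) (fun S _ v => v ∈ S)
    (fun _ _ => mem_univ _) (fun _ _ => mem_univ _) (fun _ _ => rfl)
    (fun _ _ => rfl) fun P _ => prod_congr rfl fun u _ => ?_
  exact if_congr Iff.rfl rfl rfl

theorem sum_subsets_eq [Fintype V] {n : ℕ} (g : V → Fin n) (x α : V → R) (m : ℕ) :
    (∑ S : Set V, if S.Nonempty ∧ ∀ s ∈ S, (g s : ℕ) = m then
      ∏ u, (if u ∈ S then α u else x u + if m < g u then α u else 0) else 0)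
      = ∏ u, (x u + if m ≤ g u then α u else 0) - ∏ u, (x u + if m < g u then α u else 0) := by
  have h : ∏ u, (x u + if m ≤ g u then α u else 0)
      = ∑ S : Set V, ∏ u, (if u ∈ S then (if (g u : ℕ) = m then α u else 0)
        else x u + if m < g u then α u else 0) := by
    rw [← prod_add_eq_sum_set]
    refine prod_congr rfl fun u _ => ?_
    rcases lt_trichotomy (g u : ℕ) m with h | h | h
    · simp [h.ne, h.not_gt, h.not_ge]
    · simp [h]
    · simp [h, h.le, h.ne']
  let F (S : Set V) : R := ∏ u, (if u ∈ S then (if (g u : ℕ) = m then α u else 0)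
        else x u + if m < g u then α u else 0)
  have h₀ : ∏ u, (x u + if m < g u then α u else 0) = F ∅ := by simp [F]
  rw [h, h₀]
  refine Eq.trans ?_ (Finset.sum_erase_eq_sub (f := F) (mem_univ ∅))
  refine (Finset.sum_erase (a := ∅) _ (if_neg (by simp))).symm.trans ?_
  refine sum_congr rfl fun S hS => ?_
  have hS : S.Nonempty := Set.nonempty_iff_ne_empty.2 (ne_of_mem_erase hS)
  by_cases h : ∀ s ∈ S, (g s : ℕ) = m
  · rw [if_pos ⟨hS, h⟩]
    refine prod_congr rfl fun u _ => ?_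
    by_cases hu : u ∈ S
    · simp [hu, h u hu]
    · simp [hu]
  · rw [if_neg fun h' => h h'.2]
    push Not at h
    obtain ⟨s, hs, hs'⟩ := h
    exact (prod_eq_zero (mem_univ s) (by simp [hs, hs'])).symm

theorem sum_by_parts [Fintype V] {n : ℕ} (g : V → Fin n) (x α β : V → R) (δ : R) :
    (∑ m : Fin n, ∑ S : Set V, if S.Nonempty ∧ ∀ s ∈ S, g s = m then
      (∏ u, (if u ∈ S then α u else x u + if m < g u then α u else 0))
        * (δ + ∑ w, if g w < m then β w else 0) else 0)
      = δ * (∏ u, (x u + α u) - ∏ u, x u)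
        + ∑ w, β w * (∏ u, (x u + if g w < g u then α u else 0) - ∏ u, x u) := by
  -- the sum over `S` is the difference `P m - P (m + 1)`, and the sums over `m` telescope
  let P (m : ℕ) : R := ∏ u, (x u + if m ≤ g u then α u else 0)
  have hP₀ : P 0 = ∏ u, (x u + α u) := by simp [P]
  have hPn : P n = ∏ u, x u := prod_congr rfl fun u _ => by simp
  have hPs (w) : P (g w + 1) = ∏ u, (x u + if g w < g u then α u else 0) := rfl
  have h₁ (m : Fin n) : (∑ S : Set V, if S.Nonempty ∧ ∀ s ∈ S, g s = m then
      (∏ u, (if u ∈ S then α u else x u + if m < g u then α u else 0))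
        * (δ + ∑ w, if g w < m then β w else 0) else 0)
      = (P m - P (m + 1)) * (δ + ∑ w, if (g w : ℕ) < m then β w else 0) := by
    have := sum_subsets_eq g x α m
    refine Eq.trans ?_ (congrArg (· * _) this)
    rw [sum_mul]
    refine sum_congr rfl fun S _ => ?_
    simp only [Fin.ext_iff, Fin.lt_def, ite_mul, zero_mul]
  have h₂ (k : ℕ) (hk : k < n) :
      ∑ m ∈ range n, (if k < m then P m - P (m + 1) else 0) = P (k + 1) - P n := by
    rw [← sum_filter, ← neg_sub (P n), ← Finset.sum_Ico_sub P hk, ← sum_neg_distrib]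
    refine sum_congr (by ext; simp; omega) fun m _ => (neg_sub _ _).symm
  rw [sum_congr rfl fun m _ => h₁ m, Fin.sum_univ_eq_sum_range
    (fun m => (P m - P (m + 1)) * (δ + ∑ w, if (g w : ℕ) < m then β w else 0))]
  simp only [mul_add, sum_add_distrib, ← sum_mul, Finset.sum_range_sub', hP₀, hPn,
    mul_comm _ δ, mul_sum]
  congr 1
  · rw [← mul_sum, Finset.sum_range_sub', hP₀, hPn]
  rw [sum_comm]
  refine sum_congr rfl fun w _ => ?_
  rw [← hPs, ← hPn, ← h₂ _ (g w).2, mul_sum]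
  refine sum_congr rfl fun m _ => ?_
  split_ifs <;> ring

/-! ### The weighted sum of trees and the corollas -/

variable {V : Type} [Fintype V]

/-- The matrix substitution for inserting the corolla with black root `none` on the set `S` into the
vertex `S` of a tree on `V/S`. -/
noncomputable def clp (a : Option V → Option (Option V) → K) (S : Set V) :
    Collapse S → Option (Collapse S) → K
  | Sum.inl u, none => a (some u) none
  | Sum.inl u, some (Sum.inl w) => a (some u) (some (some w))
  | Sum.inl u, some (Sum.inr _) =>
      a (some u) (some none) + ∑ s : {u // u ∈ S}, a (some u) (some (some s))
  | Sum.inr _, w => a none (w.bind fun w => w.elim (fun w => some (some w.1)) fun _ => none)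
      * ∏ s : {u // u ∈ S}, a (some s) (some none)

theorem eval_treePoly_clp (hε : ε * ε = 0) (a : Option V → Option (Option V) → K) (S : Set V)
    (hS : S.Nonempty) (n : ℕ) :
    ε * algebraMap K R ((treePoly (clp a S)).eval (n : K)) = ∑ g : V → Fin n, ∑ m : Fin n,
      if ∀ s ∈ S, g s = m then (∏ u, (if u ∈ S then algebraMap K R (a (some u) (some none))
        else (ε * algebraMap K R (a (some u) none)
          + ∑ w, if g w < g u then algebraMap K R (a (some u) (some (some w))) else 0)
          + if m < g u then algebraMap K R (a (some u) (some none)) else 0))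
        * (ε * algebraMap K R (a none none)
          + ∑ w, if g w < m then algebraMap K R (a none (some (some w))) else 0) else 0 := by
  rw [eval_treePoly hε, ← Fintype.sum_prod_type']
  -- a labelling of `V/S` is a labelling of `V` that takes a constant value `m` on `S`
  let e (g : Collapse S → Fin n) : (V → Fin n) × Fin n :=
    (fun v => if h : v ∈ S then g (Sum.inr ()) else g (Sum.inl ⟨v, h⟩), g (Sum.inr ()))
  refine Finset.sum_of_injOn e (fun g _ g' _ h => ?_) (fun _ _ => Finset.mem_coe.2
    (mem_univ _)) (fun p _ hp => ?_) fun g _ => ?_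
  · funext v
    rcases v with v | v
    · have := congrFun (congrArg Prod.fst h) v.1
      simpa [e, v.2] using this
    · exact congrArg Prod.snd h
  · refine if_neg fun h => hp ⟨Sum.elim (fun v => p.1 v) fun _ => p.2, by simp, ?_⟩
    refine Prod.ext (funext fun v => ?_) rfl
    by_cases hv : v ∈ S
    · simp [e, hv, h v hv]
    · simp [e, hv]
  · have he (s) (hs : s ∈ S) : (e g).1 s = g (Sum.inr ()) := dif_pos hs
    have he' (s : {u // u ∉ S}) : (e g).1 s = g (Sum.inl s) := dif_neg s.2
    have he₂ : (e g).2 = g (Sum.inr ()) := rfl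
    rw [if_pos he, prod_sum_type, ← Fintype.prod_subtype_mul_prod_subtype (· ∈ S)]
    have hsum (f : V → R) (k : Fin n) : ∑ w, (if (e g).1 w < k then f w else 0)
        = (if g (Sum.inr ()) < k then ∑ s : {u // u ∈ S}, f s else 0)
          + ∑ w : {u // u ∉ S}, if g (Sum.inl w) < k then f w else 0 := by
      rw [← Fintype.sum_subtype_add_sum_subtype (· ∈ S)]
      congr 1
      · rw [sum_congr rfl fun s _ => by rw [he s s.2]]
        split_ifs <;> simp
      · exact sum_congr rfl fun s _ => by rw [he' s]
    refine Eq.trans ?_ (mul_assoc _ _ _).symm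
    refine Eq.trans ?_ (mul_left_comm _ _ _)
    simp only [hsum, he₂]
    congr 1
    · refine prod_congr rfl fun u _ => ?_
      rw [if_neg u.2, he' u, sum_sum_type]
      simp only [clp, univ_unique, sum_singleton, map_add, map_sum]
      split_ifs <;> ring
    · simp only [univ_unique, Finset.prod_singleton, clp, sum_sum_type, map_mul,
        map_prod, sum_singleton, lt_self_iff_false, if_false, add_zero, zero_add,
        bind_none, bind_some, Sum.elim_inl]
      rw [prod_congr rfl fun s _ => if_pos s.2, mul_add, mul_sum]
      congr 1
      · ring
      · refine sum_congr rfl fun w _ => ?_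
        split_ifs <;> ring

theorem eps_mul_algebraMap_injective {x y : K}
    (h : (DualNumber.eps : DualNumber K) * algebraMap K _ x = DualNumber.eps * algebraMap K _ y) :
    x = y := by
  have := congrArg TrivSqZeroExt.snd h
  simpa [TrivSqZeroExt.algebraMap_eq_inl] using this

/-- The product over the vertices of the sums over the vertices of smaller label vanishes, because
of the vertices of smallest label. -/
theorem prod_sum_lt_eq_zero [Nonempty V] {n : ℕ} (g : V → Fin n) (f : V → V → R) :
    ∏ u, (∑ w, if g w < g u then f u w else 0) = 0 := by
  obtain ⟨u, hu⟩ := Finite.exists_min g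
  exact prod_eq_zero (mem_univ u)
    (sum_eq_zero fun w _ => if_neg (hu w).not_gt)

theorem mul_prod_add_of_sq_eq_zero (hε : ε * ε = 0) {ι : Type} (s : Finset ι) (y z : ι → R) :
    ε * ∏ u ∈ s, (ε * y u + z u) = ε * ∏ u ∈ s, z u := by
  induction s using Finset.cons_induction with
  | empty => simp
  | cons u s _ ih =>
    rw [Finset.prod_cons, Finset.prod_cons]
    linear_combination (z u) * ih + (y u * ∏ u ∈ s, (ε * y u + z u)) * hε

theorem sum_treePoly_clp [Nonempty V] (a : Option V → Option (Option V) → K) :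
    (∑ S : Set V, if S.Nonempty then treePoly (clp a S) else 0)
      = C (a none none) * forestPoly (fun u o => a (some u) (some o))
        + ∑ w, C (a none (some (some w)))
          * (treePoly (low a w) - treePoly fun u o => a (some u) (o.map some)) := by
  -- both sides are compared at `n`, as sums over the labellings of `V` by `0, …, n - 1`
  refine Polynomial.ext_natCast fun n => eps_mul_algebraMap_injective ?_
  set ε : DualNumber K := DualNumber.eps
  have hε : ε * ε = 0 := DualNumber.eps_mul_eps
  let x (g : V → Fin n) (u : V) : DualNumber K := ε * algebraMap K _ (a (some u) none)
    + ∑ w, if g w < g u then algebraMap K _ (a (some u) (some (some w))) else 0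
  let α (u : V) : DualNumber K := algebraMap K _ (a (some u) (some none))
  let β (w : V) : DualNumber K := algebraMap K _ (a none (some (some w)))
  have h₁ : ε * algebraMap K _ ((∑ S : Set V, if S.Nonempty then treePoly (clp a S) else 0).eval
      (n : K)) = ∑ g : V → Fin n, ∑ m : Fin n, ∑ S : Set V,
        if S.Nonempty ∧ ∀ s ∈ S, g s = m then
          (∏ u, (if u ∈ S then α u else x g u + if m < g u then α u else 0))
            * (ε * algebraMap K _ (a none none) + ∑ w, if g w < m then β w else 0) else 0 := by
    have (g : V → Fin n) := sum_comm (s := univ) (t := univ)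
      (f := fun (m : Fin n) (S : Set V) => if S.Nonempty ∧ ∀ s ∈ S, g s = m then
        (∏ u, (if u ∈ S then α u else x g u + if m < g u then α u else 0))
          * (ε * algebraMap K _ (a none none) + ∑ w, if g w < m then β w else 0) else 0)
    rw [eval_finset_sum, map_sum, mul_sum, sum_congr rfl fun g _ => this g,
      sum_comm]
    refine sum_congr rfl fun S _ => ?_
    by_cases hS : S.Nonempty
    · rw [if_pos hS, eval_treePoly_clp hε a S hS n]
      simp only [hS, true_and]
      rfl
    · simp [hS]
  have h₂ (g : V → Fin n) : ε * algebraMap K _ (a none none) * (∏ u, (x g u + α u) - ∏ u, x g u)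
      = ε * algebraMap K _ (a none none * ∏ u, (a (some u) (some none)
        + ∑ w, if g w < g u then a (some u) (some (some w)) else 0)) := by
    have e₁ := mul_prod_add_of_sq_eq_zero hε univ
      (fun u => algebraMap K _ (a (some u) none)) fun u =>
        (∑ w, if g w < g u then algebraMap K _ (a (some u) (some (some w))) else 0) + α u
    have e₂ := mul_prod_add_of_sq_eq_zero hε univ
      (fun u => algebraMap K _ (a (some u) none)) fun u =>
        ∑ w, if g w < g u then algebraMap K (DualNumber K) (a (some u) (some (some w))) else 0
    rw [prod_sum_lt_eq_zero, mul_zero] at e₂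
    have e₃ : algebraMap K (DualNumber K) (∏ u, (a (some u) (some none)
        + ∑ w, if g w < g u then a (some u) (some (some w)) else 0))
        = ∏ u, ((∑ w, if g w < g u then algebraMap K (DualNumber K) (a (some u) (some (some w)))
          else 0) + α u) := by
      rw [map_prod]
      refine prod_congr rfl fun u _ => ?_
      rw [map_add, map_sum, add_comm]
      congr 1
      exact sum_congr rfl fun w _ => by split_ifs <;> simp
    simp only [← add_assoc] at e₁
    rw [map_mul, e₃]
    linear_combination algebraMap K _ (a none none) * (e₁ - e₂)
  have h₃ (w : V) : ε * algebraMap K _ ((treePoly (low a w)).eval (n : K))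
      = ∑ g : V → Fin n, ∏ u, (x g u + if g w < g u then α u else 0) := by
    rw [eval_treePoly hε]
    refine sum_congr rfl fun g _ => prod_congr rfl fun u _ => ?_
    simp only [low, map_none, map_some, reduceCtorEq, if_false, add_zero,
      Option.some_inj, map_add, x, add_assoc]
    congr 1
    have h (v : V) : (if g v < g u then algebraMap K (DualNumber K) (a (some u) (some (some v)))
        + algebraMap K _ (if v = w then a (some u) (some none) else 0) else 0)
        = (if g v < g u then algebraMap K (DualNumber K) (a (some u) (some (some v))) else 0)
          + if v = w then (if g w < g u then α u else 0) else 0 := by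
      rcases eq_or_ne v w with rfl | hv
      · simp only [if_true]
        split_ifs <;> simp [α]
      · simp [hv]
    rw [sum_congr rfl fun v _ => h v, sum_add_distrib, Finset.sum_ite_eq',
      if_pos (mem_univ _)]
  have h₄ : ε * algebraMap K _ ((treePoly fun u o => a (some u) (o.map some)).eval (n : K))
      = ∑ g : V → Fin n, ∏ u, x g u := eval_treePoly hε _ n
  rw [h₁, sum_congr rfl fun g _ => sum_by_parts g (x g) α β _, sum_add_distrib,
    sum_congr rfl fun g _ => h₂ g, eval_add, map_add, mul_add, eval_C_mul,
    eval_forestPoly, ← mul_sum, ← map_sum, ← mul_sum, sum_comm,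
    eval_finset_sum, map_sum]
  congr 1
  rw [mul_sum]
  refine sum_congr rfl fun w _ => ?_
  rw [eval_C_mul, eval_sub, map_mul, map_sub, mul_left_comm, mul_sub, h₃, h₄,
    ← sum_sub_distrib, mul_sum]

/-- The identity satisfied by the weighted sum `h` of all trees: the sum over all `S` of the
insertion of the corolla on `S` into `h` equals the sum of all insertions of `h` into corollas plus
the sum of the ways to split off a child, which is not a leaf, of a vertex of `h`. -/
theorem sum_ev_clp_weightSum [Nonempty V] (a : Option V → Option (Option V) → K) :
    (∑ S : Set V, if S.Nonempty then ev (clp a S) (weightSum K (Collapse S)) else 0)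
      = a none none * (∑ S : Set V, (∏ u : {u // u ∉ S}, a (some u.1) (some none)) *
          ev (fun (u : {u // u ∈ S}) w => a (some u) (some (w.map Subtype.val)))
            (weightSum K {u // u ∈ S}))
        + ∑ w, (ev a (Lw w (weightSum K V)) - ev a (Lf w (weightSum K V))) := by
  have h := congrArg (fun p => (derivative p).eval 1) (sum_treePoly_clp a)
  simp only [derivative_sum, derivative_add, derivative_C_mul, derivative_sub, eval_add,
    eval_finset_sum, eval_C_mul, eval_sub, derivative_forestPoly] at h
  simp only [ev_weightSum] at h
  simp only [ev_Lw, ev_Lf, ev_weightSum (K := K), ← mul_sub]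
  refine Eq.trans (sum_congr rfl fun S _ => ?_) h
  split_ifs <;> simp [ev_weightSum]

end TreeSum

/-! ### The weighted sums of trees and the corollas in `TRT` -/

theorem ParentFn.isTree_star {V : Type} {p : V → Option V} {r : V} (hr : p r = none)
    (h : ∀ v, v ≠ r → p v = some r) : IsTree p := by
  classical
  refine ⟨⟨r, hr, fun v hv => ?_⟩, fun v => if v = r then 0 else 1, fun u v huv => ?_⟩
  · by_contra hne
    cases (h v hne).symm.trans hv
  · by_cases hu : u = r
    · rw [hu, hr] at huv
      cases huv
    · rw [h u hu] at huv
      cases huv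
      simp [hu]

namespace TreeSum

open Classical Polynomial

variable {K : Type u} [Field K] [CharZero K] {V : Type}

theorem ev_weightSum_of_isEmpty [Fintype V] [IsEmpty V] (b : V → Option V → K) :
    ev b (weightSum K V) = 0 := by
  rw [ev_weightSum_eq_sum]
  refine sum_eq_zero fun T _ => if_neg fun h => ?_
  obtain ⟨r, -⟩ := h.1
  exact isEmptyElim r

theorem ev_weightSum_of_subsingleton [Fintype V] [Subsingleton V] (b : V → Option V → K) (v : V) :
    ev b (weightSum K V) = b v none := by
  have : Unique V := Unique.mk' V (h₁ := ⟨v⟩)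
  have hv : default = v := Subsingleton.elim _ _
  have h : strictPoly K (fun _ : V => none) = X := by
    refine Polynomial.ext_natCast fun n => ?_
    rw [eval_strictPoly, eval_X]
    have : Nat.card {g : V → Fin n // IsStrict (fun _ : V => none) g} = Nat.card (V → Fin n) :=
      Nat.card_congr (Equiv.subtypeUnivEquiv fun g u v h => by cases h)
    rw [this]
    simp
  rw [ev_weightSum_eq_sum, sum_eq_single fun _ => none]
  · rw [if_pos (isTree_star (r := v) rfl fun v hv => (hv (Subsingleton.elim _ _)).elim),
      strictWeight, h]
    simp [hv]
  · intro T _ hT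
    refine if_neg fun h => hT (funext fun v => ?_)
    cases hv : T v with
    | none => rfl
    | some w => exact (h.ne_self v (hv.trans (congrArg some (Subsingleton.elim _ _)))).elim
  · exact fun h => (h (mem_univ _)).elim

end TreeSum

namespace TRT

open Classical TreeSum

theorem not_split_iff {A : Type} [Finite A] (S : Set A) :
    ¬ (2 ≤ Nat.card {x // x ∈ S} ∧ 2 ≤ Nat.card (Collapse S))
      ↔ S = ∅ ∨ S = Set.univ ∨ ∃ v, S = {v} := by
  have h₁ : Nat.card {x // x ∈ S} = S.ncard := rfl
  have h₂ : Nat.card (Collapse S) = Sᶜ.ncard + 1 := by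
    rw [Nat.card_sum, Nat.card_unique (α := Unit)]
    rfl
  have h₃ : Sᶜ.ncard = 0 ↔ S = Set.univ := by
    rw [Set.ncard_eq_zero (Set.toFinite _), Set.compl_empty_iff]
  rw [h₁, h₂, ← Set.ncard_eq_one, ← h₃, ← Set.ncard_eq_zero (Set.toFinite S)]
  omega

theorem sum_set_eq {M : Type*} [AddCommMonoid M] {A : Type} [Fintype A] (hA : 2 ≤ Fintype.card A)
    (f : Set A → M) :
    ∑ S, f S = f ∅ + ∑ v, f {v} + f Set.univ + ∑ S : SplitSubset A, f S.1 := by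
  rw [← Finset.sum_filter_not_add_sum_filter univ
    fun S : Set A => 2 ≤ Nat.card {x // x ∈ S} ∧ 2 ≤ Nat.card (Collapse S)]
  congr 1
  · have hu : (Set.univ : Set A).ncard = Fintype.card A := by
      rw [Set.ncard_univ, Nat.card_eq_fintype_card]
    have h : (univ.filter fun S : Set A =>
        ¬ (2 ≤ Nat.card {x // x ∈ S} ∧ 2 ≤ Nat.card (Collapse S)))
        = insert ∅ (insert Set.univ (univ.image fun v : A => ({v} : Set A))) := by
      ext S
      simp only [mem_filter, mem_univ, true_and, not_split_iff, Finset.mem_insert,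
        mem_image, eq_comm]
    rw [h, Finset.sum_insert, Finset.sum_insert, Finset.sum_image, add_assoc,
      add_comm (f Set.univ)]
    · exact fun u _ v _ h => Set.singleton_injective h
    · simp only [mem_image, mem_univ, true_and, not_exists]
      intro v hv
      have := congrArg Set.ncard hv
      rw [Set.ncard_singleton, hu] at this
      omega
    · simp only [Finset.mem_insert, mem_image, mem_univ, true_and, not_or,
        not_exists]
      refine ⟨fun h => ?_, fun v => Set.singleton_ne_empty v⟩
      have := congrArg Set.ncard h
      rw [Set.ncard_empty, hu] at this
      omega
  · exact Finset.sum_subtype _ (by simp) _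

variable {K : Type u} [Field K] {A : Type} {m n : ℕ} [Fintype A]

/-- The elements of `A/S` other than the collapsed point. -/
def neCollapsed (S : Set A) : {u // u ∉ S} ≃ {x : Collapse S // x ≠ Sum.inr ()} where
  toFun u := ⟨Sum.inl u, Sum.inl_ne_inr⟩
  invFun
    | ⟨Sum.inl u, _⟩ => u
    | ⟨Sum.inr _, h⟩ => (h rfl).elim
  left_inv _ := rfl
  right_inv := by rintro ⟨u | u, h⟩; exacts [rfl, (h rfl).elim]

/-- The vertices of a tree on `A/S`, with the collapsed point moved to `none`. -/
noncomputable def colMark (S : Set A) (m : ℕ) : Option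
    ({u // u ∉ S} ⊕ Fin m) ≃ Collapse S ⊕ Fin m :=
  (optionCongr (sumCongr (neCollapsed S) (Equiv.refl _))).trans (markEquiv (Sum.inr ()) m)

/-- The vertices of the insertion of a tree on `S` into a tree on `A/S`. -/
noncomputable def colJoin (S : Set A) (m n : ℕ) :
    ({u // u ∉ S} ⊕ Fin m) ⊕ ({u // u ∈ S} ⊕ Fin n) ≃ A ⊕ Fin (m + n) :=
  ((sumCongr (sumCongr (neCollapsed S) (Equiv.refl _)) (Equiv.refl _)).trans
    (joinEquiv _ _ m n)).trans (sumCongr (collapseEquiv S) (Equiv.refl _))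

/-- Insertion of a sum of trees on `S` into a sum of trees on `A/S`. -/
noncomputable def colComp (S : Set A) (x : Sums K (Collapse S ⊕ Fin m))
    (y : Sums K ({u // u ∈ S} ⊕ Fin n)) : Sums K (A ⊕ Fin (m + n)) :=
  TreeSum.conj (sumCongr (collapseEquiv S) (Equiv.refl _)) (compSum (Sum.inr ()) x y)

theorem ev_colComp (S : Set A) (x : Sums K (Option ({u // u ∉ S} ⊕ Fin m)))
    (y : Sums K ({u // u ∈ S} ⊕ Fin n)) (a : A ⊕ Fin (m + n) → Option (A ⊕ Fin (m + n)) → K) :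
    ev a (colComp S (TreeSum.conj (colMark S m) x) y)
      = ev (subNone (fun v w => a (colJoin S m n v) (w.map (colJoin S m n))) y) x := by
  have h := insNone_conj (sumCongr (neCollapsed S) (Equiv.refl _)) (Equiv.refl _) x y
  rw [conj_refl] at h
  rw [colComp, colMark, ← TreeSum.conj_conj, compSum_eq, h, TreeSum.conj_conj,
    TreeSum.conj_conj, ev_conj, ev_insNone]
  rfl

/-- The tree with a black root and children labelled by `A`. -/
def star (A : Type) : A ⊕ Fin 1 → Option (A ⊕ Fin 1) :=
  Sum.elim (fun _ => some (Sum.inr 0)) fun _ => none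

theorem isTree_star (A : Type) : IsTree (star A) :=
  ParentFn.isTree_star (r := Sum.inr 0) rfl fun v hv => by
    rcases v with v | i
    · rfl
    · exact (hv (congrArg Sum.inr (Subsingleton.elim _ _))).elim

theorem ev_star (a : A ⊕ Fin 1 → Option (A ⊕ Fin 1) → K) : ev a (single K (star A))
    = a (Sum.inr 0) none * ∏ v, a (Sum.inl v) (some (Sum.inr 0)) := by
  rw [ev_single a (isTree_star A), prod_sum_type, mul_comm]
  simp [star]

/-- Any bijection turns a black star with a marked child into a star. -/
theorem exists_star_eq (S : Set A) : ∃ x : Sums K (Option ({u // u ∉ S} ⊕ Fin 1)),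
    single K (star (Collapse S)) = TreeSum.conj (colMark S 1) x ∧
    ∀ b, ev b x = b none (some (some (Sum.inr 0))) * (b (some (Sum.inr 0)) none *
      ∏ u : {u // u ∉ S}, b (some (Sum.inl u)) (some (some (Sum.inr 0)))) := by
  refine ⟨single K fun v => if v = some (Sum.inr 0) then none else some (some (Sum.inr 0)),
    ?_, fun b => ?_⟩
  · rw [conj_single]
    congr 1
    funext v
    obtain ⟨v, rfl⟩ := (colMark S 1).surjective v
    rw [ParentFn.conj, Equiv.symm_apply_apply]
    rcases v with _ | v | i
    · rfl
    · rfl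
    · obtain rfl := Subsingleton.elim i 0
      rfl
  · rw [ev_single b (ParentFn.isTree_star (r := some (Sum.inr 0)) (if_pos rfl)
      fun v hv => if_neg hv), prod_option, prod_sum_type]
    simp
    ring_nf
    simp

/-- The vertices of a tree with one black vertex. -/
def rootEquiv (A : Type) : Option A ≃ A ⊕ Fin 1 :=
  (optionCongr (sumEmpty A (Fin 0)).symm).trans (splitEquiv A 0)

/-- The restriction of a matrix along `rootEquiv`. -/
def pull (a : A ⊕ Fin 1 → Option (A ⊕ Fin 1) → K) : Option A → Option (Option A) → K :=
  fun v w => a (rootEquiv A v) (w.map (rootEquiv A))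

variable [CharZero K]

theorem ev_colComp_weightSum_star (S : Set A) (a : A ⊕ Fin 1 → Option (A ⊕ Fin 1) → K) :
    ev a (colComp (m := 0) (n := 1) S (weightSum K (Collapse S ⊕ Fin 0)) (single K (star _)))
      = ev (clp (pull a) S) (weightSum K (Collapse S)) := by
  rw [← conj_weightSum (colMark S 0), ev_colComp (m := 0) (n := 1),
    ← conj_weightSum ((colMark S 0).trans (sumEmpty _ _)), ev_conj]
  refine ev_congr _ ?_
  rintro (_ | u | i) (_ | _ | w | j) h
  · simp only [subNone, ev_star]; rfl
  · simp at h
  · simp only [subNone, ev_star]; rfl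
  · exact j.elim0
  · rfl
  · simp only [subNone, sum_sum_type, univ_unique, sum_singleton]
    exact add_comm _ _
  · rfl
  · exact j.elim0
  all_goals exact i.elim0

theorem ev_colComp_star_weightSum (S : Set A) (a : A ⊕ Fin 1 → Option (A ⊕ Fin 1) → K) :
    ev a (colComp (m := 1) (n := 0) S (single K (star _)) (weightSum K ({u // u ∈ S} ⊕ Fin 0)))
      = pull a none none * ((∏ u : {u // u ∉ S}, pull a (some u.1) (some none)) *
          ev (fun (u : {u // u ∈ S}) w => pull a (some u) (some (w.map Subtype.val)))
            (weightSum K {u // u ∈ S})) := by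
  obtain ⟨x, hx, hx'⟩ := exists_star_eq (K := K) S
  rw [hx, ev_colComp (m := 1) (n := 0), hx', ← conj_weightSum (sumEmpty {u // u ∈ S} (Fin 0)),
    ev_conj]
  rw [mul_comm, mul_assoc]
  congr 2
  simp only [subNone]
  refine ev_congr _ ?_
  rintro (u | i) (_ | w | j) h
  · rfl
  · rfl
  · exact j.elim0
  all_goals exact i.elim0

theorem ev_clp_singleton (b : Option A → Option (Option A) → K) (v : A) :
    ev (clp b {v}) (weightSum K (Collapse {v})) = ev b (Up v (weightSum K A)) := by
  let e : Collapse ({v} : Set A) ≃ A :=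
    ((Equiv.sumComm _ _).trans (sumCongr (Equiv.ofUnique Unit {x // x ∈ ({v} : Set A)})
      (Equiv.refl _))).trans (Equiv.sumCompl (· ∈ ({v} : Set A)))
  have he (u : {u // u ∉ ({v} : Set A)}) : e (Sum.inl u) = u := rfl
  have he' (i) : e (Sum.inr i) = v := rfl
  have hne (u : {u // u ∉ ({v} : Set A)}) : (u : A) ≠ v := u.2
  rw [ev_Up, ← conj_weightSum e, ev_conj]
  refine ev_congr _ ?_
  rintro (u | i) (_ | w | j) h
  · simp [clp, upp, low, he, hne u]
  · simp [clp, upp, low, he, hne u, hne w]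
  · simp [clp, upp, low, he, he', hne u, add_comm]
  · simp [clp, upp, he', mul_comm]
  · simp [clp, upp, he, he', mul_comm]
  · simp at h

theorem ev_DM_weightSum (hA : 2 ≤ Fintype.card A) (a : A ⊕ Fin 1 → Option (A ⊕ Fin 1) → K) :
    ev (pull a) (DM (fun _ => 1) (weightSum K A))
      + ((Fintype.card A : K) - 1) * ev a (single K (star A))
      = ∑ S : SplitSubset A, (ev (clp (pull a) S.1) (weightSum K (Collapse S.1))
        - pull a none none * ((∏ u : {u // u ∉ S.1}, pull a (some u.1) (some none)) *
          ev (fun (u : {u // u ∈ S.1}) w => pull a (some u) (some (w.map Subtype.val)))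
            (weightSum K {u // u ∈ S.1}))) := by
  have : Nonempty A := Fintype.card_pos_iff.1 (by omega)
  let f (S : Set A) : K := ev (clp (pull a) S) (weightSum K (Collapse S))
  let g (S : Set A) : K := pull a none none * ((∏ u : {u // u ∉ S}, pull a (some u.1) (some none)) *
    ev (fun (u : {u // u ∈ S}) w => pull a (some u) (some (w.map Subtype.val)))
      (weightSum K {u // u ∈ S}))
  -- in the identity for all subsets of `A`, the sets with less than two elements and `A` itself
  -- give corollas, the splittings of a parent, and the new root
  have hu (S : Set A) (hS : S = Set.univ) : f S = ev a (single K (star A)) := by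
    have : IsEmpty {u : A // u ∉ S} := ⟨fun u => u.2 (hS ▸ Set.mem_univ u.1)⟩
    have : Subsingleton (Collapse S) := (Equiv.emptySum _ Unit).subsingleton
    simp only [f]
    rw [ev_weightSum_of_subsingleton _ (Sum.inr ()), ev_star]
    refine congrArg (a (Sum.inr 0) none * ·) (prod_equiv (Equiv.subtypeUnivEquiv fun u =>
      hS ▸ Set.mem_univ u) _ _ fun _ => rfl)
  have hs' : ∑ S : SplitSubset A, (if S.1.Nonempty then f S.1 else 0)
      = ∑ S : SplitSubset A, f S.1 := by
    refine sum_congr rfl fun S _ => if_pos (Set.nonempty_iff_ne_empty.2 fun h => ?_)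
    have := S.2.1
    rw [h] at this
    simp at this
  have hv (v : A) (S : Set A) (hS : S = {v}) : g S = ev a (single K (star A)) := by
    have : Unique {u // u ∈ S} := hS ▸ (inferInstance : Unique {u // u ∈ ({v} : Set A)})
    simp only [g]
    rw [ev_weightSum_of_subsingleton _ default, ev_star]
    have h := Fintype.prod_subtype_mul_prod_subtype (· ∈ S) fun u => a (Sum.inl u) (some
      (Sum.inr 0))
    rw [← h, mul_comm (∏ u, _)]
    simp only [univ_unique, Finset.prod_singleton]
    rfl
  have hR (S : Set A) (hS : S = Set.univ) : g S = ev (pull a) (Rt (weightSum K A)) := by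
    have : IsEmpty {u : A // u ∉ S} := ⟨fun u => u.2 (hS ▸ Set.mem_univ u.1)⟩
    simp only [g]
    rw [ev_Rt, ← conj_weightSum (Equiv.subtypeUnivEquiv fun u => hS ▸ Set.mem_univ u :
      {u // u ∈ S} ≃ A),
      ev_conj, Finset.univ_eq_empty, prod_empty, one_mul]
    refine congrArg _ (ev_congr _ fun u w _ => ?_)
    cases w <;> rfl
  have h0 (S : Set A) (hS : S = ∅) : g S = 0 := by
    have : IsEmpty {u // u ∈ S} := ⟨fun u => Set.notMem_empty u.1 (hS ▸ u.2)⟩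
    simp only [g]
    rw [ev_weightSum_of_isEmpty, mul_zero, mul_zero]
  have key : (∑ S : Set A, if S.Nonempty then f S else 0) = (∑ S, g S)
      + ∑ w, (ev (pull a) (Lw w (weightSum K A)) - ev (pull a) (Lf w (weightSum K A))) := by
    rw [← mul_sum]
    exact sum_ev_clp_weightSum (pull a)
  have hf (v : A) : f {v} = ev (pull a) (Up v (weightSum K A)) := ev_clp_singleton _ _
  rw [sum_set_eq hA, sum_set_eq hA] at key
  simp only [Set.not_nonempty_empty, if_false, Set.singleton_nonempty, if_true,
    Set.univ_nonempty, hf, zero_add] at key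
  rw [hu _ rfl, hs', h0 _ rfl, sum_congr rfl fun v _ => hv v _ rfl, hR _ rfl, Finset.sum_const,
    card_univ,
    nsmul_eq_mul, sum_sub_distrib] at key
  change _ = ∑ S : SplitSubset A, (f S.1 - g S.1)
  rw [DM_apply, sum_sub_distrib]
  simp only [map_add, map_sum, map_sub, one_smul, sum_sub_distrib]
  linear_combination -key

theorem ev_dSum_weightSum (a : A ⊕ Fin 1 → Option (A ⊕ Fin 1) → K) :
    ev a (dSum (m := 0) (weightSum K (A ⊕ Fin 0)))
      = ev (pull a) (DM (fun _ => 1) (weightSum K A)) := by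
  rw [dSum_apply, ← conj_weightSum (sumEmpty A (Fin 0)).symm, DM_conj, TreeSum.conj_conj,
    ev_conj]
  rfl

/-- The differential of the weighted sum of all trees. -/
theorem dSum_weightSum (hA : 2 ≤ Fintype.card A) :
    (dSum (weightSum K (A ⊕ Fin 0)) + ((Fintype.card A : K) - 1) • single K (star A) :
      Sums K (A ⊕ Fin 1)) = ∑ S : SplitSubset A,
        (colComp (m := 0) (n := 1) S.1 (weightSum K (Collapse S.1 ⊕ Fin 0)) (single K (star _))
          - colComp (m := 1) (n := 0) S.1 (single K (star _))
            (weightSum K ({u // u ∈ S.1} ⊕ Fin 0)) : Sums K (A ⊕ Fin 1)) := by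
  refine ext_ev fun a => ?_
  rw [map_add, map_smul, map_sum]
  refine (congrArg₂ (· + ·) (ev_dSum_weightSum a) rfl).trans ((ev_DM_weightSum hA a).trans ?_)
  refine sum_congr rfl fun S _ => ?_
  rw [map_sub]
  exact (congrArg₂ (· - ·) (ev_colComp_weightSum_star S.1 a)
    (ev_colComp_star_weightSum S.1 a)).symm

end TRT

/-! ### The corollas and their homotopy to zero -/

namespace TRT

open Classical TreeSum

variable {K : Type u} [Field K] {A : Type}

section

variable [Fintype A]

theorem ev_colComp_star_star (S : Set A) (a : A ⊕ Fin 2 → Option (A ⊕ Fin 2) → K) :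
    ev a (colComp (m := 1) (n := 1) S (single K (star _)) (single K (star _)))
      = a (Sum.inr 0) none * a (Sum.inr 1) (some (Sum.inr 0)) *
        ∏ v, a (Sum.inl v) (some (Sum.inr (if v ∈ S then 1 else 0))) := by
  obtain ⟨x, hx, hx'⟩ := exists_star_eq (K := K) S
  rw [hx, ev_colComp (m := 1) (n := 1), hx', ← Fintype.prod_subtype_mul_prod_subtype (· ∈ S)]
  have h₁ : ∏ v : {u // u ∈ S}, a (Sum.inl v) (some (Sum.inr (if v.1 ∈ S then 1 else 0)))
      = ∏ v : {u // u ∈ S}, a (Sum.inl v) (some (Sum.inr 1)) :=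
    prod_congr rfl fun v _ => by rw [if_pos v.2]
  have h₂ : ∏ v : {u // u ∉ S}, a (Sum.inl v) (some (Sum.inr (if v.1 ∈ S then 1 else 0)))
      = ∏ v : {u // u ∉ S}, a (Sum.inl v) (some (Sum.inr 0)) :=
    prod_congr rfl fun v _ => by rw [if_neg v.2]
  simp only [subNone, ev_star]
  refine Eq.trans ?_ (congrArg _ (congrArg₂ (· * ·) h₁ h₂)).symm
  refine Eq.trans (mul_assoc _ _ _) (Eq.trans ?_ (mul_assoc _ _ _).symm)
  refine Eq.trans ?_ (mul_left_comm _ _ _)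
  refine congrArg (_ * ·) ?_
  exact mul_left_comm _ _ _

/-- The differential of the corolla with black root. In the last two terms, which cancel by the sign
rule for the black vertices, all children of the root have moved to a second black vertex. -/
theorem dSum_star (hA : 2 ≤ Fintype.card A) :
    (dSum (single K (star A)) : Sums K (A ⊕ Fin 2))
      = (∑ S : SplitSubset A, black A (swap 0 1)
          (colComp (m := 1) (n := 1) S.1 (single K (star _)) (single K (star _))))
        + (TreeSum.conj (splitEquiv A 1) (Rt (single K (star A)))
          + black A (swap 0 1) (TreeSum.conj (splitEquiv A 1) (Rt (single K (star A))))) := by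
  refine ext_ev fun a => ?_
  -- the polynomial of the tree whose root has as children the other black vertex, with children
  -- `S`, and the numbered vertices outside `S`
  let P (S : Set A) : K := a (Sum.inr 1) none * a (Sum.inr 0) (some (Sum.inr 1)) *
    ∏ v, a (Sum.inl v) (some (Sum.inr (if v ∈ S then 0 else 1)))
  let b : Option (A ⊕ Fin 1) → Option (Option (A ⊕ Fin 1)) → K :=
    fun v w => a (splitEquiv A 1 v) (w.map (splitEquiv A 1))
  have hRt : ev b (Rt (single K (star A))) = a (Sum.inr 0) none *
      (a (Sum.inr 1) (some (Sum.inr 0)) * ∏ v, a (Sum.inl v) (some (Sum.inr 1))) := by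
    rw [ev_Rt, ev_star]
    rfl
  have hRt' : ev a (black A (swap 0 1)
      (TreeSum.conj (splitEquiv A 1) (Rt (single K (star A))))) = P Set.univ := by
    rw [black, ev_conj, ev_conj, ev_Rt, ev_star]
    refine (mul_assoc _ _ _).symm.trans (congrArg _ (prod_congr rfl fun v _ => ?_))
    rw [if_pos (Set.mem_univ v)]
    rfl
  have hS (S : Set A) : ev a (black A (swap 0 1)
      (colComp (m := 1) (n := 1) S (single K (star _)) (single K (star _)))) = P S := by
    rw [black, ev_conj, ev_colComp_star_star]
    refine congrArg _ (prod_congr rfl fun v _ => ?_)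
    split_ifs <;> rfl
  have hLw : ev b (Lw (Sum.inr 0) (single K (star A))) = ∑ S, P S := by
    rw [ev_Lw, ev_star]
    simp only [P, ← mul_sum]
    have := prod_add_eq_sum_set (fun v => a (Sum.inl v) (some (Sum.inr 1)))
      fun v => a (Sum.inl v) (some (Sum.inr 0))
    have e (S : Set A) : ∏ v, a (Sum.inl v) (some (Sum.inr (if v ∈ S then 0 else 1)))
        = ∏ v, if v ∈ S then a (Sum.inl v) (some (Sum.inr 0))
          else a (Sum.inl v) (some (Sum.inr 1)) :=
      prod_congr rfl fun v _ => by split_ifs <;> rfl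
    rw [sum_congr rfl fun S _ => e S, ← this, mul_comm (a (Sum.inr 1) none), mul_assoc]
    simp [low, b, splitEquiv]
  have hLf : ev b (Lf (Sum.inr 0) (single K (star A))) = P ∅ := by
    rw [ev_Lf, ev_star]
    simp [P, b, splitEquiv]
    ring
  have hL (v : A) : ev b (Lw (Sum.inl v) (single K (star A)))
      = ev b (Lf (Sum.inl v) (single K (star A))) := by
    rw [ev_Lf, ev_Lw, ev_star, ev_star]
    simp [low]
  have hU (v : A) : ev b (Up (Sum.inl v) (single K (star A))) = P {v} := by
    rw [ev_Up, ev_star]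
    have e : ∏ u, a (Sum.inl u) (some (Sum.inr (if u ∈ ({v} : Set A) then 0 else 1)))
        = a (Sum.inl v) (some (Sum.inr 0)) *
          ∏ u ∈ univ.erase v, a (Sum.inl u) (some (Sum.inr 1)) := by
      rw [← mul_prod_erase _ _ (mem_univ v)]
      simp only [Set.mem_singleton_iff, if_true]
      refine congrArg _ (prod_congr rfl fun u hu => ?_)
      rw [if_neg (ne_of_mem_erase hu)]
    have e' : ∏ u, upp b (Sum.inl v) (Sum.inl u) (some (Sum.inr 0))
        = (a (Sum.inl v) (some (Sum.inr 0)) * a (Sum.inr 0) (some (Sum.inr 1))) *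
          ∏ u ∈ univ.erase v, a (Sum.inl u) (some (Sum.inr 1)) := by
      rw [← mul_prod_erase _ _ (mem_univ v)]
      congr 1
      · simp [upp, b, splitEquiv]
      · refine prod_congr rfl fun u hu => ?_
        simp [upp, low, b, splitEquiv, ne_of_mem_erase hu]
    have e'' : upp b (Sum.inl v) (Sum.inr 0) none = a (Sum.inr 1) none := by
      simp [upp, low, b, splitEquiv]
    rw [e', e'']
    refine Eq.trans ?_ (congrArg (a (Sum.inr 1) none * a (Sum.inr 0) (some (Sum.inr 1)) * ·) e).symm
    ring
  rw [map_add, map_add, map_sum, hRt', sum_congr rfl fun (S : SplitSubset A) _ => hS S.1,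
    ev_conj, dSum_apply, ev_conj]
  change ev b _ = _ + (ev b _ + _)
  rw [DM_apply, sum_sum_type]
  simp only [map_add, map_sub, map_sum, map_smul, hL, hU, hLw, hLf, hRt, Sum.elim_inl,
    Sum.elim_inr, one_smul, zero_smul, univ_unique, sum_singleton, sub_self, zero_sub,
    sum_neg_distrib, sum_set_eq hA, Fin.default_eq_zero,
    map_zero]
  ring

theorem isAdm_star (hA : 2 ≤ Nat.card A) : IsAdm (star A) := by
  refine ⟨isTree_star A, fun i => hA.trans ?_⟩
  refine Nat.card_le_card_of_injective (fun v => ⟨Sum.inl v, ?_⟩) fun u v h => ?_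
  · exact congrArg (some <| Sum.inr ·) (Subsingleton.elim 0 i)
  · exact Sum.inl_injective (congrArg Subtype.val h)

theorem star_mem_goodSums (hA : 2 ≤ Nat.card A) : single K (star A) ∈ goodSums K A 1 :=
  mem_goodSums_of_isAdm (isAdm_star hA)

theorem weightSum_mem_goodSums : weightSum K (A ⊕ Fin 0) ∈ goodSums K A 0 := by
  refine Submodule.sum_mem _ fun T _ => Submodule.smul_mem _ _ ?_
  by_cases hT : IsTree T
  · exact mem_goodSums_of_isAdm ⟨hT, fun i => i.elim0⟩
  · rw [single_of_not_isTree hT]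
    exact Submodule.zero_mem _

theorem corolla_eq : corolla K A = ofSum (m := 1) rfl (single K (star A)) :=
  (ofSum_single' _ _).symm

end

variable (K A) in
/-- The weighted sum of all trees without black vertices, as an element of `TRT(A)`. -/
noncomputable def treeWeight [Finite A] : (TRT K).obj A (-1 + 1) :=
  letI := ofFinite A
  ofSum (m := 0) rfl (weightSum K (A ⊕ Fin 0))

theorem treeWeight_eq [Fintype A] :
    treeWeight K A = ofSum (k := -1 + 1) (m := 0) rfl (weightSum K (A ⊕ Fin 0)) := by
  rw [treeWeight, Subsingleton.elim (ofFinite A) ‹_›]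

theorem map_corolla {B : Type} [Finite A] [Finite B] (hA : 2 ≤ Nat.card A) (e : A ≃ B) :
    (TRT K).map e (corolla K A) = corolla K B := by
  have := ofFinite A
  have := ofFinite B
  rw [corolla_eq, corolla_eq, TRT_map_ofSum _ e (star_mem_goodSums hA), conj_single]
  congr 2
  funext v
  obtain ⟨v, rfl⟩ := (sumCongr e (Equiv.refl _)).surjective v
  rw [ParentFn.conj, Equiv.symm_apply_apply]
  rcases v with v | i <;> rfl

theorem card_collapse [Finite A] (S : Set A) :
    Nat.card (Collapse S) + Nat.card {x // x ∈ S} = Nat.card A + 1 := by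
  rw [Nat.card_sum, Nat.card_unique (α := Unit), ← Nat.card_congr (Equiv.sumCompl (· ∈ S)),
    Nat.card_sum]
  omega

variable [CharZero K]

theorem map_treeWeight {B : Type} [Finite A] [Finite B] (e : A ≃ B) :
    (TRT K).map e (treeWeight K A) = treeWeight K B := by
  have := ofFinite A
  have := ofFinite B
  rw [treeWeight_eq, treeWeight_eq, TRT_map_ofSum _ e weightSum_mem_goodSums, conj_weightSum]

theorem d_corolla [Fintype A] (hA : 2 ≤ Nat.card A) :
    (TRT K).d (k := -2) (corolla K A) = -∑ S : SplitSubset A, (TRT K).map (collapseEquiv S.1)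
      ((TRT K).comp (k := -1) (l := -1) (n := -2) (Sum.inr ()) (by norm_num)
        (corolla K (Collapse S.1)) (corolla K {x // x ∈ S.1})) := by
  have hc : corolla K A = ofSum (k := -2 + 1) (m := 1) rfl (single K (star A)) := corolla_eq
  have h := dSum_star (K := K) (hA.trans_eq Nat.card_eq_fintype_card)
  have hs : ((invSign (swap (0 : Fin 2) 1) : ℤ) : K) = -1 := by
    rw [invSign_eq_sign, Equiv.Perm.sign_swap (by decide)]
    simp
  have hm : ((1 + 1 : ℕ) : ℤ) = -(-2) := rfl
  rw [hc, TRT_d_ofSum _ (star_mem_goodSums hA)]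
  refine (congrArg (ofSum hm) h).trans ?_
  rw [map_add, map_add, map_sum, ofSum_black hm hm, hs, neg_one_smul, add_neg_cancel, add_zero,
    ← sum_neg_distrib]
  refine sum_congr rfl fun S _ => ?_
  rw [ofSum_black hm hm, hs, neg_one_smul, corolla_eq, corolla_eq,
    TRT_comp_ofSum _ _ _ _ (star_mem_goodSums S.2.2) (star_mem_goodSums S.2.1),
    TRT_map_ofSum _ _ (compSum_mem_goodSums _ (star_mem_goodSums S.2.2) (star_mem_goodSums S.2.1))]
  rfl

theorem d_treeWeight [Fintype A] (hA : 2 ≤ Nat.card A) :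
    (TRT K).d (k := -1) (treeWeight K A) + ((Nat.card A : K) - 1) • corolla K A
      = ∑ S : SplitSubset A, (TRT K).map (collapseEquiv S.1)
        ((TRT K).comp (k := -1 + 1) (l := -1) (n := -2 + 1) (Sum.inr ()) (by norm_num)
          (treeWeight K (Collapse S.1)) (corolla K {x // x ∈ S.1}))
      - ∑ S : SplitSubset A, (TRT K).map (collapseEquiv S.1)
        ((TRT K).comp (k := -1) (l := -1 + 1) (n := -2 + 1) (Sum.inr ()) (by norm_num)
          (corolla K (Collapse S.1)) (treeWeight K {x // x ∈ S.1})) := by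
  have hm : ((0 + 1 : ℕ) : ℤ) = -(-1) := rfl
  have h := congrArg (ofSum hm) (dSum_weightSum (K := K) (hA.trans_eq Nat.card_eq_fintype_card))
  rw [← sum_sub_distrib]
  refine Eq.trans ?_ (h.trans ((map_sum (ofSum hm) _ _).trans (sum_congr rfl fun S _ => ?_)))
  · rw [treeWeight_eq, TRT_d_ofSum _ weightSum_mem_goodSums, corolla_eq, Nat.card_eq_fintype_card]
    exact ((map_add (ofSum hm) _ _).trans (congrArg _ (map_smul (ofSum hm) _ _))).symm
  · rw [treeWeight_eq, treeWeight_eq, corolla_eq, corolla_eq,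
      TRT_comp_ofSum _ _ _ _ weightSum_mem_goodSums (star_mem_goodSums S.2.1),
      TRT_comp_ofSum _ _ _ _ (star_mem_goodSums S.2.2) weightSum_mem_goodSums,
      TRT_map_ofSum _ _ (compSum_mem_goodSums _ weightSum_mem_goodSums (star_mem_goodSums S.2.1)),
      TRT_map_ofSum _ _ (compSum_mem_goodSums _ (star_mem_goodSums S.2.2) weightSum_mem_goodSums)]
    exact map_sub (ofSum hm) _ _

end TRT

namespace DGOperadData

variable {K : Type u} [Field K] {M : Type v} [AddCommGroup M] [Module K M]

/-- The element `p(t) x` of `M[t]`, as a linear function of `x`. -/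
noncomputable def polySmulLin (p : Polynomial K) : M →ₗ[K] (ℕ →₀ M) where
  toFun x := polySmul x p
  map_add' x y := by
    induction p using Polynomial.induction_on' with
    | add p q hp hq => simp only [map_add, hp, hq]; abel
    | monomial i c => simp [polySmul_monomial]
  map_smul' c x := by
    induction p using Polynomial.induction_on' with
    | add p q hp hq => simp only [map_add, hp, hq, smul_add]
    | monomial i c' => simp [polySmul_monomial, smul_comm c]

theorem polySmulLin_apply (p : Polynomial K) (x : M) : polySmulLin p x = polySmul x p := rfl

open Polynomial in
theorem polySmulLin_derivative {r : ℕ} (hr : 2 ≤ r) (x y : M) :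
    polySmul x (derivative ((1 - X : K[X]) ^ (r - 1))) - polySmul y ((1 - X : K[X]) ^ (r - 2))
      = -polySmulLin ((1 - X : K[X]) ^ (r - 2)) (y + ((r : K) - 1) • x) := by
  have e : ((r - 1 : ℕ) : K) = (r : K) - 1 := by
    rw [Nat.cast_sub (by omega), Nat.cast_one]
  have h : derivative ((1 - X : K[X]) ^ (r - 1)) = -(((r : K) - 1) • (1 - X : K[X]) ^ (r - 2)) := by
    rw [derivative_pow, e, Nat.sub_sub, derivative_sub, derivative_one, derivative_X, zero_sub,
      Polynomial.smul_eq_C_mul]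
    ring
  rw [h, map_neg, map_smul, map_add, map_smul, polySmulLin_apply, polySmulLin_apply, neg_add,
    add_comm, ← sub_eq_add_neg, neg_sub_left, neg_add, ← sub_eq_add_neg]

end DGOperadData

namespace TRT

open Classical DGOperadData HoLieTwo Polynomial

variable {K : Type u} [Field K] [CharZero K]

theorem path_d {Q : DGOperadData.{u, u} K} {A : Type} [Finite A] {k : ℤ}
    (p : ℕ →₀ Q.obj A (k + 1)) (q : ℕ →₀ Q.obj A (k + 1 + 1)) :
    Q.path.d (show Q.path.obj A (k + 1) from (p, q))
      = (mapRange.linearMap Q.d p, polyDeriv (K := K) p - mapRange.linearMap Q.d q) :=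
  rfl

theorem path_map {Q : DGOperadData.{u, u} K} {A B : Type} [Finite A] [Finite B] {k : ℤ}
    (e : A ≃ B) (p : ℕ →₀ Q.obj A k) (q : ℕ →₀ Q.obj A (k + 1)) :
    Q.path.map e (show Q.path.obj A k from (p, q))
      = (mapRange.linearMap (Q.map e) p, mapRange.linearMap (Q.map e) q) :=
  rfl

variable (K) in
/-- The value of the homotopy on the corolla: the corolla `c` with `r` children and the weighted sum
`h` of trees give `(1 - t)^(r-1) c + dt (1 - t)^(r-2) h`. -/
noncomputable def contractionNu (A : Type) [Finite A] : (TRT K).path.obj A (-1) :=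
  (polySmul (corolla K A) ((1 - X : K[X]) ^ (Nat.card A - 1)),
    polySmul (treeWeight K A) ((1 - X : K[X]) ^ (Nat.card A - 2)))

theorem comp_contractionNu {A : Type} [Finite A] (S : SplitSubset A) :
    (TRT K).path.map (collapseEquiv S.1)
      ((TRT K).path.comp (k := -1) (l := -1) (n := -2) (Sum.inr ()) (by norm_num)
        (contractionNu K (Collapse S.1)) (contractionNu K {x // x ∈ S.1}))
      = (polySmulLin ((1 - X : K[X]) ^ (Nat.card A - 1)) ((TRT K).map (collapseEquiv S.1)
          ((TRT K).comp (k := -1) (l := -1) (n := -2) (Sum.inr ()) (by norm_num)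
            (corolla K _) (corolla K _))),
        polySmulLin ((1 - X : K[X]) ^ (Nat.card A - 2)) ((TRT K).map (collapseEquiv S.1)
          ((TRT K).comp (k := -1 + 1) (l := -1) (n := -2 + 1) (Sum.inr ()) (by norm_num)
            (treeWeight K _) (corolla K _)) - (TRT K).map (collapseEquiv S.1)
          ((TRT K).comp (k := -1) (l := -1 + 1) (n := -2 + 1) (Sum.inr ()) (by norm_num)
            (corolla K _) (treeWeight K _)))) := by
  have h := card_collapse S.1
  have h₁ := S.2.1
  have h₂ := S.2.2
  have hk : ksgn K (-1) = -1 := by rw [ksgn_neg, ksgn_one]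
  -- the truncated subtractions are harmless because `S` and `A/S` have at least two elements
  have e₁ : Nat.card (Collapse S.1) - 1 + (Nat.card {x // x ∈ S.1} - 1) = Nat.card A - 1 := by
    omega
  have e₂ : Nat.card (Collapse S.1) - 2 + (Nat.card {x // x ∈ S.1} - 1) = Nat.card A - 2 := by
    omega
  have e₃ : Nat.card (Collapse S.1) - 1 + (Nat.card {x // x ∈ S.1} - 2) = Nat.card A - 2 := by
    omega
  rw [contractionNu, contractionNu, path_comp, polyMul_polySmul, polyMul_polySmul,
    polyMul_polySmul, hk, neg_one_smul, ← pow_add, ← pow_add, ← pow_add, e₁, e₂, e₃,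
    path_map, map_add, map_neg, mapRange_polySmul, mapRange_polySmul, mapRange_polySmul, map_sub,
    polySmulLin_apply, polySmulLin_apply, polySmulLin_apply]
  exact Prod.ext rfl (sub_eq_add_neg _ _).symm

/-- The homotopy between the corollas and zero, on the generators of `hoLie₂`. -/
noncomputable def contraction : Generators (TRT K).path where
  nu A _ _ := contractionNu K A
  map_nu {A B} _ _ hA hB e := by
    rw [contractionNu, path_map, mapRange_polySmul, mapRange_polySmul, map_corolla hA,
      map_treeWeight, Nat.card_congr e, contractionNu]
  d_nu {A} _ hA := by
    have := ofFinite A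
    rw [finsum_eq_sum_of_fintype]
    rw [sum_congr rfl fun S _ => comp_contractionNu S]
    refine (path_d (k := -2) _ _).trans (Prod.ext ?_ ?_)
    · refine Eq.trans ?_ (congrArg Neg.neg (map_sum (LinearMap.fst K _ _) _ _)).symm
      refine ((mapRange_polySmul _ _ _).trans (polySmulLin_apply _ _).symm).trans ?_
      rw [d_corolla hA, map_neg, map_sum]
      rfl
    · refine Eq.trans ?_ (congrArg Neg.neg (map_sum (LinearMap.snd K _ _) _ _)).symm
      refine (congrArg₂ (· - ·) (polyDeriv_polySmul _ _) (mapRange_polySmul _ _ _)).trans ?_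
      refine (polySmulLin_derivative hA _ _).trans (congrArg Neg.neg ?_)
      rw [d_treeWeight hA, ← sum_sub_distrib, map_sum]
      rfl

/-- The homotopy of operads exists because both ends are determined by their values on the
generators, where `treeHomotopy` interpolates between the corollas and zero. -/
theorem hoLieTwo_homotopy : (hoLieTwo K).IsDGOperad ∧ (TRT K).IsDGOperad ∧
    (∃! φ : DGOperadData.Hom (hoLieTwo K) (TRT K), SendsToCorolla φ) ∧
    (∃! ψ : DGOperadData.Hom (hoLieTwo K) (TRT K), KillsGenerators ψ) ∧
    ∀ φ ψ : DGOperadData.Hom (hoLieTwo K) (TRT K), SendsToCorolla φ → KillsGenerators ψ →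
      DGOperadData.Homotopic φ ψ := by
  have hT : (TRT K).IsDGOperad := isDGOperad
  let F : DGOperadData.Hom (hoLieTwo K) (TRT K).path := lift hT.path contraction
  let ev (c : K) : DGOperadData.Hom (hoLieTwo K) (TRT K) := (pathEvalHom (TRT K) c).comp F
  have hev (c : K) (A : Type) [Finite A] (hA : 2 ≤ Nat.card A) :
      (ev c).app A (-1) (hoLieTwo.nu K A hA) = (1 - c) ^ (Nat.card A - 1) • corolla K A := by
    have h : (ev c).app A (-1) (hoLieTwo.nu K A hA)
        = polyEval c (F.app A (-1) (hoLieTwo.nu K A hA)).1 := rfl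
    have hF : F.app A (-1) (hoLieTwo.nu K A hA) = contractionNu K A := lift_nu hT.path _ A hA
    rw [h, hF]
    refine (polyEval_polySmul c ((1 - X : K[X]) ^ (Nat.card A - 1)) (corolla K A)).trans ?_
    simp
  have h₀ : SendsToCorolla (ev 0) := fun A _ hA => by
    rw [hev]
    simp
  have h₁ : KillsGenerators (ev 1) := fun A _ hA => by
    rw [hev, sub_self, zero_pow (by omega), zero_smul]
  have u₀ (φ : DGOperadData.Hom (hoLieTwo K) (TRT K)) (h : SendsToCorolla φ) : φ = ev 0 :=
    hom_ext fun A _ hA => (h A hA).trans (h₀ A hA).symm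
  have u₁ (ψ : DGOperadData.Hom (hoLieTwo K) (TRT K)) (h : KillsGenerators ψ) : ψ = ev 1 :=
    hom_ext fun A _ hA => (h A hA).trans (h₁ A hA).symm
  refine ⟨HoLieTwo.isDGOperad K, hT, ⟨ev 0, h₀, u₀⟩, ⟨ev 1, h₁, u₁⟩, fun φ ψ hφ hψ => ?_⟩
  rw [u₀ φ hφ, u₁ ψ hψ]
  exact ⟨F, fun A _ k x => ⟨rfl, rfl⟩⟩

end TRT

/-! ### Graded pre-Lie algebras on homogeneous elements -/

namespace DGPreLie

variable {K : Type u} [Field K] {g : Type v} [AddCommGroup g] [Module K g]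
  {𝒢 : ℤ → Submodule K g} (L : DGPreLie K 𝒢)

section

variable [DirectSum.Decomposition 𝒢]

theorem scaleBy_apply (c : ℤ → K) {k : ℤ} {x : g} (hx : x ∈ 𝒢 k) :
    scaleBy 𝒢 c x = c k • x := by
  have : scaleBy 𝒢 c x = (DirectSum.decompose 𝒢).symm
      (DirectSum.lmap (fun k => c k • (LinearMap.id : 𝒢 k →ₗ[K] 𝒢 k))
        (DirectSum.decompose 𝒢 x)) := rfl
  rw [this, DirectSum.decompose_of_mem 𝒢 hx]
  change (DirectSum.decompose 𝒢).symm (DirectSum.lmap _ (DirectSum.lof K ℤ (fun k => 𝒢 k) k _)) = _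
  rw [DirectSum.lmap_lof]
  exact DirectSum.decompose_symm_of 𝒢 _

theorem gradeSign_apply {k : ℤ} {x : g} (hx : x ∈ 𝒢 k) : gradeSign 𝒢 x = ksgn K k • x :=
  scaleBy_apply _ hx

theorem eq_zero_of_eq_neg_self (K : Type u) [Field K] [CharZero K] {V : Type v} [AddCommGroup V]
    [Module K V] {z : V} (h : z = -z) : z = 0 := by
  have h' : (2 : K) • z = 0 := by rw [two_smul]; nth_rw 1 [h]; exact neg_add_cancel z
  exact (smul_eq_zero.1 h').resolve_left two_ne_zero

theorem ksgn_of_even {k : ℤ} (hk : Even k) : ksgn K k = 1 := by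
  rw [ksgn, Int.negOnePow_even _ hk]
  simp

theorem ksgn_of_odd {k : ℤ} (hk : ¬ Even k) : ksgn K k = -1 := by
  rw [ksgn, Int.negOnePow_odd _ (Int.not_even_iff_odd.1 hk)]
  simp

theorem ksgn_mul_of_odd {k : ℤ} (hk : ¬ Even k) (l : ℤ) : ksgn K (k * l) = ksgn K l := by
  by_cases hl : Even l
  · rw [ksgn_of_even hl, ksgn_of_even (hl.mul_left k)]
  · rw [ksgn_of_odd hl, ksgn_of_odd (by simp [Int.even_mul, hk, hl])]

theorem ksgn_sum {ι : Type*} (s : Finset ι) (k : ι → ℤ) :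
    ksgn K (∑ i ∈ s, k i) = ∏ i ∈ s, ksgn K (k i) := by
  classical
  induction s using Finset.induction_on with
  | empty => simp [ksgn_zero K]
  | insert i s hi ih => rw [Finset.sum_insert hi, Finset.prod_insert hi, ksgn_add, ih]

theorem actInside_apply {r : ℕ} (f : MultilinearMap K (fun _ : Fin r => g) g) {k : Fin r → ℤ}
    {v : Fin r → g} (hv : ∀ i, v i ∈ 𝒢 (k i)) {l : ℤ} {y : g} (hy : y ∈ 𝒢 l) :
    L.actInside f y v = ∑ i, ksgn K (l * ∑ j ∈ univ.filter (i < ·), k j) •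
      f (update v i (L.mul (v i) y)) := by
  rw [actInside, LinearMap.sum_apply, MultilinearMap.sum_apply]
  refine sum_congr rfl fun i _ => ?_
  have h (s : g →ₗ[K] g) (y : g) : L.actAt f s i y v = f (update
      (fun j => if j < i then v j else s (v j)) i (L.mul (v i) y)) :=
    congrArg f (L.actAt_aux s i v y)
  rw [LinearMap.add_apply, LinearMap.comp_apply, LinearMap.comp_apply, MultilinearMap.add_apply,
    h, h, evenPart, oddPart, scaleBy_apply _ hy, scaleBy_apply _ hy]
  by_cases hl : Even l
  · simp only [hl, if_true, one_smul, zero_smul, map_zero, ksgn_of_even (hl.mul_right _)]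
    rw [f.map_coord_zero i (update_self i _ _), add_zero]
    congr 2
    funext j
    simp
  · simp only [hl, if_false, one_smul, zero_smul, map_zero, ksgn_mul_of_odd hl, ksgn_sum]
    rw [f.map_coord_zero i (update_self i _ _), zero_add, Finset.prod_filter,
      ← f.map_smul_univ]
    congr 1
    funext j
    rcases lt_trichotomy j i with hj | rfl | hj
    · simp [hj, hj.ne, hj.not_gt]
    · simp
    · simp [hj, hj.ne', hj.not_gt, gradeSign_apply (hv j)]

/-- The recursion for the operations `x • (x₁, …, xᵣ)` on homogeneous elements. -/
theorem corolla_succ (x : g) {r : ℕ} {k : Fin (r + 1) → ℤ} {v : Fin (r + 1) → g}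
    (hv : ∀ i, v i ∈ 𝒢 (k i)) :
    L.corolla x (r + 1) v = L.mul (L.corolla x r (Fin.init v)) (v (Fin.last r))
      - ∑ i, ksgn K (k (Fin.last r) * ∑ j ∈ univ.filter (i < ·), k (Fin.castSucc j)) •
        L.corolla x r (update (Fin.init v) i (L.mul (Fin.init v i) (v (Fin.last r)))) := by
  have h₀ : v ((finRotate (r + 1)).symm 0) = v (Fin.last r) :=
    congrArg v ((Equiv.symm_apply_eq _).2 finRotate_last.symm)
  have h₁ : Fin.tail (fun i => v ((finRotate (r + 1)).symm i)) = Fin.init v := by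
    funext i
    refine congrArg v ((Equiv.symm_apply_eq _).2 ?_)
    rw [finRotate_apply, Fin.coeSucc_eq_succ]
  rw [corolla, MultilinearMap.domDomCongr_apply, LinearMap.uncurryLeft_apply, h₀, h₁,
    LinearMap.sub_apply, MultilinearMap.sub_apply,
    L.actInside_apply (k := fun j => k (Fin.castSucc j)) (v := Fin.init v) _ (fun i => hv _) (hv _)]
  rfl

theorem corolla_zero (x : g) (v : Fin 0 → g) : L.corolla x 0 v = x := rfl

theorem corolla_one (x : g) (v : Fin 1 → g) : L.corolla x 1 v = L.mul x (v 0) := by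
  rw [corolla, MultilinearMap.domDomCongr_apply, LinearMap.uncurryLeft_apply]
  simp [actInside]
  rfl

/-! ### The twisted differential -/

theorem twistedD_apply (α : g) {k : ℤ} {x : g} (hx : x ∈ 𝒢 k) :
    L.twistedD α x = L.d x + L.mul α x - ksgn K k • L.mul x α := by
  simp [twistedD, gradeSign_apply hx]

theorem twistedD_mem {α : g} (hα : α ∈ 𝒢 (-1)) {k : ℤ} {x : g} (hx : x ∈ 𝒢 k) :
    L.twistedD α x ∈ 𝒢 (k - 1) := by
  rw [L.twistedD_apply α hx]
  refine Submodule.sub_mem _ (Submodule.add_mem _ (L.d_mem hx) ?_) (Submodule.smul_mem _ _ ?_)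
  · exact (by ring : -1 + k = k - 1) ▸ L.mul_mem hα hx
  · exact L.mul_mem hx hα

theorem twistedD_twistedD [CharZero K] {α : g} (hα : L.IsMaurerCartan α) (x : g) :
    L.twistedD α (L.twistedD α x) = 0 := by
  induction x using DirectSum.Decomposition.inductionOn 𝒢 with
  | zero => simp
  | add x y hx hy => rw [map_add, map_add, hx, hy, add_zero]
  | @homogeneous k x =>
    obtain ⟨x, hx⟩ := x
    have hd : L.d α = -L.mul α α := eq_neg_of_add_eq_zero_left hα.2
    have h₁ := L.twistedD_apply α hx
    have h₂ := L.twistedD_apply α (L.twistedD_mem hα.1 hx)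
    have hs : ksgn K (k - 1) = -ksgn K k := by
      have := ksgn_add_one (K := K) (k - 1)
      rw [sub_add_cancel] at this
      rw [this, neg_neg]
    have hm : ksgn K (-1) = -1 := by rw [ksgn_neg, ksgn_one]
    have hp (x : g) : L.mul x (L.mul α α) = L.mul (L.mul x α) α := by
      have h := L.pre_lie x hα.1 hα.1
      rw [show (-1 : ℤ) * -1 = 1 by norm_num, ksgn_one, neg_one_smul] at h
      exact sub_eq_zero.1 (eq_zero_of_eq_neg_self K h)
    have hp' : L.mul α (L.mul α x) - L.mul (L.mul α α) x
        = ksgn K k • (L.mul α (L.mul x α) - L.mul (L.mul α x) α) := by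
      rw [L.pre_lie α hα.1 hx, neg_one_mul, ksgn_neg]
    rw [h₂, h₁, hs]
    simp only [map_add, map_sub, map_smul, LinearMap.add_apply, LinearMap.sub_apply,
      LinearMap.smul_apply, L.d_d, L.d_mul _ hα.1, L.d_mul _ hx, hd, hm, map_neg,
      LinearMap.neg_apply, hp, smul_neg, smul_add, smul_sub, smul_smul, ksgn_mul_self]
    rw [sub_eq_iff_eq_add] at hp'
    rw [hp']
    simp only [smul_sub, neg_smul, one_smul, smul_smul, neg_mul, ksgn_mul_self, mul_neg]
    module

theorem abelianOps_apply_of_ne_one {D : g →ₗ[K] g} {r : ℕ} (hr : r ≠ 1) (v : Fin r → g) :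
    abelianOps D r v = 0 := by
  match r, hr with
  | 0, _ => rfl
  | r + 2, _ => rfl

theorem abelianOps_isLInfinity {D : g →ₗ[K] g}
    (hD : ∀ {k : ℤ} {x : g}, x ∈ 𝒢 k → D x ∈ 𝒢 (k - 1)) (hDD : ∀ x, D (D x) = 0) :
    IsLInfinity 𝒢 (abelianOps D) where
  zero := rfl
  mem r k x hx := by
    by_cases hr : r = 1
    · subst hr
      have := hD (hx 0)
      simpa [abelianOps, sub_eq_add_neg] using this
    · rw [abelianOps_apply_of_ne_one hr]
      exact Submodule.zero_mem _
  symm r k x _ s := by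
    by_cases hr : r = 1
    · subst hr
      rw [Subsingleton.elim s 1]
      simp [koszulSign]
    · rw [abelianOps_apply_of_ne_one hr, abelianOps_apply_of_ne_one hr, smul_zero]
  rel r k x _ := by
    refine sum_eq_zero fun c _ => ?_
    rw [MultiOps.app]
    by_cases h : (block x c 1).length = 0
    · by_cases h' : (block x c 0).length = 1
      · obtain ⟨a, ha⟩ := List.length_eq_one_iff.1 h'
        rw [List.length_eq_zero_iff.1 h, ha]
        exact (congrArg (koszulSign K k c • ·) (hDD a)).trans (smul_zero _)
      · rw [MultilinearMap.map_coord_zero _ ⟨0, by simp⟩, smul_zero]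
        exact abelianOps_apply_of_ne_one h' _
    · rw [abelianOps_apply_of_ne_one (by simpa using h), smul_zero]

end

end DGPreLie

/-! ### Pre-Lie algebras concentrated in degree zero -/

/-- On multilinear maps, a linear map `f` acts by `c ↦ ∑ᵢ c (…, f xᵢ, …)`; this action is compatible
with commutators. -/
theorem MultilinearMap.sum_sum_update_sub {K : Type u} [Field K] {g : Type v} [AddCommGroup g]
    [Module K g] {V : Type w} [AddCommGroup V] [Module K V] {r : ℕ}
    (c : MultilinearMap K (fun _ : Fin r => g) V) (f h : g → g) (v : Fin r → g) :
    (∑ i, ∑ j, c (update (update v i (f (v i))) j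
        (h (update v i (f (v i)) j))))
      - ∑ i, ∑ j, c (update (update v i (h (v i))) j
        (f (update v i (h (v i)) j)))
      = ∑ i, c (update v i (h (f (v i)) - f (h (v i)))) := by
  conv_lhs => rw [sum_comm (f := fun i j => c (update
    (update v i (h (v i))) j (f (update v i (h (v i)) j))))]
  rw [← sum_sub_distrib]
  refine sum_congr rfl fun i _ => ?_
  rw [← sum_sub_distrib, sum_eq_single i]
  · simp [c.map_update_sub]
  · intro j _ hj
    rw [update_of_ne hj, update_of_ne hj.symm, Function.update_comm hj, sub_self]
  · simp

theorem Fin.sum_update_snoc {g : Type v} {V : Type w} [AddCommMonoid V] {r : ℕ}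
    (c : (Fin (r + 1) → g) → V) (f : g → g) (v : Fin r → g) (y : g) :
    ∑ i, c (update (snoc v y : Fin (r + 1) → g) i
        (f ((snoc v y : Fin (r + 1) → g) i)))
      = (∑ i, c (snoc (update v i (f (v i))) y)) + c (snoc v (f y)) := by
  rw [Fin.sum_univ_castSucc]
  congr 1
  · refine sum_congr rfl fun i _ => ?_
    rw [snoc_castSucc (α := fun _ => g), ← Fin.snoc_update (α := fun _ => g)]
  · rw [snoc_last (α := fun _ => g), Fin.update_snoc_last (α := fun _ => g)]

/-- For a symmetric function, the contributions of the arguments of `X^m` to a derivative agree. -/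
theorem Fin.sum_update_const {g : Type v} {V : Type w} [AddCommMonoid V] {m : ℕ}
    (f : (Fin (m + 1) → g) → V)
    (hf : ∀ (v : Fin (m + 1) → g) (σ : Equiv.Perm (Fin (m + 1))), f (v ∘ σ) = f v) (X z : g) :
    ∑ i, f (update (fun _ => X) i z) = (m + 1) • f (snoc (fun _ : Fin m => X) z) := by
  have h (i : Fin (m + 1)) : f (update (fun _ => X) i z)
      = f (snoc (fun _ : Fin m => X) z) := by
    have h1 : (snoc (fun _ : Fin m => X) z : Fin (m + 1) → g)
        = update (fun _ => X) (Fin.last m) z := by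
      funext j
      refine lastCases ?_ (fun j => ?_) j
      · simp [snoc_last (α := fun _ => g)]
      · simp [snoc_castSucc (α := fun _ => g)]
    rw [h1, ← hf (update (fun _ => X) (Fin.last m) z) (swap (Fin.last m) i),
      update_comp_equiv, Equiv.symm_swap, Equiv.swap_apply_left]
    rfl
  rw [sum_congr rfl fun i _ => h i]
  simp

theorem inv_factorial_succ_mul {K : Type u} [Field K] [CharZero K] (m : ℕ) :
    ((m + 1).factorial : K)⁻¹ * ((m + 1 : ℕ) : K) = (m.factorial : K)⁻¹ := by
  have h1 : ((m : K) + 1) ≠ 0 := by exact_mod_cast Nat.succ_ne_zero m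
  have h2 : (m.factorial : K) ≠ 0 := by exact_mod_cast Nat.factorial_ne_zero m
  rw [Nat.factorial_succ]
  push_cast
  field_simp

theorem Fin.sum_range_sum_update_const {K : Type u} [Field K] [CharZero K]
    {g : Type v} {V : Type w} [AddCommGroup V] [Module K V] (M : ℕ)
    (f : ∀ m, (Fin m → g) → V)
    (hf : ∀ m (v : Fin m → g) (σ : Equiv.Perm (Fin m)), f m (v ∘ σ) = f m v) (X z : g)
    (hM : f (M + 1) (snoc (fun _ : Fin M => X) z) = 0) :
    ∑ m ∈ range (M + 1), (m.factorial : K)⁻¹ • ∑ i, f m (update (fun _ => X) i z)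
      = ∑ m ∈ range (M + 1), (m.factorial : K)⁻¹ •
          f (m + 1) (snoc (fun _ : Fin m => X) z) := by
  rw [sum_range_succ', sum_range_succ, hM]
  simp only [Finset.univ_eq_empty, Finset.sum_empty, smul_zero]
  congr 1
  refine sum_congr rfl fun m _ => ?_
  rw [Fin.sum_update_const _ (hf _), ← Nat.cast_smul_eq_nsmul K, smul_smul,
    inv_factorial_succ_mul]

namespace DGPreLie

variable {K : Type u} [Field K] {g : Type v} [AddCommGroup g] [Module K g]
  {𝒢 : ℤ → Submodule K g} [DirectSum.Decomposition 𝒢] (L : DGPreLie K 𝒢)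

section DegreeZero

variable (h0 : ∀ x : g, x ∈ 𝒢 0)

include h0

theorem pre_lie_of_zero (x y z : g) : L.mul x (L.mul y z) - L.mul (L.mul x y) z
    = L.mul x (L.mul z y) - L.mul (L.mul x z) y := by
  simpa [ksgn_zero K] using L.pre_lie x (h0 y) (h0 z)

theorem corolla_snoc (x : g) {r : ℕ} (v : Fin r → g) (y : g) :
    L.corolla x (r + 1) (snoc v y) = L.mul (L.corolla x r v) y
      - ∑ i, L.corolla x r (update v i (L.mul (v i) y)) := by
  rw [L.corolla_succ x (k := fun _ => 0) (fun _ => h0 _), Fin.init_snoc (α := fun _ => g),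
    snoc_last (α := fun _ => g)]
  simp [ksgn_zero K]

theorem corolla_smul_left (c : K) (x : g) {r : ℕ} (v : Fin r → g) :
    L.corolla (c • x) r v = c • L.corolla x r v := by
  induction r with
  | zero => rfl
  | succ r ih =>
    rw [← snoc_init_self v, L.corolla_snoc h0, L.corolla_snoc h0]
    simp only [ih, map_smul, LinearMap.smul_apply, smul_sub, smul_sum]

theorem corolla_snoc_snoc_comm (x : g) {r : ℕ} (v : Fin r → g) (y z : g) :
    L.corolla x (r + 2) (snoc (snoc v y : Fin (r + 1) → g) z)
      = L.corolla x (r + 2) (snoc (snoc v z : Fin (r + 1) → g) y) := by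
  have key (y z : g) : L.corolla x (r + 2) (snoc (snoc v y : Fin (r + 1) → g) z)
      = (L.mul (L.mul (L.corolla x r v) y) z - L.mul (L.corolla x r v) (L.mul y z))
        - (∑ i, L.corolla x (r + 1) (snoc (update v i (L.mul (v i) y)) z)
          + ∑ i, L.corolla x (r + 1) (snoc (update v i (L.mul (v i) z)) y))
        - (∑ i, ∑ j, L.corolla x r (update (update v i (L.mul (v i) y)) j
            (L.mul (update v i (L.mul (v i) y) j) z)))
        + ∑ i, L.corolla x r (update v i (L.mul (v i) (L.mul y z))) := by
    have h1 (i : Fin r) := L.corolla_snoc h0 x (update v i (L.mul (v i) y)) z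
    rw [L.corolla_snoc h0, L.corolla_snoc h0, map_sub, LinearMap.sub_apply, map_sum,
      LinearMap.sum_apply, Fin.sum_update_snoc (f := fun w => L.mul w z), L.corolla_snoc h0 x v]
    simp only [h1, sum_sub_distrib]
    abel
  have h := (L.corolla x r).sum_sum_update_sub (fun w => L.mul w y) (fun w => L.mul w z) v
  have hp (x : g) := L.pre_lie_of_zero h0 x y z
  have hs : ∀ i, L.corolla x r (update v i (L.mul (L.mul (v i) y) z
      - L.mul (L.mul (v i) z) y))
      = L.corolla x r (update v i (L.mul (v i) (L.mul y z)))
        - L.corolla x r (update v i (L.mul (v i) (L.mul z y))) := fun i => by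
    rw [← MultilinearMap.map_update_sub]
    congr 2
    have := hp (v i)
    rw [sub_eq_sub_iff_add_eq_add] at this ⊢
    rw [add_comm, ← this]
  rw [key y z, key z y, ← sub_eq_zero]
  rw [sum_congr rfl fun i _ => hs i, sum_sub_distrib] at h
  have h2 := hp (L.corolla x r v)
  generalize L.mul (L.corolla x r v) (L.mul y z) = a1 at *
  rw [sub_eq_iff_eq_add] at h h2
  rw [h, h2]
  abel

theorem corolla_snoc_comp_perm (x : g) {r : ℕ}
    (hr : ∀ (v : Fin r → g) (σ : Equiv.Perm (Fin r)), L.corolla x r (v ∘ σ) = L.corolla x r v)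
    (v : Fin r → g) (y : g) (σ : Equiv.Perm (Fin r)) :
    L.corolla x (r + 1) (snoc (v ∘ σ) y) = L.corolla x (r + 1) (snoc v y) := by
  rw [L.corolla_snoc h0, L.corolla_snoc h0, hr]
  congr 1
  refine Fintype.sum_equiv σ _ _ fun i => ?_
  refine Eq.trans ?_ (hr (update v (σ i) (L.mul (v (σ i)) y)) σ)
  congr 1
  rw [update_comp_equiv, Equiv.symm_apply_apply]
  rfl

theorem corolla_comp_perm (x : g) {r : ℕ} (v : Fin r → g) (σ : Equiv.Perm (Fin r)) :
    L.corolla x r (v ∘ σ) = L.corolla x r v := by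
  induction r with
  | zero => rw [Subsingleton.elim (v ∘ σ) v]
  | succ n ih =>
    have hσ : σ ∈ Submonoid.closure
        (Set.range fun i : Fin n => swap i.castSucc i.succ) := by
      rw [Equiv.Perm.mclosure_swap_castSucc_succ]
      trivial
    induction hσ using Submonoid.closure_induction generalizing v with
    | one => rfl
    | mul σ τ _ _ hs ht =>
      rw [Equiv.Perm.coe_mul, ← Function.comp_assoc, ht, hs]
    | mem σ hσ =>
      obtain ⟨i, rfl⟩ := hσ
      rcases n with _ | n
      · exact i.elim0
      -- adjacent transpositions not involving the last argument are covered by induction, the last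
      -- one by the pre-Lie identity
      rcases Fin.eq_castSucc_or_eq_last i with ⟨j, rfl⟩ | rfl
      · have hv : v ∘ swap j.castSucc.castSucc j.castSucc.succ
            = snoc (Fin.init v ∘ swap j.castSucc j.succ) (v (Fin.last _)) := by
          funext i
          refine lastCases ?_ (fun i => ?_) i
          · rw [snoc_last (α := fun _ => g), comp_apply, swap_apply_of_ne_of_ne
              (Fin.castSucc_ne_last _).symm (by
                rw [← Fin.castSucc_succ]; exact (Fin.castSucc_ne_last _).symm)]
          · rw [snoc_castSucc (α := fun _ => g), comp_apply, comp_apply,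
              Fin.init, ← Fin.castSucc_succ,
              (Fin.castSucc_injective _).swap_apply]
        conv_rhs => rw [← snoc_init_self v]
        rw [hv, L.corolla_snoc_comp_perm h0 x ih]
      · obtain ⟨w, y, z, rfl⟩ : ∃ (w : Fin n → g) (y z : g),
            v = snoc (snoc w y : Fin (n + 1) → g) z :=
          ⟨Fin.init (Fin.init v), Fin.init v (Fin.last _), v (Fin.last _), by
            rw [snoc_init_self, snoc_init_self]⟩
        rw [L.corolla_snoc_snoc_comm h0 x w y z]
        congr 1
        funext i
        refine lastCases ?_ (fun i => lastCases ?_ (fun i => ?_) i) i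
        · simp [snoc_last (α := fun _ => g), snoc_castSucc (α := fun _ => g)]
        · simp [snoc_last (α := fun _ => g), snoc_castSucc (α := fun _ => g)]
        · rw [comp_apply, swap_apply_of_ne_of_ne
            (by simp) (by simpa using (Fin.castSucc_ne_last _))]
          simp [snoc_castSucc (α := fun _ => g)]

theorem corolla_cons (x : g) {r : ℕ} (v : Fin r → g) (y : g) :
    L.corolla x (r + 1) (Fin.cons y v) = L.corolla x (r + 1) (snoc v y) := by
  rw [← L.corolla_comp_perm h0 x (Fin.cons y v) (finRotate (r + 1))]
  congr 1
  funext i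
  refine lastCases ?_ (fun i => ?_) i
  · simp [snoc_last (α := fun _ => g)]
  · simp [snoc_castSucc (α := fun _ => g), Fin.coeSucc_eq_succ]

theorem derivation_corolla {δ : g →ₗ[K] g}
    (hδ : ∀ x y, δ (L.mul x y) = L.mul (δ x) y + L.mul x (δ y)) (x : g) {r : ℕ} (v : Fin r → g) :
    δ (L.corolla x r v)
      = L.corolla (δ x) r v + ∑ i, L.corolla x r (update v i (δ (v i))) := by
  induction r with
  | zero => simp [corolla_zero]
  | succ r ih =>
    rw [← snoc_init_self v]
    set y := v (Fin.last r)
    set u := Fin.init v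
    have h1 (i : Fin r) := L.corolla_snoc h0 x (update u i (δ (u i))) y
    have h := (L.corolla x r).sum_sum_update_sub δ (fun w => L.mul w y) u
    have hs (i : Fin r) : L.corolla x r (update u i (L.mul (δ (u i)) y
        - δ (L.mul (u i) y))) = - L.corolla x r (update u i (L.mul (u i) (δ y))) := by
      rw [hδ, sub_add_cancel_left, MultilinearMap.map_update_neg]
    rw [sum_congr rfl fun i _ => hs i, sub_eq_iff_eq_add, sum_neg_distrib] at h
    rw [Fin.sum_update_snoc (f := δ), L.corolla_snoc h0, L.corolla_snoc h0, map_sub, hδ, ih,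
      map_add, LinearMap.add_apply, map_sum, map_sum, LinearMap.sum_apply,
      L.corolla_snoc h0 x u (δ y)]
    simp only [h1, ih, sum_sub_distrib, sum_add_distrib, h]
    abel

/-- Elements of a multiplicative filtration as arguments of `x • (x₁, …, xᵣ)`. -/
theorem corolla_mem_filtration {F : ℕ → Submodule K g} (hF0 : F 0 = ⊤)
    (hF : ∀ {m n : ℕ} {x y : g}, x ∈ F m → y ∈ F n → L.mul x y ∈ F (m + n))
    (x : g) {r : ℕ} {n : Fin r → ℕ} {v : Fin r → g} (hv : ∀ i, v i ∈ F (n i)) :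
    L.corolla x r v ∈ F (∑ i, n i) := by
  induction r with
  | zero => simp [hF0]
  | succ r ih =>
    rw [← snoc_init_self v, L.corolla_snoc h0, Fin.sum_univ_castSucc]
    refine Submodule.sub_mem _ (hF (ih fun i => hv _) (hv _)) (Submodule.sum_mem _ fun i _ => ?_)
    have h' := ih (n := update (fun j => n (Fin.castSucc j)) i
      (n (Fin.castSucc i) + n (Fin.last r)))
      (v := update (Fin.init v) i (L.mul (Fin.init v i) (v (Fin.last r)))) fun j => by
        rcases eq_or_ne j i with rfl | hj
        · simpa [Fin.init] using hF (hv (Fin.castSucc j)) (hv (Fin.last r))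
        · simpa [hj, Fin.init] using hv (Fin.castSucc j)
    rw [Finset.sum_update_of_mem (mem_univ i)] at h'
    convert h' using 2
    rw [← add_sum_erase _ _ (mem_univ i), Finset.sdiff_singleton_eq_erase]
    ring

end DegreeZero

section Exponential

/-- The sum `∑ₘ a • (X, …, X) / m!`, where `m ≤ M`. -/
noncomputable def expC (M : ℕ) (X a : g) : g :=
  ∑ m ∈ range (M + 1), (m.factorial : K)⁻¹ • L.corolla a m fun _ => X

/-- The sum `∑ₘ a • (X, …, X, b) / m!`, where `m ≤ M`. -/
noncomputable def expC₁ (M : ℕ) (X a b : g) : g :=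
  ∑ m ∈ range (M + 1), (m.factorial : K)⁻¹ •
    L.corolla a (m + 1) (snoc (fun _ => X) b)

/-- The sum `∑ₘ a • (X, …, X, b, c) / m!`, where `m ≤ M`. -/
noncomputable def expC₂ (M : ℕ) (X a b c : g) : g :=
  ∑ m ∈ range (M + 1), (m.factorial : K)⁻¹ •
    L.corolla a (m + 2) (snoc (snoc (fun _ => X) b : Fin (m + 1) → g) c)

/-- The terms with `M` or more arguments equal to `X` that occur in the calculus vanish, so that the
truncated sums `expC`, `expC₁`, `expC₂` agree with the infinite ones. -/
structure ExpNilpotent (M : ℕ) (X : g) : Prop where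
  one : ∀ a b, L.corolla a (M + 1) (snoc (fun _ => X) b) = 0
  two : ∀ a b c,
    L.corolla a (M + 2) (snoc (snoc (fun _ => X) b : Fin (M + 1) → g) c) = 0

variable {L} {M : ℕ} {X : g} (h0 : ∀ x : g, x ∈ 𝒢 0)

theorem expC₁_add (a b c : g) : L.expC₁ M X a (b + c) = L.expC₁ M X a b + L.expC₁ M X a c := by
  have h (m : ℕ) (b : g) : (snoc (fun _ => X) b : Fin (m + 1) → g)
      = update (snoc (fun _ => X) 0 : Fin (m + 1) → g) (Fin.last m) b :=
    (Fin.update_snoc_last (α := fun _ => g) _ _ _).symm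
  simp only [expC₁, h _ (b + c), h _ b, h _ c, MultilinearMap.map_update_add, smul_add,
    sum_add_distrib]

theorem expC₂_add (a b c d : g) :
    L.expC₂ M X a b (c + d) = L.expC₂ M X a b c + L.expC₂ M X a b d := by
  have h (m : ℕ) (c : g) : (snoc (snoc (fun _ => X) b : Fin (m + 1) → g) c : Fin (m + 2) → g)
      = update (snoc (snoc (fun _ => X) b : Fin (m + 1) → g) 0 : Fin (m + 2) → g)
        (Fin.last (m + 1)) c :=
    (Fin.update_snoc_last (α := fun _ => g) _ _ _).symm
  simp only [expC₂, h _ (c + d), h _ c, h _ d, MultilinearMap.map_update_add, smul_add,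
    sum_add_distrib]

include h0

theorem expC_smul_left (c : K) (a : g) : L.expC M X (c • a) = c • L.expC M X a := by
  simp only [expC, L.corolla_smul_left h0, smul_sum, smul_comm c]

theorem expC_zero_left : L.expC M X 0 = 0 := by
  simpa using expC_smul_left (L := L) (M := M) (X := X) h0 0 0

theorem expC₁_zero_left (b : g) : L.expC₁ M X 0 b = 0 := by
  have h (m : ℕ) (v : Fin m → g) : L.corolla 0 m v = 0 := by
    simpa using L.corolla_smul_left h0 0 0 v
  simp [expC₁, h]

variable [CharZero K] (hX : L.ExpNilpotent M X)

include hX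

theorem mul_expC (a z : g) : L.mul (L.expC M X a) z
    = L.expC₁ M X a z + L.expC₁ M X a (L.mul X z) := by
  have h := Fin.sum_range_sum_update_const (K := K) M (fun m v => L.corolla a m v)
    (fun m v σ => L.corolla_comp_perm h0 a v σ) X (L.mul X z) (hX.one a _)
  rw [expC₁, expC₁, ← h, ← sum_add_distrib, expC, map_sum, LinearMap.sum_apply]
  refine sum_congr rfl fun m _ => ?_
  rw [L.corolla_snoc h0, map_smul, LinearMap.smul_apply, ← smul_add, sub_add_cancel]

theorem mul_expC₁ (a b z : g) : L.mul (L.expC₁ M X a b) z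
    = L.expC₂ M X a b z + L.expC₁ M X a (L.mul b z) + L.expC₂ M X a b (L.mul X z) := by
  have h := Fin.sum_range_sum_update_const (K := K) M
    (fun m v => L.corolla a (m + 1) (snoc v b)) (fun m v σ =>
      L.corolla_snoc_comp_perm h0 a (L.corolla_comp_perm h0 a) v b σ) X (L.mul X z)
    ((L.corolla_snoc_snoc_comm h0 a _ _ _).trans (hX.two a _ _))
  have h' : L.expC₂ M X a b (L.mul X z) = L.expC₂ M X a (L.mul X z) b := by
    rw [expC₂, expC₂]
    simp only [L.corolla_snoc_snoc_comm h0 a _ b]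
  rw [h', expC₂, expC₂, expC₁, expC₁, ← h, ← sum_add_distrib, ← sum_add_distrib,
    map_sum, LinearMap.sum_apply]
  refine sum_congr rfl fun m _ => ?_
  rw [L.corolla_snoc h0 a (snoc (fun _ => X) b : Fin (m + 1) → g) z,
    Fin.sum_update_snoc (f := fun w => L.mul w z), map_smul, LinearMap.smul_apply, ← smul_add,
      ← smul_add]
  congr 1
  abel

variable {δ : g →ₗ[K] g} (hδ : ∀ x y, δ (L.mul x y) = L.mul (δ x) y + L.mul x (δ y))

include hδ

theorem derivation_expC (a : g) :
    δ (L.expC M X a) = L.expC M X (δ a) + L.expC₁ M X a (δ X) := by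
  have h := Fin.sum_range_sum_update_const (K := K) M (fun m v => L.corolla a m v)
    (fun m v σ => L.corolla_comp_perm h0 a v σ) X (δ X) (hX.one a _)
  rw [expC₁, ← h, expC, expC, ← sum_add_distrib, map_sum]
  refine sum_congr rfl fun m _ => ?_
  rw [map_smul, L.derivation_corolla h0 hδ, smul_add]

theorem derivation_expC₁ (a b : g) : δ (L.expC₁ M X a b)
    = L.expC₁ M X (δ a) b + L.expC₁ M X a (δ b) + L.expC₂ M X a b (δ X) := by
  have h := Fin.sum_range_sum_update_const (K := K) M
    (fun m v => L.corolla a (m + 1) (snoc v b)) (fun m v σ =>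
      L.corolla_snoc_comp_perm h0 a (L.corolla_comp_perm h0 a) v b σ) X (δ X)
    ((L.corolla_snoc_snoc_comm h0 a _ _ _).trans (hX.two a _ _))
  have h' : L.expC₂ M X a b (δ X) = L.expC₂ M X a (δ X) b := by
    rw [expC₂, expC₂]
    simp only [L.corolla_snoc_snoc_comm h0 a _ b]
  rw [h', expC₂, expC₁, expC₁, expC₁, ← h, ← sum_add_distrib, ← sum_add_distrib,
    map_sum]
  refine sum_congr rfl fun m _ => ?_
  rw [map_smul, L.derivation_corolla h0 hδ, Fin.sum_update_snoc (f := δ), ← smul_add, ← smul_add]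
  congr 1
  abel

/-- If `δ X = y + X • y`, then `∑ₘ a • (X, …, X) / m!` solves the equation `δ Z = Z • y`. -/
theorem derivation_expC_of_eq {y a : g} (ha : δ a = 0) (hy : δ X = y + L.mul X y) :
    δ (L.expC M X a) = L.mul (L.expC M X a) y := by
  rw [derivation_expC h0 hX hδ, mul_expC h0 hX, hy, expC₁_add, ha, expC_zero_left h0,
    zero_add]

theorem derivation_expC₁_expC_of_eq {y a b : g} (ha : δ a = 0) (hb : δ b = 0)
    (hy : δ X = y + L.mul X y) :
    δ (L.expC₁ M X a (L.expC M X b)) = L.mul (L.expC₁ M X a (L.expC M X b)) y := by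
  rw [derivation_expC₁ h0 hX hδ, mul_expC₁ h0 hX, hy, ha, derivation_expC_of_eq h0 hX hδ hb hy,
    expC₁_zero_left h0, expC₂_add]
  abel

end Exponential

end DGPreLie

/-! ### Signs of products of index sets -/

section KoszulRule

variable {K : Type u} [Field K] {ι : Type w}

/-- The sign rule `eᵢ eⱼ = t i j e_{i,j}` for multiplying square-zero generators `eᵢ` of degree
`k i` of a graded commutative algebra with basis the products `e_I` of finite sets of generators. -/
structure IsKoszulRule (k : ι → ℤ) (t : ι → ι → K) : Prop where
  diag : ∀ i, t i i = 0
  symm : ∀ i j, t i j = ksgn K (k i * k j) * t j i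

/-- The degree of `e_I`. -/
def setDeg (k : ι → ℤ) (I : Finset ι) : ℤ := ∑ i ∈ I, k i

/-- The coefficient in `e_I e_J = s(I, J) e_{I ∪ J}`. -/
def setSign (t : ι → ι → K) (I J : Finset ι) : K := ∏ i ∈ I, ∏ j ∈ J, t i j

/-- The coefficient of `e_{I₁ ∪ … ∪ Iᵣ}` in the product of the `e_{I_b}`. -/
def tupleSign (t : ι → ι → K) {r : ℕ} (I : Fin r → Finset ι) : K :=
  ∏ b, ∏ b', if b < b' then setSign t (I b) (I b') else 1

variable {k : ι → ℤ} {t : ι → ι → K}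

@[simp] theorem setSign_empty_left (I : Finset ι) : setSign t ∅ I = 1 := by simp [setSign]

@[simp] theorem setSign_empty_right (I : Finset ι) : setSign t I ∅ = 1 := by simp [setSign]

theorem setSign_singleton (i j : ι) : setSign t {i} {j} = t i j := by simp [setSign]

theorem setSign_symm (ht : IsKoszulRule k t) (I J : Finset ι) :
    setSign t I J = ksgn K (setDeg k I * setDeg k J) * setSign t J I := by
  rw [setSign, setDeg, setDeg, Finset.sum_mul_sum, DGPreLie.ksgn_sum]
  simp_rw [DGPreLie.ksgn_sum]
  rw [setSign, prod_comm (s := J), ← prod_mul_distrib]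
  refine prod_congr rfl fun i _ => ?_
  rw [← prod_mul_distrib]
  exact prod_congr rfl fun j _ => ht.symm i j

variable [DecidableEq ι]

theorem setDeg_union {I J : Finset ι} (h : Disjoint I J) :
    setDeg k (I ∪ J) = setDeg k I + setDeg k J := sum_union h

theorem setSign_union_left {I J : Finset ι} (h : Disjoint I J) (L : Finset ι) :
    setSign t (I ∪ J) L = setSign t I L * setSign t J L := Finset.prod_union h

theorem setSign_union_right {I J : Finset ι} (h : Disjoint I J) (L : Finset ι) :
    setSign t L (I ∪ J) = setSign t L I * setSign t L J := by
  simp only [setSign, Finset.prod_union h, prod_mul_distrib]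

theorem disjoint_of_setSign_ne_zero (ht : IsKoszulRule k t) {I J : Finset ι}
    (h : setSign t I J ≠ 0) : Disjoint I J := by
  rw [Finset.disjoint_left]
  intro i hi hj
  exact h (prod_eq_zero hi (prod_eq_zero hj (ht.diag i)))

theorem setSign_mul_union_left (ht : IsKoszulRule k t) (I J L : Finset ι) :
    setSign t I J * setSign t (I ∪ J) L = setSign t I J * (setSign t I L * setSign t J L) := by
  by_cases h : setSign t I J = 0
  · rw [h, zero_mul, zero_mul]
  · rw [setSign_union_left (disjoint_of_setSign_ne_zero ht h)]

theorem setSign_mul_union_right (ht : IsKoszulRule k t) (I J L : Finset ι) :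
    setSign t I J * setSign t L (I ∪ J) = setSign t I J * (setSign t L I * setSign t L J) := by
  by_cases h : setSign t I J = 0
  · rw [h, zero_mul, zero_mul]
  · rw [setSign_union_right (disjoint_of_setSign_ne_zero ht h)]

theorem tupleSign_snoc {r : ℕ} (I : Fin r → Finset ι) (L : Finset ι) :
    tupleSign t (snoc I L : Fin (r + 1) → Finset ι)
      = tupleSign t I * ∏ b, setSign t (I b) L := by
  rw [tupleSign, Fin.prod_univ_castSucc]
  simp only [Fin.prod_univ_castSucc, snoc_castSucc (α := fun _ => Finset ι),
    snoc_last (α := fun _ => Finset ι), Fin.castSucc_lt_castSucc_iff, Fin.castSucc_lt_last,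
    if_true, lt_irrefl, if_false, (Fin.castSucc_lt_last _).not_gt, prod_const_one, mul_one,
    prod_mul_distrib]
  rfl

theorem tupleSign_cons {r : ℕ} (P : Finset ι) (I : Fin r → Finset ι) :
    tupleSign t (Fin.cons P I : Fin (r + 1) → Finset ι)
      = (∏ b, setSign t P (I b)) * tupleSign t I := by
  rw [tupleSign, Fin.prod_univ_succ]
  simp only [Fin.prod_univ_succ, Fin.cons_zero, Fin.cons_succ, lt_irrefl, if_false,
    Fin.succ_pos, if_true, Fin.not_lt_zero, one_mul, Fin.succ_lt_succ_iff]
  rfl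

theorem tupleSign_update (ht : IsKoszulRule k t) {r : ℕ} (I : Fin r → Finset ι) (L : Finset ι)
    (i : Fin r) :
    setSign t (I i) L * tupleSign t (update I i (I i ∪ L))
      = ksgn K (setDeg k L * ∑ j ∈ univ.filter (i < ·), setDeg k (I j))
        * tupleSign t (snoc I L : Fin (r + 1) → Finset ι) := by
  rw [tupleSign_snoc]
  by_cases h : setSign t (I i) L = 0
  · rw [h, zero_mul, prod_eq_zero (mem_univ i) h, mul_zero, mul_zero]
  have hd := disjoint_of_setSign_ne_zero ht h
  have h1 : tupleSign t (update I i (I i ∪ L)) = tupleSign t I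
      * (∏ b', if i < b' then setSign t L (I b') else 1)
      * ∏ b, if b < i then setSign t (I b) L else 1 := by
    have e1 : (∏ b', if i < b' then setSign t L (I b') else 1)
        = ∏ b, ∏ b', if b = i then (if i < b' then setSign t L (I b') else 1) else 1 :=
      ((Finset.prod_eq_single i (fun b _ hb => by simp [hb]) (by simp)).trans (by simp)).symm
    have e2 : (∏ b, if b < i then setSign t (I b) L else 1)
        = ∏ b, ∏ b', if b' = i then (if b < i then setSign t (I b) L else 1) else 1 := by
      simp
    rw [e1, e2, tupleSign, tupleSign, ← prod_mul_distrib, ← prod_mul_distrib]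
    refine prod_congr rfl fun b _ => ?_
    rw [← prod_mul_distrib, ← prod_mul_distrib]
    refine prod_congr rfl fun b' _ => ?_
    by_cases hb : b = i
    · subst hb
      by_cases hb' : b' = b
      · simp [hb']
      · by_cases hlt : b < b' <;> simp [hb', hlt, setSign_union_left hd]
    · by_cases hb' : b' = i
      · subst hb'
        by_cases hlt : b < b' <;> simp [hb, hlt, setSign_union_right hd]
      · simp [hb, hb']
  have h2 : ∏ b, setSign t (I b) L = setSign t (I i) L
      * (∏ b, if i < b then setSign t (I b) L else 1)
      * ∏ b, if b < i then setSign t (I b) L else 1 := by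
    have : setSign t (I i) L = ∏ b, if b = i then setSign t (I b) L else 1 := by simp
    rw [this, ← prod_mul_distrib, ← prod_mul_distrib]
    refine prod_congr rfl fun b _ => ?_
    rcases lt_trichotomy b i with hb | rfl | hb
    · simp [hb, hb.ne, hb.not_gt]
    · simp
    · simp [hb, hb.ne', hb.not_gt]
  have h3 : (∏ b', if i < b' then setSign t L (I b') else 1)
      = ksgn K (setDeg k L * ∑ j ∈ univ.filter (i < ·), setDeg k (I j))
        * ∏ b, if i < b then setSign t (I b) L else 1 := by
    rw [mul_sum, DGPreLie.ksgn_sum, Finset.prod_filter, ← prod_mul_distrib]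
    refine prod_congr rfl fun b _ => ?_
    split_ifs
    · exact setSign_symm ht _ _
    · rw [mul_one]
  rw [h1, h2, h3]
  ring

theorem tupleSign_mul_setSign_biUnion (ht : IsKoszulRule k t) {r : ℕ} (I : Fin r → Finset ι)
    (L : Finset ι) : tupleSign t I * setSign t (univ.biUnion I) L
      = tupleSign t I * ∏ b, setSign t (I b) L := by
  by_cases h : tupleSign t I = 0
  · rw [h, zero_mul, zero_mul]
  · have hlt : ∀ b b', b < b' → Disjoint (I b) (I b') := fun b b' hb =>
      disjoint_of_setSign_ne_zero ht fun h0 => h (prod_eq_zero (mem_univ b)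
        (prod_eq_zero (mem_univ b') (by rw [if_pos hb, h0])))
    have hd : ((univ : Finset (Fin r)) : Set (Fin r)).PairwiseDisjoint I := fun b _ b' _ hb =>
      (lt_or_gt_of_ne hb).elim (hlt b b') fun h => (hlt b' b h).symm
    rw [setSign, Finset.prod_biUnion hd]
    rfl

end KoszulRule

/-! ### Extension of scalars by square-zero generators -/

section TrivGrading

variable (K : Type u) [Field K] (V : Type v) [AddCommGroup V] [Module K V]

/-- The grading for which the whole vector space has degree zero. -/
def trivGrading (n : ℤ) : Submodule K V := if n = 0 then ⊤ else ⊥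

theorem mem_trivGrading_zero (x : V) : x ∈ trivGrading K V 0 := by simp [trivGrading]

variable {K V} in
theorem eq_zero_of_mem_trivGrading {n : ℤ} (hn : n ≠ 0) {x : V} (hx : x ∈ trivGrading K V n) :
    x = 0 := by simpa [trivGrading, hn] using hx

noncomputable instance : DirectSum.Decomposition (trivGrading K V) :=
  DirectSum.Decomposition.ofLinearMap (trivGrading K V)
    (DirectSum.lof K ℤ (fun n => trivGrading K V n) 0 ∘ₗ
      LinearMap.codRestrict (trivGrading K V 0) LinearMap.id (mem_trivGrading_zero K V))
    (by ext x; simp)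
    (by
      ext n x : 2
      by_cases hn : n = 0
      · subst hn
        simp
        rfl
      · have : x = 0 := Subtype.ext (eq_zero_of_mem_trivGrading hn x.2)
        simp [this])

end TrivGrading

namespace DGPreLie

variable {K : Type u} [Field K] {g : Type v} [AddCommGroup g] [Module K g]
  {𝒢 : ℤ → Submodule K g} (L : DGPreLie K 𝒢) {ι : Type w} [Fintype ι] [DecidableEq ι]

/-- The elements `∑_I e_I z_I` of total degree zero of the extension of `g` by square-zero
generators `eᵢ` of degrees `-k i`: the coefficient `z_I` has the degree opposite to `e_I`. -/
def coeffModule (𝒢 : ℤ → Submodule K g) (k : ι → ℤ) : Submodule K (Finset ι → g) :=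
  Submodule.pi Set.univ fun I => 𝒢 (setDeg k I)

theorem mem_coeffModule {k : ι → ℤ} {Z : Finset ι → g} :
    Z ∈ coeffModule 𝒢 k ↔ ∀ I, Z I ∈ 𝒢 (setDeg k I) := by simp [coeffModule]

theorem single_mem_coeffModule {k : ι → ℤ} {I : Finset ι} {z : g} (hz : z ∈ 𝒢 (setDeg k I)) :
    Pi.single I z ∈ coeffModule 𝒢 k := by
  rw [mem_coeffModule]
  intro J
  rcases eq_or_ne J I with rfl | h
  · simpa using hz
  · simp [h]

theorem coeffModule_induction {k : ι → ℤ} {p : (Finset ι → g) → Prop}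
    (hs : ∀ I (z : g), z ∈ 𝒢 (setDeg k I) → p (Pi.single I z)) (h0 : p 0)
    (ha : ∀ Z W, p Z → p W → p (Z + W)) {Z : Finset ι → g} (hZ : Z ∈ coeffModule 𝒢 k) : p Z := by
  rw [← univ_sum_single Z]
  exact Finset.sum_induction _ p ha h0 fun I _ => hs I _ (mem_coeffModule.1 hZ I)

/-- The product `e_I x • e_J y = s(I, J) e_{I ∪ J} (x • y)`. -/
noncomputable def coeffMul (t : ι → ι → K) :
    (Finset ι → g) →ₗ[K] (Finset ι → g) →ₗ[K] (Finset ι → g) :=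
  mk₂ K (fun Z W => ∑ I, ∑ J, Pi.single (I ∪ J) (setSign t I J • L.mul (Z I) (W J)))
    (fun Z Z' W => by simp [Pi.single_add, sum_add_distrib])
    (fun c Z W => by simp [smul_sum, smul_comm c, ← Pi.single_smul])
    (fun Z W W' => by simp [Pi.single_add, sum_add_distrib])
    (fun c Z W => by simp [smul_sum, smul_comm c, ← Pi.single_smul])

theorem coeffMul_apply (t : ι → ι → K) (Z W : Finset ι → g) : L.coeffMul t Z W
    = ∑ I, ∑ J, Pi.single (I ∪ J) (setSign t I J • L.mul (Z I) (W J)) := rfl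

theorem coeffMul_single (t : ι → ι → K) (I J : Finset ι) (x y : g) :
    L.coeffMul t (Pi.single I x) (Pi.single J y)
      = Pi.single (I ∪ J) (setSign t I J • L.mul x y) := by
  rw [coeffMul_apply, sum_eq_single I, sum_eq_single J]
  · simp
  · intro J' _ hJ; simp [hJ]
  · simp
  · intro I' _ hI; simp [hI]
  · simp

variable {k : ι → ℤ} {t : ι → ι → K} (ht : IsKoszulRule k t)

include ht

theorem setSign_smul_mem {I J : Finset ι} {n : ℤ} {z : g} (hz : z ∈ 𝒢 n)
    (hn : n = setDeg k I + setDeg k J) : setSign t I J • z ∈ 𝒢 (setDeg k (I ∪ J)) := by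
  by_cases h : setSign t I J = 0
  · simp [h]
  · rw [setDeg_union (disjoint_of_setSign_ne_zero ht h), ← hn]
    exact Submodule.smul_mem _ _ hz

theorem coeffMul_mem {Z W : Finset ι → g} (hZ : Z ∈ coeffModule 𝒢 k) (hW : W ∈ coeffModule 𝒢 k) :
    L.coeffMul t Z W ∈ coeffModule 𝒢 k := by
  rw [coeffMul_apply]
  refine Submodule.sum_mem _ fun I _ => Submodule.sum_mem _ fun J _ => single_mem_coeffModule ?_
  exact setSign_smul_mem ht (L.mul_mem (mem_coeffModule.1 hZ I) (mem_coeffModule.1 hW J)) rfl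

theorem coeffMul_pre_lie (X : Finset ι → g) {Y Z : Finset ι → g} (hY : Y ∈ coeffModule 𝒢 k)
    (hZ : Z ∈ coeffModule 𝒢 k) : L.coeffMul t X (L.coeffMul t Y Z)
      - L.coeffMul t (L.coeffMul t X Y) Z
        = L.coeffMul t X (L.coeffMul t Z Y) - L.coeffMul t (L.coeffMul t X Z) Y := by
  rw [← univ_sum_single X]
  simp only [map_sum, LinearMap.sum_apply, ← sum_sub_distrib]
  refine sum_congr rfl fun I _ => ?_
  generalize X I = x
  refine coeffModule_induction (p := fun Y => L.coeffMul t (Pi.single I x) (L.coeffMul t Y Z)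
    - L.coeffMul t (L.coeffMul t (Pi.single I x) Y) Z = L.coeffMul t (Pi.single I x)
      (L.coeffMul t Z Y) - L.coeffMul t (L.coeffMul t (Pi.single I x) Z) Y)
    (fun J y hy => ?_) (by simp) (fun Y Y' h h' => ?_) hY
  · refine coeffModule_induction (p := fun Z => L.coeffMul t (Pi.single I x)
      (L.coeffMul t (Pi.single J y) Z)
      - L.coeffMul t (L.coeffMul t (Pi.single I x) (Pi.single J y)) Z = L.coeffMul t (Pi.single I x)
        (L.coeffMul t Z (Pi.single J y))
        - L.coeffMul t (L.coeffMul t (Pi.single I x) Z) (Pi.single J y))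
      (fun M z hz => ?_) (by simp) (fun Z Z' h h' => ?_) hZ
    · have key (J M : Finset ι) (y z : g) :
          L.coeffMul t (Pi.single I x) (L.coeffMul t (Pi.single J y) (Pi.single M z))
            - L.coeffMul t (L.coeffMul t (Pi.single I x) (Pi.single J y)) (Pi.single M z)
          = Pi.single (I ∪ (J ∪ M)) ((setSign t J M * (setSign t I J * setSign t I M)) •
              (L.mul x (L.mul y z) - L.mul (L.mul x y) z)) := by
        simp only [coeffMul_single, map_smul, LinearMap.smul_apply, smul_smul]
        rw [Finset.union_assoc, ← Pi.single_sub, smul_sub, mul_comm (setSign t I (J ∪ M)),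
          setSign_mul_union_right ht, mul_comm (setSign t (I ∪ J) M), setSign_mul_union_left ht]
        congr 3
        ring
      rw [key J M y z, key M J z y, L.pre_lie x hy hz, Finset.union_comm M J, smul_smul,
        setSign_symm ht J M]
      congr 2
      have := ksgn_mul_self (K := K) (setDeg k J * setDeg k M)
      linear_combination (setSign t M J * (setSign t I J * setSign t I M)) * this
    · simp only [map_add, LinearMap.add_apply]
      rw [add_sub_add_comm, h, h', add_sub_add_comm]
  · simp only [map_add, LinearMap.add_apply]
    rw [add_sub_add_comm, h, h', add_sub_add_comm]

/-- The elements of total degree zero of the extension of a graded pre-Lie algebra by square-zero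
generators are a pre-Lie algebra without grading. -/
noncomputable def coeffPreLie : DGPreLie K (trivGrading K (coeffModule 𝒢 k)) where
  d := 0
  mul := mk₂ K (fun Z W => ⟨L.coeffMul t Z W, L.coeffMul_mem ht Z.2 W.2⟩)
    (fun _ _ _ => Subtype.ext (by simp)) (fun _ _ _ => Subtype.ext (by simp))
    (fun _ _ _ => Subtype.ext (by simp)) (fun _ _ _ => Subtype.ext (by simp))
  d_mem _ := Submodule.zero_mem _
  mul_mem {m n x y} hx hy := by
    by_cases hm : m = 0
    · by_cases hn : n = 0
      · subst hm hn
        exact mem_trivGrading_zero K _ _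
      · rw [eq_zero_of_mem_trivGrading hn hy, map_zero]
        exact Submodule.zero_mem _
    · rw [eq_zero_of_mem_trivGrading hm hx, map_zero]
      exact Submodule.zero_mem _
  d_d _ := rfl
  d_mul _ _ := by simp only [LinearMap.zero_apply, map_zero, smul_zero, add_zero]
  pre_lie {m n} x y z hy hz := by
    by_cases hm : m = 0
    · subst hm
      rw [zero_mul, ksgn_zero K, one_smul]
      exact Subtype.ext (L.coeffMul_pre_lie ht x y.2 z.2)
    · simp [eq_zero_of_mem_trivGrading hm hy]

theorem coe_coeffPreLie_mul (Z W : coeffModule 𝒢 k) :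
    (((L.coeffPreLie ht).mul Z W : coeffModule 𝒢 k) : Finset ι → g) = L.coeffMul t Z W := rfl

omit ht in
theorem mem_of_coe_eq_single {Z : coeffModule 𝒢 k} {I : Finset ι} {z : g}
    (h : (Z : Finset ι → g) = Pi.single I z) : z ∈ 𝒢 (setDeg k I) := by
  simpa [h] using mem_coeffModule.1 Z.2 I

/-- The operation `x • (x₁, …, xᵣ)` on monomials `e_I z`. -/
theorem coe_coeffPreLie_corolla [DirectSum.Decomposition 𝒢] {r : ℕ} {Z₀ : coeffModule 𝒢 k}
    {Z : Fin r → coeffModule 𝒢 k} {I₀ : Finset ι} {I : Fin r → Finset ι} {z₀ : g} {z : Fin r → g}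
    (h₀ : (Z₀ : Finset ι → g) = Pi.single I₀ z₀)
    (h : ∀ b, (Z b : Finset ι → g) = Pi.single (I b) (z b)) :
    ((L.coeffPreLie ht).corolla Z₀ r Z : Finset ι → g)
      = Pi.single (I₀ ∪ univ.biUnion I)
          (tupleSign t (Fin.cons I₀ I : Fin (r + 1) → Finset ι) • L.corolla z₀ r z) := by
  induction r with
  | zero => simp [corolla_zero, h₀, tupleSign]
  | succ r ih =>
    have hz (b) := mem_of_coe_eq_single (h b)
    have hU : univ.biUnion (Fin.cons I₀ (Fin.init I) : Fin (r + 1) → Finset ι)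
        = I₀ ∪ univ.biUnion (Fin.init I) := by
      ext j; simp [Fin.exists_fin_succ]
    have hU' : univ.biUnion I = univ.biUnion (Fin.init I) ∪ I (Fin.last r) := by
      ext j; simp [Fin.exists_fin_succ']; rfl
    have hJ : (Fin.cons I₀ I : Fin (r + 2) → Finset ι)
        = snoc (Fin.cons I₀ (Fin.init I) : Fin (r + 1) → Finset ι) (I (Fin.last r)) := by
      rw [← Fin.cons_snoc_eq_snoc_cons, snoc_init_self]
    have h1 := ih (Z := Fin.init Z) (I := Fin.init I) (z := Fin.init z) fun b => h b.castSucc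
    have h2 (i : Fin r) := ih
      (Z := update (Fin.init Z) i ((L.coeffPreLie ht).mul (Fin.init Z i) (Z (Fin.last r))))
      (I := update (Fin.init I) i (Fin.init I i ∪ I (Fin.last r)))
      (z := update (Fin.init z) i (setSign t (Fin.init I i) (I (Fin.last r)) •
        L.mul (Fin.init z i) (z (Fin.last r)))) (fun b => by
        rcases eq_or_ne b i with rfl | hb
        · simp [coe_coeffPreLie_mul, Fin.init, h, coeffMul_single]
        · simp [hb, Fin.init, h])
    have hU2 (i : Fin r) : univ.biUnion
        (update (Fin.init I) i (Fin.init I i ∪ I (Fin.last r)))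
          = univ.biUnion I := by
      rw [hU']
      ext j
      simp only [mem_biUnion, mem_univ, true_and, Finset.mem_union]
      constructor
      · rintro ⟨b, hb⟩
        rcases eq_or_ne b i with rfl | hbi
        · simp at hb
          exact hb.imp_left fun hb => ⟨_, hb⟩
        · rw [update_of_ne hbi] at hb
          exact Or.inl ⟨_, hb⟩
      · rintro (⟨b, hb⟩ | hj)
        · refine ⟨b, ?_⟩
          rcases eq_or_ne b i with rfl | hbi
          · simp [hb]
          · rwa [update_of_ne hbi]
        · exact ⟨i, by simp [hj]⟩
    have hu (i : Fin r) : (Fin.cons I₀ (update (Fin.init I) i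
        (Fin.init I i ∪ I (Fin.last r))) : Fin (r + 1) → Finset ι)
        = update (Fin.cons I₀ (Fin.init I) : Fin (r + 1) → Finset ι) i.succ
          ((Fin.cons I₀ (Fin.init I) : Fin (r + 1) → Finset ι) i.succ ∪ I (Fin.last r)) := by
      rw [Fin.cons_update, Fin.cons_succ]
    have hs (i : Fin r) := tupleSign_update ht (Fin.cons I₀ (Fin.init I) : Fin (r + 1) → Finset ι)
      (I (Fin.last r)) i.succ
    have hf (i : Fin r) : ∑ j ∈ univ.filter (i.succ < ·),
        setDeg k ((Fin.cons I₀ (Fin.init I) : Fin (r + 1) → Finset ι) j)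
          = ∑ j ∈ univ.filter (i < ·), setDeg k (I j.castSucc) := by
      rw [sum_filter, Fin.sum_univ_succ, sum_filter]
      simp [Fin.init]
    have hc := L.corolla_succ z₀ hz
    rw [hc]
    have hA := (L.coeffPreLie ht).corolla_snoc (mem_trivGrading_zero K _) Z₀ (Fin.init Z)
      (Z (Fin.last r))
    rw [snoc_init_self] at hA
    rw [hA, AddSubgroupClass.coe_sub, AddSubmonoidClass.coe_finset_sum, coe_coeffPreLie_mul, h1,
      h (Fin.last r), coeffMul_single, smul_sub, Pi.single_sub, smul_sum]
    congr 1
    · rw [hJ, tupleSign_snoc, ← tupleSign_mul_setSign_biUnion ht, hU, hU', Finset.union_assoc,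
        map_smul, LinearMap.smul_apply, smul_smul, mul_comm]
    · have hsum : ∀ (s : Finset (Fin r)) (I : Finset ι) (f : Fin r → g),
          Pi.single (M := fun _ => g) I (∑ i ∈ s, f i) = ∑ i ∈ s, Pi.single I (f i) :=
        fun s I f => map_sum (AddMonoidHom.single (fun _ => g) I) f s
      rw [hsum]
      refine sum_congr rfl fun i _ => ?_
      rw [h2, hU2, MultilinearMap.map_update_smul, smul_smul, hu, smul_smul, hJ]
      congr 2
      rw [mul_comm]
      refine (hs i).trans ?_
      rw [hf, mul_comm]

end DGPreLie

/-! ### Derivations and the filtration by weight -/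

namespace DGPreLie

variable {K : Type u} [Field K] {g : Type v} [AddCommGroup g] [Module K g]
  {𝒢 : ℤ → Submodule K g} (L : DGPreLie K 𝒢) {ι : Type w} [Fintype ι] [DecidableEq ι]
  {k : ι → ℤ} {t : ι → ι → K} (ht : IsKoszulRule k t)

-- the ungraded pre-Lie algebra obtained from `L` by adjoining square-zero generators
local notation "Lc" => DGPreLie.coeffPreLie L ht

/-- The derivation that multiplies `e_I z` by the weight `∑_{i ∈ I} w i`. -/
noncomputable def weightDer (𝒢 : ℤ → Submodule K g) (k : ι → ℤ) (w : ι → ℕ) :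
    coeffModule 𝒢 k →ₗ[K] coeffModule 𝒢 k where
  toFun Z := ⟨fun I => ((∑ i ∈ I, w i : ℕ) : K) • (Z : Finset ι → g) I,
    mem_coeffModule.2 fun I => Submodule.smul_mem _ _ (mem_coeffModule.1 Z.2 I)⟩
  map_add' Z W := by ext I; simp
  map_smul' c Z := by ext I; simp [smul_comm c]

theorem coe_weightDer_apply (w : ι → ℕ) (Z : coeffModule 𝒢 k) (I : Finset ι) :
    (weightDer 𝒢 k w Z : Finset ι → g) I = ((∑ i ∈ I, w i : ℕ) : K) • (Z : Finset ι → g) I := rfl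

theorem weightDer_mul (w : ι → ℕ) (Z W : coeffModule 𝒢 k) :
    weightDer 𝒢 k w ((Lc).mul Z W)
      = (Lc).mul (weightDer 𝒢 k w Z) W
        + (Lc).mul Z (weightDer 𝒢 k w W) := by
  ext U
  rw [coe_weightDer_apply, Submodule.coe_add, coe_coeffPreLie_mul, coe_coeffPreLie_mul,
    coe_coeffPreLie_mul, coeffMul_apply, coeffMul_apply, coeffMul_apply]
  simp only [Pi.add_apply, Finset.sum_apply, smul_sum, ← sum_add_distrib]
  refine sum_congr rfl fun I _ => sum_congr rfl fun J _ => ?_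
  rw [coe_weightDer_apply, coe_weightDer_apply]
  rcases eq_or_ne U (I ∪ J) with rfl | hU
  · by_cases h : setSign t I J = 0
    · simp [h]
    · rw [sum_union (disjoint_of_setSign_ne_zero ht h)]
      simp only [Pi.single_eq_same, map_smul, LinearMap.smul_apply, Nat.cast_add, add_smul,
        smul_add, smul_comm (setSign t I J)]
  · simp [hU]

/-- The map `e_I z ↦ e_p e_I (d z)` on all families of coefficients. -/
noncomputable def diffMap (t : ι → ι → K) (p : ι) : (Finset ι → g) →ₗ[K] (Finset ι → g) where
  toFun Z := ∑ I, Pi.single ({p} ∪ I) (setSign t {p} I • L.d (Z I))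
  map_add' Z W := by simp [Pi.single_add, sum_add_distrib]
  map_smul' c Z := by simp [smul_sum, smul_comm c, ← Pi.single_smul]

theorem diffMap_single (p : ι) (I : Finset ι) (z : g) :
    L.diffMap t p (Pi.single I z) = Pi.single ({p} ∪ I) (setSign t {p} I • L.d z) := by
  change ∑ J, _ = _
  rw [sum_eq_single I]
  · simp
  · intro J _ hJ; simp [hJ]
  · simp

theorem diffMap_diffMap (p q : ι) (Z : Finset ι → g) : L.diffMap t p (L.diffMap t q Z) = 0 := by
  rw [← univ_sum_single Z]
  simp [diffMap_single, L.d_d]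

include ht in
theorem diffMap_mem {p : ι} (hp : k p = -1) {Z : Finset ι → g} (hZ : Z ∈ coeffModule 𝒢 k) :
    L.diffMap t p Z ∈ coeffModule 𝒢 k := by
  refine Submodule.sum_mem _ fun I _ => single_mem_coeffModule ?_
  refine setSign_smul_mem ht (L.d_mem (mem_coeffModule.1 hZ I)) ?_
  simp only [setDeg, sum_singleton, hp]
  ring

include ht in
theorem diffMap_coeffMul {p : ι} (hp : k p = -1) {Z : Finset ι → g} (hZ : Z ∈ coeffModule 𝒢 k)
    (W : Finset ι → g) : L.diffMap t p (L.coeffMul t Z W)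
      = L.coeffMul t (L.diffMap t p Z) W + L.coeffMul t Z (L.diffMap t p W) := by
  refine coeffModule_induction (p := fun Z => L.diffMap t p (L.coeffMul t Z W)
      = L.coeffMul t (L.diffMap t p Z) W + L.coeffMul t Z (L.diffMap t p W))
      (fun I z hz => ?_) (by simp) (fun Z Z' h h' => ?_) hZ
  · rw [← univ_sum_single W]
    simp only [map_sum, ← sum_add_distrib]
    refine sum_congr rfl fun J _ => ?_
    have h1 : setDeg k {p} = -1 := by simp [setDeg, hp]
    have h2 := setSign_symm ht I {p}
    rw [h1, mul_neg_one, ksgn_neg] at h2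
    simp only [coeffMul_single, diffMap_single, map_smul, LinearMap.smul_apply, smul_smul]
    rw [L.d_mul _ hz, Finset.union_left_comm I, ← Finset.union_assoc, ← Pi.single_add, smul_add,
      smul_smul, mul_comm _ (setSign t I J), setSign_mul_union_right ht,
      mul_comm (setSign t ({p} ∪ I) J), setSign_mul_union_left ht,
      mul_comm (setSign t I ({p} ∪ J)), setSign_mul_union_right ht, h2]
    congr 3
    · ring
    · ring
  · simp only [map_add, LinearMap.add_apply, h, h']
    abel

/-- The derivation `e_I z ↦ e_p e_I (d z)` determined by the differential and a generator `e_p` of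
degree one. -/
noncomputable def diffDer {p : ι} (hp : k p = -1) : coeffModule 𝒢 k →ₗ[K] coeffModule 𝒢 k :=
  (L.diffMap t p).restrict fun _ hZ => L.diffMap_mem ht hp hZ

theorem coe_diffDer {p : ι} (hp : k p = -1) (Z : coeffModule 𝒢 k) :
    (L.diffDer ht hp Z : Finset ι → g) = L.diffMap t p Z := rfl

theorem diffDer_mul {p : ι} (hp : k p = -1) (Z W : coeffModule 𝒢 k) :
    L.diffDer ht hp ((Lc).mul Z W)
      = (Lc).mul (L.diffDer ht hp Z) W
        + (Lc).mul Z (L.diffDer ht hp W) :=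
  Subtype.ext (L.diffMap_coeffMul ht hp Z.2 W)

theorem diffDer_diffDer {p q : ι} (hp : k p = -1) (hq : k q = -1) (Z : coeffModule 𝒢 k) :
    L.diffDer ht hp (L.diffDer ht hq Z) = 0 := Subtype.ext (L.diffMap_diffMap p q Z)

/-- The elements all of whose coefficients of weight less than `n` vanish. -/
def weightFiltration (𝒢 : ℤ → Submodule K g) (k : ι → ℤ) (w : ι → ℕ) (n : ℕ) :
    Submodule K (coeffModule 𝒢 k) where
  carrier := {Z | ∀ I, ∑ i ∈ I, w i < n → (Z : Finset ι → g) I = 0}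
  add_mem' {Z W} hZ hW I hI := by simp [hZ I hI, hW I hI]
  zero_mem' I _ := rfl
  smul_mem' c Z hZ I hI := by simp [hZ I hI]

variable {w : ι → ℕ}

theorem weightFiltration_zero : weightFiltration 𝒢 k w 0 = ⊤ :=
  eq_top_iff.2 fun _ _ _ h => absurd h (Nat.not_lt_zero _)

theorem weightFiltration_antitone : Antitone (weightFiltration 𝒢 k w) :=
  fun _ _ h _ hZ I hI => hZ I (hI.trans_le h)

theorem eq_zero_of_mem_weightFiltration {n : ℕ} (hn : ∑ i, w i < n) {Z : coeffModule 𝒢 k}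
    (hZ : Z ∈ weightFiltration 𝒢 k w n) : Z = 0 :=
  Subtype.ext <| funext fun I =>
    hZ I ((Finset.sum_le_sum_of_subset (Finset.subset_univ I)).trans_lt hn)

theorem single_mem_weightFiltration {Z : coeffModule 𝒢 k} {I : Finset ι} {z : g}
    (h : (Z : Finset ι → g) = Pi.single I z) {n : ℕ} (hn : n ≤ ∑ i ∈ I, w i) :
    Z ∈ weightFiltration 𝒢 k w n := by
  intro J hJ
  rw [h, Pi.single_eq_of_ne]
  rintro rfl
  exact absurd hn hJ.not_ge

theorem mul_mem_weightFiltration {m n : ℕ} {Z W : coeffModule 𝒢 k}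
    (hZ : Z ∈ weightFiltration 𝒢 k w m) (hW : W ∈ weightFiltration 𝒢 k w n) :
    (Lc).mul Z W ∈ weightFiltration 𝒢 k w (m + n) := by
  intro U hU
  rw [coe_coeffPreLie_mul, coeffMul_apply, Finset.sum_apply]
  refine sum_eq_zero fun I _ => ?_
  rw [Finset.sum_apply]
  refine sum_eq_zero fun J _ => ?_
  rcases eq_or_ne U (I ∪ J) with rfl | h
  · by_cases h : setSign t I J = 0
    · simp [h]
    · rw [sum_union (disjoint_of_setSign_ne_zero ht h)] at hU
      rcases lt_or_ge (∑ i ∈ I, w i) m with h1 | h1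
      · simp [hZ I h1]
      · simp [hW J (by omega)]
  · simp [h]

theorem weightDer_mem {n : ℕ} {Z : coeffModule 𝒢 k} (hZ : Z ∈ weightFiltration 𝒢 k w n) :
    weightDer 𝒢 k w Z ∈ weightFiltration 𝒢 k w n := by
  intro I hI
  rw [coe_weightDer_apply, hZ I hI, smul_zero]

theorem weightDer_eq_zero {Z : coeffModule 𝒢 k} {I : Finset ι} {z : g}
    (h : (Z : Finset ι → g) = Pi.single I z) (hI : ∑ i ∈ I, w i = 0) :
    weightDer 𝒢 k w Z = 0 := by
  ext J
  rw [coe_weightDer_apply, h]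
  rcases eq_or_ne J I with rfl | hJ
  · simp [hI]
  · simp [hJ]

/-- An equation `N Z = Z • y + …` with `y` of positive weight determines `Z` from its part of weight
zero. -/
theorem eq_zero_of_weightDer_eq [CharZero K] {Z y : coeffModule 𝒢 k}
    (hZ : Z ∈ weightFiltration 𝒢 k w 1) (hy : y ∈ weightFiltration 𝒢 k w 1)
    (h : weightDer 𝒢 k w Z = (Lc).mul Z y) : Z = 0 := by
  have hn (n : ℕ) : Z ∈ weightFiltration 𝒢 k w (n + 1) := by
    induction n with
    | zero => exact hZ
    | succ n ih =>
      intro I hI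
      rcases Nat.lt_succ_iff_lt_or_eq.1 hI with hI' | hI'
      · exact ih I hI'
      · have h1 := L.mul_mem_weightFiltration ht ih hy I (by omega)
        rw [← h, coe_weightDer_apply, hI'] at h1
        exact (smul_eq_zero.1 h1).resolve_left (by exact_mod_cast Nat.succ_ne_zero n)
  exact eq_zero_of_mem_weightFiltration (Nat.lt_succ_self _) (hn _)

theorem exists_weightDer_eq {X : coeffModule 𝒢 k} (hX : X ∈ weightFiltration 𝒢 k w 1) :
    ∃ y ∈ weightFiltration 𝒢 k w 1, weightDer 𝒢 k w X = y + (Lc).mul X y := by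
  set f : Module.End K (coeffModule 𝒢 k) := -(Lc).mul X
  have hpow (n : ℕ) : (f ^ n) (weightDer 𝒢 k w X) ∈ weightFiltration 𝒢 k w (n + 1) := by
    induction n with
    | zero => simpa using weightDer_mem hX
    | succ n ih =>
      rw [pow_succ', Module.End.mul_apply, add_comm]
      exact Submodule.neg_mem _ (L.mul_mem_weightFiltration ht hX ih)
  refine ⟨(∑ j ∈ range (∑ i, w i), f ^ j) (weightDer 𝒢 k w X), ?_, ?_⟩
  · rw [LinearMap.sum_apply]
    exact Submodule.sum_mem _ fun j _ => weightFiltration_antitone (by omega) (hpow j)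
  · have h := congrArg (fun F : Module.End K (coeffModule 𝒢 k) => F (weightDer 𝒢 k w X))
      (mul_neg_geom_sum f (∑ i, w i))
    simp only [Module.End.mul_apply, LinearMap.sub_apply, Module.End.one_apply] at h
    rw [eq_zero_of_mem_weightFiltration (Nat.lt_succ_self _) (hpow _), sub_zero] at h
    have hf' (z : coeffModule 𝒢 k) : f z = -(Lc).mul X z := rfl
    rw [hf', sub_neg_eq_add] at h
    exact h.symm

section Exponential

variable [DirectSum.Decomposition 𝒢] {M : ℕ} {X : coeffModule 𝒢 k}

theorem expNilpotent (hM : ∑ i, w i < M) (hX : X ∈ weightFiltration 𝒢 k w 1) :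
    (Lc).ExpNilpotent M X := by
  have key {r : ℕ} (a : coeffModule 𝒢 k) (n : Fin r → ℕ) (v : Fin r → coeffModule 𝒢 k)
      (hv : ∀ i, v i ∈ weightFiltration 𝒢 k w (n i)) (hn : ∑ i, n i = M) :
      (Lc).corolla a r v = 0 :=
    eq_zero_of_mem_weightFiltration (w := w) hM (hn ▸ (Lc).corolla_mem_filtration
      (mem_trivGrading_zero K _) weightFiltration_zero (L.mul_mem_weightFiltration ht) a hv)
  have h0 (Z : coeffModule 𝒢 k) : Z ∈ weightFiltration 𝒢 k w 0 := by
    rw [weightFiltration_zero]; trivial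
  constructor
  · intro a b
    refine key a (snoc (fun _ => 1) 0 : Fin (M + 1) → ℕ) _ (fun i => ?_) ?_
    · refine lastCases ?_ (fun i => ?_) i
      · simpa [snoc_last (α := fun _ => ℕ)] using h0 _
      · simpa [snoc_castSucc (α := fun _ => ℕ),
          snoc_castSucc (α := fun _ => coeffModule 𝒢 k)] using hX
    · simp [Fin.sum_univ_castSucc, snoc_last (α := fun _ => ℕ),
        snoc_castSucc (α := fun _ => ℕ)]
  · intro a b c
    refine key a (snoc (snoc (fun _ => 1) 0 : Fin (M + 1) → ℕ) 0 : Fin (M + 2) → ℕ) _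
      (fun i => ?_) ?_
    · refine lastCases ?_ (fun i => lastCases ?_ (fun i => ?_) i) i
      · simpa [snoc_last (α := fun _ => ℕ)] using h0 _
      · simpa [snoc_last (α := fun _ => ℕ), snoc_castSucc (α := fun _ => ℕ)] using h0 _
      · simpa [snoc_castSucc (α := fun _ => ℕ),
          snoc_castSucc (α := fun _ => coeffModule 𝒢 k)] using hX
    · simp [Fin.sum_univ_castSucc, snoc_last (α := fun _ => ℕ),
        snoc_castSucc (α := fun _ => ℕ)]

theorem expC_sub_mem (hX : X ∈ weightFiltration 𝒢 k w 1) (a : coeffModule 𝒢 k) :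
    (Lc).expC M X a - a ∈ weightFiltration 𝒢 k w 1 := by
  rw [expC, sum_range_succ']
  simp only [Nat.factorial_zero, Nat.cast_one, inv_one, one_smul, corolla_zero,
    add_sub_cancel_right]
  refine Submodule.sum_mem _ fun m _ => Submodule.smul_mem _ _ ?_
  have := (Lc).corolla_mem_filtration (mem_trivGrading_zero K _)
    weightFiltration_zero (L.mul_mem_weightFiltration (w := w) ht) a
    (r := m + 1) (n := fun _ => 1) (v := fun _ => X) (fun _ => hX)
  exact weightFiltration_antitone (by simp) this

theorem expC₁_sub_mem (hX : X ∈ weightFiltration 𝒢 k w 1) (a b : coeffModule 𝒢 k) :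
    (Lc).expC₁ M X a b - (Lc).mul a b
      ∈ weightFiltration 𝒢 k w 1 := by
  rw [expC₁, sum_range_succ']
  have h0 : (Lc).corolla a (0 + 1) (snoc (fun _ => X) b)
      = (Lc).mul a b := corolla_one _ _ _
  simp only [Nat.factorial_zero, Nat.cast_one, inv_one, one_smul, h0, add_sub_cancel_right]
  refine Submodule.sum_mem _ fun m _ => Submodule.smul_mem _ _ ?_
  have := (Lc).corolla_mem_filtration (mem_trivGrading_zero K _)
    weightFiltration_zero (L.mul_mem_weightFiltration (w := w) ht) a
    (r := m + 1 + 1) (n := (snoc (fun _ => 1) 0 : Fin (m + 1 + 1) → ℕ))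
    (v := (snoc (fun _ => X) b : Fin (m + 1 + 1) → coeffModule 𝒢 k)) (fun i => by
      refine lastCases ?_ (fun i => ?_) i
      · simp [snoc_last (α := fun _ => ℕ), weightFiltration_zero]
      · simpa [snoc_castSucc (α := fun _ => ℕ),
          snoc_castSucc (α := fun _ => coeffModule 𝒢 k)] using hX)
  refine weightFiltration_antitone ?_ this
  simp [Fin.sum_univ_castSucc, snoc_last (α := fun _ => ℕ),
        snoc_castSucc (α := fun _ => ℕ)]

/-- The symmetric brace identity `(a • b) • exp X = a • (exp X, b • exp X)`: both sides solve the
equation `N Z = Z • y`, where `N X = y + X • y`. -/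
theorem expC_mul [CharZero K] (hM : ∑ i, w i < M) (hX : X ∈ weightFiltration 𝒢 k w 1)
    {a b : coeffModule 𝒢 k} (ha : weightDer 𝒢 k w a = 0) (hb : weightDer 𝒢 k w b = 0) :
    (Lc).expC M X ((Lc).mul a b)
      = (Lc).expC₁ M X a ((Lc).expC M X b) := by
  obtain ⟨y, hy, hNX⟩ := L.exists_weightDer_eq ht hX
  have hN := L.weightDer_mul ht w
  have hnil := L.expNilpotent ht hM hX
  have h0 := mem_trivGrading_zero K (coeffModule 𝒢 k)
  have hab : weightDer 𝒢 k w ((Lc).mul a b) = 0 := by simp [hN, ha, hb]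
  -- the difference of the two sides has no part of weight zero and solves `N Z = Z • y`
  rw [← sub_eq_zero]
  refine L.eq_zero_of_weightDer_eq ht ?_ hy ?_
  · have h1 := L.expC_sub_mem ht (M := M) hX ((Lc).mul a b)
    have h2 := L.expC₁_sub_mem ht (M := M) hX a ((Lc).expC M X b)
    have h3 := L.mul_mem_weightFiltration ht (w := w) (m := 0) (Z := a)
      (by rw [weightFiltration_zero]; trivial) (L.expC_sub_mem ht (M := M) hX b)
    rw [map_sub, zero_add] at h3
    convert Submodule.sub_mem _ (Submodule.sub_mem _ h1 h2) h3 using 1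
    abel
  · rw [map_sub, map_sub, LinearMap.sub_apply, derivation_expC_of_eq h0 hnil hN hab hNX,
      derivation_expC₁_expC_of_eq h0 hnil hN ha hb hNX]

end Exponential

end DGPreLie

/-! ### Lifting operations to the extended algebra -/

namespace DGPreLie

variable {K : Type u} [Field K] {g : Type v} [AddCommGroup g] [Module K g]
  {𝒢 : ℤ → Submodule K g} (L : DGPreLie K 𝒢) {ι : Type w} [Fintype ι] [DecidableEq ι]
  {k : ι → ℤ} {t : ι → ι → K} (ht : IsKoszulRule k t)

-- the ungraded pre-Lie algebra obtained from `L` by adjoining square-zero generators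
local notation "Lc" => DGPreLie.coeffPreLie L ht

/-- Symmetric operations `F'` on the extended algebra with
`F' (e_{I₁} z₁, …, e_{I_m} z_m) = e_P e_{I₁} ⋯ e_{I_m} F (z₁, …, z_m)`. -/
structure IsLift (t : ι → ι → K) (P : Finset ι)
    (F' : MultiOps K (coeffModule 𝒢 k) (coeffModule 𝒢 k)) (F : MultiOps K g g) : Prop where
  symm : ∀ m (v : Fin m → coeffModule 𝒢 k) (σ : Equiv.Perm (Fin m)), F' m (v ∘ σ) = F' m v
  coe_apply : ∀ m (Z : Fin m → coeffModule 𝒢 k) (I : Fin m → Finset ι) (z : Fin m → g),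
    (∀ b, (Z b : Finset ι → g) = Pi.single (I b) (z b)) →
      (F' m Z : Finset ι → g) = Pi.single (P ∪ univ.biUnion I)
        (tupleSign t (Fin.cons P I : Fin (m + 1) → Finset ι) • F m z)

/-- The element `e_p α`. -/
def liftElem {α : g} (hα : α ∈ 𝒢 (-1)) {p : ι} (hp : k p = -1) : coeffModule 𝒢 k :=
  ⟨Pi.single {p} α, single_mem_coeffModule (by simpa [setDeg, hp] using hα)⟩

theorem coe_liftElem {α : g} (hα : α ∈ 𝒢 (-1)) {p : ι} (hp : k p = -1) :
    (liftElem hα hp : Finset ι → g) = Pi.single {p} α := rfl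

theorem weightDer_liftElem {w : ι → ℕ} {α : g} (hα : α ∈ 𝒢 (-1)) {p : ι} (hp : k p = -1)
    (hw : w p = 0) : weightDer 𝒢 k w (liftElem hα hp) = 0 :=
  weightDer_eq_zero (coe_liftElem hα hp) (by simpa using hw)

theorem diffDer_liftElem {α : g} (hα : L.IsMaurerCartan α) {p q : ι} (hp : k p = -1)
    (hq : k q = -1) : L.diffDer ht hp (liftElem hα.1 hq)
      = -(Lc).mul (liftElem hα.1 hp) (liftElem hα.1 hq) := by
  refine Subtype.ext ?_
  rw [coe_diffDer, NegMemClass.coe_neg, coe_coeffPreLie_mul, coe_liftElem, coe_liftElem,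
    diffMap_single, coeffMul_single, eq_neg_of_add_eq_zero_left hα.2, smul_neg, Pi.single_neg]

/-- The twisted differential `D + [e_p α, -]` of the extended algebra. -/
noncomputable def liftD {α : g} (hα : α ∈ 𝒢 (-1)) {p : ι} (hp : k p = -1) :
    coeffModule 𝒢 k →ₗ[K] coeffModule 𝒢 k :=
  L.diffDer ht hp + (Lc).mul (liftElem hα hp)
    - (Lc).mul.flip (liftElem hα hp)

theorem liftD_apply {α : g} (hα : α ∈ 𝒢 (-1)) {p : ι} (hp : k p = -1) (Z : coeffModule 𝒢 k) :
    L.liftD ht hα hp Z = L.diffDer ht hp Z + (Lc).mul (liftElem hα hp) Z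
      - (Lc).mul Z (liftElem hα hp) := rfl

/-- The lifts of the operations `ν_r`. -/
noncomputable def liftNu {α : g} (hα : α ∈ 𝒢 (-1)) {p : ι} (hp : k p = -1) :
    MultiOps K (coeffModule 𝒢 k) (coeffModule 𝒢 k)
  | 0 => 0
  | 1 => MultilinearMap.ofSubsingleton K _ _ 0 (L.liftD ht hα hp)
  | m + 2 => (Lc).corolla (liftElem hα hp) (m + 2)

variable [DirectSum.Decomposition 𝒢]

theorem coe_liftD {α : g} (hα : α ∈ 𝒢 (-1)) {p : ι} (hp : k p = -1) {Z : coeffModule 𝒢 k}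
    {I : Finset ι} {z : g} (h : (Z : Finset ι → g) = Pi.single I z) :
    (L.liftD ht hα hp Z : Finset ι → g)
      = Pi.single ({p} ∪ I) (setSign t {p} I • L.twistedD α z) := by
  have h1 : setDeg k {p} = -1 := by simp [setDeg, hp]
  have h2 := setSign_symm ht I {p}
  rw [h1, mul_neg_one, ksgn_neg] at h2
  rw [L.twistedD_apply α (mem_of_coe_eq_single h), liftD_apply, AddSubgroupClass.coe_sub,
    Submodule.coe_add, coe_coeffPreLie_mul, coe_coeffPreLie_mul, coe_diffDer, h, coe_liftElem,
    diffMap_single, coeffMul_single, coeffMul_single, Finset.union_comm I, h2, ← Pi.single_add,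
    ← Pi.single_sub, smul_sub, smul_add, smul_smul, mul_comm (ksgn K _)]

theorem isLift_liftNu {α : g} (hα : α ∈ 𝒢 (-1)) {p : ι} (hp : k p = -1) :
    IsLift t {p} (L.liftNu ht hα hp) (L.nu α) where
  symm m v σ := by
    match m with
    | 0 => rfl
    | 1 => rw [Subsingleton.elim σ 1]; rfl
    | m + 2 => exact (Lc).corolla_comp_perm (mem_trivGrading_zero K _) _ v σ
  coe_apply m Z I z h := by
    match m with
    | 0 => simp [liftNu, nu]
    | 1 =>
      have := L.coe_liftD ht hα hp (h 0)
      simpa [liftNu, nu, tupleSign_cons, tupleSign] using this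
    | m + 2 => exact L.coe_coeffPreLie_corolla ht (coe_liftElem hα hp) h

theorem isLift_abelianOps {α : g} (hα : α ∈ 𝒢 (-1)) {p : ι} (hp : k p = -1) :
    IsLift t {p} (abelianOps (L.liftD ht hα hp)) (abelianOps (L.twistedD α)) where
  symm m v σ := by
    by_cases hm : m = 1
    · subst hm
      rw [Subsingleton.elim σ 1]; rfl
    · rw [abelianOps_apply_of_ne_one hm, abelianOps_apply_of_ne_one hm]
  coe_apply m Z I z h := by
    by_cases hm : m = 1
    · subst hm
      have := L.coe_liftD ht hα hp (h 0)
      simpa [abelianOps, tupleSign_cons, tupleSign] using this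
    · rw [abelianOps_apply_of_ne_one hm, abelianOps_apply_of_ne_one hm]
      simp

variable {M : ℕ} {X : coeffModule 𝒢 k}

theorem sum_liftNu_const (hM : 0 < M) {α : g} (hα : α ∈ 𝒢 (-1)) {p : ι} (hp : k p = -1) :
    ∑ m ∈ range (M + 1), (m.factorial : K)⁻¹ • L.liftNu ht hα hp m (fun _ => X)
      = (Lc).expC M X (liftElem hα hp) - liftElem hα hp + L.diffDer ht hp X
        - (Lc).mul X (liftElem hα hp) := by
  obtain ⟨M, rfl⟩ := Nat.exists_eq_succ_of_ne_zero hM.ne'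
  have h2 (m : ℕ) : L.liftNu ht hα hp (m + 1 + 1) (fun _ => X)
      = (Lc).corolla (liftElem hα hp) (m + 1 + 1) (fun _ => X) := rfl
  have h1 : L.liftNu ht hα hp 1 (fun _ => X) = L.liftD ht hα hp X := rfl
  have h0 : L.liftNu ht hα hp 0 (fun _ => X) = 0 := rfl
  have h1' : (Lc).corolla (liftElem hα hp) 1 (fun _ => X)
      = (Lc).mul (liftElem hα hp) X := corolla_one _ _ _
  rw [expC, sum_range_succ', sum_range_succ', sum_range_succ',
    sum_range_succ']
  simp only [h2, zero_add, h1, h1', h0, liftD_apply, corolla_zero, Nat.factorial_zero,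
    Nat.factorial_one, Nat.cast_one, inv_one, one_smul]
  abel

theorem sum_liftNu_cons {α : g} (hα : α ∈ 𝒢 (-1)) {p : ι} (hp : k p = -1)
    (Y : coeffModule 𝒢 k) :
    ∑ m ∈ range (M + 1), (m.factorial : K)⁻¹ •
        L.liftNu ht hα hp (m + 1) (Fin.cons Y fun _ => X)
      = (Lc).expC₁ M X (liftElem hα hp) Y + L.diffDer ht hp Y
        - (Lc).mul Y (liftElem hα hp) := by
  have h2 (m : ℕ) : L.liftNu ht hα hp (m + 1 + 1) (Fin.cons Y fun _ => X)
      = (Lc).corolla (liftElem hα hp) (m + 1 + 1) (snoc (fun _ => X) Y) :=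
    (Lc).corolla_cons (mem_trivGrading_zero K _) _ _ _
  have h1 : L.liftNu ht hα hp 1 (Fin.cons Y fun _ => X) = L.liftD ht hα hp Y := rfl
  have h1' : (Lc).corolla (liftElem hα hp) 1 (snoc (fun _ => X) Y)
      = (Lc).mul (liftElem hα hp) Y := corolla_one _ _ _
  rw [expC₁, sum_range_succ', sum_range_succ']
  simp only [h2, zero_add, h1, h1', liftD_apply, Nat.factorial_zero, Nat.cast_one, inv_one,
    one_smul]
  abel

/-- The vector fields `V_p = ∑ₘ ν_{p, m} (X, …, X) / m!` for two generators `e_p`, `e_q` of degree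
one commute. -/
theorem sum_liftNu_cons_comm [CharZero K] {w : ι → ℕ} (hM : ∑ i, w i < M)
    (hX : X ∈ weightFiltration 𝒢 k w 1) {α : g} (hα : L.IsMaurerCartan α) {p q : ι}
    (hp : k p = -1) (hq : k q = -1) (hwp : w p = 0) (hwq : w q = 0) :
    ∑ m ∈ range (M + 1), (m.factorial : K)⁻¹ • L.liftNu ht hα.1 hp (m + 1)
      (Fin.cons (∑ n ∈ range (M + 1), (n.factorial : K)⁻¹ •
        L.liftNu ht hα.1 hq n fun _ => X) fun _ => X)
    = ∑ m ∈ range (M + 1), (m.factorial : K)⁻¹ • L.liftNu ht hα.1 hq (m + 1)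
      (Fin.cons (∑ n ∈ range (M + 1), (n.factorial : K)⁻¹ •
        L.liftNu ht hα.1 hp n fun _ => X) fun _ => X) := by
  have hM0 : 0 < M := by omega
  have h0 := mem_trivGrading_zero K (coeffModule 𝒢 k)
  have hnil := L.expNilpotent ht hM hX
  set A := L.coeffPreLie (𝒢 := 𝒢) ht
  have hneg (a : coeffModule 𝒢 k) : A.expC M X (-a) = -A.expC M X a := by
    simpa using expC_smul_left (L := A) (M := M) (X := X) h0 (-1) a
  have hsub (a b c : coeffModule 𝒢 k) :
      A.expC₁ M X a (b - c) = A.expC₁ M X a b - A.expC₁ M X a c :=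
    eq_sub_of_add_eq (by rw [← expC₁_add, sub_add_cancel])
  -- with `a = e_p α`, `b = e_q α`, the left side is the derivative of `V_p` in the direction `V_q`;
  -- the right side is symmetric, apart from the last summand, which is so by the pre-Lie identity
  have key {p q : ι} (hp : k p = -1) (hq : k q = -1) (hwp : w p = 0) (hwq : w q = 0)
      {a b : coeffModule 𝒢 k} (ea : a = liftElem hα.1 hp) (eb : b = liftElem hα.1 hq) :
      A.expC₁ M X a (A.expC M X b - b + L.diffDer ht hq X - A.mul X b)
        + L.diffDer ht hp (A.expC M X b - b + L.diffDer ht hq X - A.mul X b)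
        - A.mul (A.expC M X b - b + L.diffDer ht hq X - A.mul X b) a
      = (A.expC₁ M X a (L.diffDer ht hq X) + A.expC₁ M X b (L.diffDer ht hp X))
        - (A.expC₁ M X a b + A.expC₁ M X b a)
        - (A.expC₁ M X a (A.mul X b) + A.expC₁ M X b (A.mul X a))
        + (A.mul a b + A.mul b a)
        - (A.mul (L.diffDer ht hp X) b + A.mul (L.diffDer ht hq X) a)
        + (A.mul X (A.mul a b) + A.mul (A.mul X b) a) := by
    subst ea eb
    have hb : A.expC M X (A.mul (liftElem hα.1 hp) (liftElem hα.1 hq))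
        = A.expC₁ M X (liftElem hα.1 hp) (A.expC M X (liftElem hα.1 hq)) :=
      L.expC_mul ht hM hX (weightDer_liftElem hα.1 hp hwp) (weightDer_liftElem hα.1 hq hwq)
    have hda : L.diffDer ht hp (liftElem hα.1 hq)
        = -A.mul (liftElem hα.1 hp) (liftElem hα.1 hq) := L.diffDer_liftElem ht hα hp hq
    have hdm (Z W : coeffModule 𝒢 k) : L.diffDer ht hp (A.mul Z W)
        = A.mul (L.diffDer ht hp Z) W + A.mul Z (L.diffDer ht hp W) := L.diffDer_mul ht hp Z W
    simp only [hsub, expC₁_add, map_sub, map_add, LinearMap.sub_apply, LinearMap.add_apply,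
      derivation_expC h0 hnil hdm, hdm, L.diffDer_diffDer, hda, hneg, map_neg,
      mul_expC h0 hnil, hb]
    abel
  have hp3 := A.pre_lie_of_zero h0 X (liftElem hα.1 hp) (liftElem hα.1 hq)
  rw [sub_eq_sub_iff_add_eq_add] at hp3
  rw [L.sum_liftNu_const ht hM0, L.sum_liftNu_const ht hM0, L.sum_liftNu_cons, L.sum_liftNu_cons,
    key hp hq hwp hwq rfl rfl, key hq hp hwq hwp rfl rfl, hp3]
  abel

end DGPreLie

/-! ### Symmetric operations on sums of square-zero elements -/

/-- The elements of a set of indices in increasing order. -/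
def sortedList {r : ℕ} (J : Finset (Fin r)) : List (Fin r) := (List.finRange r).filter (· ∈ J)

theorem mem_sortedList {r : ℕ} {J : Finset (Fin r)} {i : Fin r} : i ∈ sortedList J ↔ i ∈ J := by
  simp [sortedList]

theorem pairwise_sortedList {r : ℕ} (J : Finset (Fin r)) : (sortedList J).Pairwise (· < ·) :=
  (List.pairwise_lt_finRange r).filter _

theorem nodup_sortedList {r : ℕ} (J : Finset (Fin r)) : (sortedList J).Nodup :=
  (List.nodup_finRange r).filter _

theorem length_sortedList {r : ℕ} (J : Finset (Fin r)) : (sortedList J).length = J.card := by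
  rw [← List.toFinset_card_of_nodup (nodup_sortedList J)]
  congr 1
  ext i
  simp [mem_sortedList]

namespace MultiOps

variable {K : Type u} [Field K] {V : Type v} [AddCommGroup V] [Module K V]
  {W : Type w} [AddCommGroup W] [Module K W]

theorem app_eq (ν : MultiOps K V W) {l : List V} {m : ℕ} (h : l.length = m) :
    ν.app l = ν m fun i => l.get (i.cast h.symm) := by
  subst h; rfl

theorem app_map {α : Type*} (ν : MultiOps K V W) (l : List α) (x : α → V) {m : ℕ}
    (h : l.length = m) : ν.app (l.map x) = ν m fun i => x (l.get (i.cast h.symm)) := by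
  rw [ν.app_eq ((List.length_map x).trans h)]
  simp

theorem app_cons (ν : MultiOps K V W) (a : V) {l : List V} {m : ℕ} (h : l.length = m) :
    ν.app (a :: l) = ν (m + 1) (Fin.cons a fun i => l.get (i.cast h.symm)) := by
  subst h
  rw [app]
  congr 1
  funext i
  refine Fin.cases rfl (fun i => rfl) i

/-- For symmetric operations that vanish when a letter `yᵢ` is repeated, `ν (X, …, X) / m!` with
`X = ∑ᵢ yᵢ` is the sum over the sets of `m` letters. -/
theorem inv_factorial_smul_apply_sum [CharZero K] (ν : MultiOps K V W) {r : ℕ} (y : Fin r → V)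
    (m : ℕ) (hs : ∀ (v : Fin m → V) (σ : Equiv.Perm (Fin m)), ν m (v ∘ σ) = ν m v)
    (h0 : ∀ f : Fin m → Fin r, ¬ Function.Injective f → ν m (y ∘ f) = 0) :
    (m.factorial : K)⁻¹ • ν m (fun _ => ∑ i, y i)
      = ∑ J ∈ univ.powersetCard m, ν.app ((sortedList J).map y) := by
  classical
  have hm : (m.factorial : K) ≠ 0 := by exact_mod_cast Nat.factorial_ne_zero m
  rw [inv_smul_eq_iff₀ hm, MultilinearMap.map_sum (g := fun _ j => y j),
    ← Finset.sum_filter_of_ne (p := Function.Injective) (f := fun f : Fin m →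
      Fin r => ν m fun i => y (f i))
      (fun f _ hf => by_contra fun h => hf (h0 f h)),
    ← Finset.sum_fiberwise_of_maps_to (t := univ.powersetCard m)
      (g := fun f => univ.image f), smul_sum]
  · refine sum_congr rfl fun J hJ => ?_
    have hJ' : (sortedList J).length = m :=
      (length_sortedList J).trans (Finset.mem_powersetCard.1 hJ).2
    set e : Fin m → Fin r := fun i => (sortedList J).get (i.cast hJ'.symm) with he
    have hinj : Function.Injective e := fun i j hij => by
      simpa using (nodup_sortedList J).get_inj_iff.1 hij
    have hmem (i : Fin m) : e i ∈ J := mem_sortedList.1 (List.get_mem _ _)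
    have hsurj (j : Fin r) (hj : j ∈ J) : ∃ i, e i = j := by
      obtain ⟨i, hi⟩ := List.mem_iff_get.1 (mem_sortedList.2 hj)
      exact ⟨i.cast hJ', by simpa [he] using hi⟩
    -- the injections with image `J` are the permutations of the sorted list of `J`
    have key : ∑ σ : Equiv.Perm (Fin m), ν m (fun i => y (e (σ i)))
        = ∑ f ∈ (univ.filter Function.Injective).filter
            (fun f : Fin m → Fin r => univ.image f = J), ν m fun i => y (f i) := by
      refine Finset.sum_nbij (fun σ => e ∘ σ) (fun σ _ => ?_) (fun σ _ τ _ h => ?_)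
        (fun f hf => ?_) (fun σ _ => rfl)
      · simp only [mem_filter, mem_univ, true_and]
        refine ⟨hinj.comp σ.injective, Finset.ext fun j => ?_⟩
        simp only [mem_image, mem_univ, true_and, comp_apply]
        constructor
        · rintro ⟨i, rfl⟩
          exact hmem _
        · intro hj
          obtain ⟨i, rfl⟩ := hsurj j hj
          exact ⟨σ.symm i, by simp⟩
      · exact Equiv.ext fun i => hinj (congrFun h i)
      · simp only [Finset.coe_filter, mem_filter, mem_univ, true_and,
          Set.mem_setOf_eq] at hf
        have hex (i : Fin m) : ∃ j, e j = f i :=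
          hsurj _ (by rw [← hf.2]; exact Finset.mem_image_of_mem _ (mem_univ i))
        choose σ hσ using hex
        have hσi : Function.Injective σ := fun i j hij => hf.1 (by rw [← hσ, ← hσ, hij])
        exact ⟨Equiv.ofBijective σ (Finite.injective_iff_bijective.1 hσi), Finset.mem_coe.2
          (mem_univ _), funext hσ⟩
    rw [← key]
    refine (sum_congr rfl fun σ _ => hs (fun i => y (e i)) σ).trans ?_
    rw [Finset.sum_const, card_univ, card_perm, card_fin, Nat.cast_smul_eq_nsmul K,
      ν.app_map _ _ hJ']
  · intro f hf
    rw [Finset.mem_powersetCard]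
    refine ⟨Finset.subset_univ _, ?_⟩
    rw [Finset.card_image_of_injective _ (mem_filter.1 hf).2, card_univ,
      card_fin]

theorem sum_range_inv_factorial_smul [CharZero K] (ν : MultiOps K V W) {r : ℕ} (y : Fin r → V)
    (hs : ∀ m (v : Fin m → V) (σ : Equiv.Perm (Fin m)), ν m (v ∘ σ) = ν m v)
    (h0 : ∀ m (f : Fin m → Fin r), ¬ Function.Injective f → ν m (y ∘ f) = 0) :
    ∑ m ∈ range (r + 2), (m.factorial : K)⁻¹ • ν m (fun _ => ∑ i, y i)
      = ∑ J, ν.app ((sortedList J).map y) := by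
  rw [sum_range_succ, sum_congr rfl fun m _ =>
    ν.inv_factorial_smul_apply_sum y m (hs m) (h0 m),
    ν.inv_factorial_smul_apply_sum y (r + 1) (hs _) (h0 _),
    Finset.powersetCard_eq_empty.2 (by simp), Finset.sum_empty, add_zero, ← Finset.powerset_univ,
    Finset.sum_powerset, card_univ, card_fin]

end MultiOps

theorem block_eq {V : Type v} {r m : ℕ} (x : Fin r → V) (c : Fin r → Fin m) (b : Fin m) :
    block x c b = (sortedList (univ.filter fun i => c i = b)).map x := by
  simp [block, sortedList]

/-! ### The extension by letters -/

section Letters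

variable {K : Type u} [Field K] {r : ℕ}

/-- Degrees of the generators: two of degree `-1`, and one for each argument. -/
def letterDeg (k : Fin r → ℤ) : Fin 2 ⊕ Fin r → ℤ := Sum.elim (fun _ => -1) k

/-- The generators of degree `-1` have weight zero, the others have weight one. -/
def letterWeight (r : ℕ) : Fin 2 ⊕ Fin r → ℕ := Sum.elim (fun _ => 0) fun _ => 1

/-- The sign rule for which products of generators in increasing order have coefficient one. -/
def letterSign (K : Type u) [Field K] (k : Fin r → ℤ) : Fin 2 ⊕ Fin r → Fin 2 ⊕ Fin r → K
  | .inl a, .inl b => if a < b then 1 else if b < a then -1 else 0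
  | .inl _, .inr _ => 1
  | .inr j, .inl _ => ksgn K (k j)
  | .inr i, .inr j => if i < j then 1 else if j < i then ksgn K (k i * k j) else 0

theorem isKoszulRule_letterSign (k : Fin r → ℤ) :
    IsKoszulRule (letterDeg k) (letterSign K k) where
  diag i := by rcases i with i | i <;> simp [letterSign]
  symm i j := by
    rcases i with i | i <;> rcases j with j | j
    · rcases lt_trichotomy i j with h | rfl | h
      · simp [letterSign, letterDeg, h, h.not_gt, ksgn_one]
      · simp [letterSign]
      · simp [letterSign, letterDeg, h, h.not_gt, ksgn_one]
    · simp [letterSign, letterDeg, ksgn_neg, ksgn_mul_self]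
    · simp [letterSign, letterDeg, ksgn_neg]
    · rcases lt_trichotomy i j with h | rfl | h
      · simp [letterSign, letterDeg, h, h.not_gt, mul_comm (k j), ksgn_mul_self]
      · simp [letterSign]
      · simp [letterSign, letterDeg, h, h.not_gt]

theorem setSign_disjSum_left (k : Fin r → ℤ) (P : Finset (Fin 2)) (J L : Finset (Fin r)) :
    setSign (letterSign K k) (P.disjSum J) ((∅ : Finset (Fin 2)).disjSum L)
      = setSign (letterSign K k) ((∅ : Finset (Fin 2)).disjSum J)
          ((∅ : Finset (Fin 2)).disjSum L) := by
  simp only [setSign, prod_disjSum, letterSign, prod_empty, prod_const_one,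
    one_mul]

theorem setSign_disjSum_right (k : Fin r → ℤ) (P Q : Finset (Fin 2)) (L : Finset (Fin r)) :
    setSign (letterSign K k) (P.disjSum ∅) (Q.disjSum L)
      = setSign (letterSign K k) (P.disjSum ∅) (Q.disjSum ∅) := by
  simp only [setSign, prod_disjSum, letterSign, prod_empty, prod_const_one,
    mul_one]

theorem setSign_disjSum_empty (k : Fin r → ℤ) (P : Finset (Fin 2)) (L : Finset (Fin r)) :
    setSign (letterSign K k) (P.disjSum ∅) ((∅ : Finset (Fin 2)).disjSum L) = 1 := by
  rw [setSign_disjSum_right, Finset.empty_disjSum, Finset.map_empty, setSign_empty_right]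

theorem disjSum_union (P Q : Finset (Fin 2)) (J L : Finset (Fin r)) :
    P.disjSum J ∪ Q.disjSum L = (P ∪ Q).disjSum (J ∪ L) := by
  ext (i | i) <;> simp

theorem biUnion_disjSum {m : ℕ} (J : Fin m → Finset (Fin r)) :
    univ.biUnion (fun b => (∅ : Finset (Fin 2)).disjSum (J b))
      = (∅ : Finset (Fin 2)).disjSum (univ.biUnion J) := by
  ext (i | i) <;> simp

theorem disjoint_of_tupleSign_ne_zero {ι : Type w} [DecidableEq ι] {k : ι → ℤ} {t : ι → ι → K}
    (ht : IsKoszulRule k t) {m : ℕ} {I : Fin m → Finset ι} (h : tupleSign t I ≠ 0) {b b' : Fin m}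
    (hb : b ≠ b') : Disjoint (I b) (I b') := by
  have hlt (b b' : Fin m) (hb : b < b') : Disjoint (I b) (I b') :=
    disjoint_of_setSign_ne_zero ht fun h0 => h (prod_eq_zero (mem_univ b)
      (prod_eq_zero (mem_univ b') (by rw [if_pos hb, h0])))
  exact (lt_or_gt_of_ne hb).elim (hlt b b') fun h => (hlt b' b h).symm

theorem tupleSign_letters_eq_zero (k : Fin r → ℤ) {m : ℕ} (f : Fin m → Fin r)
    (hf : ¬ Function.Injective f) :
    tupleSign (letterSign K k) (fun b => (∅ : Finset (Fin 2)).disjSum {f b}) = 0 := by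
  by_contra h
  refine hf fun b b' hb => by_contra fun hne => ?_
  have := disjoint_of_tupleSign_ne_zero (isKoszulRule_letterSign k) h hne
  rw [hb, disjoint_self] at this
  have := Finset.ext_iff.1 this (Sum.inr (f b'))
  simp at this

theorem tupleSign_fibers (k : Fin r → ℤ) {m : ℕ} (c : Fin r → Fin m) :
    tupleSign (letterSign K k) (fun b => (∅ : Finset (Fin 2)).disjSum
      (univ.filter fun i => c i = b)) = koszulSign K k c := by
  have h (b b' : Fin m) : (if b < b' then setSign (letterSign K k)
      ((∅ : Finset (Fin 2)).disjSum (univ.filter fun i => c i = b))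
      ((∅ : Finset (Fin 2)).disjSum (univ.filter fun i => c i = b')) else 1)
      = ∏ i, ∏ j, if c i = b then (if c j = b' then (if c i < c j then
          letterSign K k (.inr i) (.inr j) else 1) else 1) else 1 := by
    simp only [setSign, prod_disjSum, prod_empty, one_mul, Finset.prod_filter]
    split_ifs with hb
    · refine prod_congr rfl fun i _ => ?_
      by_cases hi : c i = b
      · simp only [hi, if_true]
        refine prod_congr rfl fun j _ => ?_
        by_cases hj : c j = b'
        · simp [hj, hb]
        · simp [hj]
      · simp [hi]
    · symm
      refine prod_eq_one fun i _ => prod_eq_one fun j _ => ?_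
      split_ifs with h1 h2 h3
      · subst h1 h2
        exact absurd h3 hb
      all_goals rfl
  -- exchanging the products, each pair of letters occurs only for the pair of its own blocks
  have h' (i j : Fin r) : (∏ b, ∏ b', if c i = b then (if c j = b' then (if c i < c j then
      letterSign K k (.inr i) (.inr j) else 1) else 1) else 1)
      = if c i < c j then letterSign K k (.inr i) (.inr j) else 1 := by
    rw [Finset.prod_eq_single (c i) (fun b _ hb => by simp [hb.symm]) (by simp),
      Finset.prod_eq_single (c j) (fun b _ hb => by simp [hb.symm]) (by simp)]
    simp
  calc tupleSign (letterSign K k) _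
      = ∏ b, ∏ b', ∏ i, ∏ j, if c i = b then (if c j = b' then (if c i < c j then
          letterSign K k (.inr i) (.inr j) else 1) else 1) else 1 :=
        prod_congr rfl fun b _ => prod_congr rfl fun b' _ => h b b'
    _ = ∏ b, ∏ i, ∏ b', ∏ j, if c i = b then (if c j = b' then (if c i < c j then
          letterSign K k (.inr i) (.inr j) else 1) else 1) else 1 :=
        prod_congr rfl fun b _ => prod_comm
    _ = ∏ i, ∏ b, ∏ b', ∏ j, if c i = b then (if c j = b' then (if c i < c j then
          letterSign K k (.inr i) (.inr j) else 1) else 1) else 1 := prod_comm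
    _ = ∏ i, ∏ b, ∏ j, ∏ b', if c i = b then (if c j = b' then (if c i < c j then
          letterSign K k (.inr i) (.inr j) else 1) else 1) else 1 :=
        prod_congr rfl fun i _ => prod_congr rfl fun b _ => prod_comm
    _ = ∏ i, ∏ j, ∏ b, ∏ b', if c i = b then (if c j = b' then (if c i < c j then
          letterSign K k (.inr i) (.inr j) else 1) else 1) else 1 :=
        prod_congr rfl fun i _ => prod_comm
    _ = ∏ i, ∏ j, if c i < c j then letterSign K k (.inr i) (.inr j) else 1 :=
        prod_congr rfl fun i _ => prod_congr rfl fun j _ => h' i j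
    _ = ∏ j, ∏ i, if c i < c j then letterSign K k (.inr i) (.inr j) else 1 := prod_comm
    _ = koszulSign K k c := by
        refine prod_congr rfl fun j _ => prod_congr rfl fun i _ => ?_
        by_cases hc : c i < c j
        · rcases lt_trichotomy i j with hij | rfl | hij
          · simp [hc, letterSign, hij, hij.not_gt]
          · exact absurd hc (lt_irrefl _)
          · simp [hc, letterSign, hij, hij.not_gt, mul_comm (k i)]
        · simp [hc]

theorem sum_disjoint_covers {V : Type v} [AddCommGroup V] [Module K V] (k : Fin r → ℤ) {m : ℕ}
    (H : (Fin m → Finset (Fin r)) → V) :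
    ∑ φ : Fin m → Finset (Fin r), (if univ.biUnion φ = univ then
        tupleSign (letterSign K k) (fun b => (∅ : Finset (Fin 2)).disjSum (φ b)) • H φ else 0)
      = ∑ c : Fin r → Fin m, koszulSign K k c • H fun b => univ.filter fun i => c i = b := by
  symm
  refine Finset.sum_of_injOn (fun c b => univ.filter fun i => c i = b) (fun c _ c' _ h => ?_)
    (fun _ _ => Finset.mem_coe.2 (mem_univ _)) (fun φ _ hφ => ?_) (fun c _ => ?_)
  · funext i
    have h' := Finset.ext_iff.1 (congrFun h (c i)) i
    simp only [mem_filter, mem_univ, true_and, true_iff] at h'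
    exact h'.symm
  · split_ifs with hu
    · by_cases ht : tupleSign (letterSign K k) (fun b => (∅ : Finset (Fin 2)).disjSum (φ b)) = 0
      · rw [ht, zero_smul]
      · refine absurd ?_ hφ
        have hd {b b' : Fin m} (hb : b ≠ b') :=
          disjoint_of_tupleSign_ne_zero (isKoszulRule_letterSign k) ht hb
        have hex (i : Fin r) : ∃ b, i ∈ φ b := by
          have := mem_univ i
          rw [← hu] at this
          simpa using this
        choose c hc using hex
        refine ⟨c, Finset.mem_coe.2 (mem_univ _), funext fun b => Finset.ext fun i => ?_⟩
        simp only [mem_filter, mem_univ, true_and]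
        constructor
        · rintro rfl
          exact hc i
        · intro hi
          by_contra hne
          exact Finset.disjoint_left.1 (hd hne) (Finset.inr_mem_disjSum.2 (hc i))
            (Finset.inr_mem_disjSum.2 hi)
    · rfl
  · rw [if_pos, tupleSign_fibers]
    ext i
    simp

theorem prod_get_sortedList {V : Type v} [CommMonoid V] (L : Finset (Fin r)) (f : Fin r → V) :
    ∏ b, f ((sortedList L).get b) = ∏ j ∈ L, f j := by
  refine Finset.prod_nbij (fun b => (sortedList L).get b) (fun b _ => mem_sortedList.1
    (List.get_mem _ _)) (fun b _ b' _ h => (nodup_sortedList L).get_inj_iff.1 h) (fun j hj => ?_)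
    (fun _ _ => rfl)
  obtain ⟨b, hb⟩ := List.mem_iff_get.1 (mem_sortedList.2 (Finset.mem_coe.1 hj))
  exact ⟨b, Finset.mem_coe.2 (mem_univ _), hb⟩

theorem biUnion_get_sortedList (L : Finset (Fin r)) :
    univ.biUnion (fun b => {(sortedList L).get b}) = L := by
  ext j
  simp only [mem_biUnion, mem_univ, true_and, Finset.mem_singleton]
  rw [← mem_sortedList (J := L), List.mem_iff_get]
  simp only [eq_comm]

theorem tupleSign_sortedList (k : Fin r → ℤ) (L : Finset (Fin r)) :
    tupleSign (letterSign K k) (fun b => (∅ : Finset (Fin 2)).disjSum {(sortedList L).get b})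
      = 1 := by
  refine prod_eq_one fun b _ => prod_eq_one fun b' _ => ?_
  split_ifs with hb
  · have := List.pairwise_iff_get.1 (pairwise_sortedList L) b b' hb
    simp only [List.get_eq_getElem] at this
    simp [setSign, prod_disjSum, letterSign, this]
  · rfl

theorem prod_setSign_sortedList (k : Fin r → ℤ) (X : Finset (Fin 2 ⊕ Fin r))
    (L : Finset (Fin r)) :
    ∏ b, setSign (letterSign K k) X ((∅ : Finset (Fin 2)).disjSum {(sortedList L).get b})
      = setSign (letterSign K k) X ((∅ : Finset (Fin 2)).disjSum L) := by
  simp only [setSign, prod_disjSum, prod_empty, one_mul, Finset.prod_singleton]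
  rw [prod_comm]
  exact prod_congr rfl fun i _ => prod_get_sortedList L fun j => letterSign K k i (.inr j)

end Letters

namespace DGPreLie

variable {K : Type u} [Field K] {g : Type v} [AddCommGroup g] [Module K g]
  {𝒢 : ℤ → Submodule K g} {r : ℕ} {k : Fin r → ℤ} {x : Fin r → g}

/-- The element `eᵢ xᵢ`. -/
def letter (hx : ∀ i, x i ∈ 𝒢 (k i)) (i : Fin r) : coeffModule 𝒢 (letterDeg k) :=
  ⟨Pi.single ((∅ : Finset (Fin 2)).disjSum {i}) (x i),
    single_mem_coeffModule (by simpa [setDeg, letterDeg, sum_disjSum] using hx i)⟩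

theorem coe_letter (hx : ∀ i, x i ∈ 𝒢 (k i)) (i : Fin r) :
    (letter hx i : Finset (Fin 2 ⊕ Fin r) → g)
      = Pi.single ((∅ : Finset (Fin 2)).disjSum {i}) (x i) := rfl

variable (hx : ∀ i, x i ∈ 𝒢 (k i)) {P Q : Finset (Fin 2)}
  {F' μ' : MultiOps K (coeffModule 𝒢 (letterDeg k)) (coeffModule 𝒢 (letterDeg k))}
  {F μ : MultiOps K g g} (hF : IsLift (letterSign K k) (P.disjSum ∅) F' F)

include hF

theorem IsLift.coe_app_letters (J : Finset (Fin r)) :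
    (F'.app ((sortedList J).map (letter hx)) : Finset (Fin 2 ⊕ Fin r) → g)
      = Pi.single (P.disjSum J) (F.app ((sortedList J).map x)) := by
  rw [F'.app_map _ _ rfl, F.app_map _ _ rfl, hF.coe_apply _ _
    (fun b => (∅ : Finset (Fin 2)).disjSum {(sortedList J).get b})
    (fun b => x ((sortedList J).get b)) (fun b => rfl), tupleSign_cons, tupleSign_sortedList,
    prod_eq_one fun b _ => setSign_disjSum_empty k P _, one_mul, one_smul, biUnion_disjSum,
    biUnion_get_sortedList, disjSum_union, union_empty, empty_union]
  rfl

theorem IsLift.coe_app_cons_letters {V : coeffModule 𝒢 (letterDeg k)} {J : Finset (Fin r)} {v : g}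
    (hV : (V : Finset (Fin 2 ⊕ Fin r) → g) = Pi.single (Q.disjSum J) v) (L : Finset (Fin r)) :
    (F'.app (V :: (sortedList L).map (letter hx)) : Finset (Fin 2 ⊕ Fin r) → g)
      = Pi.single ((P ∪ Q).disjSum (J ∪ L))
        ((setSign (letterSign K k) (P.disjSum ∅) (Q.disjSum ∅)
          * setSign (letterSign K k) ((∅ : Finset (Fin 2)).disjSum J)
            ((∅ : Finset (Fin 2)).disjSum L)) • F.app (v :: (sortedList L).map x)) := by
  have hU : univ.biUnion (Fin.cons (Q.disjSum J) fun b =>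
      (∅ : Finset (Fin 2)).disjSum {(sortedList L).get b} :
        Fin ((sortedList L).length + 1) → Finset (Fin 2 ⊕ Fin r)) = Q.disjSum (J ∪ L) := by
    have := biUnion_disjSum fun b => {(sortedList L).get b}
    rw [biUnion_get_sortedList] at this
    have h2 := disjSum_union Q ∅ J L
    rw [← this, union_empty] at h2
    rw [← h2]
    ext j
    simp [Fin.exists_fin_succ]
  rw [F'.app_cons V (List.length_map _), F.app_cons v (List.length_map _), hF.coe_apply _ _
    (Fin.cons (Q.disjSum J) fun b => (∅ : Finset (Fin 2)).disjSum {(sortedList L).get b})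
    (Fin.cons v fun b => x ((sortedList L).get b)) (fun b => by
      refine Fin.cases ?_ (fun b => ?_) b
      · exact hV
      · simp [coe_letter]), tupleSign_cons, tupleSign_cons, tupleSign_sortedList,
        Fin.prod_univ_succ,
    hU, disjSum_union, empty_union]
  simp only [Fin.cons_zero, Fin.cons_succ, setSign_disjSum_empty, prod_const_one, mul_one,
    setSign_disjSum_right, setSign_disjSum_left]
  rw [prod_setSign_sortedList]
  simp

theorem IsLift.apply_letters_eq_zero {m : ℕ} (f : Fin m → Fin r) (hf : ¬ Function.Injective f) :
    F' m (letter hx ∘ f) = 0 := by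
  refine Subtype.ext ?_
  rw [hF.coe_apply _ _ (fun b => (∅ : Finset (Fin 2)).disjSum {f b}) (fun b => x (f b))
    (fun b => rfl), tupleSign_cons, tupleSign_letters_eq_zero k f hf]
  simp

theorem IsLift.apply_cons_letters_eq_zero {V : coeffModule 𝒢 (letterDeg k)}
    {I : Finset (Fin 2 ⊕ Fin r)} {v : g} (hV : (V : Finset (Fin 2 ⊕ Fin r) → g) = Pi.single I v)
    {m : ℕ} (f : Fin m → Fin r) (hf : ¬ Function.Injective f) :
    F' (m + 1) (Fin.cons V (letter hx ∘ f)) = 0 := by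
  refine Subtype.ext ?_
  rw [hF.coe_apply _ _ (Fin.cons I fun b => (∅ : Finset (Fin 2)).disjSum {f b})
    (Fin.cons v fun b => x (f b)) (fun b => by
      refine Fin.cases ?_ (fun b => ?_) b
      · exact hV
      · simp [coe_letter]), tupleSign_cons, tupleSign_cons, tupleSign_letters_eq_zero k f hf]
  simp

theorem IsLift.sum_letters [CharZero K] :
    ∑ m ∈ range (r + 2), (m.factorial : K)⁻¹ • F' m (fun _ => ∑ i, letter hx i)
      = ∑ J, F'.app ((sortedList J).map (letter hx)) :=
  F'.sum_range_inv_factorial_smul _ hF.symm fun _ f hf => hF.apply_letters_eq_zero hx f hf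

theorem IsLift.sum_cons_letters [CharZero K] {V : coeffModule 𝒢 (letterDeg k)}
    {I : Finset (Fin 2 ⊕ Fin r)} {v : g} (hV : (V : Finset (Fin 2 ⊕ Fin r) → g) = Pi.single I v) :
    ∑ m ∈ range (r + 2), (m.factorial : K)⁻¹ •
        F' (m + 1) (Fin.cons V fun _ => ∑ i, letter hx i)
      = ∑ J, F'.app (V :: (sortedList J).map (letter hx)) := by
  have := MultiOps.sum_range_inv_factorial_smul (K := K) (fun m => (F' (m + 1)).curryLeft V)
    (letter hx) (fun m v σ => by
      rw [MultilinearMap.curryLeft_apply, MultilinearMap.curryLeft_apply,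
        ← hF.symm _ (Fin.cons V v) (Equiv.Perm.decomposeFin.symm (0, σ))]
      congr 1
      funext i
      refine Fin.cases ?_ (fun i => ?_) i <;> simp)
    fun m f hf => hF.apply_cons_letters_eq_zero hx hV f hf
  refine this.trans (sum_congr rfl fun J _ => ?_)
  rw [F'.app_cons V rfl]
  rfl

/-- The coefficient of `e_P e_Q e₁ ⋯ eᵣ` in `∑ₘ F' (V, X, …, X) / m!`, where
`V = ∑ₙ μ' (X, …, X) / n!`. -/
theorem IsLift.coe_sum_cons_sum [CharZero K] (hμ : IsLift (letterSign K k) (Q.disjSum ∅) μ' μ) :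
    (∑ m ∈ range (r + 2), (m.factorial : K)⁻¹ • F' (m + 1)
      (Fin.cons (∑ n ∈ range (r + 2), (n.factorial : K)⁻¹ • μ' n fun _ => ∑ i, letter hx i)
        fun _ => ∑ i, letter hx i) : coeffModule 𝒢 (letterDeg k)).1 ((P ∪ Q).disjSum univ)
      = setSign (letterSign K k) (P.disjSum ∅) (Q.disjSum ∅) •
        ∑ c : Fin r → Fin 2, koszulSign K k c • F.app (μ.app (block x c 0) :: block x c 1) := by
  have h1 (m : ℕ) (v : Fin m → coeffModule 𝒢 (letterDeg k))
      (f : Finset (Fin r) → coeffModule 𝒢 (letterDeg k)) :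
      F' (m + 1) (Fin.cons (∑ J, f J) v) = ∑ J, F' (m + 1) (Fin.cons (f J) v) := by
    simp only [← MultilinearMap.curryLeft_apply]
    rw [map_sum, MultilinearMap.sum_apply]
  rw [hμ.sum_letters hx]
  simp only [h1, smul_sum]
  rw [sum_comm, sum_congr rfl fun J _ =>
    hF.sum_cons_letters hx (hμ.coe_app_letters hx J)]
  rw [AddSubmonoidClass.coe_finset_sum, Finset.sum_apply]
  simp only [AddSubmonoidClass.coe_finset_sum, Finset.sum_apply,
    hF.coe_app_cons_letters hx (hμ.coe_app_letters hx _)]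
  rw [← smul_sum]
  -- the pairs of disjoint sets that cover all letters are the maps to `Fin 2`
  have h2 := sum_disjoint_covers (K := K) k (m := 2) fun φ =>
    F.app (μ.app ((sortedList (φ 0)).map x) :: (sortedList (φ 1)).map x)
  simp only [block_eq]
  rw [← h2, ← (finTwoArrowEquiv (Finset (Fin r))).symm.sum_comp, Fintype.sum_prod_type,
    smul_sum]
  refine sum_congr rfl fun J _ => ?_
  rw [smul_sum]
  refine sum_congr rfl fun L _ => ?_
  have h3 : univ.biUnion ((finTwoArrowEquiv (Finset (Fin r))).symm (J, L)) = J ∪ L := by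
    ext i; simp
  have h4 : tupleSign (letterSign K k) (fun b => (∅ : Finset (Fin 2)).disjSum
      ((finTwoArrowEquiv (Finset (Fin r))).symm (J, L) b))
      = setSign (letterSign K k) ((∅ : Finset (Fin 2)).disjSum J)
        ((∅ : Finset (Fin 2)).disjSum L) := by
    simp [tupleSign, Fin.prod_univ_two]
  rw [h3, h4]
  split_ifs with h
  · rw [h, Pi.single_eq_same, smul_smul]
    simp
  · rw [Pi.single_eq_of_ne, smul_zero]
    intro h'
    refine h (Finset.ext fun i => ?_)
    have := Finset.ext_iff.1 h' (Sum.inr i)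
    simpa using this.symm

/-- The coefficient of `e_P e₁ ⋯ eᵣ` in `F' (Y, …, Y)`, where `Y = ∑_J e_J y_J`. -/
theorem IsLift.coe_apply_sum {Y : Finset (Fin r) → coeffModule 𝒢 (letterDeg k)}
    {y : Finset (Fin r) → g} (hY : ∀ J, (Y J : Finset (Fin 2 ⊕ Fin r) → g)
      = Pi.single ((∅ : Finset (Fin 2)).disjSum J) (y J)) (m : ℕ) :
    (F' m fun _ => ∑ J, Y J : coeffModule 𝒢 (letterDeg k)).1 (P.disjSum univ)
      = ∑ c : Fin r → Fin m, koszulSign K k c •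
          F m fun b => y (univ.filter fun i => c i = b) := by
  have h2 := sum_disjoint_covers (K := K) k fun φ : Fin m → Finset (Fin r) => F m fun b => y (φ b)
  rw [← h2, MultilinearMap.map_sum (g := fun _ J => Y J), AddSubmonoidClass.coe_finset_sum,
    Finset.sum_apply]
  refine sum_congr rfl fun φ _ => ?_
  rw [hF.coe_apply _ _ (fun b => (∅ : Finset (Fin 2)).disjSum (φ b)) (fun b => y (φ b))
    (fun b => hY _), tupleSign_cons, prod_eq_one fun b _ => setSign_disjSum_empty k P _,
    one_mul, biUnion_disjSum, disjSum_union, union_empty, empty_union]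
  split_ifs with h
  · rw [h, Pi.single_eq_same]
  · rw [Pi.single_eq_of_ne]
    intro h'
    refine h (Finset.ext fun i => ?_)
    have := Finset.ext_iff.1 h' (Sum.inr i)
    simpa using this.symm

end DGPreLie

/-! ### Signs of permutations of index sets -/

theorem Fin.prod_lt_comp_perm {V : Type v} [CommMonoid V] {r : ℕ} (f : Fin r → Fin r → V)
    (hf : ∀ b b', f b b' = f b' b) (σ : Equiv.Perm (Fin r)) :
    (∏ b, ∏ b', if b < b' then f (σ b) (σ b') else 1) = ∏ b, ∏ b',
      if b < b' then f b b' else 1 := by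
  have h1 : (∏ b, ∏ b', if b < b' then f (σ b) (σ b') else 1)
      = ∏ c, ∏ c', if σ.symm c < σ.symm c' then f c c' else 1 := by
    refine (prod_equiv σ.symm _ _ fun c => prod_equiv σ.symm _ _ fun c' => ?_).symm
    simp only [Equiv.apply_symm_apply]
  have h2 : (∏ c, ∏ c', if σ.symm c < σ.symm c' then f c c' else 1)
      = (∏ c, ∏ c', if c < c' ∧ σ.symm c < σ.symm c' then f c c' else 1)
        * ∏ c, ∏ c', if c' < c ∧ σ.symm c < σ.symm c' then f c c' else 1 := by
    rw [← prod_mul_distrib]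
    refine prod_congr rfl fun c _ => ?_
    rw [← prod_mul_distrib]
    refine prod_congr rfl fun c' _ => ?_
    rcases lt_trichotomy c c' with h | rfl | h
    · simp [h, h.not_gt]
    · simp
    · simp [h, h.not_gt]
  rw [h1, h2, prod_comm (f := fun c c' => if c' < c ∧ σ.symm c < σ.symm c'
    then f c c' else 1), ← prod_mul_distrib]
  refine prod_congr rfl fun c _ => ?_
  rw [← prod_mul_distrib]
  refine prod_congr rfl fun c' _ => ?_
  by_cases hc : c < c'
  · rcases lt_or_gt_of_ne (σ.symm.injective.ne hc.ne) with h | h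
    · simp [hc, h, h.not_gt]
    · simp [hc, h, h.not_gt, hf c' c]
  · simp [hc]

theorem tupleSign_comp_perm {K : Type u} [Field K] {ι : Type w} {k : ι → ℤ} {t : ι → ι → K}
    (ht : IsKoszulRule k t) {r : ℕ} (I : Fin r → Finset ι) (σ : Equiv.Perm (Fin r)) :
    tupleSign t (I ∘ σ) = koszulSign K (fun b => setDeg k (I (σ b))) σ * tupleSign t I := by
  set f : Fin r → Fin r → K := fun b b' =>
    if b < b' then setSign t (I b) (I b') else setSign t (I b') (I b) with hfd
  have hf (b b' : Fin r) : f b b' = f b' b := by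
    rcases lt_trichotomy b b' with h | rfl | h
    · simp [hfd, h, h.not_gt]
    · rfl
    · simp [hfd, h, h.not_gt]
  have h1 : tupleSign t I = ∏ b, ∏ b', if b < b' then f b b' else 1 := by
    refine prod_congr rfl fun b _ => prod_congr rfl fun b' _ => ?_
    by_cases h : b < b' <;> simp [hfd, h]
  rw [h1, ← Fin.prod_lt_comp_perm f hf σ, koszulSign, tupleSign, ← prod_mul_distrib]
  refine prod_congr rfl fun b _ => ?_
  rw [← prod_mul_distrib]
  refine prod_congr rfl fun b' _ => ?_
  by_cases h : b < b'
  · rcases lt_or_gt_of_ne (σ.injective.ne h.ne) with h' | h'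
    · simp [hfd, h, h', h'.not_gt]
    · simp only [h, h', true_and, if_true, hfd, h'.not_gt, if_false]
      exact setSign_symm ht _ _
  · simp [h]

theorem koszulSign_mul_self {K : Type u} [Field K] {r m : ℕ} (k : Fin r → ℤ) (c : Fin r → Fin m) :
    koszulSign K k c * koszulSign K k c = 1 := by
  rw [koszulSign, ← prod_mul_distrib]
  refine prod_eq_one fun i _ => ?_
  rw [← prod_mul_distrib]
  refine prod_eq_one fun j _ => ?_
  split_ifs
  · exact ksgn_mul_self (K := K) _
  · exact one_mul 1

theorem ksgn_mul_congr {K : Type u} [Field K] {k l k' l' : ℤ} (hk : Even k ↔ Even k')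
    (hl : Even l ↔ Even l') : ksgn K (k * l) = ksgn K (k' * l') := by
  have h : Even (k * l) ↔ Even (k' * l') := by rw [Int.even_mul, Int.even_mul, hk, hl]
  by_cases h1 : Even (k * l)
  · rw [DGPreLie.ksgn_of_even h1, DGPreLie.ksgn_of_even (h.1 h1)]
  · rw [DGPreLie.ksgn_of_odd h1, DGPreLie.ksgn_of_odd fun h2 => h1 (h.2 h2)]

theorem koszulSign_congr {K : Type u} [Field K] {r m : ℕ} {k k' : Fin r → ℤ}
    (h : ∀ i, Even (k i) ↔ Even (k' i)) (c : Fin r → Fin m) :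
    koszulSign K k c = koszulSign K k' c := by
  refine prod_congr rfl fun i _ => prod_congr rfl fun j _ => ?_
  rw [ksgn_mul_congr (h i) (h j)]

/-! ### The components of the isomorphism -/

namespace DGPreLie

variable {K : Type u} [Field K] {g : Type v} [AddCommGroup g] [Module K g]
  {𝒢 : ℤ → Submodule K g} (L : DGPreLie K 𝒢)

/-- The iterated product `((x₁ • x₂) • …) • xᵣ`. -/
noncomputable def iterMul : ∀ r : ℕ, MultilinearMap K (fun _ : Fin r => g) g
  | 0 => 0
  | 1 => MultilinearMap.ofSubsingleton K g g 0 LinearMap.id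
  | r + 2 => MultilinearMap.uncurryRight (L.mul.compMultilinearMap (iterMul (r + 1)))

theorem iterMul_one (v : Fin 1 → g) : L.iterMul 1 v = v 0 := rfl

theorem iterMul_succ_succ {r : ℕ} (v : Fin (r + 2) → g) :
    L.iterMul (r + 2) v = L.mul (L.iterMul (r + 1) (Fin.init v)) (v (Fin.last _)) := rfl

variable [DirectSum.Decomposition 𝒢]

theorem evenPart_apply {k : ℤ} {x : g} (hx : x ∈ 𝒢 k) :
    evenPart 𝒢 x = if Even k then x else 0 := by
  rw [evenPart, scaleBy_apply _ hx]
  split_ifs <;> simp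

theorem oddPart_apply {k : ℤ} {x : g} (hx : x ∈ 𝒢 k) :
    oddPart 𝒢 x = if Even k then 0 else x := by
  rw [oddPart, scaleBy_apply _ hx]
  split_ifs <;> simp

/-- The graded symmetrization of the iterated product. The signs depend on the parities of the
arguments only, so the arguments are split into their even and odd parts. -/
noncomputable def symMul : MultiOps K g g := fun r =>
  ((r.factorial : K)⁻¹) • ∑ ε : Fin r → Fin 2, ∑ σ : Equiv.Perm (Fin r),
    koszulSign K (fun i => ((ε (σ i) : ℕ) : ℤ)) σ •
      ((L.iterMul r).domDomCongr σ).compLinearMap fun i =>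
        if ε i = 0 then evenPart 𝒢 else oddPart 𝒢

theorem symMul_apply {r : ℕ} {k : Fin r → ℤ} {v : Fin r → g} (hv : ∀ i, v i ∈ 𝒢 (k i)) :
    L.symMul r v = ((r.factorial : K)⁻¹) • ∑ σ : Equiv.Perm (Fin r),
      koszulSign K (k ∘ σ) σ • L.iterMul r (v ∘ σ) := by
  rw [symMul, MultilinearMap.smul_apply, MultilinearMap.sum_apply]
  congr 1
  have hpar (ε : Fin r → Fin 2) (i : Fin r) :
      (if ε i = 0 then evenPart 𝒢 else oddPart 𝒢) (v i)
        = if (Even (k i) ↔ ε i = 0) then v i else 0 := by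
    by_cases hε : ε i = 0 <;> by_cases hk : Even (k i) <;>
      simp [hε, hk, evenPart_apply (hv i), oddPart_apply (hv i)]
  have key (ε : Fin r → Fin 2) : (∑ σ : Equiv.Perm (Fin r),
      koszulSign K (fun i => ((ε (σ i) : ℕ) : ℤ)) σ •
        ((L.iterMul r).domDomCongr σ).compLinearMap fun i =>
          if ε i = 0 then evenPart 𝒢 else oddPart 𝒢) v
      = ∑ σ : Equiv.Perm (Fin r), koszulSign K (fun i => ((ε (σ i) : ℕ) : ℤ)) σ •
        L.iterMul r fun i => if (Even (k (σ i)) ↔ ε (σ i) = 0) then v (σ i) else 0 := by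
    rw [MultilinearMap.sum_apply]
    refine sum_congr rfl fun σ _ => ?_
    rw [MultilinearMap.smul_apply, MultilinearMap.compLinearMap_apply,
      MultilinearMap.domDomCongr_apply]
    simp only [hpar]
  simp only [key]
  -- only the splitting into the actual parities contributes
  rw [sum_eq_single fun i => if Even (k i) then 0 else 1]
  · refine sum_congr rfl fun σ _ => ?_
    congr 1
    · refine koszulSign_congr (fun i => ?_) _
      by_cases h : Even (k (σ i)) <;> simp [h]
    · congr 1
      funext i
      by_cases h : Even (k (σ i)) <;> simp [h]
  · intro ε _ hε
    refine sum_eq_zero fun σ _ => ?_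
    obtain ⟨i, hi⟩ := Function.ne_iff.1 hε
    rw [MultilinearMap.map_coord_zero _ (σ.symm i), smul_zero]
    rw [Equiv.apply_symm_apply, if_neg]
    intro h
    apply hi
    by_cases hk : Even (k i)
    · simp [hk, h.1 hk]
    · simp only [hk, if_false]
      have : ε i ≠ 0 := fun h0 => hk (h.2 h0)
      omega
  · simp

theorem symMul_zero : L.symMul 0 = 0 := by
  ext v
  rw [L.symMul_apply (k := fun _ => 0) (fun i => i.elim0)]
  simp [iterMul]

theorem symMul_one (x : g) : L.symMul 1 (fun _ => x) = x := by
  have h (x : g) : L.symMul 1 (fun _ => x)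
      = (MultilinearMap.ofSubsingleton K g g (0 : Fin 1)).symm (L.symMul 1) x := rfl
  induction x using DirectSum.Decomposition.inductionOn 𝒢 with
  | zero => rw [h, map_zero]
  | add x y hx hy => rw [h, map_add, ← h, ← h, hx, hy]
  | @homogeneous k x =>
    rw [L.symMul_apply (k := fun _ => k) (fun _ => x.2)]
    simp [koszulSign, iterMul_one]

section DegreeZero

variable (h0 : ∀ x : g, x ∈ 𝒢 0)

include h0

theorem symMul_apply_of_zero {r : ℕ} (v : Fin r → g) : L.symMul r v
    = ((r.factorial : K)⁻¹) • ∑ σ : Equiv.Perm (Fin r), L.iterMul r (v ∘ σ) := by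
  rw [L.symMul_apply (k := fun _ => 0) (fun i => h0 _)]
  simp [koszulSign, ksgn_zero K]

theorem symMul_comp_perm {r : ℕ} (v : Fin r → g) (τ : Equiv.Perm (Fin r)) :
    L.symMul r (v ∘ τ) = L.symMul r v := by
  rw [L.symMul_apply_of_zero h0, L.symMul_apply_of_zero h0]
  congr 1
  exact Fintype.sum_equiv (Equiv.mulLeft τ) _ _ fun σ => rfl

theorem symMul_const [CharZero K] (r : ℕ) (y : g) :
    L.symMul r (fun _ => y) = L.iterMul r fun _ => y := by
  have hr : (r.factorial : K) ≠ 0 := by exact_mod_cast Nat.factorial_ne_zero r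
  rw [L.symMul_apply_of_zero h0, inv_smul_eq_iff₀ hr]
  refine (Finset.sum_const (L.iterMul r fun _ => y)).trans ?_
  rw [card_univ, card_perm, card_fin, Nat.cast_smul_eq_nsmul K]

/-- Polarization of the iterated product. -/
theorem symMul_cons_const [CharZero K] (r : ℕ) (y z : g) :
    ((r + 1 : ℕ) : K) • L.symMul (r + 1) (Fin.cons z fun _ => y)
      = ∑ i, L.iterMul (r + 1) (update (fun _ => y) i z) := by
  have hr : ((r + 1).factorial : K) ≠ 0 := by exact_mod_cast Nat.factorial_ne_zero (r + 1)
  have hc : (Fin.cons z fun _ => y : Fin (r + 1) → g) = update (fun _ => y) 0 z := by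
    funext i
    refine Fin.cases ?_ (fun i => ?_) i <;> simp
  have h1 (i : Fin (r + 1)) : L.symMul (r + 1) (update (fun _ => y) i z)
      = L.symMul (r + 1) (Fin.cons z fun _ => y) := by
    rw [hc, ← L.symMul_comp_perm h0 (update (fun _ => y) 0 z) (swap 0 i),
      update_comp_equiv, Equiv.symm_swap, Equiv.swap_apply_left]
    rfl
  have h2 : ∑ i, L.symMul (r + 1) (update (fun _ => y) i z)
      = ∑ i, L.iterMul (r + 1) (update (fun _ => y) i z) := by
    simp only [L.symMul_apply_of_zero h0]
    rw [← smul_sum, inv_smul_eq_iff₀ hr, sum_comm]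
    have h3 (σ : Equiv.Perm (Fin (r + 1))) :
        ∑ i, L.iterMul (r + 1) (update (fun _ => y) i z ∘ σ)
          = ∑ i, L.iterMul (r + 1) (update (fun _ => y) i z) := by
      refine Fintype.sum_equiv σ.symm _ _ fun i => ?_
      rw [update_comp_equiv]
      rfl
    rw [sum_congr rfl fun σ _ => h3 σ, Finset.sum_const, card_univ,
      card_perm, card_fin, Nat.cast_smul_eq_nsmul K]
  rw [← h2, sum_congr rfl fun i _ => h1 i, Finset.sum_const, card_univ,
    card_fin, Nat.cast_smul_eq_nsmul K]

omit h0 in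
theorem sum_iterMul_update_succ (r : ℕ) (y z : g) :
    ∑ i, L.iterMul (r + 2) (update (fun _ => y) i z)
      = L.mul (∑ i, L.iterMul (r + 1) (update (fun _ => y) i z)) y
        + L.mul (L.iterMul (r + 1) fun _ => y) z := by
  rw [Fin.sum_univ_castSucc, map_sum, LinearMap.sum_apply]
  congr 1
  · refine sum_congr rfl fun i _ => ?_
    rw [iterMul_succ_succ, update_of_ne (Fin.castSucc_ne_last i).symm]
    congr 3
    funext j
    rcases eq_or_ne j i with rfl | hj
    · simp [Fin.init]
    · simp [Fin.init, hj]
  · rw [iterMul_succ_succ, update_self]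
    congr 3
    funext j
    simp [Fin.init]

end DegreeZero

section Lift

variable {ι : Type w} [Fintype ι] [DecidableEq ι] {k : ι → ℤ} {t : ι → ι → K}
  (ht : IsKoszulRule k t)

omit [DirectSum.Decomposition 𝒢] in
theorem coe_iterMul {r : ℕ} {Z : Fin r → coeffModule 𝒢 k} {I : Fin r → Finset ι} {z : Fin r → g}
    (h : ∀ b, (Z b : Finset ι → g) = Pi.single (I b) (z b)) :
    ((L.coeffPreLie ht).iterMul r Z : Finset ι → g)
      = Pi.single (univ.biUnion I) (tupleSign t I • L.iterMul r z) := by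
  induction r with
  | zero => simp [iterMul]
  | succ r ih =>
    rcases r with _ | r
    · rw [iterMul_one, iterMul_one, h 0]
      simp [tupleSign]
    · have hU : univ.biUnion I = univ.biUnion (Fin.init I) ∪ I (Fin.last _) := by
        ext j; simp [Fin.exists_fin_succ']; rfl
      rw [iterMul_succ_succ, iterMul_succ_succ, coe_coeffPreLie_mul,
        ih (Z := Fin.init Z) (I := Fin.init I) (z := Fin.init z) (fun b => h b.castSucc), h
          (Fin.last _),
        coeffMul_single, hU, map_smul, LinearMap.smul_apply, smul_smul, mul_comm,
        tupleSign_mul_setSign_biUnion ht, ← tupleSign_snoc, snoc_init_self]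

theorem isLift_symMul : IsLift t ∅ (L.coeffPreLie (𝒢 := 𝒢) ht).symMul L.symMul where
  symm m v σ := (L.coeffPreLie ht).symMul_comp_perm (mem_trivGrading_zero K _) v σ
  coe_apply m Z I z h := by
    have hU (σ : Equiv.Perm (Fin m)) :
        univ.biUnion (I ∘ σ) = univ.biUnion I := by
      ext j
      simp only [mem_biUnion, mem_univ, true_and, comp_apply]
      exact ⟨fun ⟨b, hb⟩ => ⟨σ b, hb⟩, fun ⟨b, hb⟩ => ⟨σ.symm b, by simpa using hb⟩⟩
    have hc : tupleSign t (Fin.cons ∅ I : Fin (m + 1) → Finset ι) = tupleSign t I := by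
      rw [tupleSign_cons]; simp
    rw [(L.coeffPreLie ht).symMul_apply_of_zero (mem_trivGrading_zero K _),
      L.symMul_apply (fun b => mem_of_coe_eq_single (h b)), Submodule.coe_smul,
      AddSubmonoidClass.coe_finset_sum, empty_union, hc]
    have h1 (σ : Equiv.Perm (Fin m)) := L.coe_iterMul ht (Z := Z ∘ σ) (I := I ∘ σ) (z := z ∘ σ)
      fun b => h (σ b)
    simp only [h1, hU, tupleSign_comp_perm ht]
    rw [smul_comm, Pi.single_smul]
    congr 1
    have hsum : ∀ (s : Finset (Equiv.Perm (Fin m))) (I : Finset ι) (f : Equiv.Perm (Fin m) → g),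
        Pi.single (M := fun _ => g) I (∑ i ∈ s, f i) = ∑ i ∈ s, Pi.single I (f i) :=
      fun s I f => map_sum (AddMonoidHom.single (fun _ => g) I) f s
    rw [smul_sum, hsum]
    refine sum_congr rfl fun σ _ => ?_
    rw [smul_smul, mul_comm]
    rfl

end Lift

end DGPreLie

/-! ### Graded symmetry of lifted operations -/

namespace DGPreLie

section GradedSymm

variable {K : Type u} [Field K] {g : Type v} [AddCommGroup g] [Module K g]
  {𝒢 : ℤ → Submodule K g}

theorem IsLift.coe_apply_letters_comp_perm {r : ℕ} {k : Fin r → ℤ} {x : Fin r → g}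
    (hx : ∀ i, x i ∈ 𝒢 (k i)) {P : Finset (Fin 2)}
    {F' : MultiOps K (coeffModule 𝒢 (letterDeg k)) (coeffModule 𝒢 (letterDeg k))}
    {F : MultiOps K g g} (hF : IsLift (letterSign K k) (P.disjSum ∅) F' F)
    (σ : Equiv.Perm (Fin r)) :
    (F' r (letter hx ∘ σ) : Finset (Fin 2 ⊕ Fin r) → g)
      = Pi.single (P.disjSum univ) (koszulSign K (k ∘ σ) σ • F r (x ∘ σ)) := by
  set I : Fin r → Finset (Fin 2 ⊕ Fin r) := fun b => (∅ : Finset (Fin 2)).disjSum {b} with hI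
  have h1 : tupleSign (letterSign K k) I = 1 := by
    refine prod_eq_one fun b _ => prod_eq_one fun b' _ => ?_
    split_ifs with hb
    · simp [hI, setSign, prod_disjSum, letterSign, hb]
    · rfl
  have hk (b : Fin r) : setDeg (letterDeg k) (I b) = k b := by
    simp [hI, setDeg, letterDeg, sum_disjSum]
  have h2 := tupleSign_comp_perm (isKoszulRule_letterSign (K := K) k) I σ
  simp only [hk, h1, mul_one] at h2
  have h3 : univ.biUnion (fun b => ({σ b} : Finset (Fin r))) = univ := by
    ext j
    simp only [mem_biUnion, mem_univ, true_and, Finset.mem_singleton, iff_true]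
    exact ⟨σ.symm j, by simp⟩
  rw [hF.coe_apply _ _ (I ∘ σ) (x ∘ σ) (fun b => rfl), tupleSign_cons,
    prod_eq_one fun b _ => setSign_disjSum_empty k P _, one_mul, h2]
  have h4 : P.disjSum ∅ ∪ univ.biUnion (I ∘ σ) = P.disjSum univ := by
    refine (congrArg (P.disjSum ∅ ∪ ·) (biUnion_disjSum fun b => {σ b})).trans ?_
    rw [h3, disjSum_union, union_empty, empty_union]
  rw [h4]
  rfl

theorem koszulSign_one {r : ℕ} (k : Fin r → ℤ) :
    koszulSign K k (1 : Equiv.Perm (Fin r)) = 1 :=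
  prod_eq_one fun i _ => prod_eq_one fun j _ => if_neg fun h => lt_asymm h.1 h.2

/-- Operations with symmetric lifts are graded symmetric. -/
theorem isGradedSymm_of_isLift {F : MultiOps K g g} (P : Finset (Fin 2)) (hF₀ : F 0 = 0)
    (hF : ∀ {r : ℕ} (k : Fin r → ℤ), ∃ F' : MultiOps K (coeffModule 𝒢 (letterDeg k))
      (coeffModule 𝒢 (letterDeg k)), IsLift (letterSign K k) (P.disjSum ∅) F' F) :
    IsGradedSymm 𝒢 𝒢 (-P.card) F where
  zero := hF₀
  mem r k x hx := by
    obtain ⟨F', hF'⟩ := hF k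
    have h1 := hF'.coe_apply_letters_comp_perm hx 1
    rw [koszulSign_one, one_smul] at h1
    simpa [setDeg, sum_disjSum, letterDeg, add_comm] using mem_of_coe_eq_single h1
  symm r k x hx σ := by
    obtain ⟨F', hF'⟩ := hF k
    have h1 := hF'.coe_apply_letters_comp_perm hx σ
    have h2 := hF'.coe_apply_letters_comp_perm hx 1
    rw [hF'.symm, ← hF'.symm _ _ 1, h2] at h1
    have h3 := Pi.single_injective (M := fun _ => g) _ h1
    rw [koszulSign_one, one_smul] at h3
    have h5 := congrArg (koszulSign K (k ∘ σ) σ • ·) h3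
    simp only [smul_smul, koszulSign_mul_self, one_smul] at h5
    exact h5.symm

theorem singleton_inl {r : ℕ} (a : Fin 2) :
    ({Sum.inl a} : Finset (Fin 2 ⊕ Fin r)) = ({a} : Finset (Fin 2)).disjSum ∅ := by
  ext (i | i) <;> simp

end GradedSymm

/-! ### The relations between the operations and the isomorphism -/

section Structure

variable {K : Type u} [Field K] [CharZero K] {g : Type v} [AddCommGroup g] [Module K g]
  {𝒢 : ℤ → Submodule K g} [DirectSum.Decomposition 𝒢] (L : DGPreLie K 𝒢) {α : g}

omit [DirectSum.Decomposition 𝒢] [CharZero K] in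
theorem sum_letter_mem {r : ℕ} {k : Fin r → ℤ} {x : Fin r → g} (hx : ∀ i, x i ∈ 𝒢 (k i)) :
    ∑ i, letter hx i ∈ weightFiltration 𝒢 (letterDeg k) (letterWeight r) 1 :=
  Submodule.sum_mem _ fun i _ => single_mem_weightFiltration (coe_letter hx i)
    (by simp [letterWeight, sum_disjSum])

theorem sum_letterWeight (r : ℕ) : ∑ i, letterWeight r i = r := by
  simp [letterWeight]

theorem isLift_nu (hα : α ∈ 𝒢 (-1)) {r : ℕ} (k : Fin r → ℤ) (p : Fin 2) :
    IsLift (letterSign K k) (({p} : Finset (Fin 2)).disjSum ∅)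
      (L.liftNu (isKoszulRule_letterSign k) hα (p := Sum.inl p) rfl) (L.nu α) :=
  singleton_inl (r := r) p ▸ L.isLift_liftNu (isKoszulRule_letterSign k) hα rfl

/-- The quadratic relation between the `ν_r` is the coefficient of the identity expressing that the
vector fields for two generators of degree one commute, in which the two sides have opposite
signs. -/
theorem nu_isLInfinity (hα : L.IsMaurerCartan α) : IsLInfinity 𝒢 (L.nu α) where
  toIsGradedSymm := by
    simpa using isGradedSymm_of_isLift (𝒢 := 𝒢) {(0 : Fin 2)} (F := L.nu α) rfl
      fun k => ⟨_, L.isLift_nu hα.1 k 0⟩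
  rel r k x hx := by
    have h := L.sum_liftNu_cons_comm (isKoszulRule_letterSign k) (w := letterWeight r)
      (M := r + 1) (by rw [sum_letterWeight]; omega) (sum_letter_mem hx) hα
      (p := Sum.inl 0) (q := Sum.inl 1) rfl rfl rfl rfl
    have h01 := (L.isLift_nu hα.1 k 0).coe_sum_cons_sum hx (L.isLift_nu hα.1 k 1)
    have h10 := (L.isLift_nu hα.1 k 1).coe_sum_cons_sum hx (L.isLift_nu hα.1 k 0)
    have h' := congrArg (fun Z : coeffModule 𝒢 (letterDeg k) =>
      Z.1 (({0} ∪ {1} : Finset (Fin 2)).disjSum univ)) h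
    beta_reduce at h'
    rw [h01, Finset.union_comm, h10] at h'
    rw [← singleton_inl, ← singleton_inl, setSign_singleton, setSign_singleton] at h'
    -- the generators of degree `-1` anticommute, so the relation equals its own negative
    refine eq_zero_of_eq_neg_self K ?_
    simpa [letterSign] using h'

section Flow

variable {ι : Type w} [Fintype ι] [DecidableEq ι] {k : ι → ℤ} {t : ι → ι → K}
  (ht : IsKoszulRule k t) {w : ι → ℕ}

-- the ungraded pre-Lie algebra obtained from `L` by adjoining square-zero generators
local notation "Lc" => DGPreLie.coeffPreLie L ht

omit [DirectSum.Decomposition 𝒢] [CharZero K] in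
theorem weightDer_of_coe_eq_single {Z : coeffModule 𝒢 k} {I : Finset ι} {z : g}
    (h : (Z : Finset ι → g) = Pi.single I z) :
    weightDer 𝒢 k w Z = ((∑ i ∈ I, w i : ℕ) : K) • Z := by
  refine Subtype.ext (funext fun J => ?_)
  rw [coe_weightDer_apply, Submodule.coe_smul, Pi.smul_apply, h]
  rcases eq_or_ne J I with rfl | hJ
  · rfl
  · simp [hJ]

omit [DirectSum.Decomposition 𝒢] in
theorem mem_weightFiltration_of_weightDer_eq {n : ℕ} {Z : coeffModule 𝒢 k}
    (h : weightDer 𝒢 k w Z = (n : K) • Z) : Z ∈ weightFiltration 𝒢 k w n := by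
  intro I hI
  have h1 := congrFun (congrArg Subtype.val h) I
  rw [coe_weightDer_apply, Submodule.coe_smul, Pi.smul_apply, ← sub_eq_zero, ← sub_smul,
    smul_eq_zero, sub_eq_zero, Nat.cast_inj] at h1
  exact h1.resolve_left hI.ne

omit [DirectSum.Decomposition 𝒢] [CharZero K] in
theorem weightDer_diffDer {p : ι} (hp : k p = -1) (hw : w p = 0) (Z : coeffModule 𝒢 k) :
    weightDer 𝒢 k w (L.diffDer ht hp Z) = L.diffDer ht hp (weightDer 𝒢 k w Z) := by
  refine Subtype.ext (funext fun U => ?_)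
  rw [coe_weightDer_apply, coe_diffDer, coe_diffDer]
  change _ • (∑ I, _ : Finset ι → g) U = (∑ I, _ : Finset ι → g) U
  rw [Finset.sum_apply, Finset.sum_apply, smul_sum]
  refine sum_congr rfl fun I _ => ?_
  rw [coe_weightDer_apply, map_smul]
  rcases eq_or_ne U ({p} ∪ I) with rfl | hU
  · by_cases h : setSign t {p} I = 0
    · simp [h]
    · rw [sum_union (disjoint_of_setSign_ne_zero ht h), sum_singleton, hw, zero_add,
        Pi.single_eq_same, Pi.single_eq_same, smul_comm]
  · rw [Pi.single_eq_of_ne hU, Pi.single_eq_of_ne hU, smul_zero]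

omit [DirectSum.Decomposition 𝒢] [CharZero K] in
theorem diffDer_mem_weightFiltration {p : ι} (hp : k p = -1) (hw : w p = 0) {n : ℕ}
    {Z : coeffModule 𝒢 k} (hZ : Z ∈ weightFiltration 𝒢 k w n) :
    L.diffDer ht hp Z ∈ weightFiltration 𝒢 k w n := by
  intro U hU
  rw [coe_diffDer]
  change (∑ I, _ : Finset ι → g) U = 0
  rw [Finset.sum_apply]
  refine sum_eq_zero fun I _ => ?_
  rcases eq_or_ne U ({p} ∪ I) with rfl | h
  · rw [hZ I ((Finset.sum_le_sum_of_subset Finset.subset_union_right).trans_lt hU)]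
    simp
  · exact Pi.single_eq_of_ne h _

variable {M : ℕ} {y z : coeffModule 𝒢 k} (hy : weightDer 𝒢 k w y = y)

include hy

omit [DirectSum.Decomposition 𝒢] [CharZero K] in
theorem weightDer_iterMul (n : ℕ) :
    weightDer 𝒢 k w ((Lc).iterMul (n + 1) fun _ => y)
      = ((n + 1 : ℕ) : K) • (Lc).iterMul (n + 1) fun _ => y := by
  induction n with
  | zero => rw [iterMul_one, hy]; simp
  | succ n ih =>
    have h : Fin.init (fun _ : Fin (n + 2) => y) = fun _ => y := rfl
    rw [iterMul_succ_succ, h, L.weightDer_mul ht w, ih, hy, map_smul, LinearMap.smul_apply,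
      Nat.cast_succ (n + 1), add_smul, one_smul]

omit [DirectSum.Decomposition 𝒢] [CharZero K] in
theorem weightDer_sum_iterMul_update (hz : weightDer 𝒢 k w z = z) (n : ℕ) :
    weightDer 𝒢 k w (∑ i, (Lc).iterMul (n + 1) (update (fun _ => y) i z))
      = ((n + 1 : ℕ) : K) •
        ∑ i, (Lc).iterMul (n + 1) (update (fun _ => y) i z) := by
  induction n with
  | zero => simp [iterMul_one, hz]
  | succ n ih =>
    rw [sum_iterMul_update_succ, map_add, L.weightDer_mul ht w, L.weightDer_mul ht w, ih, hy, hz,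
      L.weightDer_iterMul ht hy, map_smul, LinearMap.smul_apply, map_smul, LinearMap.smul_apply,
      Nat.cast_succ (n + 1), add_smul, one_smul, smul_add]
    abel

/-- The element `X = ∑ₙ (…(y • y)…) • y / n!` satisfies `N X = y + X • y`. -/
theorem weightDer_sum_symMul (hM : ∑ i, w i < M) :
    weightDer 𝒢 k w (∑ m ∈ range (M + 1), (m.factorial : K)⁻¹ •
        (Lc).symMul m fun _ => y)
      = y + (Lc).mul (∑ m ∈ range (M + 1), (m.factorial : K)⁻¹ •
        (Lc).symMul m fun _ => y) y := by
  have h0 := mem_trivGrading_zero K (coeffModule 𝒢 k)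
  obtain ⟨M, rfl⟩ := Nat.exists_eq_succ_of_ne_zero (n := M) (by omega)
  simp only [(Lc).symMul_const h0]
  have hlast : (Lc).iterMul (M + 1) (fun _ => y) = 0 :=
    eq_zero_of_mem_weightFiltration hM
      (mem_weightFiltration_of_weightDer_eq (L.weightDer_iterMul ht hy M))
  have h1 : weightDer 𝒢 k w (∑ m ∈ range (M + 2), (m.factorial : K)⁻¹ •
      (Lc).iterMul m fun _ => y)
      = ∑ m ∈ range (M + 1), (m.factorial : K)⁻¹ •
        (Lc).iterMul (m + 1) fun _ => y := by
    rw [sum_range_succ', map_add, map_sum]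
    simp only [iterMul, MultilinearMap.zero_apply, smul_zero, map_zero, add_zero]
    refine sum_congr rfl fun m _ => ?_
    rw [map_smul, L.weightDer_iterMul ht hy, smul_smul, inv_factorial_succ_mul]
  rw [h1, sum_range_succ', sum_range_succ, hlast, smul_zero, add_zero,
    sum_range_succ' _ M]
  have h2 : (L.coeffPreLie (𝒢 := 𝒢) ht).iterMul 0 (fun _ => y) = 0 := rfl
  have h3 : (Lc).iterMul (0 + 1) (fun _ => y) = y := rfl
  rw [h2, h3, smul_zero, add_zero, map_sum, LinearMap.sum_apply, add_comm]
  simp only [Nat.factorial_zero, Nat.cast_one, inv_one, one_smul]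
  congr 1
  refine sum_congr rfl fun m _ => ?_
  rw [map_smul, LinearMap.smul_apply]
  rfl

/-- The derivative of `X = ∑ₙ (…(y • y)…) • y / n!` in the direction `z`. -/
theorem weightDer_sum_symMul_cons (hz : weightDer 𝒢 k w z = z) (hM : ∑ i, w i < M) :
    weightDer 𝒢 k w (∑ m ∈ range (M + 1), (m.factorial : K)⁻¹ •
        (Lc).symMul (m + 1) (Fin.cons z fun _ => y))
      = z + (Lc).mul (∑ m ∈ range (M + 1), (m.factorial : K)⁻¹ •
          (Lc).symMul (m + 1) (Fin.cons z fun _ => y)) y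
        + (Lc).mul (∑ m ∈ range (M + 1), (m.factorial : K)⁻¹ •
          (Lc).symMul m fun _ => y) z := by
  have h0 := mem_trivGrading_zero K (coeffModule 𝒢 k)
  have hs (m : ℕ) : (m.factorial : K)⁻¹ •
      (Lc).symMul (m + 1) (Fin.cons z fun _ => y)
      = ((m + 1).factorial : K)⁻¹ •
        ∑ i, (Lc).iterMul (m + 1) (update (fun _ => y) i z) := by
    rw [← (Lc).symMul_cons_const h0, smul_smul, inv_factorial_succ_mul]
  have hN (m : ℕ) : weightDer 𝒢 k w (((m + 1).factorial : K)⁻¹ •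
        ∑ i, (Lc).iterMul (m + 1) (update (fun _ => y) i z))
      = (m.factorial : K)⁻¹ •
        ∑ i, (Lc).iterMul (m + 1) (update (fun _ => y) i z) := by
    rw [map_smul, L.weightDer_sum_iterMul_update ht hy hz, smul_smul, inv_factorial_succ_mul]
  simp only [hs, (Lc).symMul_const h0]
  have hlast : ∑ i, (Lc).iterMul (M + 1) (update (fun _ => y) i z) = 0 :=
    eq_zero_of_mem_weightFiltration (hM.trans (Nat.lt_succ_self M))
      (mem_weightFiltration_of_weightDer_eq (L.weightDer_sum_iterMul_update ht hy hz M))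
  have h3 : ∑ i, (Lc).iterMul (0 + 1) (update (fun _ => y) i z) = z := by
    simp [iterMul_one]
  have h2 : (L.coeffPreLie (𝒢 := 𝒢) ht).iterMul 0 (fun _ => y) = 0 := rfl
  rw [map_sum, sum_congr rfl fun m _ => hN m, sum_range_succ', h3]
  simp only [sum_iterMul_update_succ]
  rw [sum_range_succ (n := M), hlast, smul_zero, add_zero, sum_range_succ' (n := M),
    h2, smul_zero, add_zero]
  simp only [smul_add, sum_add_distrib, map_sum, LinearMap.sum_apply, map_smul,
    LinearMap.smul_apply, Nat.factorial_zero, Nat.cast_one, inv_one, one_smul]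
  abel

/-- The map `y ↦ X = ∑ₙ (…(y • y)…) • y / n!` takes the vector field given by the twisted
differential to the one given by the operations `ν_r`: both sides solve the equation
`N Z = Z • y + X • z + z`, where `z` is the twisted differential of `y`. -/
theorem sum_symMul_cons_liftD (hM : ∑ i, w i < M) (hα : α ∈ 𝒢 (-1)) {p : ι} (hp : k p = -1)
    (hw : w p = 0) :
    ∑ m ∈ range (M + 1), (m.factorial : K)⁻¹ •
        (Lc).symMul (m + 1) (Fin.cons (L.liftD ht hα hp y) fun _ => y)
      = ∑ m ∈ range (M + 1), (m.factorial : K)⁻¹ • L.liftNu ht hα hp m fun _ =>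
          ∑ n ∈ range (M + 1), (n.factorial : K)⁻¹ •
            (Lc).symMul n fun _ => y := by
  have h0 := mem_trivGrading_zero K (coeffModule 𝒢 k)
  have hM0 : 0 < M := by omega
  have hNX := L.weightDer_sum_symMul ht hy hM
  have hNa : weightDer 𝒢 k w (liftElem hα hp) = 0 := weightDer_liftElem hα hp hw
  have hz : weightDer 𝒢 k w (L.liftD ht hα hp y) = L.liftD ht hα hp y := by
    rw [liftD_apply, map_sub, map_add, L.weightDer_diffDer ht hp hw, L.weightDer_mul ht,
      L.weightDer_mul ht, hNa, hy]
    simp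
  have hNΞ := L.weightDer_sum_symMul_cons ht hy hz hM
  have hy1 : y ∈ weightFiltration 𝒢 k w 1 :=
    mem_weightFiltration_of_weightDer_eq (by rw [hy, Nat.cast_one, one_smul])
  have hΞ1 : ∑ m ∈ range (M + 1), (m.factorial : K)⁻¹ • (Lc).symMul (m + 1)
      (Fin.cons (L.liftD ht hα hp y) fun _ => y) ∈ weightFiltration 𝒢 k w 1 := by
    refine Submodule.sum_mem _ fun m _ => Submodule.smul_mem _ _ ?_
    have h1 := (Lc).symMul_cons_const h0 m y (L.liftD ht hα hp y)
    have h2 := weightFiltration_antitone (Nat.le_add_left 1 m)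
      (mem_weightFiltration_of_weightDer_eq (L.weightDer_sum_iterMul_update ht hy hz m))
    rw [← h1] at h2
    exact (Submodule.smul_mem_iff _ (by exact_mod_cast Nat.succ_ne_zero m)).1 h2
  have hX1 : ∑ n ∈ range (M + 1), (n.factorial : K)⁻¹ •
      (Lc).symMul n (fun _ => y) ∈ weightFiltration 𝒢 k w 1 := by
    refine Submodule.sum_mem _ fun m _ => Submodule.smul_mem _ _ ?_
    rw [(Lc).symMul_const h0]
    rcases m with _ | m
    · exact Submodule.zero_mem _
    · exact weightFiltration_antitone (Nat.le_add_left 1 m)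
        (mem_weightFiltration_of_weightDer_eq (L.weightDer_iterMul ht hy m))
  rw [L.sum_liftNu_const ht hM0]
  generalize (∑ m ∈ range (M + 1), (m.factorial : K)⁻¹ • (Lc).symMul (m + 1)
      (Fin.cons (L.liftD ht hα hp y) fun _ => y)) = Ξ at *
  generalize (∑ n ∈ range (M + 1), (n.factorial : K)⁻¹ •
      (Lc).symMul n (fun _ => y)) = X at *
  -- the difference has no part of weight zero and solves `N Z = Z • y`
  rw [← sub_eq_zero]
  refine L.eq_zero_of_weightDer_eq ht ?_ hy1 ?_
  · have h1 := L.expC_sub_mem ht (M := M) hX1 (liftElem hα hp)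
    have h2 := L.diffDer_mem_weightFiltration ht hp hw hX1
    have h3 := L.mul_mem_weightFiltration ht (n := 0) (W := liftElem hα hp) hX1
      (by rw [weightFiltration_zero]; trivial)
    exact Submodule.sub_mem _ hΞ1 (Submodule.sub_mem _ (Submodule.add_mem _ h1 h2) h3)
  · have hE := derivation_expC_of_eq h0 (L.expNilpotent ht hM hX1) (L.weightDer_mul ht w) hNa hNX
    have hp3 := (Lc).pre_lie_of_zero h0 X (liftElem hα hp) y
    simp only [map_sub, map_add, LinearMap.sub_apply, LinearMap.add_apply, hNΞ, hE, hNa,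
      L.weightDer_diffDer ht hp hw, hNX, L.diffDer_mul ht hp, L.weightDer_mul ht, map_zero,
      liftD_apply]
    rw [sub_eq_iff_eq_add] at hp3
    rw [hp3]
    abel

end Flow

theorem isLift_abelian (hα : α ∈ 𝒢 (-1)) {r : ℕ} (k : Fin r → ℤ) (p : Fin 2) :
    IsLift (letterSign K k) (({p} : Finset (Fin 2)).disjSum ∅)
      (abelianOps (L.liftD (isKoszulRule_letterSign k) hα (p := Sum.inl p) rfl))
      (abelianOps (L.twistedD α)) :=
  singleton_inl (r := r) p ▸ L.isLift_abelianOps (isKoszulRule_letterSign k) hα rfl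

theorem isLift_symMul_letters {r : ℕ} (k : Fin r → ℤ) :
    IsLift (letterSign K k) ((∅ : Finset (Fin 2)).disjSum ∅)
      (L.coeffPreLie (𝒢 := 𝒢) (isKoszulRule_letterSign k)).symMul L.symMul := by
  have h : (∅ : Finset (Fin 2)).disjSum (∅ : Finset (Fin r)) = ∅ := rfl
  exact h ▸ L.isLift_symMul (isKoszulRule_letterSign (K := K) k)

theorem symMul_isLInfinityIso (hα : L.IsMaurerCartan α) :
    IsLInfinityIso 𝒢 𝒢 (abelianOps (L.twistedD α)) (L.nu α) L.symMul where
  toIsGradedSymm := by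
    simpa using isGradedSymm_of_isLift (𝒢 := 𝒢) ∅ (F := L.symMul) L.symMul_zero
      fun k => ⟨_, L.isLift_symMul_letters k⟩
  rel r k x hx := by
    have hW := L.isLift_symMul_letters (K := K) k
    have h1 := hW.coe_sum_cons_sum hx (L.isLift_abelian hα.1 k 0)
    have hV : ∑ n ∈ range (r + 2), (n.factorial : K)⁻¹ •
        abelianOps (L.liftD (isKoszulRule_letterSign k) hα.1 (p := Sum.inl 0) rfl) n
          (fun _ => ∑ i, letter hx i)
        = L.liftD (isKoszulRule_letterSign k) hα.1 (p := Sum.inl 0) rfl (∑ i, letter hx i) := by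
      rw [sum_eq_single 1]
      · simp [abelianOps]
      · intro n _ hn
        rw [abelianOps_apply_of_ne_one hn, smul_zero]
      · intro h
        simp at h
    have hy : weightDer 𝒢 (letterDeg k) (letterWeight r) (∑ i, letter hx i)
        = ∑ i, letter hx i := by
      rw [map_sum]
      refine sum_congr rfl fun i _ => ?_
      rw [weightDer_of_coe_eq_single (coe_letter hx i)]
      simp [letterWeight, sum_disjSum]
    rw [hV, L.sum_symMul_cons_liftD (isKoszulRule_letterSign k) hy
      (by rw [sum_letterWeight]; omega) hα.1 rfl rfl, hW.sum_letters hx] at h1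
    rw [empty_union, Finset.empty_disjSum, Finset.map_empty, setSign_empty_left,
      one_smul] at h1
    rw [← h1, AddSubmonoidClass.coe_finset_sum, Finset.sum_apply]
    have h2 (m : ℕ) := (L.isLift_nu hα.1 k 0).coe_apply_sum (hW.coe_app_letters hx) m
    simp only [Submodule.coe_smul, Pi.smul_apply, h2, ← block_eq]
    rw [sum_range_succ _ (r + 1)]
    -- among `r + 1` blocks of `r` letters one is empty
    have h3 : ∑ c : Fin r → Fin (r + 1), koszulSign K k c •
        L.nu α (r + 1) (fun b => L.symMul.app (block x c b)) = 0 := by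
      refine sum_eq_zero fun c _ => ?_
      obtain ⟨b, hb⟩ : ∃ b, ∀ i, c i ≠ b := by
        by_contra! h
        have := Fintype.card_le_of_surjective c h
        simp at this
      rw [MultilinearMap.map_coord_zero _ b, smul_zero]
      have : block x c b = [] := by simp [block, hb]
      rw [this, MultiOps.app]
      exact congrArg (fun F : MultilinearMap K (fun _ : Fin 0 => g) g => F _) L.symMul_zero
    rw [h3, smul_zero, add_zero]
  bijective := by
    have : (fun x : g => L.symMul 1 fun _ => x) = id := funext L.symMul_one
    rw [this]
    exact Function.bijective_id

end Structure

end DGPreLie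

theorem mainTheorem5 {K : Type u} [Field K] [CharZero K] :
    ((hoLieTwo K).IsDGOperad ∧ (TRT K).IsDGOperad ∧
      (∃! φ : DGOperadData.Hom (hoLieTwo K) (TRT K), SendsToCorolla φ) ∧
      (∃! ψ : DGOperadData.Hom (hoLieTwo K) (TRT K), KillsGenerators ψ) ∧
      ∀ φ ψ : DGOperadData.Hom (hoLieTwo K) (TRT K), SendsToCorolla φ → KillsGenerators ψ →
        DGOperadData.Homotopic φ ψ) ∧
    ∀ {g : Type v} [AddCommGroup g] [Module K g] (𝒢 : ℤ → Submodule K g)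
      [DirectSum.Decomposition 𝒢] (L : DGPreLie K 𝒢) (α : g), L.IsMaurerCartan α →
      IsLInfinity 𝒢 (abelianOps (L.twistedD α)) ∧ IsLInfinity 𝒢 (L.nu α) ∧
      ∃ W : MultiOps K g g, IsLInfinityIso 𝒢 𝒢 (abelianOps (L.twistedD α)) (L.nu α) W :=
  ⟨TRT.hoLieTwo_homotopy, fun 𝒢 _ L α hα =>
    ⟨DGPreLie.abelianOps_isLInfinity (L.twistedD_mem hα.1) (L.twistedD_twistedD hα),
      L.nu_isLInfinity hα, L.symMul, L.symMul_isLInfinityIso hα⟩⟩
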